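/- **Setting.** Let $l>0$, $r_0\ge 0$, and let $\bar\gamma_{AB}$ be a fixed smooth Lorentzian metric on the cylinder with coordinates $x^A=(\tau,\phi)$, $\phi\sim\phi+2\pi$. $F=O(r^k)$ (resp. $o(r^k)$) means that $F$ is smooth for $r>r_0$ and that all derivatives $(r\partial_r)^i\partial_x^\alpha F$ are $O(r^k)$ (resp. $o(r^k)$) as $r\to\infty$, locally uniformly in $x$. The generalized asymptotic conditions on a metric $g$ on $\{r>r_0\}\times$ cylinder are $$g_{rr}=\tfrac{l^2}{r^2}+C_{rr}r^{-4}+o(r^{-4}),\quad g_{rA}=O(r^{-3}),\quad g_{AB}=r^2\gamma_{AB}+C_{AB}+o(1),\quad K+\tfrac2l=o(r^{-2}),$$ where $\gamma_{AB}=e^{2\varphi}\bar\gamma_{AB}$; $\varphi, C_{rr}, C_{AB}$ are smooth on the cylinder and vary with $g$, and $K=-\nabla_\mu n^\mu$ is the trace of the extrinsic curvature of the surfaces of constant $r$, with unit normal $n$ pointing towards increasing $r$ (here the remainder may be taken pointwise in $x$). These conditions make $g$ Lorentzian near infinity; nothing is required of the symmetric tensor $g$ elsewhere. A smooth vector field $\xi$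 on $r>r_0$ *preserves the conditions at $g$* if there are smooth $\omega,\eta_{rr},\eta_{AB}$ on the cylinder with $$\mathcal L_\xi g_{rr}=\eta_{rr}r^{-4}+o(r^{-4}),\quad \mathcal L_\xi g_{rA}=O(r^{-3}),\quad \mathcal L_\xi g_{AB}=2\omega\gamma_{AB}r^2+\eta_{AB}+o(1),$$ $$-2\omega\gamma^{AB}C_{AB}+\gamma^{AB}\eta_{AB}+\tfrac1{l^2}\eta_{rr}=0 .$$ **(1) Form of the vector fields.** For every $g$ satisfying the conditions, a smooth vector field $\xi$ preserves the conditions at $g$ if and only if $$\xi^r=-\tfrac12\psi r+\tfrac{R}{r}+o(r^{-1}),\qquad \xi^A=Y^A-\tfrac{l^2}{4r^2}\gamma^{AB}\partial_B\psi+O(r^{-4}),$$ with $R,\psi,Y^A$ smooth on the cylinder, $Y$ a conformal Killing vector of $\gamma$ and $\psi$ harmonic, $\Delta_\gamma\psi=0$. In particular $\xi^r=-\tfrac12\psi r+O(r^{-1})$. **(2) The algebra.** A *smooth finite-dimensional family* of metrics is a family $g_p$ of metrics satisfying the conditions, $p$ in a finite-dimensional real vector space, for which $\varphi, C_{rr},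 C_{AB}$ are smooth in $(p,x)$ and the expansions hold jointly in $(p,x)$. Let $\mathfrak X$ be the set of metric-dependent vector fields $\xi[g]$ that preserve the conditions at every $g$ and have the form in (1) with $(Y,\psi)$ independent of $g$, jointly in $(p,x)$ on every such family. For $\xi_1,\xi_2\in\mathfrak X$ let $$[\xi_1,\xi_2]_M=[\xi_1,\xi_2]-\delta_{\xi_1}\xi_2+\delta_{\xi_2}\xi_1,$$ where $\delta_{\xi_1}\xi_2$ is the change of $\xi_2[g]$ under $\delta g=\mathcal L_{\xi_1}g$, i.e. its derivative along every smooth curve (one-parameter family) of metrics satisfying the conditions, through $g$ with this velocity. Then this bracket exists, and it belongs to $\mathfrak X$ with data $$\hat Y^A=Y_1^B\partial_BY_2^A-Y_2^B\partial_BY_1^A,\qquad \hat\psi=Y_1^A\partial_A\psi_2-Y_2^A\partial_A\psi_1 .$$ $\mathfrak X$ is a vector space, the pure gauge elements ($Y=0=\psi$) form a subspace $\mathfrak N$, the conformal Killing vectors of $\bar\gamma$ form a Lie algebra $\mathfrak c$ acting by $\psi\mapsto Y^A\partial_A\psi$ on the abelian Lie algebra $\mathcal H$ of $\bar\gamma$-harmonic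 functions, and $\xi\mapsto(Y,\psi)$ induces a linear isomorphism $\mathfrak X/\mathfrak N\cong\mathcal H\rtimes\mathfrak c$ taking $[\cdot,\cdot]_M$ to the bracket of the semidirect product. **(3) Asymptotically $AdS_3$ case.** Let $\bar\gamma=-d\tau^2+d\phi^2$, $x^\pm=\tau\pm\phi$, $\partial_\pm=\frac12(\partial_\tau\pm\partial_\phi)$. In the complexification of $\mathcal H\rtimes\mathfrak c$ there are the elements $l^\pm_n=e^{inx^\pm}\partial_\pm$, $p^\pm_n=e^{inx^\pm}$ ($n\in\mathbb Z$) and $q=\tau$; they satisfy $p^+_0=p^-_0$ and $$\begin{array}{ll} i[l^\pm_m,l^\pm_n]=(m-n)l^\pm_{m+n}, & i[l^+_m,l^-_n]=0,\\ i[l^\pm_m,p^\pm_n]=-n\,p^\pm_{m+n}, & i[l^\pm_m,p^\mp_n]=0,\\ i[p^\pm_m,p^\pm_n]=0, & i[p^+_m,p^-_n]=0,\\ i[l^\pm_m,q]=\tfrac i2p^\pm_m, & i[p^\pm_m,q]=0 .\end{array}$$ So for each sign $(l_m,p_m)$ is a centreless Virasoro algebra in semidirect product with a $U(1)$ current algebra.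 These generators form a basis in the Fourier sense: every element $(Y,\psi)$ has a unique expansion $$Y=\sum_\pm\sum_n c_\pm^n e^{inx^\pm}\partial_\pm,\qquad \psi=\sum_\pm\sum_n\psi^\pm_ne^{inx^\pm}+V\tau$$ with rapidly decreasing coefficients $c_\pm^n,\psi^\pm_n$, normalized by $\psi^-_0=0$; conversely every choice of rapidly decreasing coefficients and of $V$ defines exactly one element. -/

import Mathlib

open scoped ContDiff TensorProduct

namespace AsymptoticAdS3

noncomputable section

/-! ### Coordinates

The boundary cylinder has coordinates `x = (τ, φ)` and the bulk has coordinates `z = (r, τ, φ)`;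
fields are functions on the universal cover that are `2π`-periodic in the last coordinate. -/

/-- Coordinates `(τ, φ)` on the boundary cylinder. -/
abbrev Bdry : Type := Fin 2 → ℝ

/-- Coordinates `(r, τ, φ)` on the bulk. -/
abbrev Bulk : Type := Fin 3 → ℝ

/-- The bulk point with radial coordinate `r` over the boundary point `x`. -/
def pt (r : ℝ) (x : Bdry) : Bulk := ![r, x 0, x 1]

/-- The asymptotic region `r > r₀`. -/
def region (r₀ : ℝ) : Set Bulk := {z | r₀ < z 0}

/-- Partial derivative with respect to the `i`-th coordinate. -/
def pd {n : ℕ} (i : Fin n) (f : (Fin n → ℝ) → ℝ) (x : Fin n → ℝ) : ℝ :=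
  fderiv ℝ f x (Pi.single i 1)

/-- Lie derivative of a twice covariant tensor field `g` along `V`, in coordinates. -/
def lieDeriv {n : ℕ} (V : (Fin n → ℝ) → (Fin n → ℝ))
    (g : (Fin n → ℝ) → Matrix (Fin n) (Fin n) ℝ) (x : Fin n → ℝ) : Matrix (Fin n) (Fin n) ℝ :=
  Matrix.of fun i j => ∑ k, (V x k * pd k (fun y => g y i j) x
    + g x k j * pd i (fun y => V y k) x + g x i k * pd j (fun y => V y k) x)

/-- Smooth functions (or vector valued functions) on the cylinder. -/
def CylSmooth {E : Type*} [NormedAddCommGroup E] [NormedSpace ℝ E] (f : Bdry → E) : Prop :=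
  ContDiff ℝ ∞ f ∧ ∀ x, f (x + Pi.single 1 (2 * Real.pi)) = f x

/-! ### Fall-off conditions

All fall-offs may be differentiated: `F = O(r^k)` means that every derivative
`(r ∂_r)^i ∂_y^j F` is `O(r^k)`, locally uniformly in the parameters `y`; similarly for `o(r^k)`.
With `r = e^s` one has `r ∂_r = ∂_s`, so this says that all derivatives of
`(y, s) ↦ e^{-k s} F (y, e^s)` are bounded (tend to zero) as `s → ∞`. -/

/-- `(y, s) ↦ e^{-k s} F (y, e^s)`. -/
def logRescale {Y : Type*} (k : ℤ) (F : Y → ℝ → ℝ) : Y × ℝ → ℝ :=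
  fun w => Real.exp w.2 ^ (-k) * F w.1 (Real.exp w.2)

/-- `F` is smooth on `r > r₀` and `F = O(r^k)` as `r → ∞`, with all derivatives. -/
def IsBigO {Y : Type*} [NormedAddCommGroup Y] [NormedSpace ℝ Y] (r₀ : ℝ) (k : ℤ)
    (F : Y → ℝ → ℝ) : Prop :=
  ContDiffOn ℝ ∞ (fun w : Y × ℝ => F w.1 w.2) {w | r₀ < w.2} ∧
  ∀ (n : ℕ) (K : Set Y), IsCompact K → ∃ C S : ℝ, ∀ y ∈ K, ∀ s : ℝ, S ≤ s →
    ‖iteratedFDeriv ℝ n (logRescale k F) (y, s)‖ ≤ C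

/-- `F` is smooth on `r > r₀` and `F = o(r^k)` as `r → ∞`, with all derivatives. -/
def IsLittleO {Y : Type*} [NormedAddCommGroup Y] [NormedSpace ℝ Y] (r₀ : ℝ) (k : ℤ)
    (F : Y → ℝ → ℝ) : Prop :=
  ContDiffOn ℝ ∞ (fun w : Y × ℝ => F w.1 w.2) {w | r₀ < w.2} ∧
  ∀ (n : ℕ) (K : Set Y), IsCompact K → ∀ ε : ℝ, 0 < ε → ∃ S : ℝ, ∀ y ∈ K, ∀ s : ℝ, S ≤ s →
    ‖iteratedFDeriv ℝ n (logRescale k F) (y, s)‖ ≤ ε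

/-! ### Geometry of the boundary -/

/-- A smooth Lorentzian metric on the cylinder. -/
structure IsLorentzMetric (γ : Bdry → Matrix (Fin 2) (Fin 2) ℝ) : Prop where
  smooth : ∀ A B, CylSmooth fun x => γ x A B
  symm : ∀ x, (γ x).IsSymm
  lorentz : ∀ x, (γ x).det < 0

/-- `Y` is a conformal Killing vector of `γ`. -/
def IsConformalKilling (γ : Bdry → Matrix (Fin 2) (Fin 2) ℝ) (Y : Bdry → Bdry) : Prop :=
  ∃ σ : Bdry → ℝ, ∀ x, lieDeriv Y γ x = σ x • γ x

/-- Christoffel symbols `Γ^C_{AB}` of `γ`. -/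
def christoffel (γ : Bdry → Matrix (Fin 2) (Fin 2) ℝ) (C A B : Fin 2) (x : Bdry) : ℝ :=
  ∑ D, (1 / 2) * (γ x)⁻¹ C D * (pd A (fun y => γ y D B) x + pd B (fun y => γ y D A) x
    - pd D (fun y => γ y A B) x)

/-- The Laplacian `Δψ = D_A D^A ψ` of `γ`. -/
def laplacian (γ : Bdry → Matrix (Fin 2) (Fin 2) ℝ) (ψ : Bdry → ℝ) (x : Bdry) : ℝ :=
  ∑ A, ∑ B, (γ x)⁻¹ A B * (pd A (pd B ψ) x - ∑ C, christoffel γ C A B x * pd C ψ x)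

/-- The gradient `γ^{AB} ∂_B ψ`. -/
def grad (γ : Bdry → Matrix (Fin 2) (Fin 2) ℝ) (ψ : Bdry → ℝ) (x : Bdry) : Bdry :=
  fun A => ∑ B, (γ x)⁻¹ A B * pd B ψ x

/-- The flat metric `-dτ² + dφ²`. -/
def flat : Bdry → Matrix (Fin 2) (Fin 2) ℝ := fun _ => !![-1, 0; 0, 1]

/-! ### The generalized asymptotic conditions -/

/-- The unit normal `n^μ = g^{μ r} / √(g^{rr})` of the surfaces of constant `r`. -/
def unitNormal (g : Bulk → Matrix (Fin 3) (Fin 3) ℝ) (z : Bulk) : Bulk :=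
  fun μ => (g z)⁻¹ μ 0 / √((g z)⁻¹ 0 0)

/-- Trace of the extrinsic curvature of the surfaces of constant `r`,
`K = -∇_μ n^μ = -|g|^{-1/2} ∂_μ (|g|^{1/2} n^μ)`; with this sign `K = -2/l` for the metric
`l² dr²/r² + r² γ_{AB} dx^A dx^B`. -/
def extrinsicTrace (g : Bulk → Matrix (Fin 3) (Fin 3) ℝ) (z : Bulk) : ℝ :=
  -(1 / √|(g z).det|) * ∑ μ, pd μ (fun y => √|(g y).det| * unitNormal g y μ) z

/-- The expansions
`g_rr = l²/r² + C_rr r⁻⁴ + o(r⁻⁴)`, `g_rA = O(r⁻³)`, `g_AB = r² e^{2φ} γbar_AB + C_AB + o(1)`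
for a field depending smoothly on parameters `y : Y`, where `π y` is the boundary point. -/
def HasExpansion {Y : Type*} [NormedAddCommGroup Y] [NormedSpace ℝ Y] (l r₀ : ℝ)
    (γbar : Bdry → Matrix (Fin 2) (Fin 2) ℝ) (π : Y → Bdry)
    (g : Y → ℝ → Matrix (Fin 3) (Fin 3) ℝ) (φ Crr : Y → ℝ)
    (C : Y → Matrix (Fin 2) (Fin 2) ℝ) : Prop :=
  ContDiff ℝ ∞ φ ∧ ContDiff ℝ ∞ Crr ∧ (∀ A B, ContDiff ℝ ∞ fun y => C y A B) ∧
  IsLittleO r₀ (-4) (fun y r => g y r 0 0 - (l ^ 2 / r ^ 2 + Crr y / r ^ 4)) ∧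
  (∀ A : Fin 2, IsBigO r₀ (-3) fun y r => g y r 0 A.succ) ∧
  (∀ A B : Fin 2, IsLittleO r₀ 0 fun y r =>
    g y r A.succ B.succ - (r ^ 2 * (Real.exp (2 * φ y) * γbar (π y) A B) + C y A B))

/-- A metric on `r > r₀` satisfying the generalized asymptotic conditions, together with its
(uniquely determined) asymptotic data `φ`, `C_rr`, `C_AB`. The expansions force `g` to be
nondegenerate and Lorentzian near infinity, locally uniformly in the boundary point; all conditions
concern only this asymptotic end, and nothing is required of `g` away from it. -/
structure AsympMetric (l r₀ : ℝ) (γbar : Bdry → Matrix (Fin 2) (Fin 2) ℝ) where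
  g : Bulk → Matrix (Fin 3) (Fin 3) ℝ
  φ : Bdry → ℝ
  Crr : Bdry → ℝ
  C : Bdry → Matrix (Fin 2) (Fin 2) ℝ
  symm : ∀ z ∈ region r₀, (g z).IsSymm
  periodic : ∀ z ∈ region r₀, g (z + Pi.single 2 (2 * Real.pi)) = g z
  periodic_φ : ∀ x, φ (x + Pi.single 1 (2 * Real.pi)) = φ x
  periodic_Crr : ∀ x, Crr (x + Pi.single 1 (2 * Real.pi)) = Crr x
  periodic_C : ∀ x, C (x + Pi.single 1 (2 * Real.pi)) = C x
  expansion : HasExpansion l r₀ γbar id (fun x r => g (pt r x)) φ Crr C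
  /-- `K - ₀K = o(r⁻²)` with `₀K = -2/l`. -/
  extrinsic : ∀ x, (fun r => extrinsicTrace g (pt r x) - (-2 / l)) =o[Filter.atTop]
    fun r : ℝ => r ^ (-2 : ℤ)

variable {l r₀ : ℝ} {γbar : Bdry → Matrix (Fin 2) (Fin 2) ℝ}

/-- The leading boundary metric `γ = e^{2φ} γbar`. -/
def AsympMetric.γ (m : AsympMetric l r₀ γbar) (x : Bdry) : Matrix (Fin 2) (Fin 2) ℝ :=
  Real.exp (2 * m.φ x) • γbar x

/-- A vector field on the asymptotic region: smooth and periodic there. -/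
def IsBulkField (r₀ : ℝ) (ξ : Bulk → Bulk) : Prop :=
  ContDiffOn ℝ ∞ ξ (region r₀) ∧
    ∀ z ∈ region r₀, ξ (z + Pi.single 2 (2 * Real.pi)) = ξ z

/-- The infinitesimal diffeomorphism `ξ` leaves the generalized asymptotic conditions invariant
at the metric `m`; `om`, `ηrr`, `η` are the variations of `φ`, `C_rr`, `C_AB`, and the last
condition is the variation of the constraint `γ^{AB} C_AB + C_rr / l² = 0`, which is what
`K - ₀K = o(r⁻²)` says about the asymptotic data. -/
def Preserves (m : AsympMetric l r₀ γbar) (ξ : Bulk → Bulk) : Prop :=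
  ∃ (om ηrr : Bdry → ℝ) (η : Bdry → Matrix (Fin 2) (Fin 2) ℝ),
    CylSmooth om ∧ CylSmooth ηrr ∧ (∀ A B, CylSmooth fun x => η x A B) ∧
    IsLittleO r₀ (-4) (fun (x : Bdry) r => lieDeriv ξ m.g (pt r x) 0 0 - ηrr x / r ^ 4) ∧
    (∀ A : Fin 2, IsBigO r₀ (-3) fun (x : Bdry) r => lieDeriv ξ m.g (pt r x) 0 A.succ) ∧
    (∀ A B : Fin 2, IsLittleO r₀ 0 fun (x : Bdry) r =>
      lieDeriv ξ m.g (pt r x) A.succ B.succ - (2 * om x * m.γ x A B * r ^ 2 + η x A B)) ∧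
    ∀ x, -2 * om x * (∑ A, ∑ B, (m.γ x)⁻¹ A B * m.C x A B)
      + (∑ A, ∑ B, (m.γ x)⁻¹ A B * η x A B) + 1 / l ^ 2 * ηrr x = 0

/-! ### Field dependent vector fields and the modified bracket -/

/-- A vector field depending on the metric. -/
abbrev FieldVF (l r₀ : ℝ) (γbar : Bdry → Matrix (Fin 2) (Fin 2) ℝ) : Type :=
  AsympMetric l r₀ γbar → Bulk → Bulk

/-- A smooth finite dimensional family of metrics satisfying the asymptotic conditions: the
expansions hold jointly in the parameters and the boundary coordinates. -/
def IsSmoothFamily {P : Type*} [NormedAddCommGroup P] [NormedSpace ℝ P]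
    (c : P → AsympMetric l r₀ γbar) : Prop :=
  HasExpansion l r₀ γbar (Y := P × Bdry) Prod.snd (fun y r => (c y.1).g (pt r y.2))
    (fun y => (c y.1).φ y.2) (fun y => (c y.1).Crr y.2) (fun y => (c y.1).C y.2)

/-- The form `ξ^r = -ψ r/2 + R/r + o(r⁻¹)`, `ξ^A = Y^A - (l²/4r²) γ^{AB} ∂_B ψ + O(r⁻⁴)` of a
vector field at the metric `m`. -/
def HasForm (m : AsympMetric l r₀ γbar) (ξ : Bulk → Bulk) (Y : Bdry → Bdry) (ψ : Bdry → ℝ) :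
    Prop :=
  (∃ R : Bdry → ℝ, CylSmooth R ∧ IsLittleO r₀ (-1) fun (x : Bdry) r =>
    ξ (pt r x) 0 - (-(1 / 2) * ψ x * r + R x / r)) ∧
  ∀ A : Fin 2, IsBigO r₀ (-4) fun (x : Bdry) r =>
    ξ (pt r x) A.succ - (Y x A - l ^ 2 / (4 * r ^ 2) * grad m.γ ψ x A)

/-- The metric dependent vector field `ξ` is an asymptotic symmetry with (metric independent)
leading data `(Y, ψ)`: at every metric it preserves the asymptotic conditions, and on every smooth
finite dimensional family of metrics it has the above form jointly in the parameters of the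
family, so that it depends smoothly on the metric. -/
structure IsGenerator (ξ : FieldVF l r₀ γbar) (Y : Bdry → Bdry) (ψ : Bdry → ℝ) : Prop where
  smooth_Y : CylSmooth Y
  smooth_ψ : CylSmooth ψ
  field : ∀ m, IsBulkField r₀ (ξ m)
  preserves : ∀ m, Preserves m (ξ m)
  form_r : ∀ (P : Type) [NormedAddCommGroup P] [NormedSpace ℝ P] [FiniteDimensional ℝ P]
    (c : P → AsympMetric l r₀ γbar), IsSmoothFamily c →
    ∃ R : P × Bdry → ℝ, ContDiff ℝ ∞ R ∧ IsLittleO r₀ (-1) fun (y : P × Bdry) r =>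
      ξ (c y.1) (pt r y.2) 0 - (-(1 / 2) * ψ y.2 * r + R y / r)
  form_A : ∀ (P : Type) [NormedAddCommGroup P] [NormedSpace ℝ P] [FiniteDimensional ℝ P]
    (c : P → AsympMetric l r₀ γbar), IsSmoothFamily c →
    ∀ A : Fin 2, IsBigO r₀ (-4) fun (y : P × Bdry) r =>
      ξ (c y.1) (pt r y.2) A.succ
        - (Y y.2 A - l ^ 2 / (4 * r ^ 2) * grad (c y.1).γ ψ y.2 A)

/-- `v` is the change `δ_h ξ` of `ξ` at `m` induced by the variation `δg = h` of the metric: it is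
the derivative of `ξ` along every smooth curve of metrics through `m` with velocity `h`. -/
def IsVariation (ξ : FieldVF l r₀ γbar) (m : AsympMetric l r₀ γbar)
    (h : Bulk → Matrix (Fin 3) (Fin 3) ℝ) (v : Bulk → Bulk) : Prop :=
  ∀ c : ℝ → AsympMetric l r₀ γbar, IsSmoothFamily c → c 0 = m →
    (∀ z ∈ region r₀, ∀ μ ν, HasDerivAt (fun ε => (c ε).g z μ ν) (h z μ ν) 0) →
    ∀ z ∈ region r₀, ∀ μ, HasDerivAt (fun ε => ξ (c ε) z μ) (v z μ) 0

/-- `ζ` is the modified bracket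
`[ξ₁, ξ₂]_M = [ξ₁, ξ₂] - δ_{ξ₁} ξ₂ + δ_{ξ₂} ξ₁`, where `δ_ξ` is the change under
`δg = L_ξ g`. -/
def IsModBracket (ξ₁ ξ₂ ζ : FieldVF l r₀ γbar) : Prop :=
  ∀ m, ∃ v₁₂ v₂₁ : Bulk → Bulk,
    IsVariation ξ₂ m (lieDeriv (ξ₁ m) m.g) v₁₂ ∧ IsVariation ξ₁ m (lieDeriv (ξ₂ m) m.g) v₂₁ ∧
    ∀ z ∈ region r₀, ζ m z = VectorField.lieBracket ℝ (ξ₁ m) (ξ₂ m) z - v₁₂ z + v₂₁ z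

/-! ### Lie algebras of vector fields and of functions on the cylinder -/

/-- Smooth vector fields on the cylinder. -/
def CylVF : Submodule ℝ (Bdry → Bdry) where
  carrier := {Y | CylSmooth Y}
  add_mem' {a b} ha hb := ⟨ha.1.add hb.1, fun x => by simp [ha.2 x, hb.2 x]⟩
  zero_mem' := ⟨contDiff_const, fun _ => rfl⟩
  smul_mem' t a ha := ⟨ha.1.const_smul t, fun x => by simp [ha.2 x]⟩

/-- Smooth functions on the cylinder. -/
def CylFun : Submodule ℝ (Bdry → ℝ) where
  carrier := {f | CylSmooth f}
  add_mem' {a b} ha hb := ⟨ha.1.add hb.1, fun x => by simp [ha.2 x, hb.2 x]⟩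
  zero_mem' := ⟨contDiff_const, fun _ => rfl⟩
  smul_mem' t a ha := ⟨ha.1.const_smul t, fun x => by simp [ha.2 x]⟩

theorem cylVF_diff (Y : CylVF) (x : Bdry) : DifferentiableAt ℝ (Y : Bdry → Bdry) x :=
  (Y.2.1.differentiable (by simp)) x

theorem cylVF_bracket_mem (Y Z : CylVF) :
    CylSmooth (VectorField.lieBracket ℝ (Y : Bdry → Bdry) (Z : Bdry → Bdry)) := by
  refine ⟨Y.2.1.lieBracket_vectorField Z.2.1 (by simp), fun x => ?_⟩
  have key : ∀ W : CylVF, fderiv ℝ (W : Bdry → Bdry) (x + Pi.single 1 (2 * Real.pi))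
      = fderiv ℝ (W : Bdry → Bdry) x := by
    intro W
    rw [← fderiv_comp_add_right]
    congr 1
    funext y
    exact W.2.2 y
  simp only [VectorField.lieBracket, key, Y.2.2 x, Z.2.2 x]

/-- The Lie bracket of vector fields, `Y₁^B ∂_B Y₂^A - Y₂^B ∂_B Y₁^A`. -/
instance : Bracket CylVF CylVF :=
  ⟨fun Y Z => ⟨VectorField.lieBracket ℝ Y Z, cylVF_bracket_mem Y Z⟩⟩

theorem cylVF_coe_lie (Y Z : CylVF) :
    ((⁅Y, Z⁆ : CylVF) : Bdry → Bdry) = VectorField.lieBracket ℝ Y Z := rfl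

instance : LieRing CylVF where
  add_lie X Y Z := by
    ext1; funext x
    exact VectorField.lieBracket_add_left (cylVF_diff X x) (cylVF_diff Y x)
  lie_add X Y Z := by
    ext1; funext x
    exact VectorField.lieBracket_add_right (cylVF_diff Y x) (cylVF_diff Z x)
  lie_self X := by
    ext1
    exact VectorField.lieBracket_self
  leibniz_lie X Y Z := by
    ext1; funext x
    exact VectorField.leibniz_identity_lieBracket (n := ∞)
      (by simpa using WithTop.coe_le_coe.2 (le_top : (2 : ℕ∞) ≤ ⊤))
      X.2.1.contDiffAt Y.2.1.contDiffAt Z.2.1.contDiffAt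

instance : LieAlgebra ℝ CylVF where
  lie_smul t X Y := by
    ext1; funext x
    exact VectorField.lieBracket_const_smul_right (cylVF_diff Y x)

/-- Functions (infinitesimal Weyl rescalings) form an abelian Lie algebra. -/
instance : LieRing CylFun where
  bracket _ _ := 0
  add_lie _ _ _ := by simp
  lie_add _ _ _ := by simp
  lie_self _ := rfl
  leibniz_lie _ _ _ := by simp

instance : LieAlgebra ℝ CylFun where
  lie_smul t _ _ := (smul_zero t).symm

/-! ### Light-cone modes on the flat cylinder -/

/-- The light-cone coordinate `x^± = τ ± φ`. -/
def lc (s : ℤˣ) (x : Bdry) : ℝ := x 0 + ((s : ℤ) : ℝ) * x 1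

/-- The components of `∂_± = (∂_τ ± ∂_φ) / 2`. -/
def dlc (s : ℤˣ) : Fin 2 → ℂ := ![1 / 2, ((s : ℤ) : ℂ) / 2]

/-- The mode `e^{i n x^±}`. -/
def mode (s : ℤˣ) (n : ℤ) (x : Bdry) : ℂ := Complex.exp (Complex.I * (n : ℂ) * (lc s x : ℂ))

/-- The element `T` of the complexified semidirect product is the pair of the complex vector field
`Y` and the complex function `ψ`. -/
def Represents {𝔠 : LieSubalgebra ℝ CylVF} {ℋ : LieSubalgebra ℝ CylFun}
    {act : 𝔠 →ₗ⁅ℝ⁆ LieDerivation ℝ ℋ ℋ} (T : ℂ ⊗[ℝ] LieAlgebra.SemiDirectSum ℋ 𝔠 act)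
    (Y : Bdry → Fin 2 → ℂ) (ψ : Bdry → ℂ) : Prop :=
  ∃ a b : LieAlgebra.SemiDirectSum ℋ 𝔠 act,
    T = (1 : ℂ) ⊗ₜ[ℝ] a + Complex.I ⊗ₜ[ℝ] b ∧
    (∀ x A, Y x A = (((a.right : CylVF) : Bdry → Bdry) x A : ℂ)
      + Complex.I * (((b.right : CylVF) : Bdry → Bdry) x A : ℂ)) ∧
    ∀ x, ψ x = (((a.left : CylFun) : Bdry → ℝ) x : ℂ)
      + Complex.I * (((b.left : CylFun) : Bdry → ℝ) x : ℂ)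

/-- Rapidly decreasing coefficients. -/
def RapidDecay (c : ℤ → ℂ) : Prop := ∀ k : ℕ, Summable fun n : ℤ => |(n : ℝ)| ^ k * ‖c n‖

end

end AsymptoticAdS3

open Filter Topology Asymptotics MeasureTheory
open scoped ContDiff TensorProduct
open ContinuousLinearMap (coe_snd' comp_apply id_apply inr_apply proj_apply prod_apply)
open Matrix (det_fin_two of_apply cons_val_zero cons_val_one det_smul isSymm_zero)
open Finset (mul_sum sum_sub_distrib sum_congr sum_add_distrib sum_insert mem_univ sum_le_sum sum_nonneg single_le_sum)

namespace AsymptoticAdS3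

noncomputable section

set_option linter.unusedSectionVars false

local notation "I" => Complex.I
local notation "twoPi" => 2 * Real.pi
local notation:max "period" i:max => Pi.single i twoPi
local notation "Mat2" => Matrix (Fin 2) (Fin 2) ℝ
local notation "Mat3" => Matrix (Fin 3) (Fin 3) ℝ
local notation "Cinf" => ContDiff ℝ ∞
local notation "CinfOn" => ContDiffOn ℝ ∞
local notation "CinfAt" => ContDiffAt ℝ ∞
local notation "DiffAt" => DifferentiableAt ℝ
local notation:max "Fn" Y:max => Y × ℝ → ℝ
local notation "idB" => ContinuousLinearMap.id ℝ Bdry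
local notation:max "inB" P:max => ContinuousLinearMap.inr ℝ P Bdry
local notation:max "sndB" P:max => ContinuousLinearMap.snd ℝ P Bdry

/-- The region `ρ < r`. -/
local notation:max "far" ρ:max => Set.ofPred fun w => ρ < Prod.snd w

/-- The boundary metrics of a family. -/
local notation:max "famG" c:max => fun A B y => AsympMetric.γ (c (Prod.fst y)) (Prod.snd y) A B

lemma _root_.ContDiff.dif {E F : Type*} [NormedAddCommGroup E] [NormedSpace ℝ E] [NormedAddCommGroup F] [NormedSpace ℝ F]
    {f : E → F} (h : Cinf f) : Differentiable ℝ f := h.differentiable (by simp)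

lemma _root_.ContDiffAt.difAt {E F : Type*} [NormedAddCommGroup E] [NormedSpace ℝ E] [NormedAddCommGroup F]
    [NormedSpace ℝ F] {f : E → F} {x : E} (h : CinfAt f x) : DiffAt f x := h.differentiableAt (by simp)

variable {Y : Type*} [NormedAddCommGroup Y] [NormedSpace ℝ Y]

/-! ### Differentiable fall-offs at the asymptotic end -/

section FallOff

/-- The derivation `v.1 ∂_y + v.2 r ∂_r`. -/
def logD (v : Y × ℝ) (f : Fn Y) : Fn Y := fun w => fderiv ℝ f w (v.1, v.2 * w.2)

notation "lD" => logD

/-- The filter `r → ∞` with boundary parameter in `K`. -/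
def endAt (K : Set Y) : Filter (Y × ℝ) := 𝓟 K ×ˢ atTop

lemma eventually_endAt {K : Set Y} {p : Y × ℝ → Prop} :
    (∀ᶠ w in endAt K, p w) ↔ ∃ S : ℝ, ∀ y ∈ K, ∀ r, S ≤ r → p (y, r) := by
  rw [endAt, eventually_prod_iff]
  constructor
  · rintro ⟨pa, ha, pb, hb, h⟩
    obtain ⟨S, hS⟩ := eventually_atTop.1 hb
    exact ⟨S, fun y hy r hr => h (ha hy) (hS r hr)⟩
  · rintro ⟨S, hS⟩
    exact ⟨fun y => y ∈ K, by simp, fun r => S ≤ r, eventually_ge_atTop S, fun hy _ hr => hS _ hy _ hr⟩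

lemma eventually_gt_endAt (K : Set Y) (a : ℝ) : ∀ᶠ w in endAt K, a < w.2 :=
  eventually_endAt.2 ⟨a + 1, fun _ _ r hr => by simp only; linarith⟩

lemma eventually_mem_endAt (K : Set Y) : ∀ᶠ w in endAt K, w.1 ∈ K := eventually_endAt.2 ⟨0, fun _ hy _ _ => hy⟩

/-- Smoothness near the asymptotic end over `K`. -/
def GermSmooth (K : Set Y) (f : Fn Y) : Prop := ∀ᶠ w in endAt K, CinfAt f w

/-- Equality near the asymptotic end over `K`. -/
def GermEq (K : Set Y) (f g : Fn Y) : Prop := ∀ᶠ w in endAt K, f =ᶠ[𝓝 w] g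

/-- `f = O(r^k)` (for `b = true`) or `f = o(r^k)` (for `b = false`), uniformly on `K`. -/
def Small (b : Bool) (K : Set Y) (k : ℤ) (f : Fn Y) : Prop := match b with
  | true => f =O[endAt K] fun w => w.2 ^ k
  | false => f =o[endAt K] fun w => w.2 ^ k

/-- `Small` for all derivatives up to order `n`. -/
def Jet (b : Bool) (K : Set Y) (k : ℤ) : ℕ → (Fn Y) → Prop
  | 0, f => Small b K k f
  | n + 1, f => Small b K k f ∧ ∀ v, Jet b K k n (logD v f)

/-- Smooth near the asymptotic end over `K` and `Small` with all derivatives. -/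
structure Fall (b : Bool) (K : Set Y) (k : ℤ) (f : Fn Y) : Prop where
  smooth : GermSmooth K f
  jet : ∀ n, Jet b K k n f

variable {b b₁ b₂ : Bool} {K : Set Y} {k k₁ k₂ : ℤ} {n : ℕ} {f g : Fn Y}

lemma GermEq.refl (f : Fn Y) : GermEq K f f := Eventually.of_forall fun _ => EventuallyEq.rfl

lemma GermEq.symm (h : GermEq K f g) : GermEq K g f := h.mono fun _ hw => hw.symm

lemma GermEq.trans {h : Fn Y} (h₁ : GermEq K f g) (h₂ : GermEq K g h) : GermEq K f h := by
  filter_upwards [h₁, h₂] with w a b using a.trans b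

lemma GermEq.eventuallyEq (h : GermEq K f g) : f =ᶠ[endAt K] g := h.mono fun _ hw => hw.eq_of_nhds

lemma GermEq.logD (h : GermEq K f g) (v : Y × ℝ) : GermEq K (logD v f) (logD v g) := by
  filter_upwards [h] with w hw
  filter_upwards [hw.eventuallyEq_nhds] with w' hw'
  simp only [AsymptoticAdS3.logD, hw'.fderiv_eq]

lemma GermEq.of_forall_gt {R : ℝ} (h : ∀ w : Y × ℝ, R < w.2 → f w = g w) : GermEq K f g := by
  filter_upwards [eventually_gt_endAt K R] with w hw
  filter_upwards [(isOpen_lt continuous_const continuous_snd).mem_nhds hw] with w' hw' using h w' hw'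

lemma GermSmooth.congr (hf : GermSmooth K f) (h : GermEq K f g) : GermSmooth K g := by
  filter_upwards [hf, h] with w a b using a.congr_of_eventuallyEq b.symm

lemma GermSmooth.eventually_nhds (hf : GermSmooth K f) : ∀ᶠ w in endAt K, ∀ᶠ w' in 𝓝 w, DiffAt f w' := by
  filter_upwards [hf] with w hw
  have h1 : ContDiffAt ℝ 1 f w := hw.of_le (by simp)
  filter_upwards [h1.eventually (by simp)] with w' hw' using hw'.differentiableAt one_ne_zero

lemma GermSmooth.add (hf : GermSmooth K f) (hg : GermSmooth K g) : GermSmooth K (fun w => f w + g w) := by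
  filter_upwards [hf, hg] with w a b using a.add b

lemma GermSmooth.mul (hf : GermSmooth K f) (hg : GermSmooth K g) : GermSmooth K (fun w => f w * g w) := by
  filter_upwards [hf, hg] with w a b using a.mul b

lemma GermSmooth.const_mul (c : ℝ) (hf : GermSmooth K f) : GermSmooth K (fun w => c * f w) := by
  filter_upwards [hf] with w a using contDiffAt_const.mul a

lemma GermSmooth.logD (hf : GermSmooth K f) (v : Y × ℝ) : GermSmooth K (logD v f) := by
  filter_upwards [hf] with w hw
  have h1 : CinfAt (fderiv ℝ f) w := hw.fderiv_right (by simp)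
  exact h1.clm_apply (contDiffAt_const.prodMk (contDiffAt_const.mul contDiffAt_snd))

lemma logD_add_germ (hf : GermSmooth K f) (hg : GermSmooth K g) (v : Y × ℝ) :
    GermEq K (logD v fun w => f w + g w) (fun w => logD v f w + logD v g w) := by
  filter_upwards [hf.eventually_nhds, hg.eventually_nhds] with w a b
  filter_upwards [a, b] with w' a' b'
  simp [logD, fderiv_fun_add a' b']

lemma logD_mul_germ (hf : GermSmooth K f) (hg : GermSmooth K g) (v : Y × ℝ) :
    GermEq K (logD v fun w => f w * g w) (fun w => logD v f w * g w + f w * logD v g w) := by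
  filter_upwards [hf.eventually_nhds, hg.eventually_nhds] with w a b
  filter_upwards [a, b] with w' a' b'
  simp [logD, fderiv_fun_mul a' b']
  ring

lemma logD_const_mul_germ (c : ℝ) (hf : GermSmooth K f) (v : Y × ℝ) :
    GermEq K (logD v fun w => c * f w) (fun w => c * logD v f w) := by
  filter_upwards [hf.eventually_nhds] with w a
  filter_upwards [a] with w' a'
  simp [logD, fderiv_const_mul a']

lemma Small.congr (hf : Small b K k f) (h : f =ᶠ[endAt K] g) : Small b K k g := by
  cases b
  · exact IsLittleO.congr' hf h EventuallyEq.rfl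
  · exact IsBigO.congr' hf h EventuallyEq.rfl

lemma Small.add (hf : Small b K k f) (hg : Small b K k g) : Small b K k (fun w => f w + g w) := by
  cases b
  · exact IsLittleO.add hf hg
  · exact IsBigO.add hf hg

lemma Small.const_mul (c : ℝ) (hf : Small b K k f) : Small b K k (fun w => c * f w) := by
  cases b
  · exact IsLittleO.const_mul_left hf c
  · exact IsBigO.const_mul_left hf c

lemma Small.mul (hf : Small b₁ K k₁ f) (hg : Small b₂ K k₂ g) : Small (b₁ && b₂) K (k₁ + k₂) (fun w => f w * g w) := by
  have e : (fun w : Y × ℝ => w.2 ^ k₁ * w.2 ^ k₂) =ᶠ[endAt K] fun w => w.2 ^ (k₁ + k₂) := by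
    filter_upwards [eventually_gt_endAt K 0] with w hw using (zpow_add₀ hw.ne' _ _).symm
  cases b₁ <;> cases b₂
  · exact (IsLittleO.mul hf hg).congr' EventuallyEq.rfl e
  · exact (IsLittleO.mul_isBigO hf hg).congr' EventuallyEq.rfl e
  · exact (IsBigO.mul_isLittleO hf hg).congr' EventuallyEq.rfl e
  · exact (IsBigO.mul hf hg).congr' EventuallyEq.rfl e

lemma Small.big (hf : Small b K k f) : Small true K k f := by
  cases b
  · exact IsLittleO.isBigO hf
  · exact hf

lemma zpow_isBigO_endAt (h : k₁ ≤ k₂) : (fun w : Y × ℝ => w.2 ^ k₁) =O[endAt K] fun w => w.2 ^ k₂ := by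
  refine IsBigO.of_bound 1 ?_
  filter_upwards [eventually_gt_endAt K 1] with w hw
  rw [one_mul, Real.norm_of_nonneg (zpow_nonneg (by linarith) _), Real.norm_of_nonneg (zpow_nonneg (by linarith) _)]
  exact zpow_le_zpow_right₀ hw.le h

lemma tendsto_snd_endAt : Tendsto (fun w : Y × ℝ => w.2) (endAt K) atTop := tendsto_snd

lemma zpow_isLittleO_endAt (h : k₁ < k₂) : (fun w : Y × ℝ => w.2 ^ k₁) =o[endAt K] fun w => w.2 ^ k₂ := by
  rw [isLittleO_iff_tendsto']
  · have h1 : Tendsto (fun w : Y × ℝ => w.2 ^ (-(k₂ - k₁))) (endAt K) (𝓝 0) :=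
      (tendsto_zpow_atTop_zero (by omega)).comp tendsto_snd_endAt
    refine h1.congr' ?_
    filter_upwards [eventually_gt_endAt K 0] with w hw
    rw [← zpow_sub₀ hw.ne']; congr 1; omega
  · filter_upwards [eventually_gt_endAt K 0] with w hw h0
    exact absurd h0 (zpow_ne_zero _ hw.ne')

lemma Small.mono (hf : Small b K k₁ f) (h : k₁ ≤ k₂) : Small b K k₂ f := by
  cases b
  · exact IsLittleO.trans_isBigO hf (zpow_isBigO_endAt h)
  · exact IsBigO.trans hf (zpow_isBigO_endAt h)

lemma Small.lt (hf : Small b₁ K k₁ f) (h : k₁ < k₂) : Small b₂ K k₂ f := by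
  have : Small false K k₂ f := IsBigO.trans_isLittleO hf.big (zpow_isLittleO_endAt h)
  cases b₂
  · exact this
  · exact this.big

lemma Small.zero : Small b K k (fun _ => 0) := by
  cases b
  · exact isLittleO_zero _ _
  · exact isBigO_zero _ _

lemma Jet.small (h : Jet b K k n f) : Small b K k f := by
  cases n
  · exact h
  · exact h.1

lemma Jet.congr (hf : Jet b K k n f) (h : GermEq K f g) : Jet b K k n g := by
  induction n generalizing f g with
  | zero => exact Small.congr hf h.eventuallyEq
  | succ n ih => exact ⟨hf.1.congr h.eventuallyEq, fun v => ih (hf.2 v) (h.logD v)⟩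

lemma Jet.pred (hf : Jet b K k (n + 1) f) : Jet b K k n f := by
  induction n generalizing f with
  | zero => exact hf.1
  | succ n ih => exact ⟨hf.1, fun v => ih (hf.2 v)⟩

lemma Jet.imp {b' : Bool} {k' : ℤ} (H : ∀ f : Fn Y, Small b K k f → Small b' K k' f)
    (hf : Jet b K k n f) : Jet b' K k' n f := by
  induction n generalizing f with
  | zero => exact H _ hf
  | succ n ih => exact ⟨H _ hf.1, fun v => ih (hf.2 v)⟩

lemma Jet.add (hf' : GermSmooth K f) (hg' : GermSmooth K g) (hf : Jet b K k n f)
    (hg : Jet b K k n g) : Jet b K k n (fun w => f w + g w) := by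
  induction n generalizing f g with
  | zero => exact Small.add hf hg
  | succ n ih =>
    exact ⟨hf.1.add hg.1, fun v => (ih (hf'.logD v) (hg'.logD v) (hf.2 v) (hg.2 v)).congr
      (logD_add_germ hf' hg' v).symm⟩

lemma Jet.const_mul (c : ℝ) (hf' : GermSmooth K f) (hf : Jet b K k n f) : Jet b K k n (fun w => c * f w) := by
  induction n generalizing f with
  | zero => exact Small.const_mul c hf
  | succ n ih =>
    exact ⟨hf.1.const_mul c, fun v => (ih (hf'.logD v) (hf.2 v)).congr (logD_const_mul_germ c hf' v).symm⟩

lemma Jet.mul (hf' : GermSmooth K f) (hg' : GermSmooth K g) (hf : Jet b₁ K k₁ n f)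
    (hg : Jet b₂ K k₂ n g) : Jet (b₁ && b₂) K (k₁ + k₂) n (fun w => f w * g w) := by
  induction n generalizing f g with
  | zero => exact Small.mul hf hg
  | succ n ih =>
    refine ⟨hf.1.mul hg.1, fun v => ?_⟩
    exact (Jet.add ((hf'.logD v).mul hg') (hf'.mul (hg'.logD v))
      (ih (hf'.logD v) hg' (hf.2 v) hg.pred) (ih hf' (hg'.logD v) hf.pred (hg.2 v))).congr
      (logD_mul_germ hf' hg' v).symm

lemma Fall.congr (hf : Fall b K k f) (h : GermEq K f g) : Fall b K k g :=
  ⟨hf.smooth.congr h, fun n => (hf.jet n).congr h⟩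

lemma Fall.small (hf : Fall b K k f) : Small b K k f := hf.jet 0

lemma Fall.add (hf : Fall b K k f) (hg : Fall b K k g) : Fall b K k (fun w => f w + g w) :=
  ⟨hf.smooth.add hg.smooth, fun n => (hf.jet n).add hf.smooth hg.smooth (hg.jet n)⟩

lemma Fall.const_mul (c : ℝ) (hf : Fall b K k f) : Fall b K k (fun w => c * f w) :=
  ⟨hf.smooth.const_mul c, fun n => (hf.jet n).const_mul c hf.smooth⟩

lemma Fall.neg (hf : Fall b K k f) : Fall b K k (fun w => -f w) := by
  simpa using hf.const_mul (-1)

lemma Fall.sub (hf : Fall b K k f) (hg : Fall b K k g) : Fall b K k (fun w => f w - g w) := by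
  simpa [sub_eq_add_neg] using hf.add hg.neg

lemma Fall.mul (hf : Fall b₁ K k₁ f) (hg : Fall b₂ K k₂ g) : Fall (b₁ && b₂) K (k₁ + k₂) (fun w => f w * g w) :=
  ⟨hf.smooth.mul hg.smooth, fun n => (hf.jet n).mul hf.smooth hg.smooth (hg.jet n)⟩

lemma Fall.big (hf : Fall b K k f) : Fall true K k f := ⟨hf.smooth, fun n => (hf.jet n).imp fun _ h => h.big⟩

lemma Fall.mono (hf : Fall b K k₁ f) (h : k₁ ≤ k₂) : Fall b K k₂ f :=
  ⟨hf.smooth, fun n => (hf.jet n).imp fun _ h' => h'.mono h⟩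

lemma Fall.lt (hf : Fall b₁ K k₁ f) (h : k₁ < k₂) : Fall b₂ K k₂ f :=
  ⟨hf.smooth, fun n => (hf.jet n).imp fun _ h' => h'.lt h⟩

lemma Fall.logD (hf : Fall b K k f) (v : Y × ℝ) : Fall b K k (logD v f) :=
  ⟨hf.smooth.logD v, fun n => (hf.jet (n + 1)).2 v⟩

lemma Fall.zero : Fall b K k (fun _ : Y × ℝ => 0) := by
  refine ⟨Eventually.of_forall fun _ => contDiffAt_const, fun n => ?_⟩
  induction n with
  | zero => exact Small.zero
  | succ n ih =>
    refine ⟨Small.zero, fun v => ?_⟩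
    have : lD v (fun _ : Y × ℝ => 0) = fun _ => 0 := by
      funext w; simp [AsymptoticAdS3.logD]
    rw [this]; exact ih

lemma Fall.sum {ι : Type*} {s : Finset ι} {F : ι → Fn Y} (h : ∀ i ∈ s, Fall b K k (F i)) :
    Fall b K k (fun w => ∑ i ∈ s, F i w) := by
  classical
  induction s using Finset.induction_on with
  | empty => simpa using Fall.zero
  | insert i s hi ih =>
    simp only [sum_insert hi]
    exact (h i (by simp)).add (ih fun j hj => h j (by simp [hj]))

lemma Fall.of_fst {a : Y → ℝ} (ha : Cinf a) (hK : IsCompact K) : Fall true K 0 (fun w : Y × ℝ => a w.1) := by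
  refine ⟨Eventually.of_forall fun _ => (ha.comp contDiff_fst).contDiffAt, fun n => ?_⟩
  have small : ∀ a : Y → ℝ, Cinf a → Small true K 0 (fun w : Y × ℝ => a w.1) := by
    intro a ha
    obtain ⟨C, hC⟩ := hK.exists_bound_of_continuousOn ha.continuous.continuousOn
    refine IsBigO.of_bound C ?_
    filter_upwards [eventually_mem_endAt K] with w hw
    simpa using hC _ hw
  induction n generalizing a with
  | zero => exact small a ha
  | succ n ih =>
    refine ⟨small a ha, fun v => ?_⟩
    have e : lD v (fun w : Y × ℝ => a w.1) = fun w => (fun y => fderiv ℝ a y v.1) w.1 := by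
      funext w
      have h1 : HasFDerivAt (fun w : Y × ℝ => a w.1) ((fderiv ℝ a w.1).comp (ContinuousLinearMap.fst ℝ Y ℝ)) w :=
        ((ha.dif) w.1).hasFDerivAt.comp w hasFDerivAt_fst
      simp [AsymptoticAdS3.logD, h1.fderiv]
    rw [e]
    exact ih ((ha.fderiv_right (by simp)).clm_apply contDiff_const)

lemma contDiffAt_zpow_snd (m : ℤ) {w : Y × ℝ} (hw : 0 < w.2) : CinfAt (fun w : Y × ℝ => w.2 ^ m) w := by
  cases m with
  | ofNat m => simpa using (contDiffAt_snd (𝕜 := ℝ) (p := w)).pow m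
  | negSucc m =>
    simp only [zpow_negSucc]
    exact ((contDiffAt_snd (𝕜 := ℝ) (p := w)).pow (m + 1)).inv (pow_ne_zero _ hw.ne')

lemma logD_zpow {m : ℤ} {v w : Y × ℝ} (hw : 0 < w.2) : logD v (fun w : Y × ℝ => w.2 ^ m) w = v.2 * m * w.2 ^ m := by
  have h1 : HasFDerivAt (fun w : Y × ℝ => w.2 ^ m) (((m : ℝ) * w.2 ^ (m - 1)) • (ContinuousLinearMap.snd ℝ Y ℝ)) w :=
    (hasDerivAt_zpow m w.2 (Or.inl hw.ne')).comp_hasFDerivAt w hasFDerivAt_snd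
  simp only [logD, h1.fderiv, smul_apply, coe_snd', smul_eq_mul]
  rw [zpow_sub_one₀ hw.ne']
  field_simp

lemma Fall.zpow (m : ℤ) : Fall true K m (fun w : Y × ℝ => w.2 ^ m) := by
  have hs : GermSmooth K (fun w : Y × ℝ => w.2 ^ m) := by
    filter_upwards [eventually_gt_endAt K 0] with w hw
    exact contDiffAt_zpow_snd m hw
  refine ⟨hs, fun n => ?_⟩
  induction n with
  | zero => exact isBigO_refl _ _
  | succ n ih =>
    refine ⟨isBigO_refl _ _, fun v => ?_⟩
    refine (ih.const_mul (v.2 * m) hs).congr (GermEq.of_forall_gt (R := 0) fun w hw => ?_)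
    rw [logD_zpow hw]

lemma Fall.inv (hf : Fall true K 0 f) {c : ℝ} (hc : 0 < c) (h : ∀ᶠ w in endAt K, c ≤ |f w|) :
    Fall true K 0 (fun w => (f w)⁻¹) := by
  have hne : ∀ᶠ w in endAt K, f w ≠ 0 := h.mono fun w hw h0 => by
    rw [h0, abs_zero] at hw; linarith
  have hs : GermSmooth K (fun w => (f w)⁻¹) := by
    filter_upwards [hf.smooth, hne] with w a b using a.inv b
  refine ⟨hs, fun n => ?_⟩
  have h0 : Small true K 0 (fun w => (f w)⁻¹) := by
    refine IsBigO.of_bound c⁻¹ ?_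
    filter_upwards [h] with w hw
    simp only [zpow_zero, norm_one, mul_one, norm_inv, Real.norm_eq_abs]
    exact inv_anti₀ hc hw
  induction n with
  | zero => exact h0
  | succ n ih =>
    refine ⟨h0, fun v => ?_⟩
    have e : GermEq K (lD v fun w => (f w)⁻¹) (fun w => -1 * (((f w)⁻¹ * (f w)⁻¹) * lD v f w)) := by
      filter_upwards [hf.smooth.eventually_nhds, hne, hf.smooth] with w a hw hcont
      have hne' : ∀ᶠ w' in 𝓝 w, f w' ≠ 0 := hcont.continuousAt.eventually_ne hw
      filter_upwards [a, hne'] with w' a' b'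
      have := (hasDerivAt_inv b').comp_hasFDerivAt w' a'.hasFDerivAt
      have h2 : HasFDerivAt (fun w => (f w)⁻¹) _ w' := this
      simp only [AsymptoticAdS3.logD, h2.fderiv]
      simp only [smul_apply, smul_eq_mul]
      field_simp
    have := ((ih.mul hs hs ih).mul (hs.mul hs) (hf.smooth.logD v) ((hf.jet (n + 1)).2 v))
    exact (this.const_mul (-1) ((hs.mul hs).mul (hf.smooth.logD v))).congr e.symm

end FallOff

section Bridge

/-- The change of variables `r = e^s`. -/
def logMap (w : Y × ℝ) : Y × ℝ := (w.1, Real.exp w.2)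

variable {b : Bool} {K : Set Y} {k : ℤ} {n : ℕ} {f g : Fn Y}

lemma tendsto_logMap : Tendsto (logMap (Y := Y)) (endAt K) (endAt K) :=
  (tendsto_fst).prodMk (Real.tendsto_exp_atTop.comp tendsto_snd)

lemma Small.comp {φ : Y × ℝ → Y × ℝ} (hφ : Tendsto φ (endAt K) (endAt K)) (h : Small b K 0 f) :
    Small b K 0 (f ∘ φ) := by
  cases b
  · exact (IsLittleO.comp_tendsto h hφ).congr_right fun x => by simp
  · exact (IsBigO.comp_tendsto h hφ).congr_right fun x => by simp

lemma Small.of_comp_logMap (h : Small b K 0 (f ∘ logMap)) : Small b K 0 f := by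
  have hφ : Tendsto (fun w : Y × ℝ => (w.1, Real.log w.2)) (endAt K) (endAt K) :=
    (tendsto_fst).prodMk (Real.tendsto_log_atTop.comp tendsto_snd)
  refine (h.comp hφ).congr ?_
  filter_upwards [eventually_gt_endAt K 0] with w hw
  simp [logMap, Real.exp_log hw]

lemma Small.of_norm_le {f g : Fn Y} (hg : Small b K k g) (h : ∀ᶠ w in endAt K, ‖f w‖ ≤ ‖g w‖) :
    Small b K k f := by
  cases b
  · exact (IsBigO.of_bound' h).trans_isLittleO hg
  · exact (IsBigO.of_bound' h).trans hg

lemma contDiff_logMap : Cinf (logMap (Y := Y)) := contDiff_fst.prodMk (Real.contDiff_exp.comp contDiff_snd)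

lemma fderiv_comp_logMap {w : Y × ℝ} (hf : DiffAt f (logMap w)) (v : Y × ℝ) :
    fderiv ℝ (f ∘ logMap) w v = logD v f (logMap w) := by
  have h1 : HasFDerivAt (logMap (Y := Y)) ((ContinuousLinearMap.fst ℝ Y ℝ).prod
      (Real.exp w.2 • ContinuousLinearMap.snd ℝ Y ℝ)) w :=
    hasFDerivAt_fst.prodMk ((Real.hasDerivAt_exp w.2).comp_hasFDerivAt w hasFDerivAt_snd)
  rw [(hf.hasFDerivAt.comp w h1).fderiv]
  simp [logD, logMap, mul_comm]

lemma GermSmooth.comp_logMap (hf : GermSmooth K f) : GermSmooth K (f ∘ logMap) := by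
  filter_upwards [tendsto_logMap.eventually hf] with w hw
  exact ContDiffAt.comp w hw contDiff_logMap.contDiffAt

lemma fderiv_comp_logMap_germ (hf : GermSmooth K f) (v : Y × ℝ) :
    GermEq K (logD v f ∘ logMap) (fun w => fderiv ℝ (f ∘ logMap) w v) := by
  filter_upwards [tendsto_logMap.eventually hf.eventually_nhds] with w hw
  filter_upwards [contDiff_logMap.continuous.continuousAt.eventually hw] with w' hw'
  simp [fderiv_comp_logMap hw']

lemma jet_of_iteratedFDeriv (hf : GermSmooth K f)
    (h : ∀ n, Small b K 0 fun w => ‖iteratedFDeriv ℝ n (f ∘ logMap) w‖) (n : ℕ) :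
    Jet b K 0 n f := by
  have h0 : ∀ f : Fn Y, (∀ n, Small b K 0 fun w => ‖iteratedFDeriv ℝ n (f ∘ logMap) w‖) →
      Small b K 0 f := fun f h => Small.of_comp_logMap <|
    (h 0).of_norm_le (Eventually.of_forall fun w => by simp)
  induction n generalizing f with
  | zero => exact h0 f h
  | succ n ih =>
    refine ⟨h0 f h, fun v => ih (hf.logD v) fun m => ?_⟩
    refine ((h (m + 1)).const_mul ‖v‖).of_norm_le ?_
    filter_upwards [fderiv_comp_logMap_germ hf v, hf.comp_logMap] with w hw hs
    rw [hw.iteratedFDeriv ℝ m |>.eq_of_nhds, norm_norm]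
    have h1 : ContDiffAt ℝ m (fderiv ℝ (f ∘ logMap)) w := hs.fderiv_right (by exact_mod_cast le_top)
    refine (norm_iteratedFDeriv_clm_apply_const h1 le_rfl).trans (le_of_eq ?_)
    rw [norm_iteratedFDeriv_fderiv]
    simp

lemma small_sum {ι : Type*} (s : Finset ι) {F : ι → Fn Y} (h : ∀ i ∈ s, Small b K k (F i)) :
    Small b K k (fun w => ∑ i ∈ s, F i w) := by
  classical
  induction s using Finset.induction_on with
  | empty => simpa using Small.zero
  | insert i s hi ih =>
    simp only [sum_insert hi]
    exact (h i (by simp)).add (ih fun j hj => h j (by simp [hj]))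

lemma iteratedFDeriv_of_jet [FiniteDimensional ℝ Y] (hf : GermSmooth K f) (h : Jet b K 0 n f) :
    Small b K 0 fun w => ‖iteratedFDeriv ℝ n (f ∘ logMap) w‖ := by
  induction n generalizing f with
  | zero =>
    have h' : Small b K 0 f := h
    exact (h'.comp tendsto_logMap).of_norm_le (Eventually.of_forall fun w => by simp)
  | succ n ih =>
    let B := Module.finBasis ℝ (Y × ℝ)
    let c : ∀ i, (Y × ℝ) →L[ℝ] ℝ := fun i => LinearMap.toContinuousLinearMap (B.coord i)
    have key : ∀ w : Y × ℝ, fderiv ℝ (f ∘ logMap) w = ∑ i, (fderiv ℝ (f ∘ logMap) w (B i)) • c i := by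
      intro w
      refine ContinuousLinearMap.ext fun v => ?_
      have h1 := congrArg (fderiv ℝ (f ∘ logMap) w) (B.sum_repr v).symm
      rw [map_sum] at h1
      rw [h1]
      simp [c, mul_comm]
    have hF : fderiv ℝ (f ∘ logMap) = fun w => ∑ i, (fderiv ℝ (f ∘ logMap) w (B i)) • c i := funext key
    have hs := small_sum (b := b) (K := K) (k := 0) Finset.univ (F := fun i w =>
        ‖c i‖ * ‖iteratedFDeriv ℝ n (logD (B i) f ∘ logMap) w‖)
      (fun i _ => (ih (hf.logD (B i)) (h.2 (B i))).const_mul _)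
    refine hs.of_norm_le ?_
    have hev : ∀ᶠ w in endAt K, ∀ i, (logD (B i) f ∘ logMap) =ᶠ[𝓝 w] (fun w => fderiv ℝ (f ∘ logMap) w (B i)) :=
      eventually_all.2 fun i => fderiv_comp_logMap_germ hf (B i)
    filter_upwards [hev, hf.comp_logMap] with w hw hcd
    rw [norm_norm, ← norm_iteratedFDeriv_fderiv, hF]
    have hcd1 : ContDiffAt ℝ n (fderiv ℝ (f ∘ logMap)) w := hcd.fderiv_right (by exact_mod_cast le_top)
    have hcd2 : ∀ i, ContDiffAt ℝ n (fun w => fderiv ℝ (f ∘ logMap) w (B i)) w := fun i =>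
      hcd1.clm_apply contDiffAt_const
    have e1 : iteratedFDeriv ℝ n (fun w => ∑ i, (fderiv ℝ (f ∘ logMap) w (B i)) • c i) w
        = ∑ i, iteratedFDeriv ℝ n (fun w => (fderiv ℝ (f ∘ logMap) w (B i)) • c i) w := by
      rw [iteratedFDeriv_fun_sum_apply]
      intro i _
      exact (hcd2 i).smul contDiffAt_const
    rw [e1, Real.norm_of_nonneg (sum_nonneg fun i _ => by positivity)]
    refine (norm_sum_le _ _).trans (sum_le_sum fun i _ => ?_)
    rw [(hw i).iteratedFDeriv ℝ n |>.eq_of_nhds]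
    have e2 : (fun w => (fderiv ℝ (f ∘ logMap) w (B i)) • c i) = (ContinuousLinearMap.smulRight (1 : ℝ →L[ℝ] ℝ) (c i)) ∘
          (fun w => fderiv ℝ (f ∘ logMap) w (B i)) := by
      funext w; simp
    rw [e2]
    refine (ContinuousLinearMap.norm_iteratedFDeriv_comp_left _ (hcd2 i) le_rfl).trans ?_
    gcongr
    simp

/-- Smooth on `r > ρ` with fall-off over every compact set. -/
structure IsFall (ρ : ℝ) (b : Bool) (k : ℤ) (f : Fn Y) : Prop where
  smooth : CinfOn f (far ρ)
  fall : ∀ K, IsCompact K → Fall b K k f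

lemma germSmooth_of_contDiffOn {ρ : ℝ} (h : CinfOn f (far ρ)) (K : Set Y) :
    GermSmooth K f := by
  filter_upwards [eventually_gt_endAt K ρ] with w hw
  exact h.contDiffAt ((isOpen_lt continuous_const continuous_snd).mem_nhds hw)

lemma logRescale_eq (k : ℤ) (F : Y → ℝ → ℝ) : logRescale k F = (fun w : Y × ℝ => w.2 ^ (-k) * F w.1 w.2) ∘ logMap := rfl

lemma fall_rescale (hf : Fall b K 0 (fun w => w.2 ^ (-k) * f w)) : Fall b K k f := by
  have h := (Fall.zpow (Y := Y) (K := K) k).mul hf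
  rw [add_zero] at h
  refine h.congr (GermEq.of_forall_gt (R := 0) fun w hw => ?_)
  rw [← mul_assoc, ← zpow_add₀ hw.ne']
  simp

lemma iteratedFDeriv_logRescale_iff [FiniteDimensional ℝ Y] {F : Y → ℝ → ℝ} (hs : GermSmooth K (fun w => F w.1 w.2)) :
    (∀ n, Small b K 0 fun w => ‖iteratedFDeriv ℝ n (logRescale k F) w‖) ↔ Fall b K k (fun w => F w.1 w.2) := by
  have hs' : GermSmooth K (fun w => w.2 ^ (-k) * F w.1 w.2) := (Fall.zpow (-k)).smooth.mul hs
  rw [logRescale_eq]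
  constructor
  · intro h
    exact fall_rescale ⟨hs', jet_of_iteratedFDeriv hs' h⟩
  · intro h n
    have h2 := (Fall.zpow (Y := Y) (K := K) (-k)).mul h
    rw [neg_add_cancel] at h2
    exact iteratedFDeriv_of_jet hs' (h2.jet n)

lemma isBigO_iff_isFall [FiniteDimensional ℝ Y] {ρ : ℝ} {F : Y → ℝ → ℝ} :
    IsBigO ρ k F ↔ IsFall ρ true k (fun w => F w.1 w.2) := by
  have key : ∀ n (K : Set Y), (∃ C S : ℝ, ∀ y ∈ K, ∀ s : ℝ, S ≤ s → ‖iteratedFDeriv ℝ n (logRescale k F) (y, s)‖ ≤ C) ↔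
      Small true K 0 fun w => ‖iteratedFDeriv ℝ n (logRescale k F) w‖ := by
    intro n K
    simp only [Small, zpow_zero]
    rw [isBigO_iff]
    simp only [norm_norm, norm_one, mul_one, eventually_endAt]
  exact ⟨fun ⟨h1, h2⟩ => ⟨h1, fun K hK => (iteratedFDeriv_logRescale_iff (germSmooth_of_contDiffOn h1 K)).1
      fun n => (key n K).1 (h2 n K hK)⟩, fun ⟨h1, h2⟩ => ⟨h1, fun n K hK => (key n K).2
      ((iteratedFDeriv_logRescale_iff (germSmooth_of_contDiffOn h1 K)).2 (h2 K hK) n)⟩⟩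

lemma isLittleO_iff_isFall [FiniteDimensional ℝ Y] {ρ : ℝ} {F : Y → ℝ → ℝ} :
    IsLittleO ρ k F ↔ IsFall ρ false k (fun w => F w.1 w.2) := by
  have key : ∀ n (K : Set Y), (∀ ε : ℝ, 0 < ε → ∃ S : ℝ, ∀ y ∈ K, ∀ s : ℝ, S ≤ s →
      ‖iteratedFDeriv ℝ n (logRescale k F) (y, s)‖ ≤ ε) ↔
      Small false K 0 fun w => ‖iteratedFDeriv ℝ n (logRescale k F) w‖ := by
    intro n K
    simp only [Small, zpow_zero]
    rw [isLittleO_iff]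
    simp only [norm_norm, norm_one, mul_one, eventually_endAt]
  exact ⟨fun ⟨h1, h2⟩ => ⟨h1, fun K hK => (iteratedFDeriv_logRescale_iff (germSmooth_of_contDiffOn h1 K)).1
      fun n => (key n K).1 (h2 n K hK)⟩, fun ⟨h1, h2⟩ => ⟨h1, fun n K hK => (key n K).2
      ((iteratedFDeriv_logRescale_iff (germSmooth_of_contDiffOn h1 K)).2 (h2 K hK) n)⟩⟩

end Bridge

section Integration

variable {b b₁ b₂ : Bool} {K : Set Y} {k k₁ k₂ : ℤ} {n : ℕ} {f g : Fn Y} {ρ : ℝ}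

lemma isOpen_end (ρ : ℝ) : IsOpen (far ρ : Set (Y × ℝ)) := isOpen_lt continuous_const continuous_snd

lemma logD_comm {w : Y × ℝ} (hf : CinfAt f w) (u v : Y × ℝ) : logD u (logD v f) w = logD v (logD u f) w := by
  have hsymm : IsSymmSndFDerivAt ℝ f w := hf.isSymmSndFDerivAt
    (by simpa using WithTop.coe_le_coe.2 (le_top : (2 : ℕ∞) ≤ ⊤))
  have hd : DiffAt (fderiv ℝ f) w := (hf.fderiv_right (m := ∞) (by simp)).difAt
  have key : ∀ u v : Y × ℝ, logD u (logD v f) w = fderiv ℝ (fderiv ℝ f) w (u.1, u.2 * w.2) (v.1, v.2 * w.2)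
        + fderiv ℝ f w (0, v.2 * (u.2 * w.2)) := by
    intro u v
    have h1 : HasFDerivAt (fun w : Y × ℝ => ((v.1, v.2 * w.2) : Y × ℝ))
        ((0 : Y × ℝ →L[ℝ] Y).prod (v.2 • ContinuousLinearMap.snd ℝ Y ℝ)) w :=
      (hasFDerivAt_const _ _).prodMk (hasFDerivAt_snd.const_mul v.2)
    have h2 := hd.hasFDerivAt.clm_apply h1
    have h3 : HasFDerivAt (logD v f) _ w := h2
    simp only [logD] at h3 ⊢
    rw [h3.fderiv]
    simp [add_comm]
  rw [key, key, hsymm.eq]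
  congr 2
  ext <;> simp
  ring

lemma logD_comm_germ (hf : CinfOn f (far ρ)) (u v : Y × ℝ) : GermEq K (logD u (logD v f)) (logD v (logD u f)) :=
  GermEq.of_forall_gt (R := ρ) fun _ hw =>
    logD_comm (hf.contDiffAt ((isOpen_end ρ).mem_nhds hw)) u v

lemma logD_contDiffOn (hf : CinfOn f (far ρ)) (v : Y × ℝ) : CinfOn (logD v f) (far ρ) := by
  have h1 : CinfOn (fderiv ℝ f) (far ρ) := hf.fderiv_of_isOpen (isOpen_end ρ) (by simp)
  exact h1.clm_apply (contDiff_const.prodMk (contDiff_const.mul contDiff_snd)).contDiffOn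

lemma hasDerivAt_snd {y : Y} {r : ℝ} (hr : r ≠ 0) (hf : DiffAt f (y, r)) :
    HasDerivAt (fun r => f (y, r)) (logD (0, 1) f (y, r) / r) r := by
  have h1 : HasDerivAt (fun r : ℝ => ((y, r) : Y × ℝ)) (0, 1) r := (hasDerivAt_const r y).prodMk (hasDerivAt_id r)
  have h2 := hf.hasFDerivAt.comp_hasDerivAt r h1
  have e : ((0, 1 * r) : Y × ℝ) = r • ((0, 1) : Y × ℝ) := by ext <;> simp
  refine h2.congr_deriv ?_
  simp only [logD, e, map_smul, smul_eq_mul]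
  field_simp

lemma hasFDerivAt_fst_slot {y : Y} {r : ℝ} (hf : DiffAt f (y, r)) :
    HasFDerivAt (fun y => f (y, r)) ((fderiv ℝ f (y, r)).comp (ContinuousLinearMap.inl ℝ Y ℝ)) y := by
  have h1 : HasFDerivAt (fun y : Y => ((y, r) : Y × ℝ)) (ContinuousLinearMap.inl ℝ Y ℝ) y := hasFDerivAt_prodMk_left y r
  exact hf.hasFDerivAt.comp y h1

lemma logD_fst {a : Y → ℝ} {w v : Y × ℝ} (ha : DiffAt a w.1) :
    logD v (fun w : Y × ℝ => a w.1) w = fderiv ℝ a w.1 v.1 := by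
  have h1 : HasFDerivAt (fun w : Y × ℝ => a w.1) ((fderiv ℝ a w.1).comp
      (ContinuousLinearMap.fst ℝ Y ℝ)) w := ha.hasFDerivAt.comp w hasFDerivAt_fst
  simp [AsymptoticAdS3.logD, h1.fderiv]

/-! #### Integration from infinity -/

lemma abs_le_of_deriv_zpow {φ φ' : ℝ → ℝ} {S C : ℝ} {k : ℤ} (hk : 0 < k) (hS : 0 < S)
    (hd : ∀ r, S ≤ r → HasDerivAt φ (φ' r / r) r) (hb : ∀ r, S ≤ r → |φ' r| ≤ C * r ^ (-k)) :
    ∃ a, Tendsto φ atTop (𝓝 a) ∧ ∀ r, S ≤ r → |φ r - a| ≤ C / k * r ^ (-k) := by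
  have hk' : (0 : ℝ) < k := by exact_mod_cast hk
  have hz : ∀ r, S ≤ r → HasDerivAt (fun r : ℝ => C / k * r ^ (-k)) (-(C * r ^ (-k)) / r) r := by
    intro r hr
    have hr0 : r ≠ 0 := (hS.trans_le hr).ne'
    refine ((hasDerivAt_zpow (-k) r (Or.inl hr0)).const_mul (C / k)).congr_deriv ?_
    rw [zpow_sub_one₀ hr0]; push_cast; field_simp
  have hlim : Tendsto (fun r : ℝ => C / k * r ^ (-k)) atTop (𝓝 0) := by
    simpa using (tendsto_zpow_atTop_zero (𝕜 := ℝ) (n := -k) (by omega)).const_mul (C / k)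
  have conv : Convex ℝ (Set.Ici S) := convex_Ici S
  have hint : ∀ r ∈ interior (Set.Ici S), S ≤ r := fun r hr => interior_subset hr
  have anti : AntitoneOn (fun r => φ r + C / k * r ^ (-k)) (Set.Ici S) := by
    refine antitoneOn_of_deriv_nonpos conv (fun r hr => ((hd r hr).add (hz r hr)).continuousAt.continuousWithinAt)
      (fun r hr => ((hd r (hint r hr)).add (hz r (hint r hr))).differentiableAt.differentiableWithinAt) ?_
    intro r hr
    have hr := hint r hr
    have hD : deriv (fun r => φ r + C / k * r ^ (-k)) r = _ := ((hd r hr).add (hz r hr)).deriv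
    rw [hD, ← add_div]
    have := (abs_le.1 (hb r hr)).2
    exact div_nonpos_of_nonpos_of_nonneg (by linarith) (hS.trans_le hr).le
  have mono : MonotoneOn (fun r => φ r - C / k * r ^ (-k)) (Set.Ici S) := by
    refine monotoneOn_of_deriv_nonneg conv (fun r hr => ((hd r hr).sub (hz r hr)).continuousAt.continuousWithinAt)
      (fun r hr => ((hd r (hint r hr)).sub (hz r (hint r hr))).differentiableAt.differentiableWithinAt) ?_
    intro r hr
    have hr := hint r hr
    have hD : deriv (fun r => φ r - C / k * r ^ (-k)) r = _ := ((hd r hr).sub (hz r hr)).deriv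
    rw [hD, ← sub_div]
    have := (abs_le.1 (hb r hr)).1
    exact div_nonneg (by linarith) (hS.trans_le hr).le
  have hC : 0 ≤ C := by
    have h1 := (abs_nonneg _).trans (hb S le_rfl)
    have h2 : 0 < S ^ (-k) := zpow_pos hS _
    by_contra h
    nlinarith
  have hnn : ∀ r, S ≤ r → 0 ≤ C / k * r ^ (-k) := fun r hr => by
    have := zpow_pos (hS.trans_le hr) (-k)
    positivity
  have hex : ∃ a, Tendsto (fun r => φ (max S r) - C / k * (max S r) ^ (-k)) atTop (𝓝 a) := by
    refine ⟨_, tendsto_atTop_ciSup (fun x y hxy => mono (Set.mem_Ici.2 (le_max_left _ _)) (Set.mem_Ici.2 (le_max_left _ _))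
      (max_le_max le_rfl hxy)) ⟨φ S + C / k * S ^ (-k), ?_⟩⟩
    rintro _ ⟨r, rfl⟩
    have h1 := anti (Set.mem_Ici.2 le_rfl) (Set.mem_Ici.2 (le_max_left S r)) (le_max_left S r)
    have h2 := hnn (max S r) (le_max_left _ _)
    simp only at h1 ⊢
    linarith
  obtain ⟨a, ha⟩ := hex
  have ha' : Tendsto (fun r => φ r - C / k * r ^ (-k)) atTop (𝓝 a) := by
    refine ha.congr' ?_
    filter_upwards [eventually_ge_atTop S] with r hr
    rw [max_eq_right hr]
  have hφ : Tendsto φ atTop (𝓝 a) := by simpa using ha'.add hlim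
  refine ⟨a, hφ, fun r hr => ?_⟩
  have h1 : φ r - C / k * r ^ (-k) ≤ a := by
    refine ge_of_tendsto ha' ?_
    filter_upwards [eventually_ge_atTop r] with r' hr'
    exact mono hr (hr.trans hr') hr'
  have h2 : a ≤ φ r + C / k * r ^ (-k) := by
    have h3 : Tendsto (fun r => φ r + C / k * r ^ (-k)) atTop (𝓝 a) := by simpa using hφ.add hlim
    refine le_of_tendsto h3 ?_
    filter_upwards [eventually_ge_atTop r] with r' hr'
    exact anti hr (hr.trans hr') hr'
  rw [abs_le]; constructor <;> linarith

lemma eventually_integral_bound (hk : 0 < k) (hf : GermSmooth K f) {C : ℝ}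
    (hb : ∀ᶠ w in endAt K, ‖logD (0, 1) f w‖ ≤ C * ‖w.2 ^ (-k)‖) :
    ∃ S : ℝ, 0 < S ∧ ∀ y ∈ K, ∃ a, Tendsto (fun r => f (y, r)) atTop (𝓝 a) ∧
      ∀ r, S ≤ r → |f (y, r) - a| ≤ C / k * r ^ (-k) := by
  obtain ⟨S, hS⟩ := eventually_endAt.1 ((hf.and hb).and (eventually_gt_endAt K 0))
  refine ⟨max S 1, by positivity, fun y hy => ?_⟩
  refine abs_le_of_deriv_zpow (φ' := fun r => logD (0, 1) f (y, r)) hk (by positivity) ?_ ?_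
  · intro r hr
    obtain ⟨⟨h1, -⟩, h2⟩ := hS y hy r ((le_max_left _ _).trans hr)
    exact hasDerivAt_snd (ne_of_gt h2) (h1.difAt)
  · intro r hr
    obtain ⟨⟨-, h1⟩, h2⟩ := hS y hy r ((le_max_left _ _).trans hr)
    simpa [abs_of_pos h2] using h1

lemma small_of_logD (hk : 0 < k) (hf : GermSmooth K f) (h : Small b K (-k) (logD (0, 1) f))
    (h0 : ∀ y ∈ K, Tendsto (fun r => f (y, r)) atTop (𝓝 0)) : Small b K (-k) f := by
  have key : ∀ C : ℝ, (∀ᶠ w in endAt K, ‖logD (0, 1) f w‖ ≤ C * ‖w.2 ^ (-k)‖) →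
      ∀ᶠ w in endAt K, ‖f w‖ ≤ C / k * ‖w.2 ^ (-k)‖ := by
    intro C hC
    obtain ⟨S, hS, h1⟩ := eventually_integral_bound hk hf hC
    refine eventually_endAt.2 ⟨S, fun y hy r hr => ?_⟩
    obtain ⟨a, ha, hb⟩ := h1 y hy
    obtain rfl := tendsto_nhds_unique ha (h0 y hy)
    simpa [abs_of_pos (hS.trans_le hr)] using hb r hr
  have hk' : (0 : ℝ) < k := by exact_mod_cast hk
  cases b
  · refine isLittleO_iff.2 fun ε hε => ?_
    refine (key _ (isLittleO_iff.1 h (mul_pos hε hk'))).mono fun w hw => ?_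
    rwa [mul_div_cancel_right₀ _ hk'.ne'] at hw
  · obtain ⟨C, hC⟩ := isBigO_iff.1 h
    exact isBigO_iff.2 ⟨_, key C hC⟩

lemma tendsto_of_small (hk : k < 0) (hf : Small b K k f) {y : Y} (hy : y ∈ K) :
    Tendsto (fun r => f (y, r)) atTop (𝓝 0) := by
  have h1 : Tendsto f (endAt K) (𝓝 0) := by
    have h2 : Small false K 0 f := hf.lt hk
    have h3 : f =o[endAt K] fun _ => (1 : ℝ) := by simpa [Small] using h2
    exact (isLittleO_one_iff ℝ).1 h3
  have h2 : Tendsto (fun r : ℝ => ((y, r) : Y × ℝ)) atTop (endAt K) :=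
    (tendsto_principal.2 (Eventually.of_forall fun _ => hy)).prodMk tendsto_id
  exact h1.comp h2

/-- If `F` decays and `r ∂_r F` decays like `r^{-k}`, then so does `F`. -/
lemma IsFall.of_logD (hk : 0 < k) (hf : IsFall ρ true k₁ f) (hk₁ : k₁ < 0)
    (h : IsFall ρ b (-k) (logD (0, 1) f)) : IsFall ρ b (-k) f := by
  refine ⟨hf.smooth, fun K hK => ⟨(hf.fall K hK).smooth, fun n => ?_⟩⟩
  have aux : ∀ n (f : Fn Y), CinfOn f (far ρ) → Fall true K k₁ f →
      Fall b K (-k) (logD (0, 1) f) → Jet b K (-k) n f := by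
    intro n
    induction n with
    | zero =>
      intro f _ h1 h2
      exact small_of_logD hk h1.smooth h2.small fun y hy => tendsto_of_small hk₁ h1.small hy
    | succ n ih =>
      intro f h0 h1 h2
      refine ⟨small_of_logD hk h1.smooth h2.small fun y hy => tendsto_of_small hk₁ h1.small hy,
        fun v => ih _ (logD_contDiffOn h0 v) (h1.logD v) ?_⟩
      exact (h2.logD v).congr (logD_comm_germ h0 v (0, 1))
  exact aux n f hf.smooth (hf.fall K hK) (h.fall K hK)

/-- The limit `r → ∞`. -/
def endLim (f : Fn Y) (y : Y) : ℝ := limUnder atTop fun r => f (y, r)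

lemma endLim_eq {y : Y} {a : ℝ} (h : Tendsto (fun r => f (y, r)) atTop (𝓝 a)) : endLim f y = a := h.limUnder_eq

section Limit

variable [FiniteDimensional ℝ Y]

lemma tendsto_endLim (hk : 0 < k) (hs : CinfOn f (far ρ))
    (h : ∀ K, IsCompact K → Fall true K (-k) (logD (0, 1) f)) (y : Y) :
    Tendsto (fun r => f (y, r)) atTop (𝓝 (endLim f y)) := by
  obtain ⟨C, hC⟩ := isBigO_iff.1 (h {y} isCompact_singleton).small
  obtain ⟨S, -, hS⟩ := eventually_integral_bound hk (germSmooth_of_contDiffOn hs {y}) hC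
  obtain ⟨a, ha, -⟩ := hS y rfl
  rwa [endLim_eq ha]

lemma small_sub_endLim (hk : 0 < k) (hs : CinfOn f (far ρ))
    (h : ∀ K, IsCompact K → Fall true K (-k) (logD (0, 1) f)) {K : Set Y} (hK : IsCompact K) :
    Small true K (-k) (fun w => f w - endLim f w.1) := by
  obtain ⟨C, hC⟩ := isBigO_iff.1 (h K hK).small
  obtain ⟨S, hS0, hS⟩ := eventually_integral_bound hk (germSmooth_of_contDiffOn hs K) hC
  refine isBigO_iff.2 ⟨C / k, eventually_endAt.2 ⟨S, fun y hy r hr => ?_⟩⟩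
  obtain ⟨a, ha, hb⟩ := hS y hy
  rw [endLim_eq ha]
  simpa [abs_of_pos (hS0.trans_le hr)] using hb r hr

lemma tendsto_sub_endLim (hk : 0 < k) (hs : CinfOn f (far ρ))
    (h : ∀ K, IsCompact K → Fall true K (-k) (logD (0, 1) f)) (y : Y) :
    Tendsto (fun q : ℝ × Y => f (q.2, q.1) - endLim f q.2) (atTop ×ˢ 𝓝 y) (𝓝 0) := by
  obtain ⟨K, hK, hy⟩ := exists_compact_mem_nhds y
  have h1 : Small false K 0 (fun w => f w - endLim f w.1) := (small_sub_endLim hk hs h hK).lt (by omega)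
  have h2 : (fun w : Y × ℝ => f w - endLim f w.1) =o[endAt K] fun _ => (1 : ℝ) := by
    simpa [Small] using h1
  have h3 := (isLittleO_one_iff ℝ).1 h2
  have h4 : Tendsto (fun q : ℝ × Y => ((q.2, q.1) : Y × ℝ)) (atTop ×ˢ 𝓝 y) (endAt K) :=
    (tendsto_principal.2 ((tendsto_snd (f := atTop)).eventually hy)).prodMk tendsto_fst
  exact h3.comp h4

lemma fall_logD_logD (hs : CinfOn f (far ρ))
    (h : ∀ K, IsCompact K → Fall true K (-k) (logD (0, 1) f)) (v : Y × ℝ) (K : Set Y)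
    (hK : IsCompact K) : Fall true K (-k) (logD (0, 1) (logD v f)) :=
  ((h K hK).logD v).congr (logD_comm_germ hs v (0, 1))

lemma hasFDerivAt_endLim (hk : 0 < k) (hs : CinfOn f (far ρ))
    (h : ∀ K, IsCompact K → Fall true K (-k) (logD (0, 1) f)) (y : Y) :
    HasFDerivAt (endLim f) (∑ i, endLim (logD (Module.finBasis ℝ Y i, 0) f) y •
      LinearMap.toContinuousLinearMap ((Module.finBasis ℝ Y).coord i)) y := by
  set B := Module.finBasis ℝ Y
  set c : ∀ i, Y →L[ℝ] ℝ := fun i => LinearMap.toContinuousLinearMap (B.coord i)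
  have hdiff : ∀ r, ρ < r → ∀ y, DiffAt f (y, r) := fun r hr y =>
    (hs.contDiffAt ((isOpen_end ρ).mem_nhds (show ρ < (y, r).2 from hr))).difAt
  have hfd : ∀ r, ρ < r → ∀ y, HasFDerivAt (fun y => f (y, r)) (∑ i, logD (B i, 0) f (y, r) • c i) y := by
    intro r hr y
    have h1 := hasFDerivAt_fst_slot (hdiff r hr y)
    convert h1 using 1
    refine ContinuousLinearMap.ext fun v => ?_
    have h2 := congrArg ((fderiv ℝ f (y, r)).comp (ContinuousLinearMap.inl ℝ Y ℝ)) (B.sum_repr v).symm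
    rw [map_sum] at h2
    rw [h2]
    simp [c, logD, mul_comm]
  refine hasFDerivAt_of_tendstoUniformlyOnFilter (l := atTop)
    (f := fun r y => f (y, r)) (f' := fun r y => ∑ i, logD (B i, 0) f (y, r) • c i)
    (g' := fun y => ∑ i, endLim (logD (B i, 0) f) y • c i) ?_ ?_ ?_
  · rw [Metric.tendstoUniformlyOnFilter_iff]
    have h1 : Tendsto (fun q : ℝ × Y => ∑ i, ‖logD (B i, 0) f (q.2, q.1)
        - endLim (logD (B i, 0) f) q.2‖ * ‖c i‖) (atTop ×ˢ 𝓝 y) (𝓝 0) := by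
      have : ∀ i, Tendsto (fun q : ℝ × Y => ‖logD (B i, 0) f (q.2, q.1)
        - endLim (logD (B i, 0) f) q.2‖ * ‖c i‖) (atTop ×ˢ 𝓝 y) (𝓝 0) := fun i => by
        simpa using (tendsto_sub_endLim hk (logD_contDiffOn hs (B i, 0))
          (fall_logD_logD hs h (B i, 0)) y).norm.mul_const ‖c i‖
      simpa using tendsto_finsetSum Finset.univ fun i _ => this i
    intro ε hε
    filter_upwards [h1.eventually (gt_mem_nhds hε)] with q hq
    rw [dist_comm, dist_eq_norm, ← sum_sub_distrib]
    refine lt_of_le_of_lt (norm_sum_le _ _) (lt_of_le_of_lt (sum_le_sum fun i _ => ?_) hq)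
    rw [← sub_smul, norm_smul]
  · have h1 : ∀ᶠ q : ℝ × Y in atTop ×ˢ 𝓝 y, ρ < q.1 := tendsto_fst.eventually (eventually_gt_atTop ρ)
    filter_upwards [h1] with q hq using hfd q.1 hq q.2
  · exact Eventually.of_forall fun y => tendsto_endLim hk hs h y

lemma contDiff_endLim (hk : 0 < k) (hs : CinfOn f (far ρ))
    (h : ∀ K, IsCompact K → Fall true K (-k) (logD (0, 1) f)) : Cinf (endLim f) := by
  rw [contDiff_infty]
  intro n
  induction n generalizing f with
  | zero =>
    rw [Nat.cast_zero, contDiff_zero]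
    exact continuous_iff_continuousAt.2 fun y => (hasFDerivAt_endLim hk hs h y).continuousAt
  | succ n ih =>
    rw [Nat.cast_succ, contDiff_succ_iff_fderiv]
    refine ⟨fun y => (hasFDerivAt_endLim hk hs h y).differentiableAt, by simp, ?_⟩
    have e : fderiv ℝ (endLim f) = fun y => ∑ i, endLim (logD (Module.finBasis ℝ Y i, 0) f) y •
      LinearMap.toContinuousLinearMap ((Module.finBasis ℝ Y).coord i) :=
      funext fun y => (hasFDerivAt_endLim hk hs h y).fderiv
    rw [e]
    exact ContDiff.sum fun i _ => (ih (logD_contDiffOn hs _) (fall_logD_logD hs h _)).smul contDiff_const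

lemma fderiv_endLim (hk : 0 < k) (hs : CinfOn f (far ρ))
    (h : ∀ K, IsCompact K → Fall true K (-k) (logD (0, 1) f)) (v : Y × ℝ) (y : Y) :
    fderiv ℝ (endLim f) y v.1 = endLim (logD v f) y := by
  refine (endLim_eq ?_).symm
  rw [(hasFDerivAt_endLim hk hs h y).fderiv]
  set B := Module.finBasis ℝ Y
  have h1 : Tendsto (fun r => ∑ i, (B.repr v.1 i) * logD (B i, 0) f (y, r) + v.2 * logD (0, 1) f (y, r)) atTop
      (𝓝 (∑ i, (B.repr v.1 i) * endLim (logD (B i, 0) f) y + v.2 * 0)) := by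
    refine Tendsto.add (tendsto_finsetSum _ fun i _ => ?_) ?_
    · exact (tendsto_endLim hk (logD_contDiffOn hs _) (fall_logD_logD hs h _) y).const_mul _
    · exact (tendsto_of_small (by omega) (h {y} isCompact_singleton).small rfl).const_mul _
  have e : ∀ r, logD v f (y, r) = ∑ i, (B.repr v.1 i) * logD (B i, 0) f (y, r) + v.2 * logD (0, 1) f (y, r) := by
    intro r
    have h2 := congrArg ((fderiv ℝ f (y, r)).comp (ContinuousLinearMap.inl ℝ Y ℝ)) (B.sum_repr v.1).symm
    rw [map_sum] at h2
    have h3 : ((v.1, v.2 * r) : Y × ℝ) = ContinuousLinearMap.inl ℝ Y ℝ v.1 + v.2 • (0, 1 * r) := by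
      ext <;> simp
    simp only [logD]
    rw [h3, map_add, map_smul]
    simp only [comp_apply, map_smul, smul_eq_mul] at h2
    rw [h2]
    simp
  simp only [e]
  convert h1 using 2
  simp [mul_comm, B]

/-- If `r ∂_r F = O(r^{-k})` with `k > 0`, then `F` has a smooth limit `a` and `F - a = O(r^{-k})`. -/
lemma exists_limit (hk : 0 < k) (hs : CinfOn f (far ρ)) (h : ∀ K, IsCompact K → Fall true K (-k) (logD (0, 1) f)) :
    ∃ a : Y → ℝ, Cinf a ∧ IsFall ρ true (-k) (fun w => f w - a w.1) := by
  have hc := contDiff_endLim hk hs h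
  have hs' : CinfOn (fun w => f w - endLim f w.1) (far ρ) := hs.sub (hc.comp contDiff_fst).contDiffOn
  refine ⟨endLim f, hc, hs', fun K hK => ⟨germSmooth_of_contDiffOn hs' K, fun n => ?_⟩⟩
  clear hc hs'
  induction n generalizing f with
  | zero => exact small_sub_endLim hk hs h hK
  | succ n ih =>
    refine ⟨small_sub_endLim hk hs h hK, fun v => ?_⟩
    refine (ih (logD_contDiffOn hs v) (fall_logD_logD hs h v)).congr ?_
    refine GermEq.of_forall_gt (R := ρ) fun w hw => ?_
    have hd : DiffAt f w := (hs.contDiffAt ((isOpen_end ρ).mem_nhds hw)).difAt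
    have hd2 : DiffAt (endLim f) w.1 := ((contDiff_endLim hk hs h).dif) w.1
    have hd3 : DiffAt (fun w : Y × ℝ => endLim f w.1) w := hd2.comp w differentiableAt_fst
    rw [← fderiv_endLim hk hs h, ← logD_fst hd2]
    simp [logD, fderiv_fun_sub hd hd3]

end Limit

end Integration

section Growth

variable {b b₁ b₂ : Bool} {K : Set Y} {k k₁ k₂ : ℤ} {n : ℕ} {f g : Fn Y} {ρ : ℝ}

/-! #### Polynomial growth of solutions of linear radial equations -/

lemma energy_bound {ι : Type*} [Fintype ι] {x x' : ι → ℝ → ℝ} {A : ι → ι → ℝ → ℝ}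
    {β : ι → ℝ → ℝ} {S M C : ℝ} {N : ℕ} (hS : 0 < S) (hd : ∀ i r, S ≤ r → HasDerivAt (x i) (x' i r / r) r)
    (hx : ∀ i r, S ≤ r → x' i r = ∑ j, A i j r * x j r + β i r)
    (hA : ∀ i j r, S ≤ r → |A i j r| ≤ M) (hβ : ∀ i r, S ≤ r → |β i r| ≤ C * r ^ N)
    (hN : Fintype.card ι * M + 1 ≤ N) (r : ℝ) (hr : S ≤ r) :
    ∑ i, (x i r) ^ 2 ≤ (Fintype.card ι * C ^ 2 + ∑ i, (x i S) ^ 2 / S ^ (2 * N)) * r ^ (2 * N) := by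
  set c : ℝ := (Fintype.card ι : ℝ) with hc
  set E : ℝ → ℝ := fun r => (∑ i, (x i r) ^ 2) / r ^ (2 * N) with hE
  have hEd : ∀ r, S ≤ r → HasDerivAt (fun r => r * (E r - c * C ^ 2))
      ((E r - c * C ^ 2) + (2 * ∑ i, x i r * x' i r) / r ^ (2 * N) - 2 * N * E r) r := by
    intro r hr
    have hr0 : r ≠ 0 := (hS.trans_le hr).ne'
    have h1 : HasDerivAt (fun r => ∑ i, (x i r) ^ 2) (∑ i, 2 * x i r * (x' i r / r)) r := by
      refine HasDerivAt.fun_sum fun i _ => ?_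
      exact ((hd i r hr).fun_pow 2).congr_deriv (by simp)
    have h2 := h1.div (hasDerivAt_pow (2 * N) r) (pow_ne_zero _ hr0)
    have h3 := (hasDerivAt_id r).mul (h2.sub_const (c * C ^ 2))
    refine h3.congr_deriv ?_
    have e : ∑ i, 2 * x i r * (x' i r / r) = (2 * ∑ i, x i r * x' i r) / r := by
      rw [mul_sum, Finset.sum_div]
      exact sum_congr rfl fun i _ => by ring
    simp only [hE, id, Pi.div_apply, e]
    rcases Nat.eq_zero_or_pos N with h0 | h0
    · subst h0; simp; field_simp
    · obtain ⟨m, hm⟩ : ∃ m, 2 * N = m + 1 := ⟨2 * N - 1, by omega⟩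
      have hm' : (2 * N : ℝ) = m + 1 := by exact_mod_cast hm
      rw [hm']
      simp only [hm, Nat.add_sub_cancel]
      push_cast
      field_simp
      ring
  have hneg : ∀ r, S ≤ r → (E r - c * C ^ 2) + (2 * ∑ i, x i r * x' i r) / r ^ (2 * N) - 2 * N * E r ≤ 0 := by
    intro r hr
    have hr0 : 0 < r := hS.trans_le hr
    have hp : 0 < r ^ (2 * N) := by positivity
    have hX : 0 ≤ ∑ i, (x i r) ^ 2 := sum_nonneg fun i _ => sq_nonneg _
    have h1 : 2 * ∑ i, x i r * x' i r ≤ (2 * (c * M) + 1) * ∑ i, (x i r) ^ 2 + c * (C * r ^ N) ^ 2 := by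
      have h2 : ∀ i, 2 * (x i r * x' i r) ≤ (∑ j, M * ((x i r) ^ 2 + (x j r) ^ 2)) + (x i r) ^ 2 + (C * r ^ N) ^ 2 := by
        intro i
        rw [hx i r hr]
        have h3 : ∀ j, 2 * (x i r * (A i j r * x j r)) ≤ M * ((x i r) ^ 2 + (x j r) ^ 2) := by
          intro j
          obtain ⟨ha, hb⟩ := abs_le.1 (hA i j r hr)
          nlinarith [sq_nonneg (x i r - x j r), sq_nonneg (x i r + x j r)]
        have h4 : 2 * (x i r * β i r) ≤ (x i r) ^ 2 + (C * r ^ N) ^ 2 := by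
          have := sq_le_sq' (abs_le.1 (hβ i r hr)).1 (abs_le.1 (hβ i r hr)).2
          nlinarith [sq_nonneg (x i r - β i r)]
        have h5 : 2 * (x i r * (∑ j, A i j r * x j r + β i r))
            = (∑ j, 2 * (x i r * (A i j r * x j r))) + 2 * (x i r * β i r) := by
          rw [mul_add, mul_add, mul_sum, mul_sum]
        rw [h5]
        have := sum_le_sum fun j (_ : j ∈ Finset.univ) => h3 j
        linarith
      have h6 := sum_le_sum fun i (_ : i ∈ Finset.univ) => h2 i
      rw [mul_sum]
      refine h6.trans (le_of_eq ?_)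
      simp only [sum_add_distrib, ← mul_sum, Finset.sum_const, Finset.card_univ, nsmul_eq_mul, mul_add]
      ring
    have h7 : (2 * ∑ i, x i r * x' i r) / r ^ (2 * N) ≤ (2 * (c * M) + 1) * E r + c * C ^ 2 := by
      rw [div_le_iff₀ hp]
      refine h1.trans (le_of_eq ?_)
      simp only [hE]
      field_simp
      ring
    have hE0 : 0 ≤ E r := div_nonneg hX hp.le
    nlinarith
  have anti : AntitoneOn (fun r => r * (E r - c * C ^ 2)) (Set.Ici S) := by
    refine antitoneOn_of_deriv_nonpos (convex_Ici S) (fun r hr => (hEd r hr).continuousAt.continuousWithinAt)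
      (fun r hr => (hEd r (interior_subset hr)).differentiableAt.differentiableWithinAt) ?_
    intro r hr
    rw [(hEd r (interior_subset hr)).deriv]
    exact hneg r (interior_subset hr)
  have hr0 : 0 < r := hS.trans_le hr
  have h1 : r * (E r - c * C ^ 2) ≤ S * (E S - c * C ^ 2) := anti (Set.mem_Ici.2 le_rfl) hr hr
  have hES : 0 ≤ E S := div_nonneg (sum_nonneg fun i _ => sq_nonneg _) (by positivity)
  have hcC : 0 ≤ c * C ^ 2 := by positivity
  have h2 : E r ≤ c * C ^ 2 + E S := by
    by_contra hcon
    push Not at hcon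
    nlinarith
  have h3 : ∑ i, (x i r) ^ 2 = E r * r ^ (2 * N) := by simp only [hE]; field_simp
  rw [h3, ← Finset.sum_div]
  gcongr

lemma small_of_linear_system {ι : Type*} [Fintype ι] {X β : ι → Fn Y}
    {A : ι → ι → Fn Y} {M : ℝ} {N : ℕ} (hK : IsCompact K) (hX : ∀ i, GermSmooth K (X i))
    (heq : ∀ i, ∀ᶠ w in endAt K, logD (0, 1) (X i) w = ∑ j, A i j w * X j w + β i w)
    (hA : ∀ i j, ∀ᶠ w in endAt K, |A i j w| ≤ M) (hβ : ∀ i, Small true K N (β i))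
    (hN : Fintype.card ι * M + 1 ≤ N) (i : ι) : Small true K N (X i) := by
  have hβ' : ∃ C : ℝ, ∀ i, ∀ᶠ w in endAt K, |β i w| ≤ C * w.2 ^ N := by
    choose C hC using fun i => isBigO_iff.1 (hβ i)
    refine ⟨∑ j, |C j|, fun i => ?_⟩
    filter_upwards [hC i, eventually_gt_endAt K 0] with w hw h0
    rw [zpow_natCast, Real.norm_eq_abs, norm_pow, Real.norm_eq_abs, abs_of_pos h0] at hw
    refine hw.trans ?_
    have h1 : C i ≤ ∑ j, |C j| := (le_abs_self _).trans
      (single_le_sum (f := fun j => |C j|) (fun j _ => abs_nonneg _) (mem_univ i))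
    gcongr
  obtain ⟨C, hC⟩ := hβ'
  obtain ⟨S, hS⟩ := eventually_endAt.1 ((((eventually_all.2 hX).and (eventually_all.2 heq)).and
    ((eventually_all.2 fun i => eventually_all.2 (hA i)).and (eventually_all.2 hC))).and (eventually_gt_endAt K 0))
  set T := max S 1 with hT
  have hT0 : 0 < T := by positivity
  have hST : S ≤ T := le_max_left _ _
  have hcont : ContinuousOn (fun y => ∑ i, (X i (y, T)) ^ 2 / T ^ (2 * N)) K := by
    refine continuousOn_finsetSum _ fun i _ => ContinuousOn.div_const (ContinuousOn.pow ?_ 2) _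
    intro y hy
    have h1 := ((hS y hy T hST).1.1.1 i).continuousAt
    have h2 : ContinuousAt (fun y : Y => ((y, T) : Y × ℝ)) y := by fun_prop
    exact (ContinuousAt.comp (f := fun y : Y => ((y, T) : Y × ℝ)) h1 h2).continuousWithinAt
  obtain ⟨D, hD⟩ := hK.exists_bound_of_continuousOn hcont
  have hpos : ∀ y ∈ K, ∀ r, T ≤ r → |X i (y, r)| ^ 2 ≤ (Fintype.card ι * C ^ 2 + D) * (r ^ N) ^ 2 := by
    intro y hy r hr
    have h1 := energy_bound (x := fun i r => X i (y, r)) (x' := fun i r => logD (0, 1) (X i) (y, r))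
      (A := fun i j r => A i j (y, r)) (β := fun i r => β i (y, r)) hT0
      (fun i r hr => hasDerivAt_snd (hT0.trans_le hr).ne' (((hS y hy r (hST.trans hr)).1.1.1 i).difAt))
      (fun i r hr => (hS y hy r (hST.trans hr)).1.1.2 i) (fun i j r hr => (hS y hy r (hST.trans hr)).1.2.1 i j)
      (fun i r hr => (hS y hy r (hST.trans hr)).1.2.2 i) hN r hr
    rw [sq_abs, ← pow_mul, mul_comm N 2]
    refine (single_le_sum (f := fun i => X i (y, r) ^ 2) (fun j _ => sq_nonneg _) (mem_univ i)).trans (h1.trans ?_)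
    have h2 := (le_abs_self _).trans (hD y hy)
    have h3 : 0 < r ^ (2 * N) := pow_pos (hT0.trans_le hr) _
    gcongr
  refine isBigO_iff.2 ⟨√(Fintype.card ι * C ^ 2 + D), eventually_endAt.2 ⟨T, fun y hy r hr => ?_⟩⟩
  have h1 := hpos y hy r hr
  have hr0 := hT0.trans_le hr
  rw [zpow_natCast, Real.norm_eq_abs, norm_pow, Real.norm_eq_abs, abs_of_pos hr0]
  have h2 : 0 ≤ Fintype.card ι * C ^ 2 + D := by
    by_contra hcon
    push Not at hcon
    have : 0 < (r ^ N) ^ 2 := by positivity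
    nlinarith [sq_nonneg |X i (y, r)|]
  refine abs_le_of_sq_le_sq' ?_ (by positivity) |>.2
  rw [mul_pow, Real.sq_sqrt h2]
  exact h1

lemma Jet.sum {ι : Type*} (s : Finset ι) {F : ι → Fn Y} (hs : ∀ i, GermSmooth K (F i)) (h : ∀ i, Jet b K k n (F i)) :
    GermSmooth K (fun w => ∑ i ∈ s, F i w) ∧ Jet b K k n (fun w => ∑ i ∈ s, F i w) := by
  classical
  induction s using Finset.induction_on with
  | empty =>
    simpa using ⟨(Fall.zero (b := b) (k := k)).smooth, (Fall.zero (b := b) (k := k)).jet n⟩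
  | insert i s hi ih =>
    simp only [sum_insert hi]
    exact ⟨(hs i).add ih.1, (h i).add (hs i) ih.1 ih.2⟩

lemma logD_sum_germ {ι : Type*} (s : Finset ι) {F : ι → Fn Y} (hs : ∀ i, GermSmooth K (F i))
    (v : Y × ℝ) : GermSmooth K (fun w => ∑ i ∈ s, F i w) ∧
      GermEq K (logD v fun w => ∑ i ∈ s, F i w) (fun w => ∑ i ∈ s, logD v (F i) w) := by
  classical
  induction s using Finset.induction_on with
  | empty =>
    refine ⟨by simpa using (Fall.zero (b := true) (k := 0)).smooth, Eventually.of_forall fun w => ?_⟩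
    refine Eventually.of_forall fun w => ?_
    simp [logD]
  | insert i s hi ih =>
    simp only [sum_insert hi]
    refine ⟨(hs i).add ih.1, (logD_add_germ (hs i) ih.1 v).trans ?_⟩
    filter_upwards [ih.2] with w hw
    filter_upwards [hw] with w' hw'
    rw [hw']

lemma jet_of_linear_system {ι : Type*} [Fintype ι] {A : ι → ι → Fn Y} {M : ℝ} {N : ℕ}
    (hK : IsCompact K) (hA : ∀ i j, ∀ᶠ w in endAt K, |A i j w| ≤ M)
    (hA' : ∀ i j, Fall true K 0 (A i j)) (hN : Fintype.card ι * M + 1 ≤ N) (n : ℕ)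
    {X β : ι → Fn Y} (hXc : ∀ i, CinfOn (X i) (far ρ))
    (heq : ∀ i, GermEq K (logD (0, 1) (X i)) (fun w => ∑ j, A i j w * X j w + β i w))
    (hβs : ∀ i, GermSmooth K (β i)) (hβ : ∀ i, Jet true K N n (β i)) (i : ι) : Jet true K N n (X i) := by
  have hX := fun i => germSmooth_of_contDiffOn (hXc i) K
  induction n generalizing X β i with
  | zero => exact small_of_linear_system hK hX (fun i => (heq i).eventuallyEq) hA hβ hN i
  | succ n ih =>
    refine ⟨small_of_linear_system hK hX (fun i => (heq i).eventuallyEq) hA (fun i => (hβ i).small) hN i, fun v => ?_⟩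
    have hXn : ∀ i, Jet true K N n (X i) := fun i => ih hXc heq hβs (fun i => (hβ i).pred) i hX
    have hsum := fun i => Jet.sum (b := true) (K := K) (k := N) (n := n) Finset.univ
      (F := fun j w => logD v (A i j) w * X j w) (fun j => ((hA' i j).smooth.logD v).mul (hX j)) (fun j => by
        simpa using ((((hA' i j).logD v).jet n).mul ((hA' i j).smooth.logD v) (hX j) (hXn j)))
    refine ih (X := fun i => logD v (X i)) (β := fun i w => (∑ j, logD v (A i j) w * X j w) + logD v (β i) w)
      (fun i => logD_contDiffOn (hXc i) v) (fun i => ?_) (fun i => ?_) (fun i => ?_) i (fun i => (hX i).logD v)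
    · refine (logD_comm_germ (hXc i) (0, 1) v).trans (((heq i).logD v).trans ?_)
      have hs1 : ∀ j, GermSmooth K (fun w => A i j w * X j w) := fun j => (hA' i j).smooth.mul (hX j)
      have h1 := logD_sum_germ (K := K) Finset.univ hs1 v
      refine (logD_add_germ h1.1 (hβs i) v).trans ?_
      have h2 : ∀ᶠ w in endAt K, ∀ j, (logD v fun w => A i j w * X j w) =ᶠ[𝓝 w]
          (fun w => logD v (A i j) w * X j w + A i j w * logD v (X j) w) :=
        eventually_all.2 fun j => logD_mul_germ (hA' i j).smooth (hX j) v
      filter_upwards [h1.2, h2] with w hw1 hw2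
      filter_upwards [hw1, eventually_all.2 hw2] with w' h3 h4
      rw [h3]
      simp only [h4, sum_add_distrib]
      ring
    · exact (hsum i).1.add ((hβs i).logD v)
    · exact (hsum i).2.add (hsum i).1 ((hβs i).logD v) ((hβ i).2 v)

/-- Solutions of a linear radial system with bounded coefficients grow at most polynomially, with
all derivatives. -/
lemma fall_of_linear_system {ι : Type*} [Fintype ι] {A : ι → ι → Fn Y}
    (hK : IsCompact K) (hA : ∀ i j, Fall true K 0 (A i j)) {X β : ι → Fn Y} (hX : ∀ i, CinfOn (X i) (far ρ))
    (heq : ∀ i, GermEq K (logD (0, 1) (X i)) (fun w => ∑ j, A i j w * X j w + β i w))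
    (hβ : ∀ i, Fall true K 0 (β i)) : ∃ N : ℕ, ∀ i, Fall true K N (X i) := by
  have hM : ∃ M : ℝ, ∀ i j, ∀ᶠ w in endAt K, |A i j w| ≤ M := by
    choose C hC using fun i j => isBigO_iff.1 (hA i j).small
    refine ⟨∑ i, ∑ j, |C i j|, fun i j => ?_⟩
    filter_upwards [hC i j] with w hw
    simp only [zpow_zero, norm_one, mul_one] at hw
    refine hw.trans ((le_abs_self _).trans ?_)
    refine (single_le_sum (f := fun j => |C i j|) (fun j _ => abs_nonneg _) (mem_univ j)).trans ?_
    exact single_le_sum (f := fun i => ∑ j, |C i j|) (fun j _ => sum_nonneg fun _ _ => abs_nonneg _) (mem_univ i)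
  obtain ⟨M, hM⟩ := hM
  obtain ⟨N, hN⟩ := exists_nat_ge (Fintype.card ι * M + 1)
  refine ⟨N, fun i => ⟨germSmooth_of_contDiffOn (hX i) K, fun n => ?_⟩⟩
  exact jet_of_linear_system hK hM hA hN n hX heq (fun i => (hβ i).smooth) (fun i => ((hβ i).mono (by omega)).jet n) i

end Growth

section Closure

variable {b b₁ b₂ : Bool} {k k₁ k₂ : ℤ} {f g : Fn Y} {ρ : ℝ}

lemma IsFall.congr (hf : IsFall ρ b k f) (h : ∀ w : Y × ℝ, ρ < w.2 → f w = g w) :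
    IsFall ρ b k g :=
  ⟨hf.smooth.congr fun w hw => (h w hw).symm, fun K hK => (hf.fall K hK).congr (GermEq.of_forall_gt h)⟩

lemma IsFall.add (hf : IsFall ρ b k f) (hg : IsFall ρ b k g) : IsFall ρ b k (fun w => f w + g w) :=
  ⟨hf.smooth.add hg.smooth, fun K hK => (hf.fall K hK).add (hg.fall K hK)⟩

lemma IsFall.sub (hf : IsFall ρ b k f) (hg : IsFall ρ b k g) : IsFall ρ b k (fun w => f w - g w) :=
  ⟨hf.smooth.sub hg.smooth, fun K hK => (hf.fall K hK).sub (hg.fall K hK)⟩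

lemma IsFall.const_mul (c : ℝ) (hf : IsFall ρ b k f) : IsFall ρ b k (fun w => c * f w) :=
  ⟨contDiffOn_const.mul hf.smooth, fun K hK => (hf.fall K hK).const_mul c⟩

lemma IsFall.neg (hf : IsFall ρ b k f) : IsFall ρ b k (fun w => -f w) := ⟨hf.smooth.neg, fun K hK => (hf.fall K hK).neg⟩

lemma IsFall.mul (hf : IsFall ρ b₁ k₁ f) (hg : IsFall ρ b₂ k₂ g) : IsFall ρ (b₁ && b₂) (k₁ + k₂) (fun w => f w * g w) :=
  ⟨hf.smooth.mul hg.smooth, fun K hK => (hf.fall K hK).mul (hg.fall K hK)⟩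

lemma IsFall.sum {ι : Type*} {s : Finset ι} {F : ι → Fn Y}
    (h : ∀ i ∈ s, IsFall ρ b k (F i)) : IsFall ρ b k (fun w => ∑ i ∈ s, F i w) :=
  ⟨ContDiffOn.sum fun i hi => (h i hi).smooth, fun K hK => Fall.sum fun i hi => (h i hi).fall K hK⟩

lemma IsFall.big (hf : IsFall ρ b k f) : IsFall ρ true k f := ⟨hf.smooth, fun K hK => (hf.fall K hK).big⟩

lemma IsFall.mono (hf : IsFall ρ b k₁ f) (h : k₁ ≤ k₂) : IsFall ρ b k₂ f :=
  ⟨hf.smooth, fun K hK => (hf.fall K hK).mono h⟩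

lemma IsFall.lt (hf : IsFall ρ b₁ k₁ f) (h : k₁ < k₂) : IsFall ρ b₂ k₂ f := ⟨hf.smooth, fun K hK => (hf.fall K hK).lt h⟩

lemma IsFall.logD (hf : IsFall ρ b k f) (v : Y × ℝ) : IsFall ρ b k (logD v f) :=
  ⟨logD_contDiffOn hf.smooth v, fun K hK => (hf.fall K hK).logD v⟩

lemma IsFall.zero : IsFall ρ b k (fun _ : Y × ℝ => 0) := ⟨contDiffOn_const, fun _ _ => Fall.zero⟩

lemma IsFall.of_fst {a : Y → ℝ} (ha : Cinf a) : IsFall ρ true 0 (fun w : Y × ℝ => a w.1) :=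
  ⟨(ha.comp contDiff_fst).contDiffOn, fun _ hK => Fall.of_fst ha hK⟩

lemma IsFall.zpow [hρ : Fact (0 ≤ ρ)] (m : ℤ) : IsFall ρ true m (fun w : Y × ℝ => w.2 ^ m) :=
  ⟨fun _ hw => (contDiffAt_zpow_snd m (hρ.1.trans_lt hw)).contDiffWithinAt, fun _ _ => Fall.zpow m⟩

variable {Y' : Type*} [NormedAddCommGroup Y'] [NormedSpace ℝ Y']

lemma logD_comp_clm (L : Y' →L[ℝ] Y) {w : Y' × ℝ} (hf : DiffAt f (L w.1, w.2))
    (v : Y' × ℝ) : logD v (fun w => f (L w.1, w.2)) w = logD (L v.1, v.2) f (L w.1, w.2) := by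
  have h1 : HasFDerivAt (fun w : Y' × ℝ => ((L w.1, w.2) : Y × ℝ))
      ((L.comp (ContinuousLinearMap.fst ℝ Y' ℝ)).prod (ContinuousLinearMap.snd ℝ Y' ℝ)) w :=
    (L.hasFDerivAt.comp w hasFDerivAt_fst).prodMk hasFDerivAt_snd
  have h2 : HasFDerivAt (fun w => f (L w.1, w.2)) _ w :=
    HasFDerivAt.comp w (f := fun w : Y' × ℝ => ((L w.1, w.2) : Y × ℝ)) hf.hasFDerivAt h1
  simp [logD, h2.fderiv]

lemma IsFall.comp_clm (hf : IsFall ρ b k f) (L : Y' →L[ℝ] Y) : IsFall ρ b k (fun w : Y' × ℝ => f (L w.1, w.2)) := by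
  have smooth : ∀ f : Fn Y, CinfOn f (far ρ) → CinfOn (fun w : Y' × ℝ => f (L w.1, w.2)) (far ρ) := fun f hf =>
    hf.comp ((L.contDiff.comp contDiff_fst).prodMk contDiff_snd).contDiffOn fun w hw => hw
  refine ⟨smooth f hf.smooth, fun K hK => ⟨germSmooth_of_contDiffOn (smooth f hf.smooth) K, fun n => ?_⟩⟩
  have ht : Tendsto (fun w : Y' × ℝ => ((L w.1, w.2) : Y × ℝ)) (endAt K) (endAt (L '' K)) :=
    (tendsto_principal.2 ((eventually_mem_endAt K).mono fun w hw =>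
      Set.mem_image_of_mem L hw)).prodMk tendsto_snd
  have hsm : ∀ f : Fn Y, Small b (L '' K) k f → Small b K k (fun w => f (L w.1, w.2)) := by
    intro f hf
    cases b
    · exact IsLittleO.comp_tendsto hf ht
    · exact IsBigO.comp_tendsto hf ht
  have aux : ∀ n (f : Fn Y), CinfOn f (far ρ) → Jet b (L '' K) k n f → Jet b K k n (fun w => f (L w.1, w.2)) := by
    intro n
    induction n with
    | zero => exact fun f _ h => hsm f h
    | succ n ih =>
      refine fun f h0 h => ⟨hsm f h.1, fun v => ?_⟩
      refine (ih _ (logD_contDiffOn h0 (L v.1, v.2)) (h.2 _)).congr (GermEq.of_forall_gt (R := ρ) fun w hw => ?_)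
      rw [logD_comp_clm L ((h0.contDiffAt ((isOpen_end ρ).mem_nhds (show ρ < ((L w.1, w.2) : Y × ℝ).2 from hw))).difAt)]
  exact aux n f hf.smooth ((hf.fall _ (hK.image L.continuous)).jet n)

end Closure

variable {l ρ : ℝ} {γbar : Bdry → Mat2} [hρ : Fact (0 ≤ ρ)] [hγ : Fact (IsLorentzMetric γbar)]
variable {P : Type} [NormedAddCommGroup P] [NormedSpace ℝ P] [FiniteDimensional ℝ P]

/-! ### The logarithmic frame `r ∂_r, ∂_A` -/

section Frame

variable {ρ : ℝ} [hρ : Fact (0 ≤ ρ)]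

/-- The weight of the frame vector `e_i` with respect to the coordinate vector `∂_i`. -/
def wt (i : Fin 3) (r : ℝ) : ℝ := if i = 0 then r else 1

/-- The directions of the logarithmic frame; `J` embeds the boundary directions in the parameters. -/
def frame (J : Bdry →L[ℝ] Y) (i : Fin 3) : Y × ℝ := Fin.cases (0, 1) (fun A : Fin 2 => (J (Pi.single A 1), 0)) i

/-- The derivative along the frame. -/
notation:max "ld" J:max i:max => logD (frame J i)

/-- The Lie derivative in the logarithmic frame. -/
def lieLog (J : Bdry →L[ℝ] Y) (G : Fin 3 → Fin 3 → Fn Y) (X : Fin 3 → Fn Y) (i j : Fin 3) (w : Y × ℝ) : ℝ :=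
  ∑ k, (X k w * ld J k (G i j) w + G k j w * ld J i (X k) w + G i k w * ld J j (X k) w)

@[simp] lemma frame_zero (J : Bdry →L[ℝ] Y) : frame J 0 = (0, 1) := rfl

@[simp] lemma frame_succ (J : Bdry →L[ℝ] Y) (A : Fin 2) : frame J A.succ = (J (Pi.single A 1), 0) := rfl

lemma frame_one (J : Bdry →L[ℝ] Y) : frame J 1 = (J (Pi.single 0 1), 0) := rfl

lemma frame_two (J : Bdry →L[ℝ] Y) : frame J 2 = (J (Pi.single 1 1), 0) := rfl

@[simp] lemma wt_zero (r : ℝ) : wt 0 r = r := rfl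

@[simp] lemma wt_succ (A : Fin 2) (r : ℝ) : wt A.succ r = 1 := by simp [wt]

lemma wt_pos (i : Fin 3) {r : ℝ} (hr : 0 < r) : 0 < wt i r := by
  unfold wt; split_ifs <;> simp [hr]

@[simp] lemma pt_zero (r : ℝ) (x : Bdry) : pt r x 0 = r := rfl

@[simp] lemma pt_succ (r : ℝ) (x : Bdry) (A : Fin 2) : pt r x A.succ = x A := by
  fin_cases A <;> rfl

lemma pt_eta (z : Bulk) : pt (z 0) (fun A => z A.succ) = z := by
  funext i; refine Fin.cases ?_ (fun A => ?_) i <;> simp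

variable {h : Bulk → ℝ} {F : Fn Y} {y : Y} {x : Bdry} {r : ℝ} {J : Bdry →L[ℝ] Y}

lemma pd_eq_logD (hr : ρ < r) (hF : DiffAt F (y, r))
    (hh : ∀ r' x', ρ < r' → h (pt r' x') = F (y + J (x' - x), r')) (i : Fin 3) :
    wt i r * pd i h (pt r x) = ld J i F (y, r) := by
  let T : Bulk →L[ℝ] Bdry := ContinuousLinearMap.pi fun A : Fin 2 =>
    ContinuousLinearMap.proj (R := ℝ) (φ := fun _ : Fin 3 => ℝ) A.succ
  have hmap : HasFDerivAt (fun z : Bulk => ((y + J (T z - x), z 0) : Y × ℝ))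
      ((J.comp T).prod (ContinuousLinearMap.proj (R := ℝ) (φ := fun _ : Fin 3 => ℝ) 0)) (pt r x) := by
    refine HasFDerivAt.prodMk ?_ (ContinuousLinearMap.proj (R := ℝ) (φ := fun _ : Fin 3 => ℝ) 0).hasFDerivAt
    exact ((J.hasFDerivAt.comp _ (T.hasFDerivAt.sub_const x))).const_add y
  have hTx : T (pt r x) = x := by funext A; simp [T]
  have hpt : (y + J (T (pt r x) - x), pt r x 0) = (y, r) := by simp [hTx]
  have hF' : HasFDerivAt F (fderiv ℝ F (y, r)) (y + J (T (pt r x) - x), pt r x 0) := by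
    rw [hpt]; exact hF.hasFDerivAt
  have hcomp := hF'.comp (pt r x) hmap
  have heq : h =ᶠ[nhds (pt r x)] F ∘ fun z : Bulk => ((y + J (T z - x), z 0) : Y × ℝ) := by
    have : {z : Bulk | ρ < z 0} ∈ nhds (pt r x) :=
      (isOpen_lt continuous_const (continuous_apply 0)).mem_nhds (by simpa using hr)
    filter_upwards [this] with z hz
    have h1 := hh (z 0) (T z) hz
    rwa [show pt (z 0) (T z) = z from pt_eta z] at h1
  have hd : HasFDerivAt h _ (pt r x) := hcomp.congr_of_eventuallyEq heq
  have hr0 : r ≠ 0 := (hρ.1.trans_lt hr).ne'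
  unfold pd
  rw [hd.fderiv]
  refine Fin.cases ?_ (fun A => ?_) i
  · have e : T (Pi.single 0 1) = 0 := by funext A; simp [T]
    have e2 : ((0, 1 * r) : Y × ℝ) = r • (0, 1) := by ext <;> simp
    simp only [comp_apply, prod_apply, e, map_zero,
      proj_apply, Pi.single_eq_same, wt_zero, logD, frame_zero, e2, map_smul, smul_eq_mul]
  · have e : T (Pi.single A.succ 1) = Pi.single A 1 := by
      funext B; simp [T, Pi.single_apply]
    simp only [comp_apply, prod_apply, e, proj_apply, wt_succ, logD, frame_succ]
    simp

lemma differentiableAt_wt (k : Fin 3) {w : Y × ℝ} : DiffAt (fun w : Y × ℝ => wt k w.2) w := by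
  by_cases hk : k = 0
  · simp only [wt, hk, if_true]; exact differentiableAt_snd
  · simp only [wt, hk, if_false]; exact differentiableAt_const _

lemma DifferentiableAt.div_wt (hr : 0 < r) (hF : DiffAt F (y, r)) (k : Fin 3) :
    DiffAt (fun w => F w / wt k w.2) (y, r) := by
  simp only [div_eq_mul_inv]
  exact hF.fun_mul (DifferentiableAt.fun_inv (differentiableAt_wt k) (wt_pos k hr).ne')

lemma logD_wt_mul (hF : DiffAt F (y, r)) (i k : Fin 3) : ld J i (fun w => wt k w.2 * F w) (y, r)
      = wt k r * (ld J i F (y, r) + if i = 0 ∧ k = 0 then F (y, r) else 0) := by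
  by_cases hk : k = 0
  · subst hk
    have h1 := (hasFDerivAt_snd (𝕜 := ℝ) (p := (y, r))).mul hF.hasFDerivAt
    have h2 : HasFDerivAt (fun w : Y × ℝ => wt 0 w.2 * F w) _ (y, r) := h1
    simp only [logD, h2.fderiv]
    refine Fin.cases ?_ (fun A => ?_) i
    · simp; ring
    · simp
  · have h3 : ∀ r, wt k r = 1 := fun r => by simp [wt, hk]
    simp [h3, hk]

lemma logD_div_wt (hr : ρ < r) (hF : DiffAt F (y, r)) (i k : Fin 3) : ld J i (fun w => F w / wt k w.2) (y, r)
      = (ld J i F (y, r) - if i = 0 ∧ k = 0 then F (y, r) else 0) / wt k r := by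
  have hr0 := hρ.1.trans_lt hr
  have h1 : DiffAt (fun w => F w / wt k w.2) (y, r) := DifferentiableAt.div_wt hr0 hF k
  have h2 := logD_wt_mul (J := J) h1 i k
  have h3 : (fun w : Y × ℝ => wt k w.2 * (F w / wt k w.2)) =ᶠ[nhds (y, r)] F := by
    filter_upwards [(isOpen_lt continuous_const continuous_snd).mem_nhds (show (0 : ℝ) < (y, r).2 from hr0)] with w hw
    exact mul_div_cancel₀ _ (wt_pos k hw).ne'
  simp only [logD] at h2 ⊢
  rw [h3.fderiv_eq] at h2
  rw [h2]
  have := (wt_pos k hr0).ne'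
  split_ifs <;> field_simp <;> ring

lemma wt_mul_lieDeriv (hr : ρ < r) {G : Fin 3 → Fin 3 → Fn Y} {X : Fin 3 → Fn Y} {V : Bulk → Bulk} {g : Bulk → Mat3}
    (hG : ∀ i j, DiffAt (G i j) (y, r)) (hX : ∀ i, DiffAt (X i) (y, r)) (hg : ∀ i j r' x', ρ < r' →
      wt i r' * wt j r' * g (pt r' x') i j = G i j (y + J (x' - x), r'))
    (hV : ∀ i r' x', ρ < r' → V (pt r' x') i = wt i r' * X i (y + J (x' - x), r')) (i j : Fin 3) :
    wt i r * wt j r * lieDeriv V g (pt r x) i j = lieLog J G X i j (y, r) := by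
  have hr0 := hρ.1.trans_lt hr
  have hg' : ∀ i j r' x', ρ < r' → g (pt r' x') i j = G i j (y + J (x' - x), r') / wt j r' / wt i r' := by
    intro i j r' x' hr'
    have h1 := (wt_pos i (hρ.1.trans_lt hr')).ne'
    have h2 := (wt_pos j (hρ.1.trans_lt hr')).ne'
    rw [← hg i j r' x' hr']
    field_simp
  have hGd : ∀ i j, DiffAt (fun w => G i j w / wt j w.2) (y, r) := fun i j =>
    DifferentiableAt.div_wt hr0 (hG i j) j
  have hpg : ∀ k i j, pd k (fun z => g z i j) (pt r x) =
      ((ld J k (G i j) (y, r) - if k = 0 ∧ j = 0 then G i j (y, r) else 0) / wt j r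
        - if k = 0 ∧ i = 0 then G i j (y, r) / wt j r else 0) / wt i r / wt k r := by
    intro k i j
    rw [eq_div_iff (wt_pos k hr0).ne', mul_comm]
    rw [pd_eq_logD hr (F := fun w => G i j w / wt j w.2 / wt i w.2) (y := y) (J := J)
      (DifferentiableAt.div_wt hr0 (hGd i j) i) (fun r' x' hr' => hg' i j r' x' hr') k]
    rw [logD_div_wt hr (hGd i j), logD_div_wt hr (hG i j)]
  have hpV : ∀ k i, pd k (fun z => V z i) (pt r x) =
      (wt i r * (ld J k (X i) (y, r) + if k = 0 ∧ i = 0 then X i (y, r) else 0)) / wt k r := by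
    intro k i
    rw [eq_div_iff (wt_pos k hr0).ne', mul_comm]
    rw [pd_eq_logD hr (F := fun w => wt i w.2 * X i w) (y := y) (J := J)
      ((differentiableAt_wt i).fun_mul (hX i)) (fun r' x' hr' => hV i r' x' hr') k]
    rw [logD_wt_mul (hX i)]
  have hgx : ∀ i j, g (pt r x) i j = G i j (y, r) / wt j r / wt i r := fun i j => by
    simpa using hg' i j r x hr
  have hVx : ∀ i, V (pt r x) i = wt i r * X i (y, r) := fun i => by simpa using hV i r x hr
  simp only [lieDeriv, lieLog, of_apply, hpg, hpV, hgx, hVx, Fin.sum_univ_three]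
  have w1 : ∀ r, wt 1 r = 1 := fun r => rfl
  have w2 : ∀ r, wt 2 r = 1 := fun r => rfl
  fin_cases i <;> fin_cases j <;> simp [w1, w2] <;> field_simp <;> ring

end Frame

/-! ### Two-term expansions and the Lie derivative of the metric -/

section Expansion

/-- `f = a r^{k+2} + c r^k + o(r^k)` with smooth coefficients. -/
structure Ex (ρ : ℝ) (k : ℤ) (f : Fn Y) (a c : Y → ℝ) : Prop where
  left : Cinf a
  right : Cinf c
  fall : IsFall ρ false k (fun w => f w - (w.2 ^ (k + 2) * a w.1 + w.2 ^ k * c w.1))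

variable {k k' : ℤ} {f g : Fn Y} {a a' c c' : Y → ℝ} {b : Bool}

lemma Ex.congr (h : Ex ρ k f a c) (e : ∀ w : Y × ℝ, ρ < w.2 → f w = g w) : Ex ρ k g a c :=
  ⟨h.left, h.right, h.fall.congr fun w hw => by rw [e w hw]⟩

lemma Ex.congr_coeff (h : Ex ρ k f a c) (ha : ∀ y, a y = a' y) (hc : ∀ y, c y = c' y) : Ex ρ k f a' c' := by
  obtain rfl := funext ha; obtain rfl := funext hc; exact h

lemma Ex.smooth (h : Ex ρ k f a c) : CinfOn f (far ρ) := by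
  have h1 := h.fall.smooth.add ((((IsFall.zpow (Y := Y) (ρ := ρ) (k + 2)).mul (IsFall.of_fst h.left)).smooth).add
    ((IsFall.zpow (Y := Y) (ρ := ρ) k).mul (IsFall.of_fst h.right)).smooth)
  exact h1.congr fun w _ => by ring

lemma Ex.of_fall (h : IsFall ρ b k' f) (hk : k' < k) : Ex ρ k f 0 0 :=
  ⟨contDiff_const, contDiff_const, (h.lt hk).congr fun w _ => by simp⟩

lemma Ex.add (h : Ex ρ k f a c) (h' : Ex ρ k g a' c') :
    Ex ρ k (fun w => f w + g w) (fun y => a y + a' y) (fun y => c y + c' y) :=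
  ⟨h.left.add h'.left, h.right.add h'.right, (h.fall.add h'.fall).congr fun w _ => by ring⟩

lemma Ex.const_mul (t : ℝ) (h : Ex ρ k f a c) : Ex ρ k (fun w => t * f w) (fun y => t * a y) (fun y => t * c y) :=
  ⟨contDiff_const.mul h.left, contDiff_const.mul h.right, (h.fall.const_mul t).congr fun w _ => by ring⟩

lemma Ex.sum {ι : Type*} {s : Finset ι} {F : ι → Fn Y} {a c : ι → Y → ℝ} (h : ∀ i, Ex ρ k (F i) (a i) (c i)) :
    Ex ρ k (fun w => ∑ i ∈ s, F i w) (fun y => ∑ i ∈ s, a i y) (fun y => ∑ i ∈ s, c i y) :=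
  ⟨ContDiff.sum fun i _ => (h i).left, ContDiff.sum fun i _ => (h i).right,
    (IsFall.sum fun i (_ : i ∈ s) => (h i).fall).congr fun w _ => by
      simp only [sum_sub_distrib, sum_add_distrib, mul_sum]⟩

lemma Ex.big (h : Ex ρ k f a c) : IsFall ρ true k (fun w => f w - w.2 ^ (k + 2) * a w.1) := by
  have h1 := (IsFall.zpow (Y := Y) (ρ := ρ) k).mul (IsFall.of_fst h.right)
  rw [add_zero] at h1
  exact (h.fall.big.add h1).congr fun w _ => by ring

lemma Ex.big' (h : Ex ρ k f a c) : IsFall ρ true (k + 2) f := by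
  have h1 := (IsFall.zpow (Y := Y) (ρ := ρ) (k + 2)).mul (IsFall.of_fst h.left)
  rw [add_zero] at h1
  exact (((h.big).mono (by omega)).add h1).congr fun w _ => by ring

lemma Ex.mul (h : Ex ρ k f a c) (h' : Ex ρ k' g a' c') : Ex ρ (k + k' + 2) (fun w => f w * g w) (fun y => a y * a' y)
      (fun y => a y * c' y + c y * a' y) := by
  refine ⟨h.left.mul h'.left, (h.left.mul h'.right).add (h.right.mul h'.left), ?_⟩
  have z := fun m => IsFall.zpow (Y := Y) (ρ := ρ) m
  have t1 : IsFall ρ false (k + k' + 2) (fun w =>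
      (f w - (w.2 ^ (k + 2) * a w.1 + w.2 ^ k * c w.1)) * g w) :=
    (h.fall.mul (h'.big')).mono (by omega)
  have t2 : IsFall ρ false (k + k' + 2) (fun w => (w.2 ^ (k + 2) * a w.1) *
      (g w - (w.2 ^ (k' + 2) * a' w.1 + w.2 ^ k' * c' w.1))) :=
    (((z (k + 2)).mul (IsFall.of_fst h.left)).mul h'.fall).mono (by omega)
  have t3 : IsFall ρ false (k + k' + 2) (fun w => (w.2 ^ k * c w.1) * (g w - w.2 ^ (k' + 2) * a' w.1)) :=
    (((z k).mul (IsFall.of_fst h.right)).mul (h'.big)).lt (by omega)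
  refine ((t1.add t2).add t3).congr fun w hw => ?_
  have hw0 : w.2 ≠ 0 := (hρ.1.trans_lt hw).ne'
  have e1 : w.2 ^ (k + k' + 2 + 2) = w.2 ^ (k + 2) * w.2 ^ (k' + 2) := by
    rw [← zpow_add₀ hw0]; congr 1; ring
  have e2 : w.2 ^ (k + k' + 2) = w.2 ^ k * w.2 ^ (k' + 2) := by
    rw [← zpow_add₀ hw0]; congr 1; ring
  have e3 : w.2 ^ (k + k' + 2) = w.2 ^ (k + 2) * w.2 ^ k' := by
    rw [← zpow_add₀ hw0]; congr 1; ring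
  rw [e1, mul_add (w.2 ^ (k + k' + 2)), ]
  nth_rw 1 [e3]
  rw [e2]
  ring

lemma Ex.logD (h : Ex ρ k f a c) (v : Y × ℝ) : Ex ρ k (logD v f) (fun y => fderiv ℝ a y v.1 + v.2 * (k + 2) * a y)
      (fun y => fderiv ℝ c y v.1 + v.2 * k * c y) := by
  have hs := h.smooth
  have ha := h.left
  have hc := h.right
  refine ⟨((ha.fderiv_right (by simp)).clm_apply contDiff_const).add (contDiff_const.mul ha),
    ((hc.fderiv_right (by simp)).clm_apply contDiff_const).add (contDiff_const.mul hc),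
    (h.fall.logD v).congr fun w hw => ?_⟩
  have hw0 : 0 < w.2 := hρ.1.trans_lt hw
  have hdf : DiffAt f w := (hs.contDiffAt ((isOpen_end ρ).mem_nhds hw)).difAt
  have hz : ∀ m : ℤ, DiffAt (fun w : Y × ℝ => w.2 ^ m) w := fun m =>
    (contDiffAt_zpow_snd m hw0).difAt
  have hda : DiffAt (fun w : Y × ℝ => a w.1) w := ((ha.comp contDiff_fst).dif) w
  have hdc : DiffAt (fun w : Y × ℝ => c w.1) w := ((hc.comp contDiff_fst).dif) w
  have ea := logD_fst (v := v) ((ha.dif) w.1)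
  have ec := logD_fst (v := v) ((hc.dif) w.1)
  have e1 := logD_zpow (m := k + 2) (v := v) hw0
  have e2 := logD_zpow (m := k) (v := v) hw0
  simp only [AsymptoticAdS3.logD] at ea ec e1 e2 ⊢
  rw [fderiv_fun_sub hdf (((hz _).fun_mul hda).fun_add ((hz _).fun_mul hdc)),
    fderiv_fun_add ((hz _).fun_mul hda) ((hz _).fun_mul hdc), fderiv_fun_mul (hz _) hda, fderiv_fun_mul (hz _) hdc]
  simp only [sub_apply, add_apply, smul_apply, smul_eq_mul, ea, ec, e1, e2]
  push_cast
  ring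

lemma tendsto_mk_endAt {K : Set Y} {y : Y} (hy : y ∈ K) : Tendsto (fun r : ℝ => ((y, r) : Y × ℝ)) atTop (endAt K) :=
  (tendsto_principal.2 (Eventually.of_forall fun _ => hy)).prodMk tendsto_id

lemma Ex.unique (h : Ex ρ k f a c) (h' : Ex ρ k f a' c') : a = a' ∧ c = c' := by
  have key : ∀ {k : ℤ} {f : Fn Y}, IsFall ρ false k f → ∀ y,
      Tendsto (fun r : ℝ => r ^ (-k) * f (y, r)) atTop (𝓝 0) := by
    intro k f hf y
    have h1 : f =o[endAt {y}] fun w => w.2 ^ k := (hf.fall {y} isCompact_singleton).small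
    have h2 := tendsto_mk_endAt (Set.mem_singleton y)
    refine ((h1.comp_tendsto h2).tendsto_div_nhds_zero).congr' ?_
    filter_upwards [eventually_gt_atTop 0] with r hr
    simp [zpow_neg, div_eq_inv_mul]
  have hd := h'.fall.sub h.fall
  have ha : a = a' := by
    funext y
    have h1 := key hd y
    have h2 : Tendsto (fun r : ℝ => r ^ (-2 : ℤ)) atTop (𝓝 0) := tendsto_zpow_atTop_zero (by norm_num)
    have h3 := (h2.mul h1).add ((h2.mul_const (c' y - c y)))
    have h4 : Tendsto (fun _ : ℝ => a y - a' y) atTop (𝓝 (0 * 0 + 0 * (c' y - c y))) := by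
      refine h3.congr' ?_
      filter_upwards [eventually_gt_atTop 0] with r hr
      have e1 : r ^ (k + 2) = r ^ k * r ^ 2 := by rw [zpow_add₀ hr.ne']; norm_cast
      have e2 : r ^ (-2 : ℤ) = (r ^ 2)⁻¹ := by rw [zpow_neg]; norm_cast
      rw [e1, e2, zpow_neg]
      have : r ^ k ≠ 0 := zpow_ne_zero _ hr.ne'
      field_simp
      ring
    have := tendsto_nhds_unique h4 tendsto_const_nhds
    linarith
  refine ⟨ha, ?_⟩
  subst ha
  funext y
  have h1 := key hd y
  have h4 : Tendsto (fun _ : ℝ => c y - c' y) atTop (𝓝 0) := by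
    refine h1.congr' ?_
    filter_upwards [eventually_gt_atTop 0] with r hr
    rw [zpow_neg]
    have : r ^ k ≠ 0 := zpow_ne_zero _ hr.ne'
    field_simp
    ring
  have := tendsto_nhds_unique h4 tendsto_const_nhds
  linarith

/-- The derivative in the boundary direction `A`. -/
def bd (J : Bdry →L[ℝ] Y) (A : Fin 2) (f : Y → ℝ) (y : Y) : ℝ := fderiv ℝ f y (J (Pi.single A 1))

/-- The Lie derivative of `γ` along `V` in the boundary directions. -/
def lieB (J : Bdry →L[ℝ] Y) (V : Fin 2 → Y → ℝ) (γ : Fin 2 → Fin 2 → Y → ℝ) (A B : Fin 2) (y : Y) :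
    ℝ :=
  ∑ D, (V D y * bd J D (γ A B) y + γ D B y * bd J A (V D) y + γ A D y * bd J B (V D) y)

/-- The expansion of a metric in the logarithmic frame. -/
structure MetricExp (ρ l : ℝ) (G : Fin 3 → Fin 3 → Fn Y) (γ : Fin 2 → Fin 2 → Y → ℝ)
    (c : Y → ℝ) (C : Fin 2 → Fin 2 → Y → ℝ) : Prop where
  rr : Ex ρ (-2) (G 0 0) (fun _ => l ^ 2) c
  rA : ∀ A : Fin 2, IsFall ρ true (-2) (G 0 A.succ)
  AB : ∀ A B : Fin 2, Ex ρ 0 (G A.succ B.succ) (γ A B) (C A B)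
  symm : ∀ i j w, ρ < w.2 → G i j w = G j i w

/-- The expansion of a vector field in the logarithmic frame. -/
structure FieldExp (ρ l : ℝ) (X : Fin 3 → Fn Y) (V : Fin 2 → Y → ℝ) (ψ R : Y → ℝ)
    (N : Fin 2 → Y → ℝ) : Prop where
  smooth_V : ∀ A, Cinf (V A)
  smooth_N : ∀ A, Cinf (N A)
  r : Ex ρ (-2) (X 0) (fun y => -(1 / 2) * ψ y) R
  A : ∀ A : Fin 2, IsFall ρ true (-4) (fun w =>
    X A.succ w - (V A w.1 - l ^ 2 / 4 * w.2 ^ (-2 : ℤ) * N A w.1))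

variable {G : Fin 3 → Fin 3 → Fn Y} {γ C : Fin 2 → Fin 2 → Y → ℝ}
  {X : Fin 3 → Fn Y} {V N : Fin 2 → Y → ℝ} {ψ R : Y → ℝ} {J : Bdry →L[ℝ] Y}

lemma FieldExp.smooth_ψ (hX : FieldExp ρ l X V ψ R N) : Cinf ψ := by
  have h : Cinf fun y => (-2 : ℝ) * (-(1 / 2) * ψ y) := contDiff_const.mul hX.r.left
  have e : (fun y => (-2 : ℝ) * (-(1 / 2) * ψ y)) = ψ := by funext y; ring
  rwa [e] at h

lemma FieldExp.A_ex (hX : FieldExp ρ l X V ψ R N) (A : Fin 2) :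
    Ex ρ (-2) (X A.succ) (V A) (fun y => -(l ^ 2 / 4) * N A y) :=
  ⟨hX.smooth_V A, contDiff_const.mul (hX.smooth_N A), ((hX.A A).lt (by norm_num)).congr fun w _ => by
    simp; ring⟩

lemma MetricExp.differentiableAt (hG : MetricExp ρ l G γ c C) (i j : Fin 3) : CinfOn (G i j) (far ρ) := by
  refine Fin.cases (Fin.cases (hG.rr.smooth) (fun B => (hG.rA B).smooth) j) (fun A => ?_) i
  refine Fin.cases ?_ (fun B => (hG.AB A B).smooth) j
  exact (hG.rA A).smooth.congr fun w hw => hG.symm _ _ w hw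

lemma lieLog_rr (hG : MetricExp ρ l G γ c C) (hX : FieldExp ρ l X V ψ R N) : Ex ρ (-2) (lieLog J G X 0 0) 0
      (fun y => ψ y * c y - 4 * l ^ 2 * R y + ∑ A, V A y * bd J A c y) := by
  have m : ∀ {f g : Fn Y} {a c a' c' : Y → ℝ}, Ex ρ (-2) f a c → Ex ρ (-2) g a' c' →
      Ex ρ (-2) (fun w => f w * g w) (fun y => a y * a' y) (fun y => a y * c' y + c y * a' y) := fun h h' => h.mul h'
  have t0 := m hX.r (hG.rr.logD (frame J 0))
  have t1 := m hG.rr (hX.r.logD (frame J 0))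
  have t2 : ∀ A : Fin 2, Ex ρ (-2) (fun w => X A.succ w * ld J A.succ (G 0 0) w) _ _ :=
    fun A => m (hX.A_ex A) (hG.rr.logD (frame J A.succ))
  have t3 : ∀ A : Fin 2, Ex ρ (-2) (fun w => G 0 A.succ w * ld J 0 (X A.succ) w) 0 0 := fun A => by
    have h1 := ((hX.A_ex A).logD (frame J 0)).big
    have h2 : IsFall ρ true (-2) (ld J 0 (X A.succ)) := h1.congr fun w _ => by simp
    exact Ex.of_fall ((hG.rA A).mul h2) (by norm_num)
  have tot := (t0.add (t1.const_mul 2)).add (((t2 0).add (t2 1)).add (((t3 0).add (t3 1)).const_mul 2))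
  refine (tot.congr fun w hw => ?_).congr_coeff (fun y => ?_) (fun y => ?_)
  · simp only [lieLog, Fin.sum_univ_three, hG.symm _ 0 w hw]
    simp only [Fin.succ_zero_eq_one, Fin.succ_one_eq_two]
    ring
  · simp
  · simp only [Fin.sum_univ_two, bd, frame_zero, frame_succ]
    simp
    ring

lemma lieLog_rA (hG : MetricExp ρ l G γ c C) (hX : FieldExp ρ l X V ψ R N)
    (hN : ∀ A y, ∑ B, γ A B y * N B y = bd J A ψ y) (A : Fin 2) : IsFall ρ true (-2) (lieLog J G X 0 A.succ) := by
  have hX0 := hX.r.big'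
  have hXA := fun B => (hX.A_ex B).big'
  have t0 : IsFall ρ true (-2) (fun w => X 0 w * ld J 0 (G 0 A.succ) w) := hX0.mul ((hG.rA A).logD _)
  have t1 : ∀ B : Fin 2, IsFall ρ true (-2) (fun w => X B.succ w * ld J B.succ (G 0 A.succ) w) := fun B =>
    (hXA B).mul ((hG.rA A).logD _)
  have t2 : ∀ B : Fin 2, IsFall ρ true (-2) (fun w => G 0 B.succ w * ld J A.succ (X B.succ) w) := fun B =>
    (hG.rA B).mul ((hXA B).logD _)
  have t3 : IsFall ρ true (-2) (fun w => G 0 A.succ w * ld J 0 (X 0) w) := (hG.rA A).mul (hX0.logD _)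
  have t4 := (hG.rr.mul (hX.r.logD (frame J A.succ))).big
  have hψ := hX.smooth_ψ
  have t5 : ∀ B : Fin 2, IsFall ρ true (-2) (fun w =>
      G A.succ B.succ w * ld J 0 (X B.succ) w - l ^ 2 / 2 * (γ A B w.1 * N B w.1)) := by
    intro B
    have hAB := hG.AB A B
    have h1 : IsFall ρ true (-4) (fun w => ld J 0 (X B.succ) w - l ^ 2 / 2 * w.2 ^ (-2 : ℤ) * N B w.1) := by
      refine ((hX.A B).logD (frame J 0)).congr fun w hw => ?_
      have hw0 : 0 < w.2 := hρ.1.trans_lt hw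
      have hdf : DiffAt (X B.succ) w := (((hX.A_ex B).smooth).contDiffAt ((isOpen_end ρ).mem_nhds hw)).difAt
      have hV : DiffAt (fun w : Y × ℝ => V B w.1) w := (((hX.smooth_V B).comp contDiff_fst).dif) w
      have hNd : DiffAt (fun w : Y × ℝ => N B w.1) w := (((hX.smooth_N B).comp contDiff_fst).dif) w
      have hz : DiffAt (fun w : Y × ℝ => w.2 ^ (-2 : ℤ)) w := (contDiffAt_zpow_snd _ hw0).difAt
      have eV := logD_fst (v := frame J 0) (((hX.smooth_V B).dif) w.1)
      have eN := logD_fst (v := frame J 0) (((hX.smooth_N B).dif) w.1)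
      have ez := logD_zpow (m := -2) (v := frame J 0) hw0
      simp only [logD] at eV eN ez ⊢
      rw [fderiv_fun_sub hdf (hV.fun_sub ((hz.const_mul _).fun_mul hNd)),
        fderiv_fun_sub hV ((hz.const_mul _).fun_mul hNd), fderiv_fun_mul (hz.const_mul _) hNd, fderiv_const_mul hz]
      simp only [sub_apply, add_apply, smul_apply, smul_eq_mul, eV, eN, ez]
      simp
      ring
    have h2 : IsFall ρ true (-2) (fun w => G A.succ B.succ w * (ld J 0 (X B.succ) w
        - l ^ 2 / 2 * w.2 ^ (-2 : ℤ) * N B w.1)) := (hAB.big').mul h1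
    have h3 : IsFall ρ true (-2) (fun w => (G A.succ B.succ w - w.2 ^ (0 + 2 : ℤ) * γ A B w.1) *
        (l ^ 2 / 2 * (w.2 ^ (-2 : ℤ) * N B w.1))) := ((hAB.big).mul (((IsFall.zpow (-2)).mul
        (IsFall.of_fst (hX.smooth_N B))).const_mul (l ^ 2 / 2))).mono (by norm_num)
    refine (h2.add h3).congr fun w hw => ?_
    have hw0 : w.2 ≠ 0 := (hρ.1.trans_lt hw).ne'
    have e : w.2 ^ (0 + 2 : ℤ) * w.2 ^ (-2 : ℤ) = 1 := by rw [← zpow_add₀ hw0]; simp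
    linear_combination (-(γ A B w.1 * (l ^ 2 / 2) * N B w.1)) * e
  refine ((t0.add ((t1 0).add (t1 1))).add (((t2 0).add (t2 1)).add ((t3.add t4).add
    ((t5 0).add (t5 1))))).congr fun w hw => ?_
  have hNw := hN A w.1
  have e1 : fderiv ℝ (fun y => -(1 / 2) * ψ y) w.1 (J (Pi.single A 1)) = -(1 / 2) * bd J A ψ w.1 := by
    rw [fderiv_const_mul ((hψ.dif) w.1)]
    rfl
  simp only [Fin.sum_univ_two] at hNw
  simp only [lieLog, Fin.sum_univ_three, hG.symm _ A.succ w hw, frame_succ, e1]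
  simp only [← frame_succ, Fin.succ_zero_eq_one, Fin.succ_one_eq_two]
  rw [hG.symm A.succ 0 w hw]
  norm_num
  linear_combination (-(l ^ 2 / 2)) * hNw

lemma lieLog_AB (hG : MetricExp ρ l G γ c C) (hX : FieldExp ρ l X V ψ R N)
    (A B : Fin 2) : Ex ρ 0 (lieLog J G X A.succ B.succ) (fun y => lieB J V γ A B y - ψ y * γ A B y)
      (fun y => 2 * R y * γ A B y + lieB J V C A B y - l ^ 2 / 4 * lieB J N γ A B y) := by
  have m : ∀ {f g : Fn Y} {a c a' c' : Y → ℝ}, Ex ρ (-2) f a c → Ex ρ 0 g a' c' →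
      Ex ρ 0 (fun w => f w * g w) (fun y => a y * a' y) (fun y => a y * c' y + c y * a' y) := fun h h' => h.mul h'
  have t0 := m hX.r ((hG.AB A B).logD (frame J 0))
  have t1 : ∀ D : Fin 2, Ex ρ 0 (fun w => X D.succ w * ld J D.succ (G A.succ B.succ) w) _ _ :=
    fun D => m (hX.A_ex D) ((hG.AB A B).logD (frame J D.succ))
  have t2 : ∀ D : Fin 2, Ex ρ 0 (fun w => ld J A.succ (X D.succ) w * G D.succ B.succ w) _ _ :=
    fun D => m ((hX.A_ex D).logD (frame J A.succ)) (hG.AB D B)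
  have t3 : ∀ D : Fin 2, Ex ρ 0 (fun w => ld J B.succ (X D.succ) w * G A.succ D.succ w) _ _ :=
    fun D => m ((hX.A_ex D).logD (frame J B.succ)) (hG.AB A D)
  have t4 : ∀ A B : Fin 2, Ex ρ 0 (fun w => G 0 B.succ w * ld J A.succ (X 0) w) 0 0 :=
    fun A B => Ex.of_fall ((hG.rA B).mul ((hX.r.big').logD _)) (by norm_num)
  have tot := ((t0.add ((t4 A B).add (t4 B A))).add ((t1 0).add (t1 1))).add
    (((t2 0).add (t2 1)).add ((t3 0).add (t3 1)))
  refine (tot.congr fun w hw => ?_).congr_coeff (fun y => ?_) (fun y => ?_)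
  · simp only [lieLog, Fin.sum_univ_three]
    rw [hG.symm A.succ 0 w hw]
    simp only [Fin.succ_zero_eq_one, Fin.succ_one_eq_two]
    ring
  · simp only [lieB, Fin.sum_univ_two, bd, frame_zero, frame_succ]
    simp
    ring
  · have e1 : ∀ D E : Fin 2, fderiv ℝ (fun y => -(l ^ 2 / 4) * N D y) y (J (Pi.single E 1))
        = -(l ^ 2 / 4) * bd J E (N D) y := by
      intro D E
      rw [fderiv_const_mul (((hX.smooth_N D).dif) y)]
      rfl
    simp only [lieB, Fin.sum_univ_two, frame_zero, frame_succ, e1]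
    simp [bd]
    ring

end Expansion

/-! ### Vector fields preserving the asymptotic conditions -/

section Prolongation

variable {K : Set Y} {k j : ℤ} {f g : Fn Y} {a c : Y → ℝ}

lemma Ex.lower_bound (h : Ex ρ k f a c) (ha : ∀ y, a y ≠ 0) (hK : IsCompact K) :
    ∃ δ : ℝ, 0 < δ ∧ ∀ᶠ w in endAt K, δ ≤ |w.2 ^ (-(k + 2)) * f w| := by
  have h2 : Small false K 0 (fun w => w.2 ^ (-(k + 2)) * (f w - w.2 ^ (k + 2) * a w.1)) :=
    ((Fall.zpow (Y := Y) (K := K) (-(k + 2))).mul ((h.big).fall K hK)).small.lt (by omega)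
  have hlow : ∃ δ : ℝ, 0 < δ ∧ ∀ y ∈ K, 2 * δ ≤ |a y| := by
    rcases K.eq_empty_or_nonempty with rfl | hne
    · exact ⟨1, one_pos, by simp⟩
    · obtain ⟨y, -, hy⟩ := hK.exists_isMinOn hne h.left.continuous.abs.continuousOn
      refine ⟨|a y| / 2, half_pos (abs_pos.2 (ha y)), fun z hz => ?_⟩
      have h3 : |a y| ≤ |a z| := hy hz
      linarith
  obtain ⟨δ, hδ, hδK⟩ := hlow
  refine ⟨δ, hδ, ?_⟩
  filter_upwards [isLittleO_iff.1 h2 hδ, eventually_mem_endAt K, eventually_gt_endAt K 0] with w h5 hw hw0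
  simp only [zpow_zero, norm_one, mul_one, Real.norm_eq_abs] at h5
  have e : w.2 ^ (-(k + 2)) * (f w - w.2 ^ (k + 2) * a w.1) = w.2 ^ (-(k + 2)) * f w - a w.1 := by
    rw [mul_sub, ← mul_assoc, ← zpow_add₀ hw0.ne']; simp
  rw [e] at h5
  have h6 := hδK _ hw
  have h7 := abs_sub_abs_le_abs_sub (a w.1) (w.2 ^ (-(k + 2)) * f w)
  rw [abs_sub_comm] at h7
  linarith

lemma Ex.inv_fall (h : Ex ρ k f a c) (ha : ∀ y, a y ≠ 0) (hK : IsCompact K) :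
    Fall true K (-(k + 2)) (fun w => (f w)⁻¹) := by
  have h1 : Fall true K 0 (fun w => w.2 ^ (-(k + 2)) * f w) := by
    have := (Fall.zpow (Y := Y) (K := K) (-(k + 2))).mul ((h.big').fall K hK)
    rwa [neg_add_cancel] at this
  obtain ⟨δ, hδ, h3⟩ := h.lower_bound ha hK
  have h4 := (Fall.zpow (Y := Y) (K := K) (-(k + 2))).mul (h1.inv hδ h3)
  rw [add_zero] at h4
  refine h4.congr (GermEq.of_forall_gt (R := 0) fun w hw => ?_)
  have := zpow_ne_zero (k + 2) (ne_of_gt hw)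
  rw [zpow_neg]
  field_simp

lemma Ex.eventually_ne (h : Ex ρ k f a c) (ha : ∀ y, a y ≠ 0)
    (hK : IsCompact K) : ∀ᶠ w in endAt K, ∀ᶠ w' in 𝓝 w, f w' ≠ 0 := by
  obtain ⟨δ, hδ, h3⟩ := h.lower_bound ha hK
  filter_upwards [h3, eventually_gt_endAt K ρ] with w h1 h2
  refine ((h.smooth).contDiffAt ((isOpen_end ρ).mem_nhds h2)).continuousAt.eventually_ne ?_
  rintro h0
  rw [h0, mul_zero, abs_zero] at h1
  linarith

/-- Division by a function with nonvanishing leading coefficient. -/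
lemma Ex.fall_of_mul (h : Ex ρ k f a c) (ha : ∀ y, a y ≠ 0) (hK : IsCompact K)
    {b : Bool} {n : ℤ} {S : Fn Y} (hS : Fall b K n S) (e : ∀ w, ρ < w.2 → f w * g w = S w) :
    Fall b K (n - (k + 2)) g := by
  have h1 := (h.inv_fall ha hK).mul hS
  rw [Bool.true_and, show -(k + 2) + n = n - (k + 2) by ring] at h1
  refine h1.congr ?_
  filter_upwards [h.eventually_ne ha hK, eventually_gt_endAt K ρ] with w h2 h3
  filter_upwards [h2, (isOpen_end ρ).mem_nhds h3] with w' h4 h5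
  rw [← e w' h5]
  field_simp

lemma logD_mul_at {w v : Y × ℝ} (hf : DiffAt f w) (hg : DiffAt g w) :
    logD v (fun w => f w * g w) w = logD v f w * g w + f w * logD v g w := by
  simp [logD, fderiv_fun_mul hf hg]; ring

lemma logD_add_at {w v : Y × ℝ} (hf : DiffAt f w) (hg : DiffAt g w) :
    logD v (fun w => f w + g w) w = logD v f w + logD v g w := by
  simp [logD, fderiv_fun_add hf hg]

lemma logD_sum_at {ι : Type*} {s : Finset ι} {F : ι → Fn Y} {w v : Y × ℝ} (hf : ∀ i, DiffAt (F i) w) :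
    logD v (fun w => ∑ i ∈ s, F i w) w = ∑ i ∈ s, logD v (F i) w := by
  simp [logD, fderiv_fun_sum fun i _ => hf i]

/-- Affine combinations of the functions `U` with coefficients `O(r^k)`. -/
def Lin {ι : Type*} [Fintype ι] (K : Set Y) (U : ι → Fn Y) (k : ℤ) (F : Fn Y) : Prop :=
  ∃ (A : ι → Fn Y) (β : Fn Y), (∀ i, Fall true K k (A i)) ∧ Fall true K k β ∧
    GermEq K F (fun w => ∑ i, A i w * U i w + β w)

section Lin

variable {ι : Type*} [Fintype ι] {U : ι → Fn Y} {F F' : Fn Y}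

lemma GermEq.map₂ {f f' g g' : Fn Y} (φ : ℝ → ℝ → ℝ) (h : GermEq K f f')
    (h' : GermEq K g g') : GermEq K (fun w => φ (f w) (g w)) (fun w => φ (f' w) (g' w)) := by
  filter_upwards [h, h'] with w h1 h2
  filter_upwards [h1, h2] with w' h3 h4
  rw [h3, h4]

lemma Lin.congr (h : Lin K U k F) (e : GermEq K F F') : Lin K U k F' := by
  obtain ⟨A, β, hA, hβ, h⟩ := h
  exact ⟨A, β, hA, hβ, e.symm.trans h⟩

lemma Lin.mono (h : Lin K U k F) (hk : k ≤ j) : Lin K U j F := by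
  obtain ⟨A, β, hA, hβ, h⟩ := h
  exact ⟨A, β, fun i => (hA i).mono hk, hβ.mono hk, h⟩

lemma Lin.add (h : Lin K U k F) (h' : Lin K U k F') : Lin K U k (fun w => F w + F' w) := by
  obtain ⟨A, β, hA, hβ, h⟩ := h
  obtain ⟨A', β', hA', hβ', h'⟩ := h'
  refine ⟨fun i w => A i w + A' i w, fun w => β w + β' w, fun i => (hA i).add (hA' i), hβ.add hβ',
    (h.map₂ (· + ·) h').trans (Eventually.of_forall fun w => Eventually.of_forall fun w => ?_)⟩
  simp only [add_mul, sum_add_distrib]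
  ring

lemma Lin.mul_fall (h : Lin K U k F) (hf : Fall true K j f) : Lin K U (j + k) (fun w => f w * F w) := by
  obtain ⟨A, β, hA, hβ, h⟩ := h
  refine ⟨fun i w => f w * A i w, fun w => f w * β w, fun i => hf.mul (hA i), hf.mul hβ,
    ((GermEq.refl f).map₂ (· * ·) h).trans (Eventually.of_forall fun w => Eventually.of_forall fun w => ?_)⟩
  simp only [mul_add, mul_sum, mul_assoc]

lemma Lin.neg (h : Lin K U k F) : Lin K U k (fun w => -F w) := by
  have h1 := h.mul_fall (f := fun _ => -1) (j := 0) (by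
    simpa using (Fall.zpow (Y := Y) (K := K) 0).const_mul (-1))
  rw [zero_add] at h1
  simpa using h1

lemma Lin.of_fall {β : Fn Y} (h : Fall true K k β) : Lin K U k β := ⟨fun _ _ => 0, β, fun _ => Fall.zero, h,
    Eventually.of_forall fun w => Eventually.of_forall fun w => by simp⟩

lemma Lin.of_unknown (i : ι) : Lin K U 0 (U i) := by
  classical
  refine ⟨fun j _ => if j = i then 1 else 0, fun _ => 0, fun j => ?_, Fall.zero,
    Eventually.of_forall fun w => Eventually.of_forall fun w => by simp⟩
  by_cases hj : j = i
  · simp only [hj, if_true]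
    simpa using (Fall.zpow (Y := Y) (K := K) 0)
  · simp only [hj, if_false]
    exact Fall.zero

lemma Lin.sum {κ : Type*} (s : Finset κ) {F : κ → Fn Y} (h : ∀ i, Lin K U k (F i)) :
    Lin K U k (fun w => ∑ i ∈ s, F i w) := by
  classical
  induction s using Finset.induction_on with
  | empty => simpa using Lin.of_fall Fall.zero
  | insert i s hi ih =>
    simp only [sum_insert hi]
    exact (h i).add ih

end Lin

variable {G : Fin 3 → Fin 3 → Fn Y} {γ C : Fin 2 → Fin 2 → Y → ℝ}
  {X : Fin 3 → Fn Y} {J : Bdry →L[ℝ] Y}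

/-- The growth exponent of `G i j`. -/
def gw (i j : Fin 3) : ℤ := if i = 0 ∨ j = 0 then 0 else 2

lemma MetricExp.fall_G (hG : MetricExp ρ l G γ c C) (i j : Fin 3) : IsFall ρ true (gw i j) (G i j) := by
  refine Fin.cases ?_ (fun A => ?_) i
  · refine Fin.cases ?_ (fun B => ?_) j
    · simpa [gw] using hG.rr.big'
    · simpa [gw] using (hG.rA B).mono (by norm_num : (-2 : ℤ) ≤ 0)
  · refine Fin.cases ?_ (fun B => ?_) j
    · simpa [gw] using ((hG.rA A).mono (by norm_num : (-2 : ℤ) ≤ 0)).congr fun w hw => hG.symm _ _ w hw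
    · simpa [gw] using (hG.AB A B).big'

lemma MetricExp.symm_logD (hG : MetricExp ρ l G γ c C) (i j : Fin 3) (v w : Y × ℝ)
    (hw : ρ < w.2) : logD v (G i j) w = logD v (G j i) w := by
  have : G i j =ᶠ[𝓝 w] G j i := by
    filter_upwards [(isOpen_end ρ).mem_nhds hw] with w' hw' using hG.symm i j w' hw'
  simp only [logD, this.fderiv_eq]

/-- The part of `D_l (L_X G)_{ij}` that contains no second derivatives of `X`. -/
def lieLow (J : Bdry →L[ℝ] Y) (G : Fin 3 → Fin 3 → Fn Y) (X : Fin 3 → Fn Y) (l i j : Fin 3) (w : Y × ℝ) : ℝ :=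
  ∑ k, (ld J l (X k) w * ld J k (G i j) w + X k w * ld J l (ld J k (G i j)) w + ld J l (G k j) w * ld J i (X k) w
    + ld J l (G i k) w * ld J j (X k) w)

lemma logD_lieLog (hG : MetricExp ρ l G γ c C)
    (hX : ∀ k, CinfOn (X k) (far ρ)) (m i j : Fin 3) {w : Y × ℝ} (hw : ρ < w.2) :
    ld J m (lieLog J G X i j) w = lieLow J G X m i j w + ((∑ k, G k j w * ld J m (ld J i (X k)) w)
      + ∑ k, G k i w * ld J m (ld J j (X k)) w) := by
  have d : ∀ {f : Fn Y}, CinfOn f (far ρ) → DiffAt f w := fun hf =>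
    (hf.contDiffAt ((isOpen_end ρ).mem_nhds hw)).difAt
  have dX := fun k => d (hX k)
  have dDX := fun i k => d (logD_contDiffOn (hX k) (frame J i))
  have dG := fun i j => d (hG.differentiableAt i j)
  have dDG := fun k i j => d (logD_contDiffOn (hG.differentiableAt i j) (frame J k))
  unfold lieLog
  rw [logD_sum_at fun k => (((dX k).fun_mul (dDG k i j)).fun_add ((dG k j).fun_mul (dDX i k))).fun_add
    ((dG i k).fun_mul (dDX j k))]
  simp only [fun k => logD_add_at (v := frame J m) (((dX k).fun_mul (dDG k i j)).fun_add
    ((dG k j).fun_mul (dDX i k))) ((dG i k).fun_mul (dDX j k)),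
    fun k => logD_add_at (v := frame J m) ((dX k).fun_mul (dDG k i j)) ((dG k j).fun_mul (dDX i k)),
    fun k => logD_mul_at (v := frame J m) (dX k) (dDG k i j), fun k => logD_mul_at (v := frame J m) (dG k j) (dDX i k),
    fun k => logD_mul_at (v := frame J m) (dG i k) (dDX j k), lieLow, hG.symm _ i w hw]
  simp only [sum_add_distrib]
  ring

lemma lieLog_symm (hG : MetricExp ρ l G γ c C) (i j : Fin 3) {w : Y × ℝ} (hw : ρ < w.2) :
    lieLog J G X i j w = lieLog J G X j i w := by
  simp only [lieLog, hG.symm_logD i j _ w hw, hG.symm _ j w hw, hG.symm i _ w hw]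
  exact sum_congr rfl fun k _ => by ring

lemma lieLow_symm (hG : MetricExp ρ l G γ c C) (m i j : Fin 3) {w : Y × ℝ} (hw : ρ < w.2) :
    lieLow J G X m i j w = lieLow J G X m j i w := by
  have h1 : ∀ k, ld J m (ld J k (G i j)) w = ld J m (ld J k (G j i)) w := fun k => by
    have : ld J k (G i j) =ᶠ[𝓝 w] ld J k (G j i) := by
      filter_upwards [(isOpen_end ρ).mem_nhds hw] with w' hw' using hG.symm_logD i j _ w' hw'
    simp only [logD] at this ⊢
    rw [this.fderiv_eq]
  simp only [lieLow, h1, hG.symm_logD i j _ w hw, hG.symm_logD _ j _ w hw, hG.symm_logD i _ _ w hw]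
  exact sum_congr rfl fun k _ => by ring

/-- The unknowns of the prolonged system. -/
def unk (J : Bdry →L[ℝ] Y) (X : Fin 3 → Fn Y) : Fin 3 ⊕ (Fin 3 × Fin 3) → Fn Y
  | Sum.inl k => X k
  | Sum.inr p => ld J p.1 (X p.2)

lemma lin_lieLow (hG : MetricExp ρ l G γ c C) (hK : IsCompact K) (m i j : Fin 3) :
    Lin K (unk J X) (if i = 0 ∧ j = 0 then 0 else 2) (lieLow J G X m i j) := by
  have hle : ∀ i j, gw i j ≤ (if i = 0 ∧ j = 0 then 0 else 2 : ℤ) := by decide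
  have hle1 : ∀ i j k : Fin 3, gw k j ≤ (if i = 0 ∧ j = 0 then 0 else 2 : ℤ) := by decide
  have hle2 : ∀ i j k : Fin 3, gw i k ≤ (if i = 0 ∧ j = 0 then 0 else 2 : ℤ) := by decide
  have mulU : ∀ (a) {n : ℤ} {f : Fn Y}, Fall true K n f →
      Lin K (unk J X) n (fun w => f w * unk J X a w) := fun a n f hf => by
    have := (Lin.of_unknown (K := K) (U := unk J X) a).mul_fall hf
    rwa [add_zero] at this
  have hF := fun i j => (hG.fall_G i j).fall K hK
  refine Lin.congr (Lin.sum (U := unk J X) (K := K) Finset.univ (F := fun k w =>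
    ld J k (G i j) w * unk J X (Sum.inr (m, k)) w
    + ld J m (ld J k (G i j)) w * unk J X (Sum.inl k) w
    + ld J m (G k j) w * unk J X (Sum.inr (i, k)) w
    + ld J m (G i k) w * unk J X (Sum.inr (j, k)) w) fun k => ?_) ?_
  · refine (((mulU _ ?_).add (mulU _ ?_)).add (mulU _ ?_)).add (mulU _ ?_)
    · exact ((hF i j).logD _).mono (hle i j)
    · exact (((hF i j).logD _).logD _).mono (hle i j)
    · exact ((hF k j).logD _).mono (hle1 i j k)
    · exact ((hF i k).logD _).mono (hle2 i j k)
  · refine Eventually.of_forall fun w => Eventually.of_forall fun w => ?_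
    simp only [lieLow, unk]
    exact sum_congr rfl fun k _ => by ring

/-- The determinant of a symmetric `3 × 3` array. -/
def det3 (G : Fin 3 → Fin 3 → Fn Y) (w : Y × ℝ) : ℝ := G 0 0 w * (G 1 1 w * G 2 2 w - G 1 2 w * G 1 2 w)
    - G 0 1 w * (G 0 1 w * G 2 2 w - G 0 2 w * G 1 2 w) + G 0 2 w * (G 0 1 w * G 1 2 w - G 0 2 w * G 1 1 w)

/-- The boundary determinant. -/
def det2 (γ : Fin 2 → Fin 2 → Y → ℝ) (y : Y) : ℝ := γ 0 0 y * γ 1 1 y - γ 0 1 y * γ 0 1 y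

/-- The polarization of the determinant. -/
def pol2 (γ C : Fin 2 → Fin 2 → Y → ℝ) (y : Y) : ℝ := γ 0 0 y * C 1 1 y + C 0 0 y * γ 1 1 y - 2 * (γ 0 1 y * C 0 1 y)

/-- The determinant of the boundary block. -/
def blockDet (G : Fin 3 → Fin 3 → Fn Y) (w : Y × ℝ) : ℝ := G 1 1 w * G 2 2 w - G 1 2 w * G 1 2 w

lemma blockDet_ex (hG : MetricExp ρ l G γ c C) : Ex ρ 2 (blockDet G) (det2 γ) (pol2 γ C) := by
  have h1 := (hG.AB 0 0).mul (hG.AB 1 1)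
  have h2 := ((hG.AB 0 1).mul (hG.AB 0 1)).const_mul (-1)
  refine ((h1.add h2).congr fun w hw => ?_).congr_coeff (fun y => ?_) fun y => ?_
  · simp only [Fin.succ_zero_eq_one, Fin.succ_one_eq_two, blockDet]; ring
  · simp only [det2]; ring
  · simp only [pol2]; ring

lemma det3_ex (hG : MetricExp ρ l G γ c C) :
    Ex ρ 2 (det3 G) (fun y => l ^ 2 * det2 γ y) (fun y => l ^ 2 * pol2 γ C y + c y * det2 γ y) := by
  have h2 := hG.rr.mul (blockDet_ex hG)
  have f1 : IsFall ρ true (-2) (G 0 1) := hG.rA 0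
  have f2 : IsFall ρ true (-2) (G 0 2) := hG.rA 1
  have f11 := hG.fall_G 1 1
  have f12 := hG.fall_G 1 2
  have f22 := hG.fall_G 2 2
  have e1 : Ex ρ 2 _ 0 0 := Ex.of_fall (k := 2)
    ((f1.mul ((f1.mul f22).sub (f2.mul f12))).neg.add (f2.mul ((f1.mul f12).sub (f2.mul f11)))) (by decide)
  refine ((h2.add e1).congr fun w hw => ?_).congr_coeff (fun y => ?_) fun y => ?_
  · simp only [det3, blockDet]; ring
  · simp
  · simp

lemma lin_second (hl : l ≠ 0) (hG : MetricExp ρ l G γ c C) (hγ : ∀ y, det2 γ y ≠ 0) (hX : ∀ k, CinfOn (X k) (far ρ))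
    (h00 : IsFall ρ true 0 (lieLog J G X 0 0)) (h0A : ∀ A : Fin 2, IsFall ρ true 0
      (lieLog J G X 0 A.succ)) (hAB : ∀ A B : Fin 2, IsFall ρ true 2 (lieLog J G X A.succ B.succ))
    (hK : IsCompact K) (i k : Fin 3) : Lin K (unk J X) 0 (ld J 0 (ld J i (X k))) := by
  set Q : Fin 3 → Fin 3 → Fin 3 → Fn Y := fun m i j w =>
    ld J m (lieLog J G X i j) w + -lieLow J G X m i j w with hQ
  have hH : ∀ i j, IsFall ρ true (if i = 0 ∧ j = 0 then 0 else 2) (lieLog J G X i j) := by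
    intro i j
    refine Fin.cases ?_ (fun A => ?_) i
    · refine Fin.cases ?_ (fun B => ?_) j
      · simpa using h00
      · simpa using (h0A B).mono (by norm_num : (0 : ℤ) ≤ 2)
    · refine Fin.cases ?_ (fun B => ?_) j
      · simpa using ((h0A A).mono (by norm_num : (0 : ℤ) ≤ 2)).congr fun w hw =>
          lieLog_symm hG 0 A.succ hw
      · simpa using hAB A B
  have hQl : ∀ m i j, Lin K (unk J X) (if i = 0 ∧ j = 0 then 0 else 2) (Q m i j) := fun m i j =>
    (Lin.of_fall (((hH i j).logD _).fall K hK)).add (lin_lieLow hG hK m i j).neg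
  set T : Fin 3 → Fn Y := fun j w =>
    ∑ k, G k j w * ld J 0 (ld J i (X k)) w with hT
  have hTQ : ∀ j w, ρ < w.2 → 2 * T j w = Q 0 i j w + Q i 0 j w + -Q j 0 i w := by
    intro j w hw
    have cm : ∀ a b k, ld J a (ld J b (X k)) w = ld J b (ld J a (X k)) w := fun a b k =>
      logD_comm ((hX k).contDiffAt ((isOpen_end ρ).mem_nhds hw)) _ _
    simp only [hQ, hT, logD_lieLog hG hX _ _ _ hw]
    have e1 : ∀ k, ld J i (ld J 0 (X k)) w = ld J 0 (ld J i (X k)) w := fun k => cm i 0 k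
    have e2 : ∀ k, ld J j (ld J 0 (X k)) w = ld J 0 (ld J j (X k)) w := fun k => cm j 0 k
    have e3 : ∀ k, ld J j (ld J i (X k)) w = ld J i (ld J j (X k)) w := fun k => cm j i k
    simp only [e1, e2, e3]
    ring
  have hT2 : ∀ j, Lin K (unk J X) 2 (T j) := by
    intro j
    have h1 := ((((hQl 0 i j).mono (j := 2) (by split_ifs <;> norm_num)).add
      ((hQl i 0 j).mono (j := 2) (by split_ifs <;> norm_num))).add
      ((hQl j 0 i).mono (j := 2) (by split_ifs <;> norm_num)).neg).mul_fall (f := fun _ => 1 / 2) (j := 0)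
      (by simpa using (Fall.zpow (Y := Y) (K := K) 0).const_mul (1 / 2))
    rw [zero_add] at h1
    refine h1.congr (GermEq.of_forall_gt (R := ρ) fun w hw => ?_)
    rw [← hTQ j w hw]; ring
  have hT0 : Lin K (unk J X) 0 (T 0) := by
    have h1 := (hQl i 0 0).mul_fall (f := fun _ => 1 / 2) (j := 0)
      (by simpa using (Fall.zpow (Y := Y) (K := K) 0).const_mul (1 / 2))
    simp only [and_self, if_true, add_zero] at h1
    refine h1.congr (GermEq.of_forall_gt (R := ρ) fun w hw => ?_)
    have h2 := hTQ 0 w hw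
    have h3 : Q 0 i 0 w = Q 0 0 i w := by
      have h4 : lieLog J G X i 0 =ᶠ[𝓝 w] lieLog J G X 0 i := by
        filter_upwards [(isOpen_end ρ).mem_nhds hw] with w' hw' using lieLog_symm hG i 0 hw'
      simp only [hQ, lieLow_symm hG 0 i 0 hw]
      simp only [logD, h4.fderiv_eq]
    rw [h3] at h2
    linarith
  have hdet := det3_ex hG
  have hinv := hdet.inv_fall (fun y => mul_ne_zero (pow_ne_zero 2 hl) (hγ y)) hK
  have hdc := hdet.eventually_ne (fun y => mul_ne_zero (pow_ne_zero 2 hl) (hγ y)) hK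
  have fG := fun a b => (hG.fall_G a b).fall K hK
  have f01 : Fall true K (-2) (G 0 1) := (hG.rA 0).fall K hK
  have f02 : Fall true K (-2) (G 0 2) := (hG.rA 1).fall K hK
  have hnil : ∀ w, ρ < w.2 → G 1 0 w = G 0 1 w ∧ G 2 0 w = G 0 2 w ∧ G 2 1 w = G 1 2 w :=
    fun w hw => ⟨hG.symm _ _ w hw, hG.symm _ _ w hw, hG.symm _ _ w hw⟩
  have comb : ∀ {A0 A1 A2 : Fn Y} {F : Fn Y}, Fall true K 4 A0 → Fall true K 2 A1 →
      Fall true K 2 A2 → (∀ w, ρ < w.2 → det3 G w * F w = A0 w * T 0 w + A1 w * T 1 w + A2 w * T 2 w) →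
      Lin K (unk J X) 0 F := by
    intro A0 A1 A2 F hA0 hA1 hA2 hF
    have h1 := ((((hT0.mul_fall hA0).mono (j := 4) (by norm_num)).add
      ((hT2 1).mul_fall hA1)).add ((hT2 2).mul_fall hA2)).mul_fall hinv
    refine (h1.mono (by norm_num)).congr ?_
    filter_upwards [hdc, eventually_gt_endAt K ρ] with w h2 h3
    filter_upwards [h2, (isOpen_end ρ).mem_nhds h3] with w' h4 h5
    rw [← hF w' h5]
    field_simp
  have m2 : ∀ {f g : Fn Y} {a b n : ℤ}, Fall true K a f → Fall true K b g → a + b ≤ n →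
      Fall true K n (fun w => f w * g w) := fun hf hg h => (hf.mul hg).mono h
  fin_cases k
  · refine comb (A0 := fun w => G 1 1 w * G 2 2 w - G 1 2 w * G 1 2 w)
      (A1 := fun w => G 0 2 w * G 1 2 w - G 0 1 w * G 2 2 w)
      (A2 := fun w => G 0 1 w * G 1 2 w - G 0 2 w * G 1 1 w) ?_ ?_ ?_ ?_
    · exact (m2 (fG 1 1) (fG 2 2) (by decide)).sub (m2 (fG 1 2) (fG 1 2) (by decide))
    · exact (m2 f02 (fG 1 2) (by decide)).sub (m2 f01 (fG 2 2) (by decide))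
    · exact (m2 f01 (fG 1 2) (by decide)).sub (m2 f02 (fG 1 1) (by decide))
    · intro w hw
      obtain ⟨e1, e2, e3⟩ := hnil w hw
      simp only [hT, Fin.sum_univ_three, det3, e1, e2, e3]
      simp
      ring
  · refine comb (A0 := fun w => G 0 2 w * G 1 2 w - G 0 1 w * G 2 2 w)
      (A1 := fun w => G 0 0 w * G 2 2 w - G 0 2 w * G 0 2 w)
      (A2 := fun w => G 0 1 w * G 0 2 w - G 0 0 w * G 1 2 w) ?_ ?_ ?_ ?_
    · exact (m2 f02 (fG 1 2) (by decide)).sub (m2 f01 (fG 2 2) (by decide))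
    · exact (m2 (fG 0 0) (fG 2 2) (by decide)).sub (m2 f02 f02 (by decide))
    · exact (m2 f01 f02 (by decide)).sub (m2 (fG 0 0) (fG 1 2) (by decide))
    · intro w hw
      obtain ⟨e1, e2, e3⟩ := hnil w hw
      simp only [hT, Fin.sum_univ_three, det3, e1, e2, e3]
      simp
      ring
  · refine comb (A0 := fun w => G 0 1 w * G 1 2 w - G 0 2 w * G 1 1 w)
      (A1 := fun w => G 0 1 w * G 0 2 w - G 0 0 w * G 1 2 w)
      (A2 := fun w => G 0 0 w * G 1 1 w - G 0 1 w * G 0 1 w) ?_ ?_ ?_ ?_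
    · exact (m2 f01 (fG 1 2) (by decide)).sub (m2 f02 (fG 1 1) (by decide))
    · exact (m2 f01 f02 (by decide)).sub (m2 (fG 0 0) (fG 1 2) (by decide))
    · exact (m2 (fG 0 0) (fG 1 1) (by decide)).sub (m2 f01 f01 (by decide))
    · intro w hw
      obtain ⟨e1, e2, e3⟩ := hnil w hw
      simp only [hT, Fin.sum_univ_three, det3, e1, e2, e3]
      simp
      ring

end Prolongation

section Bootstrap

variable {K : Set Y} {f g : Fn Y} {c η : Y → ℝ}
variable {G : Fin 3 → Fin 3 → Fn Y} {γ C : Fin 2 → Fin 2 → Y → ℝ}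
  {X : Fin 3 → Fn Y} {J : Bdry →L[ℝ] Y}

/-- A polynomially bounded function grows at most as fast as its radial derivative. -/
lemma Fall.of_logD_growth (hK : IsCompact K) (hs : CinfOn f (far ρ)) {N : ℕ}
    (hN : 1 ≤ N) (h : Fall true K N (lD (0, 1) f)) : Fall true K N f := by
  refine ⟨germSmooth_of_contDiffOn hs K, fun n => ?_⟩
  exact jet_of_linear_system (ι := Unit) (A := fun _ _ _ => 0) (M := 0) (N := N) hK
    (fun _ _ => by simp) (fun _ _ => Fall.zero) (by simpa using hN) n
    (X := fun _ => f) (β := fun _ => lD (0, 1) f) (fun _ => hs)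
    (fun _ => Eventually.of_forall fun w => Eventually.of_forall fun w => by simp)
    (fun _ => h.smooth) (fun _ => h.jet n) ()

lemma exists_growth (hl : l ≠ 0) (hG : MetricExp ρ l G γ c C) (hγ : ∀ y, det2 γ y ≠ 0) (hX : ∀ k, CinfOn (X k) (far ρ))
    (h00 : IsFall ρ true 0 (lieLog J G X 0 0)) (h0A : ∀ A : Fin 2, IsFall ρ true 0
      (lieLog J G X 0 A.succ)) (hAB : ∀ A B : Fin 2, IsFall ρ true 2 (lieLog J G X A.succ B.succ))
    (hK : IsCompact K) : ∃ N : ℕ, ∀ k, Fall true K N (X k) := by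
  have hlin : ∀ a, Lin K (unk J X) 0 (logD (0, 1) (unk J X a)) := by
    rintro (k | ⟨i, k⟩)
    · exact Lin.of_unknown (K := K) (U := unk J X) (Sum.inr (0, k))
    · exact lin_second hl hG hγ hX h00 h0A hAB hK i k
  choose A β hA hβ heq using hlin
  have hs : ∀ a, CinfOn (unk J X a) (far ρ) := by
    rintro (k | ⟨i, k⟩)
    · exact hX k
    · exact logD_contDiffOn (hX k) _
  obtain ⟨N, hN⟩ := fall_of_linear_system hK hA hs heq hβ
  exact ⟨N, fun k => hN (Sum.inl k)⟩

/-- The source of the `rr` equation. -/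
def srcR (J : Bdry →L[ℝ] Y) (G : Fin 3 → Fin 3 → Fn Y) (X : Fin 3 → Fn Y) (w : Y × ℝ) : ℝ :=
  lieLog J G X 0 0 w - (∑ k, X k w * ld J k (G 0 0) w) - 2 * ∑ A : Fin 2, G 0 A.succ w * ld J 0 (X A.succ) w

/-- The source of the `rA` equation. -/
def srcA (J : Bdry →L[ℝ] Y) (G : Fin 3 → Fin 3 → Fn Y) (X : Fin 3 → Fn Y) (A : Fin 2) (w : Y × ℝ) : ℝ :=
  lieLog J G X 0 A.succ w - (∑ k, X k w * ld J k (G 0 A.succ) w)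
    - (∑ B : Fin 2, G 0 B.succ w * ld J A.succ (X B.succ) w) - G 0 A.succ w * ld J 0 (X 0) w

lemma srcR_eq (hG : MetricExp ρ l G γ c C) {w : Y × ℝ} (hw : ρ < w.2) :
    G 0 0 w * (2 * ld J 0 (X 0) w) = srcR J G X w := by
  simp only [srcR, lieLog, Fin.sum_univ_three, Fin.sum_univ_two, hG.symm _ 0 w hw,
    Fin.succ_zero_eq_one, Fin.succ_one_eq_two]
  ring

lemma srcA_eq (hG : MetricExp ρ l G γ c C) (A : Fin 2) {w : Y × ℝ} (hw : ρ < w.2) :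
    ∑ B : Fin 2, G A.succ B.succ w * ld J 0 (X B.succ) w = srcA J G X A w - G 0 0 w * ld J A.succ (X 0) w := by
  simp only [srcA, lieLog, Fin.sum_univ_three, Fin.sum_univ_two, hG.symm _ A.succ w hw,
    Fin.succ_zero_eq_one, Fin.succ_one_eq_two]
  rw [hG.symm A.succ 0 w hw]
  ring

/-- Inversion of the boundary block of the metric. -/
lemma fall_of_block (hG : MetricExp ρ l G γ c C) (hγ : ∀ y, det2 γ y ≠ 0)
    (hK : IsCompact K) {n : ℤ} {Z S : Fin 2 → Fn Y} (hS : ∀ A, Fall true K n (S A))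
    (e : ∀ (A : Fin 2) w, ρ < w.2 → ∑ B : Fin 2, G A.succ B.succ w * Z B w = S A w) (A : Fin 2) :
    Fall true K (n - 2) (Z A) := by
  have h1 := blockDet_ex hG
  have fG := fun A B : Fin 2 => ((hG.AB A B).big').fall K hK
  have e' : ∀ (A : Fin 2) w, ρ < w.2 → G A.succ 1 w * Z 0 w + G A.succ 2 w * Z 1 w = S A w :=
    fun A w hw => by simpa using e A w hw
  have hs : ∀ w, ρ < w.2 → G 2 1 w = G 1 2 w := fun w hw => hG.symm _ _ w hw
  fin_cases A
  · have := h1.fall_of_mul hγ hK (g := Z 0) (((fG 1 1).mul (hS 0)).sub ((fG 0 1).mul (hS 1))) (fun w hw => by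
        have e0 := e' 0 w hw
        have e1 := e' 1 w hw
        simp only [Fin.succ_zero_eq_one, Fin.succ_one_eq_two, hs w hw, blockDet] at e0 e1 ⊢
        linear_combination (G 2 2 w) * e0 - G 1 2 w * e1)
    exact this.mono (by omega)
  · have := h1.fall_of_mul hγ hK (g := Z 1) (((fG 0 0).mul (hS 1)).sub ((fG 0 1).mul (hS 0))) (fun w hw => by
        have e0 := e' 0 w hw
        have e1 := e' 1 w hw
        simp only [Fin.succ_zero_eq_one, Fin.succ_one_eq_two, hs w hw, blockDet] at e0 e1 ⊢
        linear_combination (G 1 1 w) * e1 - G 1 2 w * e0)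
    exact this.mono (by omega)

lemma MetricExp.fall_logD_rr (hG : MetricExp ρ l G γ c C) (v : Y × ℝ) : IsFall ρ true (-2) (logD v (G 0 0)) :=
  ((hG.rr.logD v).big).congr fun w _ => by simp

lemma fall_src (hG : MetricExp ρ l G γ c C)
    (h00 : IsFall ρ true (-2) (lieLog J G X 0 0)) (h0A : ∀ A : Fin 2, IsFall ρ true (-2)
      (lieLog J G X 0 A.succ)) (hK : IsCompact K) {N : ℤ} (hN : 0 ≤ N) (hXN : ∀ k, Fall true K N (X k)) :
    Fall true K (N - 2) (srcR J G X) ∧ ∀ A, Fall true K (N - 2) (srcA J G X A) := by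
  have hXD := fun k v => (hXN k).logD v
  have f0A := fun A => (hG.rA A).fall K hK
  constructor
  · refine ((((h00.fall K hK).mono (by omega)).sub (Fall.sum fun k _ => ?_))).sub ((Fall.sum fun A _ => ?_).const_mul 2)
    · exact ((hXN k).mul ((hG.fall_logD_rr _).fall K hK)).mono (by omega)
    · exact ((f0A A).mul (hXD A.succ _)).mono (by omega)
  · intro A
    refine (((((h0A A).fall K hK).mono (by omega)).sub (Fall.sum fun k _ => ?_)).sub (Fall.sum fun B _ => ?_)).sub ?_
    · exact ((hXN k).mul ((f0A A).logD _)).mono (by omega)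
    · exact ((f0A B).mul (hXD B.succ _)).mono (by omega)
    · exact ((f0A A).mul (hXD 0 _)).mono (by omega)

lemma fall_radial (hl : l ≠ 0) (hG : MetricExp ρ l G γ c C) (hγ : ∀ y, det2 γ y ≠ 0)
    (h00 : IsFall ρ true (-2) (lieLog J G X 0 0)) (h0A : ∀ A : Fin 2, IsFall ρ true (-2)
      (lieLog J G X 0 A.succ)) (hK : IsCompact K) {N : ℤ} (hN : 0 ≤ N) (hXN : ∀ k, Fall true K N (X k)) (k : Fin 3) :
    Fall true K (N - 2) (logD (0, 1) (X k)) := by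
  obtain ⟨hR, hA⟩ := fall_src (J := J) hG h00 h0A hK hN hXN
  refine Fin.cases ?_ (fun A => ?_) k
  · have h1 := hG.rr.fall_of_mul (fun _ => pow_ne_zero 2 hl) hK hR fun w hw => srcR_eq hG hw
    refine ((h1.const_mul (1 / 2)).mono (by omega)).congr ?_
    exact Eventually.of_forall fun w => Eventually.of_forall fun w => by simp
  · refine fall_of_block hG hγ hK (n := N) (Z := fun B => logD (0, 1) (X B.succ)) (fun A => ?_)
      (fun A w hw => srcA_eq (J := J) hG A hw) A
    refine ((hA A).mono (by omega)).sub ?_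
    exact (((hG.rr.big').fall K hK).mul ((hXN 0).logD (frame J A.succ))).mono (by omega)

lemma exists_limits [FiniteDimensional ℝ Y] (hl : l ≠ 0) (hG : MetricExp ρ l G γ c C)
    (hγ : ∀ y, det2 γ y ≠ 0) (hX : ∀ k, CinfOn (X k) (far ρ))
    (h00 : IsFall ρ true (-2) (lieLog J G X 0 0)) (h0A : ∀ A : Fin 2, IsFall ρ true (-2)
      (lieLog J G X 0 A.succ)) (hAB : ∀ A B : Fin 2, IsFall ρ true 2 (lieLog J G X A.succ B.succ))
    (k : Fin 3) : ∃ a : Y → ℝ, Cinf a ∧ IsFall ρ true (-2) (fun w => X k w - a w.1) := by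
  have h1 : ∀ K, IsCompact K → ∀ k, Fall true K 1 (X k) := by
    intro K hK
    obtain ⟨N, hN⟩ := exists_growth hl hG hγ hX (h00.mono (by norm_num)) (fun A => (h0A A).mono (by norm_num)) hAB hK
    have hN' : ∀ k, Fall true K ((N + 1 : ℕ) : ℤ) (X k) := fun k => (hN k).mono (by push_cast; omega)
    clear hN
    induction N with
    | zero => simpa using hN'
    | succ N ih =>
      refine ih fun k => ?_
      refine Fall.of_logD_growth hK (hX k) (by omega) ?_
      exact (fall_radial hl hG hγ h00 h0A hK (by positivity) hN' k).mono (by push_cast; omega)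
  have h2 : ∀ k, IsFall ρ true 0 (X k) := by
    intro k
    obtain ⟨a, ha, h3⟩ := exists_limit (k := 1) one_pos (hX k) fun K hK =>
      (fall_radial hl hG hγ h00 h0A hK (by norm_num) (h1 K hK) k).mono (by norm_num)
    exact ((h3.mono (by norm_num)).add (IsFall.of_fst ha)).congr fun w _ => by simp
  exact exists_limit (k := 2) two_pos (hX k) fun K hK =>
    (fall_radial hl hG hγ h00 h0A hK le_rfl (fun k => (h2 k).fall K hK) k).mono (by norm_num)

/-- The gradient of `ψ` with respect to `γ`. -/
def gradB (J : Bdry →L[ℝ] Y) (γ : Fin 2 → Fin 2 → Y → ℝ) (ψ : Y → ℝ) : Fin 2 → Y → ℝ :=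
  ![fun y => (γ 1 1 y * bd J 0 ψ y - γ 0 1 y * bd J 1 ψ y) / det2 γ y,
    fun y => (γ 0 0 y * bd J 1 ψ y - γ 0 1 y * bd J 0 ψ y) / det2 γ y]

lemma contDiff_bd {f : Y → ℝ} (hf : Cinf f) (A : Fin 2) : Cinf (bd J A f) :=
  (hf.fderiv_right (by simp)).clm_apply contDiff_const

lemma contDiff_gradB (hγs : ∀ A B, Cinf (γ A B)) (hγ : ∀ y, det2 γ y ≠ 0) {ψ : Y → ℝ}
    (hψ : Cinf ψ) (A : Fin 2) : Cinf (gradB J γ ψ A) := by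
  have hd : Cinf (det2 γ) := ((hγs 0 0).mul (hγs 1 1)).sub ((hγs 0 1).mul (hγs 0 1))
  fin_cases A
  · exact (((hγs 1 1).mul (contDiff_bd hψ 0)).sub ((hγs 0 1).mul (contDiff_bd hψ 1))).div hd hγ
  · exact (((hγs 0 0).mul (contDiff_bd hψ 1)).sub ((hγs 0 1).mul (contDiff_bd hψ 0))).div hd hγ

lemma sum_gradB (hγ : ∀ y, det2 γ y ≠ 0) (hsym : ∀ A B y, γ A B y = γ B A y) (ψ : Y → ℝ)
    (A : Fin 2) (y : Y) : ∑ B, γ A B y * gradB J γ ψ B y = bd J A ψ y := by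
  have h1 := hγ y
  fin_cases A
  · simp only [Fin.sum_univ_two, gradB, Fin.mk_zero, cons_val_zero, cons_val_one, Fin.isValue]
    rw [← mul_div_assoc, ← mul_div_assoc, ← add_div, div_eq_iff h1]
    simp only [det2]; ring
  · simp only [Fin.sum_univ_two, gradB, Fin.mk_one, cons_val_zero, cons_val_one, Fin.isValue, hsym 1 0]
    rw [← mul_div_assoc, ← mul_div_assoc, ← add_div, div_eq_iff h1]
    simp only [det2]; ring

lemma exists_fieldExp [FiniteDimensional ℝ Y] (hl : l ≠ 0)
    (hG : MetricExp ρ l G γ c C) (hsym : ∀ A B y, γ A B y = γ B A y)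
    (hγ : ∀ y, det2 γ y ≠ 0) (hX : ∀ k, CinfOn (X k) (far ρ))
    (h00 : Ex ρ (-2) (lieLog J G X 0 0) 0 η) (h0A : ∀ A : Fin 2, IsFall ρ true (-2)
      (lieLog J G X 0 A.succ)) (hAB : ∀ A B : Fin 2, IsFall ρ true 2 (lieLog J G X A.succ B.succ)) :
    ∃ V ψ R, FieldExp ρ l X V ψ R (gradB J γ ψ) := by
  have h00' : IsFall ρ true (-2) (lieLog J G X 0 0) := (h00.big).congr fun w _ => by simp
  choose a ha hXa using exists_limits hl hG hγ hX h00' h0A hAB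
  have z := fun m => IsFall.zpow (Y := Y) (ρ := ρ) m
  have hX0 : ∀ k, IsFall ρ true 0 (X k) := fun k =>
    (((hXa k).mono (by norm_num)).add (IsFall.of_fst (ha k))).congr fun w _ => by ring
  have dX : ∀ k {w : Y × ℝ}, ρ < w.2 → DiffAt (X k) w := fun k w hw =>
    ((hX k).contDiffAt ((isOpen_end ρ).mem_nhds hw)).difAt
  have dz : ∀ {w : Y × ℝ}, ρ < w.2 → DiffAt (fun w : Y × ℝ => w.2 ^ (-2 : ℤ)) w :=
    fun hw => (contDiffAt_zpow_snd _ (hρ.1.trans_lt hw)).difAt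
  have dfst : ∀ {b : Y → ℝ}, Cinf b → ∀ w : Y × ℝ, DiffAt (fun w : Y × ℝ => b w.1) w := fun hb w =>
    ((hb.comp contDiff_fst).dif) w
  have Dfst : ∀ {b : Y → ℝ}, Cinf b → ∀ w : Y × ℝ, logD (0, 1) (fun w : Y × ℝ => b w.1) w = 0 := fun hb w => by
    rw [logD_fst ((hb.dif) w.1)]; simp
  -- the radial derivative of `X k + b r⁻² - a`
  have Dcorr : ∀ k {b d : Y → ℝ}, Cinf b → Cinf d → ∀ w : Y × ℝ, ρ < w.2 →
      logD (0, 1) (fun w => X k w + (b w.1 * w.2 ^ (-2 : ℤ) + d w.1)) w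
        = logD (0, 1) (X k) w - 2 * b w.1 * w.2 ^ (-2 : ℤ) := by
    intro k b d hb hd w hw
    rw [logD_add_at (dX k hw) (((dfst hb w).fun_mul (dz hw)).fun_add (dfst hd w)),
      logD_add_at ((dfst hb w).fun_mul (dz hw)) (dfst hd w), logD_mul_at (dfst hb w) (dz hw),
      Dfst hb, Dfst hd, logD_zpow (hρ.1.trans_lt hw)]
    push_cast; ring
  set ψ : Y → ℝ := fun y => -2 * a 0 y with hψdef
  have hψ : Cinf ψ := contDiff_const.mul (ha 0)
  have hγs := fun A B => (hG.AB A B).left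
  have hN := contDiff_gradB (J := J) hγs hγ hψ
  set N := gradB J γ ψ
  set R : Y → ℝ := fun y => -(1 / (4 * l ^ 2)) * (η y - ψ y * c y - ∑ A, a A.succ y * bd J A c y) with hR
  have hRs : Cinf R := contDiff_const.mul ((h00.right.sub (hψ.mul hG.rr.right)).sub
    (ContDiff.sum fun A _ => (ha A.succ).mul (contDiff_bd hG.rr.right A)))
  have src := fun K (hK : IsCompact K) => fall_src (J := J) hG h00' h0A hK le_rfl (fun k => (hX0 k).fall K hK)
  refine ⟨fun A => a A.succ, ψ, R, fun A => ha A.succ, hN, ⟨contDiff_const.mul hψ, hRs, ?_⟩, fun A => ?_⟩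
  · have h1 : IsFall ρ true (-2) (fun w => X 0 w + (-R w.1 * w.2 ^ (-2 : ℤ) + -a 0 w.1)) :=
      ((hXa 0).sub (((IsFall.of_fst hRs).mul (z (-2))).mono (by norm_num))).congr fun w _ => by ring
    have h2 : IsFall ρ false (-2) (logD (0, 1) fun w => X 0 w + (-R w.1 * w.2 ^ (-2 : ℤ) + -a 0 w.1)) := by
      refine ⟨logD_contDiffOn h1.smooth _, fun K hK => ?_⟩
      have t0 : IsFall ρ false (-2) (fun w => lieLog J G X 0 0 w - η w.1 * w.2 ^ (-2 : ℤ)) :=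
        h00.fall.congr fun w _ => by simp; ring
      have t1 : ∀ k, IsFall ρ false (-2) (fun w => (X k w - a k w.1) * ld J k (G 0 0) w) :=
        fun k => ((hXa k).mul (hG.fall_logD_rr _)).lt (by norm_num)
      have t2 : ∀ k, IsFall ρ false (-2) (fun w => a k w.1 * (ld J k (G 0 0) w
          - (fderiv ℝ c w.1 (frame J k).1 - 2 * (frame J k).2 * c w.1) * w.2 ^ (-2 : ℤ))) := fun k =>
        ((IsFall.of_fst (ha k)).mul ((hG.rr.logD (frame J k)).fall.congr fun w _ => by
          simp; ring)).mono (by norm_num)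
      have t3 : ∀ A : Fin 2, IsFall ρ false (-2) (fun w => G 0 A.succ w * ld J 0 (X A.succ) w) := fun A => by
        have h3 : IsFall ρ true (-2) (ld J 0 (X A.succ)) := ((hXa A.succ).logD (frame J 0)).congr fun w hw => by
            have e := Dcorr A.succ (b := fun _ => 0) (d := fun y => -a A.succ y) contDiff_const (ha A.succ).neg w hw
            simp only [zero_mul, zero_add, mul_zero, sub_zero] at e
            simpa [sub_eq_add_neg] using e
        exact ((hG.rA A).mul h3).lt (by norm_num)
      have t4 : IsFall ρ false (-2) (fun w => (G 0 0 w - l ^ 2) * (4 * (R w.1 * w.2 ^ (-2 : ℤ)))) :=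
        (((hG.rr.big).congr fun w _ => by simp : IsFall ρ true (-2) (fun w => G 0 0 w - l ^ 2)).mul
          (((IsFall.of_fst hRs).mul (z (-2))).const_mul 4)).lt (by norm_num)
      have tot := ((((t0.sub (((t1 0).add (t1 1)).add (t1 2))).sub (((t2 0).add (t2 1)).add (t2 2))).sub
        (((t3 0).add (t3 1)).const_mul 2)).add t4)
      have h3 := hG.rr.fall_of_mul (fun _ => pow_ne_zero 2 hl) hK (tot.fall K hK)
        (g := fun w => 2 * (ld J 0 (X 0) w + 2 * R w.1 * w.2 ^ (-2 : ℤ))) (fun w hw => by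
          have e := srcR_eq (J := J) (X := X) hG hw
          have eR : 4 * l ^ 2 * R w.1 = -(η w.1 - ψ w.1 * c w.1 - ∑ A, a A.succ w.1 * bd J A c w.1) := by
            simp only [hR]; field_simp
          have eψ : ψ w.1 = -2 * a 0 w.1 := rfl
          rw [eψ] at eR
          simp only [srcR, Fin.sum_univ_three, Fin.sum_univ_two, Fin.succ_zero_eq_one, Fin.succ_one_eq_two, bd] at e eR
          simp only [frame_zero, frame_one, frame_two, map_zero, Fin.succ_zero_eq_one, Fin.succ_one_eq_two] at e ⊢
          linear_combination e + w.2 ^ (-2 : ℤ) * eR)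
      refine ((h3.const_mul (1 / 2)).mono (by norm_num)).congr (GermEq.of_forall_gt (R := ρ) fun w hw => ?_)
      rw [Dcorr 0 hRs.neg (ha 0).neg w hw]
      simp only [frame_zero]; ring
    exact (IsFall.of_logD (k := 2) two_pos h1 (by norm_num) h2).congr fun w _ => by
      simp [hψdef]; ring
  · have h1 : IsFall ρ true (-2) (fun w => X A.succ w + (l ^ 2 / 4 * N A w.1 * w.2 ^ (-2 : ℤ) + -a A.succ w.1)) :=
      ((hXa A.succ).add (((IsFall.of_fst ((contDiff_const (c := l ^ 2 / 4)).mul (hN A))).mul (z (-2))).mono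
        (by norm_num))).congr fun w _ => by ring
    have h2 : IsFall ρ true (-4) (logD (0, 1) fun w => X A.succ w +
        (l ^ 2 / 4 * N A w.1 * w.2 ^ (-2 : ℤ) + -a A.succ w.1)) := by
      refine ⟨logD_contDiffOn h1.smooth _, fun K hK => ?_⟩
      have t1 : ∀ A : Fin 2, IsFall ρ true (-2) (fun w => G 0 0 w * ld J A.succ (X 0) w
          + l ^ 2 / 2 * bd J A ψ w.1) := by
        intro A
        have u1 : IsFall ρ true (-2) (fun w => (G 0 0 w - l ^ 2) * ld J A.succ (X 0) w) :=
          ((hG.rr.big).congr fun w _ => by simp : IsFall ρ true (-2) (fun w => G 0 0 w - l ^ 2)).mul ((hX0 0).logD _)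
        have u2 : IsFall ρ true (-2) (fun w => l ^ 2 * ld J A.succ (fun w => X 0 w - a 0 w.1) w) :=
          ((hXa 0).logD _).const_mul _
        refine (u1.add u2).congr fun w hw => ?_
        have e1 := logD_add_at (v := frame J A.succ) (dX 0 hw) (dfst (ha 0).neg w)
        rw [logD_fst (((ha 0).neg.dif) w.1)] at e1
        simp only [← sub_eq_add_neg] at e1
        have e2 : fderiv ℝ (fun x => -a 0 x) w.1 (frame J A.succ).1 = - bd J A (a 0) w.1 := by
          simp [bd]
        have e3 : bd J A ψ w.1 = -2 * bd J A (a 0) w.1 := by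
          simp only [bd, hψdef]
          rw [fderiv_const_mul (((ha 0).dif) w.1)]
          simp
        rw [e1, e2, e3]
        ring
      have t2 : ∀ A B : Fin 2, IsFall ρ true (-2) (fun w => (G A.succ B.succ w - w.2 ^ (0 + 2 : ℤ) * γ A B w.1)
          * (l ^ 2 / 2 * (N B w.1 * w.2 ^ (-2 : ℤ)))) := fun A B =>
        (((hG.AB A B).big).mul (((IsFall.of_fst (hN B)).mul (z (-2))).const_mul (l ^ 2 / 2))).mono (by norm_num)
      have h3 := fall_of_block hG hγ hK (n := -2)
        (Z := fun B w => ld J 0 (X B.succ) w - l ^ 2 / 2 * (N B w.1 * w.2 ^ (-2 : ℤ)))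
        (fun A => (((src K hK).2 A).mono (by norm_num)).sub (((t1 A).fall K hK).add
          (((t2 A 0).fall K hK).add ((t2 A 1).fall K hK)))) (fun A w hw => by
          have e := srcA_eq (J := J) (X := X) hG A hw
          have eN := sum_gradB (J := J) hγ hsym ψ A w.1
          have ez : w.2 ^ (0 + 2 : ℤ) * w.2 ^ (-2 : ℤ) = 1 := by
            rw [← zpow_add₀ (hρ.1.trans_lt hw).ne']; simp
          change ∑ B, γ A B w.1 * N B w.1 = bd J A ψ w.1 at eN
          simp only [Fin.sum_univ_two] at e eN ⊢
          linear_combination e - l ^ 2 / 2 * eN - (l ^ 2 / 2) * (γ A 0 w.1 * N 0 w.1 + γ A 1 w.1 * N 1 w.1) * ez) A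
      refine (h3.mono (by norm_num)).congr (GermEq.of_forall_gt (R := ρ) fun w hw => ?_)
      rw [Dcorr A.succ (b := fun y => l ^ 2 / 4 * N A y) (contDiff_const.mul (hN A)) (ha A.succ).neg w hw]
      simp only [frame_zero]; ring
    exact (IsFall.of_logD (k := 4) (by norm_num) h1 (by norm_num) h2).congr fun w _ => by
      generalize w.2 ^ (-2 : ℤ) = t
      ring

end Bootstrap

/-! ### The extrinsic curvature of the surfaces of constant `r` -/

section Extrinsic

variable {k : ℤ} {b : Bool} {f : Fn Y} {a c : Y → ℝ}
variable {G : Fin 3 → Fin 3 → Fn Y} {γ C : Fin 2 → Fin 2 → Y → ℝ}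

lemma IsFall.tendsto (hf : IsFall ρ false k f) (y : Y) : Tendsto (fun r : ℝ => r ^ (-k) * f (y, r)) atTop (𝓝 0) := by
  have h1 : f =o[endAt {y}] fun w => w.2 ^ k := (hf.fall {y} isCompact_singleton).small
  refine ((h1.comp_tendsto (tendsto_mk_endAt (Set.mem_singleton y))).tendsto_div_nhds_zero).congr' ?_
  filter_upwards [eventually_gt_atTop 0] with r hr
  simp [zpow_neg, div_eq_inv_mul]

lemma Ex.tendsto_right (h : Ex ρ k f 0 c) (y : Y) : Tendsto (fun r : ℝ => r ^ (-k) * f (y, r)) atTop (𝓝 (c y)) := by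
  have h1 := (h.fall.tendsto y).add_const (c y)
  rw [zero_add] at h1
  refine h1.congr' ?_
  filter_upwards [eventually_gt_atTop 0] with r hr
  have := zpow_ne_zero k hr.ne'
  rw [zpow_neg]
  simp only [Pi.zero_apply]
  field_simp
  ring

lemma Ex.tendsto_left (h : Ex ρ k f a c) (y : Y) :
    Tendsto (fun r : ℝ => r ^ (-(k + 2)) * f (y, r)) atTop (𝓝 (a y)) := by
  have h0 : IsFall ρ false (k + 2) (fun w => f w - w.2 ^ (k + 2) * a w.1) := (h.big).lt (by omega)
  have h1 := (h0.tendsto y).add_const (a y)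
  rw [zero_add] at h1
  refine h1.congr' ?_
  filter_upwards [eventually_gt_atTop 0] with r hr
  have := zpow_ne_zero (k + 2) hr.ne'
  rw [zpow_neg]
  field_simp
  ring

/-- The first column of the adjugate in the logarithmic frame. -/
def adjCol (G : Fin 3 → Fin 3 → Fn Y) : Fin 2 → Fn Y :=
  ![fun w => G 0 2 w * G 1 2 w - G 0 1 w * G 2 2 w, fun w => G 0 1 w * G 1 2 w - G 0 2 w * G 1 1 w]

lemma adjCol_fall (hG : MetricExp ρ l G γ c C) (A : Fin 2) : IsFall ρ true 0 (adjCol G A) := by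
  have f1 : IsFall ρ true (-2) (G 0 1) := hG.rA 0
  have f2 : IsFall ρ true (-2) (G 0 2) := hG.rA 1
  have f11 : IsFall ρ true 2 (G 1 1) := hG.fall_G 1 1
  have f12 : IsFall ρ true 2 (G 1 2) := hG.fall_G 1 2
  have f22 : IsFall ρ true 2 (G 2 2) := hG.fall_G 2 2
  fin_cases A
  · exact (f2.mul f12).sub (f1.mul f22)
  · exact (f1.mul f12).sub (f2.mul f11)

/-- The densitized unit normal in terms of the logarithmic frame. -/
lemma densitized_normal {M : Mat3} {Γ : Fin 3 → Fin 3 → Fn Y} {r : ℝ} {y : Y}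
    (hr : 0 < r) (hΓ : ∀ i j, wt i r * wt j r * M i j = Γ i j (y, r))
    (hs : ∀ i j, M i j = M j i) (hE : blockDet Γ (y, r) < 0) (hD : det3 Γ (y, r) < 0) :
    √|M.det| = √(-det3 Γ (y, r)) / r ∧ √|M.det| * (M⁻¹ 0 0 / √(M⁻¹ 0 0)) = √(-blockDet Γ (y, r)) ∧
    ∀ A : Fin 2, √|M.det| * (M⁻¹ A.succ 0 / √(M⁻¹ 0 0)) = -(adjCol Γ A (y, r) / (r * √(-blockDet Γ (y, r)))) := by
  have w1 : wt 1 r = 1 := rfl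
  have w2 : wt 2 r = 1 := rfl
  have e : ∀ i j, M i j = Γ i j (y, r) / (wt i r * wt j r) := fun i j => by
    rw [← hΓ]; have := (wt_pos i hr).ne'; have := (wt_pos j hr).ne'; field_simp
  have hdet : M.det = det3 Γ (y, r) / r ^ 2 := by
    rw [Matrix.det_fin_three, hs 1 0, hs 2 0, hs 2 1]
    simp only [e, w1, w2, wt_zero, det3]
    field_simp
    ring
  have hinv : ∀ i j, M⁻¹ i j = M.adjugate i j / M.det := fun i j => by
    rw [Matrix.inv_def, Ring.inverse_eq_inv']
    simp [div_eq_inv_mul]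
  have ha0 : M.adjugate 0 0 = blockDet Γ (y, r) := by
    rw [Matrix.adjugate_fin_three]
    simp [hs 2 1, e, w1, w2, blockDet]
  have haA : ∀ A : Fin 2, M.adjugate A.succ 0 = adjCol Γ A (y, r) / r := fun A => by
    rw [Matrix.adjugate_fin_three]
    fin_cases A
    · simp [hs 2 0, hs 1 0, e, w1, w2, adjCol]
      field_simp
      ring
    · simp [hs 2 0, hs 1 0, hs 2 1, e, w1, w2, adjCol]
      field_simp
  have hdneg : M.det < 0 := by rw [hdet]; exact div_neg_of_neg_of_pos hD (by positivity)
  have hδ : 0 < -M.det := by linarith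
  have hE' : 0 < -blockDet Γ (y, r) := by linarith
  have hsδ : 0 < √(-M.det) := Real.sqrt_pos.2 hδ
  have hsE : 0 < √(-blockDet Γ (y, r)) := Real.sqrt_pos.2 hE'
  have h00 : M⁻¹ 0 0 = -blockDet Γ (y, r) / -M.det := by rw [hinv, ha0, neg_div_neg_eq]
  have hs00 : √(M⁻¹ 0 0) = √(-blockDet Γ (y, r)) / √(-M.det) := by
    rw [h00, Real.sqrt_div' _ hδ.le]
  have hsq : √(-M.det) * √(-M.det) = -M.det := Real.mul_self_sqrt hδ.le
  have hsqE : √(-blockDet Γ (y, r)) * √(-blockDet Γ (y, r)) = -blockDet Γ (y, r) := Real.mul_self_sqrt hE'.le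
  rw [abs_of_neg hdneg]
  refine ⟨?_, ?_, fun A => ?_⟩
  · rw [hdet, ← neg_div, Real.sqrt_div' _ (by positivity), Real.sqrt_sq hr.le]
  · rw [hs00, h00]
    rw [div_div_eq_mul_div, ← mul_div_assoc, div_eq_iff hsE.ne', div_mul_eq_mul_div, ← mul_div_assoc,
      div_eq_iff hδ.ne', hsqE]
    linear_combination (-blockDet Γ (y, r)) * hsq
  · rw [hs00, hinv, haA]
    have h1 : M.det = -(√(-M.det) * √(-M.det)) := by linarith
    generalize √(-M.det) = s at *
    rw [h1]
    field_simp

lemma logD_sqrt {E : Fn Y} {w : Y × ℝ} (hE : DiffAt E w) (h0 : 0 < E w) (v : Y × ℝ) :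
    logD v (fun w => √(E w)) w = logD v E w / (2 * √(E w)) := by
  simp only [logD, (hE.hasFDerivAt.sqrt h0.ne').fderiv, smul_apply, smul_eq_mul]
  ring

lemma logD_frame_div_sqrt {J : Bdry →L[ℝ] Y} {E a : Fn Y} {w : Y × ℝ} (hE : DiffAt E w)
    (ha : DiffAt a w) (h0 : 0 < E w) (hw : 0 < w.2) (A : Fin 2) : w.2 * ld J A.succ (fun w => a w / (w.2 * √(E w))) w
      = (ld J A.succ a w - a w * ld J A.succ E w / (2 * E w)) / √(E w) := by
  have hs : DiffAt (fun w => √(E w)) w := hE.sqrt h0.ne'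
  have hs0 : 0 < √(E w) := Real.sqrt_pos.2 h0
  have hd : DiffAt (fun w : Y × ℝ => w.2 * √(E w)) w := differentiableAt_snd.fun_mul hs
  have hf : DiffAt (fun w => a w / (w.2 * √(E w))) w := hd |> fun h => by
    simp only [div_eq_mul_inv]
    exact ha.fun_mul (h.fun_inv (by positivity))
  have e : (fun w => a w / (w.2 * √(E w)) * (w.2 * √(E w))) =ᶠ[𝓝 w] a := by
    have h1 : ∀ᶠ w' in 𝓝 w, 0 < E w' := hE.continuousAt.eventually_const_lt h0
    filter_upwards [h1, (isOpen_end 0).mem_nhds hw] with w' h2 h3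
    have h3' : 0 < w'.2 := h3
    have := Real.sqrt_pos.2 h2
    field_simp
  have h1 := logD_mul_at (v := frame J A.succ) hf hd
  have h2 : ld J A.succ (fun w => a w / (w.2 * √(E w)) * (w.2 * √(E w))) w
      = ld J A.succ a w := by simp only [logD, e.fderiv_eq]
  have h3 : ld J A.succ (fun w : Y × ℝ => w.2) w = 0 := by simp [logD, fderiv_snd]
  rw [h2, logD_mul_at differentiableAt_snd hs, h3, logD_sqrt hE h0] at h1
  have hsq : √(E w) * √(E w) = E w := Real.mul_self_sqrt h0.le
  generalize √(E w) = s at h1 hs0 hsq ⊢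
  rw [eq_div_iff hs0.ne', ← sub_eq_zero, h1, ← hsq]
  field_simp
  ring

lemma pd_congr {n : ℕ} {f g : (Fin n → ℝ) → ℝ} {x : Fin n → ℝ} (h : f =ᶠ[𝓝 x] g) (i : Fin n) : pd i f x = pd i g x := by
  simp only [pd, h.fderiv_eq]

lemma extrinsicTrace_eq {G : Fin 3 → Fin 3 → Bdry × ℝ → ℝ} (hG : ∀ i j, CinfOn (G i j) (far ρ))
    (hsym : ∀ i j w, ρ < w.2 → G i j w = G j i w) {g : Bulk → Mat3}
    (hg : ∀ i j r x, ρ < r → wt i r * wt j r * g (pt r x) i j = G i j (x, r))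
    {x : Bdry} {r : ℝ} (hr : ρ < r) (hE : blockDet G (x, r) < 0) (hD : det3 G (x, r) < 0) : extrinsicTrace g (pt r x) =
      -(logD (0, 1) (fun w => -blockDet G w) (x, r) / (2 * (√(-blockDet G (x, r)) * √(-det3 G (x, r)))))
      + ∑ A : Fin 2, (ld idB A.succ (adjCol G A) (x, r) - adjCol G A (x, r)
          * ld idB A.succ (fun w => -blockDet G w) (x, r) / (2 * -blockDet G (x, r)))
          / (√(-blockDet G (x, r)) * √(-det3 G (x, r))) := by
  have hr0 := hρ.1.trans_lt hr
  have hmem : {w : Bdry × ℝ | ρ < w.2} ∈ 𝓝 ((x, r) : Bdry × ℝ) := (isOpen_end ρ).mem_nhds hr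
  have hGd : ∀ i j, DiffAt (G i j) (x, r) := fun i j =>
    ((hG i j).contDiffAt hmem).difAt
  have hBd : DiffAt (fun w => -blockDet G w) (x, r) :=
    (((hGd 1 1).fun_mul (hGd 2 2)).fun_sub ((hGd 1 2).fun_mul (hGd 1 2))).fun_neg
  have hDc : ContinuousAt (det3 G) (x, r) := by
    have := fun i j => (hGd i j).continuousAt
    unfold det3
    fun_prop
  have hAd : ∀ A, DiffAt (adjCol G A) (x, r) := fun A => by
    fin_cases A
    · exact ((hGd 0 2).fun_mul (hGd 1 2)).fun_sub ((hGd 0 1).fun_mul (hGd 2 2))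
    · exact ((hGd 0 1).fun_mul (hGd 1 2)).fun_sub ((hGd 0 2).fun_mul (hGd 1 1))
  have hB0 : 0 < -blockDet G (x, r) := by linarith
  have hD0 : 0 < -det3 G (x, r) := by linarith
  have key : ∀ r x, ρ < r → blockDet G (x, r) < 0 → det3 G (x, r) < 0 → √|(g (pt r x)).det| = √(-det3 G (x, r)) / r ∧
      √|(g (pt r x)).det| * unitNormal g (pt r x) 0 = √(-blockDet G (x, r)) ∧
      ∀ A : Fin 2, √|(g (pt r x)).det| * unitNormal g (pt r x) A.succ
        = -(adjCol G A (x, r) / (r * √(-blockDet G (x, r)))) := fun r x hr hE hD =>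
    densitized_normal (hρ.1.trans_lt hr) (fun i j => hg i j r x hr) (fun i j => by
      have h1 := hg i j r x hr
      have h2 := hg j i r x hr
      rw [hsym i j _ hr, ← h2] at h1
      have := (wt_pos i (hρ.1.trans_lt hr)).ne'
      have := (wt_pos j (hρ.1.trans_lt hr)).ne'
      have h3 : wt i r * wt j r ≠ 0 := by positivity
      apply mul_left_cancel₀ h3
      rw [h1]; ring) hE hD
  have hnear : ∀ᶠ z in 𝓝 (pt r x), ρ < z 0 ∧ blockDet G ((fun A : Fin 2 => z A.succ), z 0) < 0 ∧
      det3 G ((fun A : Fin 2 => z A.succ), z 0) < 0 := by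
    have hc : Tendsto (fun z : Bulk => (((fun A : Fin 2 => z A.succ), z 0) : Bdry × ℝ)) (𝓝 (pt r x)) (𝓝 (x, r)) := by
      have : Continuous fun z : Bulk => (((fun A : Fin 2 => z A.succ), z 0) : Bdry × ℝ) := by fun_prop
      have h := this.tendsto (pt r x)
      simpa using h
    have hBc : ∀ᶠ w in 𝓝 ((x, r) : Bdry × ℝ), 0 < -blockDet G w := hBd.continuousAt.eventually_const_lt hB0
    filter_upwards [hc.eventually hmem, hc.eventually hBc, hc.eventually (hDc.eventually_lt_const hD)] with z h1 h2 h3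
    exact ⟨h1, by linarith, h3⟩
  have hF : ∀ (μ : Fin 3) (F : Bdry × ℝ → ℝ), DiffAt F (x, r) →
      (∀ r x, ρ < r → blockDet G (x, r) < 0 → det3 G (x, r) < 0 →
        √|(g (pt r x)).det| * unitNormal g (pt r x) μ = F (x, r)) →
      wt μ r * pd μ (fun y => √|(g y).det| * unitNormal g y μ) (pt r x) = ld idB μ F (x, r) := by
    intro μ F hFd hF
    rw [← pd_eq_logD (h := fun z => F ((fun A : Fin 2 => z A.succ), z 0)) (x := x) hr hFd (fun r' x' _ => by simp) μ]
    congr 1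
    refine pd_congr ?_ μ
    filter_upwards [hnear] with z ⟨h1, h2, h3⟩
    have := hF (z 0) (fun A => z A.succ) h1 h2 h3
    rwa [pt_eta] at this
  have hsB : 0 < √(-blockDet G (x, r)) := Real.sqrt_pos.2 hB0
  have hsD : 0 < √(-det3 G (x, r)) := Real.sqrt_pos.2 hD0
  have h0 := hF 0 (fun w => √(-blockDet G w)) (hBd.sqrt hB0.ne') fun r x h1 h2 h3 => (key r x h1 h2 h3).2.1
  have hA : ∀ A : Fin 2, r * pd A.succ (fun y => √|(g y).det| * unitNormal g y A.succ) (pt r x)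
      = -((ld idB A.succ (adjCol G A) (x, r) - adjCol G A (x, r)
          * ld idB A.succ (fun w => -blockDet G w) (x, r) / (2 * -blockDet G (x, r)))
          / √(-blockDet G (x, r))) := fun A => by
    have h1 := logD_frame_div_sqrt (J := .id ℝ Bdry) hBd (hAd A) hB0 hr0 A
    have hd : DiffAt (fun w : Bdry × ℝ => adjCol G A w / (w.2 * √(-blockDet G w))) (x, r) := by
      simp only [div_eq_mul_inv]
      exact (hAd A).fun_mul ((differentiableAt_snd.fun_mul (hBd.sqrt hB0.ne')).fun_inv (by positivity))
    have h2 := hF A.succ (fun w => -(adjCol G A w / (w.2 * √(-blockDet G w)))) hd.fun_neg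
      fun r x h1 h2 h3 => (key r x h1 h2 h3).2.2 A
    have h3 : ld idB A.succ (fun w => -(adjCol G A w / (w.2 * √(-blockDet G w)))) (x, r)
        = -ld idB A.succ (fun w => adjCol G A w / (w.2 * √(-blockDet G w))) (x, r) := by
      simp only [logD, fderiv_fun_neg, neg_apply]
    rw [wt_succ, one_mul, h3] at h2
    rw [h2, mul_neg, h1]
  rw [frame_zero, logD_sqrt hBd hB0, wt_zero] at h0
  rw [extrinsicTrace, (key r x hr hE hD).1, Fin.sum_univ_succ]
  have e : ∀ p q s : ℝ, 0 < s → -(1 / (s / r)) * (p + q) = -(1 / s) * (r * p + r * q) := by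
    intro p q s hs; field_simp
  rw [e _ _ _ hsD, h0, mul_sum]
  simp only [hA, Fin.sum_univ_two]
  field_simp
  ring

lemma tendsto_extrinsicTrace (hl : 0 < l) {G : Fin 3 → Fin 3 → Bdry × ℝ → ℝ}
    {γ C : Fin 2 → Fin 2 → Bdry → ℝ} {c : Bdry → ℝ} (hG : MetricExp ρ l G γ c C) {g : Bulk → Mat3}
    (hg : ∀ i j r x, ρ < r → wt i r * wt j r * g (pt r x) i j = G i j (x, r)) {x : Bdry} (hγ : det2 γ x < 0) :
    Tendsto (fun r => r ^ 2 * (extrinsicTrace g (pt r x) - (-2 / l))) atTop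
      (𝓝 (1 / l * (c x / l ^ 2 + pol2 γ C x / det2 γ x))) := by
  have hB := ((blockDet_ex hG).const_mul (-1)).congr (g := fun w => -blockDet G w) fun w _ => by ring
  have hD := ((det3_ex hG).const_mul (-1)).congr (g := fun w => -det3 G w) fun w _ => by ring
  have hBD := hB.mul hD
  have hDB := hB.logD (0, 1)
  have hQ := (((hDB.mul hDB).const_mul (l ^ 2)).add (hBD.const_mul (-16))).congr_coeff (a' := 0)
    (c' := fun y => -16 * (det2 γ y * (l ^ 2 * pol2 γ C y + c y * det2 γ y)))
    (fun y => by simp; ring) (fun y => by simp; ring)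
  have hd : 0 < l * -det2 γ x := by nlinarith
  set E : ℝ → ℝ := fun r => -blockDet G (x, r) with hEdef
  set Δ : ℝ → ℝ := fun r => -det3 G (x, r) with hΔdef
  set D : ℝ → ℝ := fun r => logD (0, 1) (fun w => -blockDet G w) (x, r) with hDdef
  have tE : Tendsto (fun r : ℝ => r ^ (-4 : ℤ) * E r) atTop (𝓝 (-1 * det2 γ x)) := hB.tendsto_left x
  have tΔ : Tendsto (fun r : ℝ => r ^ (-4 : ℤ) * Δ r) atTop (𝓝 (-1 * (l ^ 2 * det2 γ x))) := hD.tendsto_left x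
  have pos : ∀ {f : ℝ → ℝ} {a : ℝ}, Tendsto (fun r : ℝ => r ^ (-4 : ℤ) * f r) atTop (𝓝 a) → 0 < a →
      ∀ᶠ r in atTop, 0 < f r := fun h ha => by
    filter_upwards [h.eventually_const_lt ha, eventually_gt_atTop 0] with r h1 h2
    exact pos_of_mul_pos_right h1 (by positivity)
  have pE := pos tE (by linarith)
  have pΔ := pos tΔ (by nlinarith [sq_pos_of_pos hl])
  -- the square root of the product of the determinants
  have tS : Tendsto (fun r : ℝ => r ^ (-4 : ℤ) * (√(E r) * √(Δ r))) atTop (𝓝 (l * -det2 γ x)) := by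
    have h1 := (Real.continuous_sqrt.tendsto _).comp (tE.mul tΔ)
    rw [show -1 * det2 γ x * (-1 * (l ^ 2 * det2 γ x)) = (l * -det2 γ x) ^ 2 by ring, Real.sqrt_sq hd.le] at h1
    refine h1.congr' ?_
    filter_upwards [eventually_gt_atTop 0, pE] with r hr h2
    simp only [Function.comp]
    rw [show r ^ (-4 : ℤ) * E r * (r ^ (-4 : ℤ) * Δ r) = (r ^ (-4 : ℤ)) ^ 2 * (E r * Δ r) by ring,
      Real.sqrt_mul (by positivity), Real.sqrt_sq (by positivity), Real.sqrt_mul h2.le]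
  have tD : Tendsto (fun r : ℝ => r ^ (-4 : ℤ) * D r) atTop (𝓝 (4 * -det2 γ x)) := by
    have := hDB.tendsto_left x
    refine this.trans (le_of_eq ?_)
    congr 1; simp; norm_num
  have tq : Tendsto (fun r => l * (r ^ (-4 : ℤ) * D r) / (4 * (r ^ (-4 : ℤ) * (√(E r) * √(Δ r))))) atTop (𝓝 1) := by
    have := (tD.const_mul l).div (tS.const_mul 4) (by positivity)
    rwa [show l * (4 * -det2 γ x) / (4 * (l * -det2 γ x)) = 1 by
      have := hγ.ne
      field_simp] at this
  have tQ : Tendsto (fun r : ℝ => r ^ (-6 : ℤ) * (l ^ 2 * (D r * D r) + -16 * (E r * Δ r))) atTop _ :=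
    hQ.tendsto_right x
  have t2 := (tQ.div ((tS.mul tS).const_mul 16) (by positivity)).div (tq.add_const 1) (by norm_num)
  have tT : ∀ A : Fin 2, Tendsto (fun r : ℝ => r ^ 2 * ((ld idB A.succ (adjCol G A) (x, r)
      - adjCol G A (x, r) * ld idB A.succ (fun w => -blockDet G w) (x, r) /
          (2 * -blockDet G (x, r))) / (√(E r) * √(Δ r)))) atTop (𝓝 0) := by
    intro A
    have h1 : IsFall ρ false 2 (adjCol G A) := (adjCol_fall hG A).lt (by norm_num)
    have h2 := (h1.logD (frame idB A.succ)).tendsto x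
    have h3 := (hB.logD (frame idB A.succ)).tendsto_left x
    have h4 := (h2.sub ((h1.tendsto x).mul (h3.div (tE.const_mul 2) (by linarith)))).div tS hd.ne'
    rw [zero_mul, sub_zero, zero_div] at h4
    refine h4.congr' ?_
    filter_upwards [eventually_gt_atTop 0, pE, pΔ] with r hr h5 h6
    have e1 : r ^ (-(2 + 2) : ℤ) = (r ^ 4)⁻¹ := by norm_num
    have e2 : r ^ (-2 : ℤ) = (r ^ 2)⁻¹ := by rw [zpow_neg]; norm_cast
    have e3 : r ^ (-4 : ℤ) = (r ^ 4)⁻¹ := by rw [zpow_neg]; norm_cast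
    have h7 := Real.sqrt_pos.2 h5
    have h8 := Real.sqrt_pos.2 h6
    have h9 : E r ≠ 0 := h5.ne'
    simp only [Pi.div_apply, e1, e2, e3]
    change _ = r ^ 2 * ((_ - _ * _ / (2 * E r)) / _)
    field_simp
  have tot := (t2.const_mul (-(2 / l))).add ((tT 0).add (tT 1))
  refine (tot.congr' ?_).trans (le_of_eq ?_)
  · filter_upwards [eventually_gt_atTop ρ, pE, pΔ, tq.eventually_const_lt zero_lt_one] with r hr h5 h6 h7
    have hr0 := hρ.1.trans_lt hr
    have h8 := Real.sqrt_pos.2 h5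
    have h9 := Real.sqrt_pos.2 h6
    rw [extrinsicTrace_eq (hG.differentiableAt) hG.symm hg hr (neg_pos.1 h5) (neg_pos.1 h6)]
    simp only [Pi.div_apply, Fin.sum_univ_two]
    have e3 : r ^ (-4 : ℤ) = (r ^ 4)⁻¹ := by rw [zpow_neg]; norm_cast
    have e4 : r ^ (-6 : ℤ) = (r ^ 6)⁻¹ := by rw [zpow_neg]; norm_cast
    have e5 : E r * Δ r = (√(E r) * √(Δ r)) ^ 2 := by
      rw [mul_pow, Real.sq_sqrt h5.le, Real.sq_sqrt h6.le]
    have e6 : l * (r ^ (-4 : ℤ) * D r) / (4 * (r ^ (-4 : ℤ) * (√(E r) * √(Δ r))))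
        = l * D r / (4 * (√(E r) * √(Δ r))) := by rw [e3]; field_simp
    rw [e6] at h7 ⊢
    rw [e5, e3, e4]
    change _ = r ^ 2 * (-(D r / (2 * (√(E r) * √(Δ r)))) + _ - _)
    have hP : 0 < √(E r) * √(Δ r) := mul_pos h8 h9
    change _ + (r ^ 2 * _ + r ^ 2 * _) = r ^ 2 * (_ + (_ + _) - _)
    have e7 : -(2 / l) * ((r ^ 6)⁻¹ * (l ^ 2 * (D r * D r) + -16 * (√(E r) * √(Δ r)) ^ 2) /
        (16 * ((r ^ 4)⁻¹ * (√(E r) * √(Δ r)) * ((r ^ 4)⁻¹ * (√(E r) * √(Δ r))))) /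
        (l * D r / (4 * (√(E r) * √(Δ r))) + 1)) = r ^ 2 * (-(D r / (2 * (√(E r) * √(Δ r)))) - (-2 / l)) := by
      generalize √(E r) * √(Δ r) = P at hP h7 ⊢
      have h10 : l * D r / (4 * P) + 1 ≠ 0 := by positivity
      rw [← mul_div_assoc, div_eq_iff h10]
      field_simp
      ring
    rw [e7]
    ring
  · congr 1
    have := hγ.ne
    field_simp
    ring

end Extrinsic

/-! ### Conformal geometry of the boundary -/

section Boundary

/-- Smooth functions in the boundary coordinates. -/
def SmoothFun : Subalgebra ℝ (Bdry → ℝ) where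
  carrier := {f | Cinf f}
  mul_mem' {a b} (ha : Cinf a) (hb : Cinf b) := ha.mul hb
  add_mem' {a b} (ha : Cinf a) (hb : Cinf b) := ha.add hb
  algebraMap_mem' c := (contDiff_const : Cinf fun _ : Bdry => c)

lemma SmoothFun.contDiff (f : SmoothFun) : Cinf (f : Bdry → ℝ) := f.2

lemma SmoothFun.differentiableAt (f : SmoothFun) (x : Bdry) : DiffAt (f : Bdry → ℝ) x := ((SmoothFun.contDiff f).dif) x

lemma contDiff_pd {f : Bdry → ℝ} (hf : Cinf f) (A : Fin 2) : Cinf (pd A f) :=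
  (hf.fderiv_right (by simp)).clm_apply contDiff_const

/-- Partial derivatives as derivations of the algebra of smooth functions. -/
def dd (A : Fin 2) : Derivation ℝ SmoothFun SmoothFun where
  toFun f := ⟨pd A f, contDiff_pd f.2 A⟩
  map_add' f g := by
    ext x
    change fderiv ℝ (fun y => (f : Bdry → ℝ) y + (g : Bdry → ℝ) y) x _ = _
    rw [fderiv_fun_add (SmoothFun.differentiableAt f x) (SmoothFun.differentiableAt g x)]
    rfl
  map_smul' c f := by
    ext x
    change fderiv ℝ (fun y => c * (f : Bdry → ℝ) y) x _ = _
    rw [fderiv_const_mul (SmoothFun.differentiableAt f x)]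
    rfl
  map_one_eq_zero' := by
    ext x
    change fderiv ℝ (fun _ => (1 : ℝ)) x _ = _
    simp
  leibniz' f g := by
    ext x
    change fderiv ℝ (fun y => (f : Bdry → ℝ) y * (g : Bdry → ℝ) y) x _ = _
    rw [fderiv_fun_mul (SmoothFun.differentiableAt f x) (SmoothFun.differentiableAt g x)]
    rfl

lemma pd_pd_eq {f : Bdry → ℝ} (hf : Cinf f) (A B : Fin 2) (x : Bdry) :
    pd A (pd B f) x = fderiv ℝ (fderiv ℝ f) x (Pi.single A 1) (Pi.single B 1) := by
  have h : DiffAt (fderiv ℝ f) x := ((hf.fderiv_right (m := ∞) (by simp)).dif) x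
  change fderiv ℝ (fun y => fderiv ℝ f y (Pi.single B 1)) x _ = _
  rw [fderiv_clm_apply h (differentiableAt_const _)]
  simp

lemma pd_comm {f : Bdry → ℝ} (hf : Cinf f) (A B : Fin 2) : pd A (pd B f) = pd B (pd A f) := by
  funext x
  rw [pd_pd_eq hf, pd_pd_eq hf]
  have h : IsSymmSndFDerivAt ℝ f x := hf.contDiffAt.isSymmSndFDerivAt
    (by simpa using WithTop.coe_le_coe.2 (le_top : (2 : ℕ∞) ≤ ⊤))
  exact h _ _

lemma dd_comm (f : SmoothFun) : dd 1 (dd 0 f) = dd 0 (dd 1 f) := Subtype.ext (pd_comm f.2 1 0)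

/-- The conformal Killing equation for a unimodular metric `(a, b, d)`, first component. -/
def ckA (a b : SmoothFun) (V : Fin 2 → SmoothFun) : SmoothFun :=
  V 0 * dd 0 a + V 1 * dd 1 a + a * (dd 0 (V 0) - dd 1 (V 1)) + (b * dd 0 (V 1) + b * dd 0 (V 1))

def ckB (a b d : SmoothFun) (V : Fin 2 → SmoothFun) : SmoothFun :=
  V 0 * dd 0 b + V 1 * dd 1 b + a * dd 1 (V 0) + d * dd 0 (V 1)

def ckD (b d : SmoothFun) (V : Fin 2 → SmoothFun) : SmoothFun :=
  V 0 * dd 0 d + V 1 * dd 1 d + d * (dd 1 (V 1) - dd 0 (V 0)) + (b * dd 1 (V 0) + b * dd 1 (V 0))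

/-- The wave operator of a unimodular metric `(a, b, d)`. -/
def wave (a b d ψ : SmoothFun) : SmoothFun := dd 0 (b * dd 1 ψ - d * dd 0 ψ) + dd 1 (b * dd 0 ψ - a * dd 1 ψ)

/-- The commutator of vector fields. -/
def commF (V W : Fin 2 → SmoothFun) (A : Fin 2) : SmoothFun :=
  V 0 * dd 0 (W A) + V 1 * dd 1 (W A) - (W 0 * dd 0 (V A) + W 1 * dd 1 (V A))

lemma wave_lie {a b d ψ : SmoothFun} {V : Fin 2 → SmoothFun} (hA : ckA a b V = 0)
    (hB : ckB a b d V = 0) (hD : ckD b d V = 0) (hψ : wave a b d ψ = 0) :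
    wave a b d (V 0 * dd 0 ψ + V 1 * dd 1 ψ) = 0 := by
  have key : wave a b d (V 0 * dd 0 ψ + V 1 * dd 1 ψ) = dd 0 (V 0 * wave a b d ψ) + dd 1 (V 1 * wave a b d ψ)
        + dd 0 (ckD b d V * dd 0 ψ - ckB a b d V * dd 1 ψ) + dd 1 (ckA a b V * dd 1 ψ - ckB a b d V * dd 0 ψ) := by
    simp only [wave, ckA, ckB, ckD, Derivation.leibniz, map_add, map_sub, smul_eq_mul, dd_comm]
    ring
  rw [key, hA, hB, hD, hψ]
  simp

lemma ck_comm {a b d : SmoothFun} {V W : Fin 2 → SmoothFun} (hA : ckA a b V = 0)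
    (hB : ckB a b d V = 0) (hD : ckD b d V = 0) (hA' : ckA a b W = 0) (hB' : ckB a b d W = 0) (hD' : ckD b d W = 0) :
    ckA a b (commF V W) = 0 ∧ ckB a b d (commF V W) = 0 ∧ ckD b d (commF V W) = 0 := by
  have k1 : ckA a b (commF V W) = V 0 * dd 0 (ckA a b W) + V 1 * dd 1 (ckA a b W)
      - (W 0 * dd 0 (ckA a b V) + W 1 * dd 1 (ckA a b V))
      - ((dd 0 (W 0) - dd 1 (W 1)) * ckA a b V + 2 * (dd 0 (W 1) * ckB a b d V))
      + ((dd 0 (V 0) - dd 1 (V 1)) * ckA a b W + 2 * (dd 0 (V 1) * ckB a b d W)) := by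
    simp only [ckA, ckB, commF, Derivation.leibniz, map_add, map_sub, smul_eq_mul, dd_comm]
    ring
  have k2 : ckB a b d (commF V W) = V 0 * dd 0 (ckB a b d W) + V 1 * dd 1 (ckB a b d W)
      - (W 0 * dd 0 (ckB a b d V) + W 1 * dd 1 (ckB a b d V)) - (dd 1 (W 0) * ckA a b V + dd 0 (W 1) * ckD b d V)
      + (dd 1 (V 0) * ckA a b W + dd 0 (V 1) * ckD b d W) := by
    simp only [ckA, ckB, ckD, commF, Derivation.leibniz, map_add, map_sub, smul_eq_mul, dd_comm]
    ring
  have k3 : ckD b d (commF V W) = V 0 * dd 0 (ckD b d W) + V 1 * dd 1 (ckD b d W)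
      - (W 0 * dd 0 (ckD b d V) + W 1 * dd 1 (ckD b d V))
      - ((dd 1 (W 1) - dd 0 (W 0)) * ckD b d V + 2 * (dd 1 (W 0) * ckB a b d V))
      + ((dd 1 (V 1) - dd 0 (V 0)) * ckD b d W + 2 * (dd 1 (V 0) * ckB a b d W)) := by
    simp only [ckD, ckB, commF, Derivation.leibniz, map_add, map_sub, smul_eq_mul, dd_comm]
    ring
  rw [k1, k2, k3, hA, hB, hD, hA', hB', hD']
  simp

variable {γ : Bdry → Mat2} {φ ψ : Bdry → ℝ} {x : Bdry}

lemma inv_two (M : Mat2) : M⁻¹ 0 0 = M 1 1 / M.det ∧ M⁻¹ 0 1 = -M 0 1 / M.det ∧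
    M⁻¹ 1 0 = -M 1 0 / M.det ∧ M⁻¹ 1 1 = M 0 0 / M.det := by
  simp only [Matrix.inv_def, Ring.inverse_eq_inv', Matrix.adjugate_fin_two, Matrix.smul_apply,
    smul_eq_mul, of_apply, cons_val_zero, cons_val_one, div_eq_inv_mul]
  simp

/-- The Laplacian with all derivatives evaluated at a point. -/
lemma laplacian_explicit (hs : (γ x).IsSymm) (hd : (γ x).det ≠ 0) : laplacian γ ψ x * (γ x).det =
    γ x 1 1 * pd 0 (pd 0 ψ) x + γ x 0 0 * pd 1 (pd 1 ψ) x - γ x 0 1 * (pd 0 (pd 1 ψ) x + pd 1 (pd 0 ψ) x)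
    - ∑ D, grad γ ψ x D * (γ x 1 1 * (pd 0 (fun y => γ y D 0) x - (1 / 2) * pd D (fun y => γ y 0 0) x)
      + γ x 0 0 * (pd 1 (fun y => γ y D 1) x - (1 / 2) * pd D (fun y => γ y 1 1) x)
      - γ x 0 1 * (pd 0 (fun y => γ y D 1) x + pd 1 (fun y => γ y D 0) x
        - (1 / 2) * (pd D (fun y => γ y 0 1) x + pd D (fun y => γ y 1 0) x))) := by
  obtain ⟨i1, i2, i3, i4⟩ := inv_two (γ x)
  have h10 : γ x 1 0 = γ x 0 1 := hs.apply 0 1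
  simp only [laplacian, christoffel, grad, Fin.sum_univ_two, i1, i2, i3, i4, h10]
  field_simp
  ring

lemma pd_mul {n : ℕ} {f g : (Fin n → ℝ) → ℝ} {x : Fin n → ℝ} (hf : DiffAt f x) (hg : DiffAt g x) (i : Fin n) :
    pd i (fun y => f y * g y) x = pd i f x * g x + f x * pd i g x := by
  simp only [pd, fderiv_fun_mul hf hg, add_apply, smul_apply, smul_eq_mul]
  ring

lemma pd_add {n : ℕ} {f g : (Fin n → ℝ) → ℝ} {x : Fin n → ℝ} (hf : DiffAt f x) (hg : DiffAt g x) (i : Fin n) :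
    pd i (fun y => f y + g y) x = pd i f x + pd i g x := by
  simp only [pd, fderiv_fun_add hf hg, add_apply]

lemma pd_const_mul {n : ℕ} {f : (Fin n → ℝ) → ℝ} {x : Fin n → ℝ} (hf : DiffAt f x)
    (t : ℝ) (i : Fin n) : pd i (fun y => t * f y) x = t * pd i f x := by
  simp only [pd, fderiv_const_mul hf, smul_apply, smul_eq_mul]

/-- The Laplacian in two dimensions is conformally covariant. -/
lemma laplacian_conformal (hγ : ∀ A B, Cinf fun y => γ y A B) (hs : ∀ x, (γ x).IsSymm)
    (hd : ∀ x, (γ x).det ≠ 0) (hφ : Cinf φ) (ψ : Bdry → ℝ) (x : Bdry) :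
    laplacian (fun y => Real.exp (2 * φ y) • γ y) ψ x * Real.exp (2 * φ x) = laplacian γ ψ x := by
  set e : Bdry → ℝ := fun y => Real.exp (2 * φ y) with he
  have he0 : e x ≠ 0 := (Real.exp_pos _).ne'
  have hed : DiffAt e x := ((Real.contDiff_exp.comp (contDiff_const.mul hφ)).differentiable (n := ∞) (by simp)) x
  have hgd : ∀ A B, DiffAt (fun y => γ y A B) x := fun A B =>
    ((hγ A B).dif) x
  have h1 := laplacian_explicit (ψ := ψ) (hs x) (hd x)
  have hs' : (e x • γ x).IsSymm := (hs x).smul _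
  have hdet : (e x • γ x).det = e x ^ 2 * (γ x).det := by
    rw [det_smul]; simp
  have hd' : (e x • γ x).det ≠ 0 := by
    rw [hdet]; exact mul_ne_zero (pow_ne_zero 2 he0) (hd x)
  have h2 := laplacian_explicit (γ := fun y => e y • γ y) (ψ := ψ) hs' hd'
  have hN : ∀ D, grad (fun y => e y • γ y) ψ x D = (e x)⁻¹ * grad γ ψ x D := by
    intro D
    have h3 : (e x • γ x)⁻¹ = (e x)⁻¹ • (γ x)⁻¹ :=
      Matrix.inv_smul' (A := γ x) (Units.mk0 (e x) he0) (isUnit_iff_ne_zero.2 (hd x))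
    simp only [grad, h3, Matrix.smul_apply, smul_eq_mul, mul_sum, mul_assoc]
  have hp : ∀ A B D, pd D (fun y => (e y • γ y) A B) x
      = pd D e x * γ x A B + e x * pd D (fun y => γ y A B) x := fun A B D => by
    simp only [Matrix.smul_apply, smul_eq_mul]
    exact pd_mul hed (hgd A B) D
  have h10 : γ x 1 0 = γ x 0 1 := (hs x).apply 0 1
  beta_reduce at h2
  simp only [hN, hdet, Fin.sum_univ_two] at h1 h2
  simp only [hp] at h2
  simp only [Matrix.smul_apply, smul_eq_mul] at h2
  apply mul_right_cancel₀ (hd x)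
  rw [h1]
  apply mul_left_cancel₀ he0
  change e x * (_ * e x * _) = _
  have h3 : e x * (laplacian (fun y => e y • γ y) ψ x * e x * (γ x).det)
      = laplacian (fun y => e y • γ y) ψ x * (e x ^ 2 * (γ x).det) := by ring
  rw [h3, h2]
  field_simp
  rw [h10]
  ring

lemma fderiv_eq_sum_pd {f : Bdry → ℝ} (v : Bdry) (x : Bdry) : fderiv ℝ f x v = ∑ A, v A * pd A f x := by
  have h : v = ∑ A, v A • (Pi.single A (1 : ℝ) : Bdry) := by
    ext A; fin_cases A <;> simp
  conv_lhs => rw [h]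
  simp [pd]

lemma lieBracket_apply {V W : Bdry → Bdry} (hV : DiffAt V x)
    (hW : DiffAt W x) (A : Fin 2) : VectorField.lieBracket ℝ V W x A
      = ∑ B, (V x B * pd B (fun y => W y A) x - W x B * pd B (fun y => V y A) x) := by
  have h : ∀ {U : Bdry → Bdry}, DiffAt U x → ∀ v, fderiv ℝ U x v A = fderiv ℝ (fun y => U y A) x v := fun hU v => by
    rw [fderiv_apply hU]
    rfl
  rw [VectorField.lieBracket, Pi.sub_apply, h hV, h hW, fderiv_eq_sum_pd, fderiv_eq_sum_pd, ← sum_sub_distrib]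

end Boundary

section Conformal

variable {γ : Bdry → Mat2} {φ ψ : Bdry → ℝ} {x : Bdry} {V W : Bdry → Bdry}

lemma IsConformalKilling.conformal (hγ : ∀ A B, Cinf fun y => γ y A B) (hφ : Cinf φ) (h : IsConformalKilling γ V) :
    IsConformalKilling (fun y => Real.exp (2 * φ y) • γ y) V := by
  obtain ⟨σ, hσ⟩ := h
  set e : Bdry → ℝ := fun y => Real.exp (2 * φ y) with he
  refine ⟨fun x => σ x + (∑ k, V x k * pd k e x) / e x, fun x => ?_⟩
  have he0 : e x ≠ 0 := (Real.exp_pos _).ne'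
  have hed : DiffAt e x := ((Real.contDiff_exp.comp (contDiff_const.mul hφ)).differentiable (n := ∞) (by simp)) x
  have hp : ∀ A B D, pd D (fun y => (e y • γ y) A B) x
      = pd D e x * γ x A B + e x * pd D (fun y => γ y A B) x := fun A B D => by
    simp only [Matrix.smul_apply, smul_eq_mul]
    exact pd_mul hed (((hγ A B).dif) x) D
  ext A B
  have h1 := congrFun (congrFun (hσ x) A) B
  change lieDeriv V (fun y => e y • γ y) x A B = (σ x + (∑ k, V x k * pd k e x) / e x) * (e x * γ x A B)
  simp only [lieDeriv, of_apply, Matrix.smul_apply, smul_eq_mul, Fin.sum_univ_two] at h1 ⊢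
  simp only [Matrix.smul_apply, smul_eq_mul] at hp
  simp only [hp]
  field_simp
  linear_combination e x * h1

lemma conformal_symm : (fun y => Real.exp (2 * -φ y) • (Real.exp (2 * φ y) • γ y)) = γ := by
  funext y
  rw [smul_smul, ← Real.exp_add]
  simp

lemma isConformalKilling_conformal_iff (hγ : ∀ A B, Cinf fun y => γ y A B) (hφ : Cinf φ) :
    IsConformalKilling (fun y => Real.exp (2 * φ y) • γ y) V ↔ IsConformalKilling γ V := by
  refine ⟨fun h => ?_, fun h => h.conformal hγ hφ⟩
  have h1 := h.conformal (φ := fun y => -φ y) (fun A B => by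
    simp only [Matrix.smul_apply, smul_eq_mul]
    exact (Real.contDiff_exp.comp (contDiff_const.mul hφ)).mul (hγ A B)) hφ.neg
  rwa [conformal_symm] at h1

lemma laplacian_conformal_eq_zero_iff (hγ : ∀ A B, Cinf fun y => γ y A B)
    (hs : ∀ x, (γ x).IsSymm) (hd : ∀ x, (γ x).det ≠ 0) (hφ : Cinf φ) :
    laplacian (fun y => Real.exp (2 * φ y) • γ y) ψ x = 0 ↔ laplacian γ ψ x = 0 := by
  rw [← laplacian_conformal hγ hs hd hφ, mul_eq_zero, or_iff_left (Real.exp_pos _).ne']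

/-- A two dimensional Lorentzian metric is conformal to a unimodular one. -/
lemma IsLorentzMetric.exists_unimodular (hγ : IsLorentzMetric γ) :
    ∃ φ : Bdry → ℝ, Cinf φ ∧ ∀ x, (Real.exp (2 * φ x) • γ x).det = -1 := by
  have hs : Cinf fun x => -(γ x).det := by
    simp only [det_fin_two]
    exact (((hγ.smooth 0 0).1.mul (hγ.smooth 1 1).1).sub ((hγ.smooth 0 1).1.mul (hγ.smooth 1 0).1)).neg
  have hpos : ∀ x, 0 < -(γ x).det := fun x => neg_pos.2 (hγ.lorentz x)
  refine ⟨fun x => -(1 / 4) * Real.log (-(γ x).det), contDiff_const.mul (hs.log fun x => (hpos x).ne'), fun x => ?_⟩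
  rw [det_smul, Fintype.card_fin, ← Real.exp_nat_mul]
  have e : ((2 : ℕ) : ℝ) * (2 * (-(1 / 4) * Real.log (-(γ x).det))) = -Real.log (-(γ x).det) := by
    push_cast; ring
  rw [e, Real.exp_neg, Real.exp_log (hpos x)]
  have := (hγ.lorentz x).ne
  field_simp

lemma pd_det_unimodular (hγ : ∀ A B, Cinf fun y => γ y A B) (hs : ∀ x, (γ x).IsSymm)
    (hd : ∀ x, (γ x).det = -1) (D : Fin 2) (x : Bdry) :
    pd D (fun y => γ y 0 0) x * γ x 1 1 + γ x 0 0 * pd D (fun y => γ y 1 1) x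
      - 2 * (γ x 0 1 * pd D (fun y => γ y 0 1) x) = 0 := by
  have hdet : ∀ y, γ y 0 0 * γ y 1 1 - γ y 0 1 * γ y 0 1 = -1 := fun y => by
    rw [← hd y, det_fin_two, (hs y).apply 0 1]
  have d := fun A B => ((hγ A B).dif) x
  have h1 : pd D (fun y => γ y 0 0 * γ y 1 1 + (-1) * (γ y 0 1 * γ y 0 1)) x = 0 := by
    have : (fun y => γ y 0 0 * γ y 1 1 + (-1) * (γ y 0 1 * γ y 0 1)) = fun _ => (-1 : ℝ) :=
      funext fun y => by linarith [hdet y]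
    rw [this]; simp [pd]
  rw [pd_add ((d 0 0).fun_mul (d 1 1)) (((d 0 1).fun_mul (d 0 1)).const_mul _),
    pd_const_mul ((d 0 1).fun_mul (d 0 1)), pd_mul (d 0 0) (d 1 1), pd_mul (d 0 1) (d 0 1)] at h1
  linarith

/-- The components of a smooth field as smooth functions. -/
def comps (hV : Cinf V) (A : Fin 2) : SmoothFun := ⟨fun x => V x A, contDiff_pi.1 hV A⟩

lemma isConformalKilling_iff_ck (hγ : ∀ A B, Cinf fun y => γ y A B) (hs : ∀ x, (γ x).IsSymm)
    (hd : ∀ x, (γ x).det = -1) (hV : Cinf V) : IsConformalKilling γ V ↔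
      ckA ⟨_, hγ 0 0⟩ ⟨_, hγ 0 1⟩ (comps hV) = 0 ∧ ckB ⟨_, hγ 0 0⟩ ⟨_, hγ 0 1⟩ ⟨_, hγ 1 1⟩ (comps hV) = 0 ∧
      ckD ⟨_, hγ 0 1⟩ ⟨_, hγ 1 1⟩ (comps hV) = 0 := by
  have h10 : (fun y => γ y 1 0) = fun y => γ y 0 1 := funext fun y => (hs y).apply 0 1
  have h10' : ∀ y, γ y 1 0 = γ y 0 1 := fun y => (hs y).apply 0 1
  have hdet : ∀ y, γ y 0 0 * γ y 1 1 - γ y 0 1 * γ y 0 1 = -1 := fun y => by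
    rw [← hd y, det_fin_two, h10']
  have hp := pd_det_unimodular hγ hs hd
  have hA : ∀ x, (ckA ⟨_, hγ 0 0⟩ ⟨_, hγ 0 1⟩ (comps hV) : Bdry → ℝ) x
      = V x 0 * pd 0 (fun y => γ y 0 0) x + V x 1 * pd 1 (fun y => γ y 0 0) x
      + γ x 0 0 * (pd 0 (fun y => V y 0) x - pd 1 (fun y => V y 1) x)
      + (γ x 0 1 * pd 0 (fun y => V y 1) x + γ x 0 1 * pd 0 (fun y => V y 1) x) := fun x => rfl
  have hB : ∀ x, (ckB ⟨_, hγ 0 0⟩ ⟨_, hγ 0 1⟩ ⟨_, hγ 1 1⟩ (comps hV) : Bdry → ℝ) x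
      = V x 0 * pd 0 (fun y => γ y 0 1) x + V x 1 * pd 1 (fun y => γ y 0 1) x
      + γ x 0 0 * pd 1 (fun y => V y 0) x + γ x 1 1 * pd 0 (fun y => V y 1) x := fun x => rfl
  have hD : ∀ x, (ckD ⟨_, hγ 0 1⟩ ⟨_, hγ 1 1⟩ (comps hV) : Bdry → ℝ) x
      = V x 0 * pd 0 (fun y => γ y 1 1) x + V x 1 * pd 1 (fun y => γ y 1 1) x
      + γ x 1 1 * (pd 1 (fun y => V y 1) x - pd 0 (fun y => V y 0) x)
      + (γ x 0 1 * pd 1 (fun y => V y 0) x + γ x 0 1 * pd 1 (fun y => V y 0) x) := fun x => rfl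
  constructor
  · rintro ⟨σ, hσ⟩
    have e00 := fun x => congrFun (congrFun (hσ x) 0) 0
    have e01 := fun x => congrFun (congrFun (hσ x) 0) 1
    have e11 := fun x => congrFun (congrFun (hσ x) 1) 1
    simp only [lieDeriv, of_apply, Matrix.smul_apply, smul_eq_mul, Fin.sum_univ_two, h10'] at e00 e01 e11
    have hdiv : ∀ x, σ x = pd 0 (fun y => V y 0) x + pd 1 (fun y => V y 1) x := by
      intro x
      have d := hdet x
      linear_combination (1 / 2) * (γ x 1 1 * e00 x + γ x 0 0 * e11 x - 2 * γ x 0 1 * e01 x)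
        - (1 / 2) * (V x 0 * hp 0 x + V x 1 * hp 1 x) + (σ x - (pd 0 (fun y => V y 0) x + pd 1 (fun y => V y 1) x)) * d
    refine ⟨?_, ?_, ?_⟩ <;> ext x
    · rw [hA]; change _ = (0 : ℝ); linear_combination e00 x + γ x 0 0 * hdiv x
    · rw [hB]; change _ = (0 : ℝ); linear_combination e01 x + γ x 0 1 * hdiv x
    · rw [hD]; change _ = (0 : ℝ); linear_combination e11 x + γ x 1 1 * hdiv x
  · rintro ⟨cA, cB, cD⟩
    have cA' : ∀ x, _ = (0 : ℝ) := fun x => (hA x).symm.trans (congrFun (congrArg Subtype.val cA) x)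
    have cB' : ∀ x, _ = (0 : ℝ) := fun x => (hB x).symm.trans (congrFun (congrArg Subtype.val cB) x)
    have cD' : ∀ x, _ = (0 : ℝ) := fun x => (hD x).symm.trans (congrFun (congrArg Subtype.val cD) x)
    refine ⟨fun x => pd 0 (fun y => V y 0) x + pd 1 (fun y => V y 1) x, fun x => ?_⟩
    ext A B
    fin_cases A <;> fin_cases B <;>
      simp only [lieDeriv, of_apply, Matrix.smul_apply, smul_eq_mul, Fin.sum_univ_two, h10',
        Fin.mk_zero, Fin.mk_one, Fin.isValue]
    · linear_combination cA' x
    · linear_combination cB' x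
    · linear_combination cB' x
    · linear_combination cD' x

lemma laplacian_eq_wave (hγ : ∀ A B, Cinf fun y => γ y A B) (hs : ∀ x, (γ x).IsSymm)
    (hd : ∀ x, (γ x).det = -1) (hψ : Cinf ψ) (x : Bdry) :
    laplacian γ ψ x = (wave ⟨_, hγ 0 0⟩ ⟨_, hγ 0 1⟩ ⟨_, hγ 1 1⟩ ⟨ψ, hψ⟩ : Bdry → ℝ) x := by
  have h10 : (fun y => γ y 1 0) = fun y => γ y 0 1 := funext fun y => (hs y).apply 0 1
  have h10' : ∀ y, γ y 1 0 = γ y 0 1 := fun y => (hs y).apply 0 1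
  have hdet : ∀ y, γ y 0 0 * γ y 1 1 - γ y 0 1 * γ y 0 1 = -1 := fun y => by
    rw [← hd y, det_fin_two, h10']
  have hp := pd_det_unimodular hγ hs hd
  have h1 := laplacian_explicit (ψ := ψ) (hs x) (by rw [hd x]; norm_num)
  obtain ⟨i1, i2, i3, i4⟩ := inv_two (γ x)
  rw [hd x] at h1 i1 i2 i3 i4
  have N0 : grad γ ψ x 0 = -(γ x 1 1 * pd 0 ψ x) + γ x 0 1 * pd 1 ψ x := by
    simp only [grad, Fin.sum_univ_two, i1, i2]; ring
  have N1 : grad γ ψ x 1 = γ x 0 1 * pd 0 ψ x - γ x 0 0 * pd 1 ψ x := by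
    simp only [grad, Fin.sum_univ_two, i3, i4, h10']; ring
  have hw : (wave ⟨_, hγ 0 0⟩ ⟨_, hγ 0 1⟩ ⟨_, hγ 1 1⟩ ⟨ψ, hψ⟩ : Bdry → ℝ) x
      = γ x 0 1 * pd 0 (pd 1 ψ) x + pd 1 ψ x * pd 0 (fun y => γ y 0 1) x
      - (γ x 1 1 * pd 0 (pd 0 ψ) x + pd 0 ψ x * pd 0 (fun y => γ y 1 1) x)
      + (γ x 0 1 * pd 1 (pd 0 ψ) x + pd 0 ψ x * pd 1 (fun y => γ y 0 1) x
      - (γ x 0 0 * pd 1 (pd 1 ψ) x + pd 1 ψ x * pd 1 (fun y => γ y 0 0) x)) := by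
    rw [wave]
    simp only [map_sub, Derivation.leibniz]
    rfl
  rw [hw]
  simp only [Fin.sum_univ_two, N0, N1, h10'] at h1
  have d := hdet x
  have p0 := hp 0 x
  have p1 := hp 1 x
  linear_combination -h1 + (1 / 2) * (-(γ x 1 1 * pd 0 ψ x) + γ x 0 1 * pd 1 ψ x) * p0
    + (1 / 2) * (γ x 0 1 * pd 0 ψ x - γ x 0 0 * pd 1 ψ x) * p1
    + (pd 0 ψ x * (pd 0 (fun y => γ y 1 1) x - pd 1 (fun y => γ y 0 1) x)
      + pd 1 ψ x * (pd 1 (fun y => γ y 0 0) x - pd 0 (fun y => γ y 0 1) x)) * d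

lemma contDiff_conformal (hγ : ∀ A B, Cinf fun y => γ y A B) (hφ : Cinf φ)
    (A B : Fin 2) : Cinf fun y => (Real.exp (2 * φ y) • γ y) A B := by
  simp only [Matrix.smul_apply, smul_eq_mul]
  exact (Real.contDiff_exp.comp (contDiff_const.mul hφ)).mul (hγ A B)

/-- Conformal Killing vectors are closed under the Lie bracket. -/
lemma IsConformalKilling.lieBracket (hγ : IsLorentzMetric γ) (hV : Cinf V)
    (hW : Cinf W) (h : IsConformalKilling γ V) (h' : IsConformalKilling γ W) :
    IsConformalKilling γ (VectorField.lieBracket ℝ V W) := by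
  obtain ⟨φ, hφ, hd⟩ := hγ.exists_unimodular
  have hs := fun A B => (hγ.smooth A B).1
  have hs' := contDiff_conformal hs hφ
  have hsy : ∀ x, (Real.exp (2 * φ x) • γ x).IsSymm := fun x => (hγ.symm x).smul _
  have hVW : Cinf (VectorField.lieBracket ℝ V W) := hV.lieBracket_vectorField hW (by simp)
  rw [← isConformalKilling_conformal_iff hs hφ, isConformalKilling_iff_ck hs' hsy hd hV] at h
  rw [← isConformalKilling_conformal_iff hs hφ, isConformalKilling_iff_ck hs' hsy hd hW] at h'
  rw [← isConformalKilling_conformal_iff hs hφ, isConformalKilling_iff_ck hs' hsy hd hVW]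
  have e : comps hVW = commF (comps hV) (comps hW) := by
    funext A
    ext x
    change VectorField.lieBracket ℝ V W x A = V x 0 * pd 0 (fun y => W y A) x
      + V x 1 * pd 1 (fun y => W y A) x - (W x 0 * pd 0 (fun y => V y A) x + W x 1 * pd 1 (fun y => V y A) x)
    rw [lieBracket_apply ((hV.dif) x) ((hW.dif) x), Fin.sum_univ_two]
    ring
  rw [e]
  exact ck_comm h.1 h.2.1 h.2.2 h'.1 h'.2.1 h'.2.2

/-- Conformal Killing vectors act on harmonic functions. -/
lemma laplacian_lie_eq_zero (hγ : IsLorentzMetric γ) (hV : Cinf V) (hψ : Cinf ψ)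
    (h : IsConformalKilling γ V) (h' : ∀ x, laplacian γ ψ x = 0) (x : Bdry) :
    laplacian γ (fun x => fderiv ℝ ψ x (V x)) x = 0 := by
  obtain ⟨φ, hφ, hd⟩ := hγ.exists_unimodular
  have hs := fun A B => (hγ.smooth A B).1
  have hs' := contDiff_conformal hs hφ
  have hsy : ∀ x, (Real.exp (2 * φ x) • γ x).IsSymm := fun x => (hγ.symm x).smul _
  have hdet : ∀ x, (γ x).det ≠ 0 := fun x => (hγ.lorentz x).ne
  rw [← isConformalKilling_conformal_iff hs hφ, isConformalKilling_iff_ck hs' hsy hd hV] at h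
  have e : (fun x => fderiv ℝ ψ x (V x)) = fun x => V x 0 * pd 0 ψ x + V x 1 * pd 1 ψ x := by
    funext x
    rw [fderiv_eq_sum_pd, Fin.sum_univ_two]
  have hVψ : Cinf fun x => V x 0 * pd 0 ψ x + V x 1 * pd 1 ψ x :=
    ((contDiff_pi.1 hV 0).mul (contDiff_pd hψ 0)).add ((contDiff_pi.1 hV 1).mul (contDiff_pd hψ 1))
  have h1 : wave ⟨_, hs' 0 0⟩ ⟨_, hs' 0 1⟩ ⟨_, hs' 1 1⟩ ⟨ψ, hψ⟩ = 0 := by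
    ext x
    rw [← laplacian_eq_wave hs' hsy hd hψ x]
    exact (laplacian_conformal_eq_zero_iff hs hγ.symm hdet hφ).2 (h' x)
  have h2 := wave_lie h.1 h.2.1 h.2.2 h1
  rw [e, ← laplacian_conformal_eq_zero_iff hs hγ.symm hdet hφ, laplacian_eq_wave hs' hsy hd hVψ x]
  exact congrFun (congrArg Subtype.val h2) x

lemma IsConformalKilling.add_smul (hV : Cinf V) (hW : Cinf W)
    (h : IsConformalKilling γ V) (h' : IsConformalKilling γ W) (s t : ℝ) : IsConformalKilling γ (s • V + t • W) := by
  obtain ⟨σ, hσ⟩ := h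
  obtain ⟨τ, hτ⟩ := h'
  refine ⟨fun x => s * σ x + t * τ x, fun x => ?_⟩
  have e : ∀ A D, pd D (fun y => s * V y A + t * W y A) x
      = s * pd D (fun y => V y A) x + t * pd D (fun y => W y A) x := fun A D => by
    have dV := (((contDiff_pi.1 hV) A).dif) x
    have dW := (((contDiff_pi.1 hW) A).dif) x
    rw [pd_add (dV.const_mul s) (dW.const_mul t), pd_const_mul dV, pd_const_mul dW]
  ext A B
  have h1 := congrFun (congrFun (hσ x) A) B
  have h2 := congrFun (congrFun (hτ x) A) B
  simp only [lieDeriv, of_apply, Matrix.smul_apply, smul_eq_mul, Fin.sum_univ_two,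
    Pi.add_apply, Pi.smul_apply] at h1 h2 ⊢
  simp only [e]
  linear_combination s * h1 + t * h2

lemma laplacian_add_smul {χ : Bdry → ℝ} (hψ : Cinf ψ) (hχ : Cinf χ) (s t : ℝ) (x : Bdry) :
    laplacian γ (s • ψ + t • χ) x = s * laplacian γ ψ x + t * laplacian γ χ x := by
  have e : ∀ {f g : Bdry → ℝ}, Cinf f → Cinf g → ∀ D,
      pd D (s • f + t • g) = s • pd D f + t • pd D g := fun {f g} hf hg D => by
    funext x
    have df := (hf.dif) x
    have dg := (hg.dif) x
    change pd D (fun y => s * f y + t * g y) x = _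
    rw [pd_add (df.const_mul s) (dg.const_mul t), pd_const_mul df, pd_const_mul dg]
    rfl
  simp only [laplacian, e hψ hχ, e (contDiff_pd hψ _) (contDiff_pd hχ _), Fin.sum_univ_two,
    Pi.add_apply, Pi.smul_apply, smul_eq_mul]
  ring

end Conformal

/-! ### Passage to the logarithmic frame -/

section Interface

variable {π : Y →L[ℝ] Bdry} {J : Bdry →L[ℝ] Y}

/-- The components of a family of metrics in the logarithmic frame. -/
def gLog (π : Y →L[ℝ] Bdry) (g : Y → Bulk → Mat3) (i j : Fin 3) (w : Y × ℝ) : ℝ :=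
  wt i w.2 * wt j w.2 * g w.1 (pt w.2 (π w.1)) i j

/-- The components of a family of vector fields in the logarithmic frame. -/
def xLog (π : Y →L[ℝ] Bdry) (ξ : Y → Bulk → Bulk) (i : Fin 3) (w : Y × ℝ) : ℝ := ξ w.1 (pt w.2 (π w.1)) i / wt i w.2

lemma lieLog_gLog (hπ : ∀ v, π (J v) = v) {g : Y → Bulk → Mat3}
    {ξ : Y → Bulk → Bulk} (hgJ : ∀ y v, g (y + J v) = g y) (hξJ : ∀ y v, ξ (y + J v) = ξ y)
    (hG : ∀ i j, CinfOn (gLog π g i j) (far ρ))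
    (hX : ∀ i, CinfOn (xLog π ξ i) (far ρ)) {w : Y × ℝ} (hw : ρ < w.2) (i j : Fin 3) :
    lieLog J (gLog π g) (xLog π ξ) i j w = wt i w.2 * wt j w.2 * lieDeriv (ξ w.1) (g w.1) (pt w.2 (π w.1)) i j := by
  obtain ⟨y, r⟩ := w
  have d : ∀ {f : Fn Y}, CinfOn f (far ρ) → DiffAt f (y, r) := fun hf =>
    (hf.contDiffAt ((isOpen_end ρ).mem_nhds hw)).difAt
  refine (wt_mul_lieDeriv hw (fun i j => d (hG i j)) (fun i => d (hX i))
    (fun i j r' x' hr' => ?_) (fun i r' x' hr' => ?_) i j).symm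
  · simp only [gLog, map_add, hπ, hgJ, add_sub_cancel]
  · have := (wt_pos i (hρ.1.trans_lt hr')).ne'
    simp only [xLog, map_add, hπ, hξJ, add_sub_cancel]
    field_simp

lemma metricExp_of_hasExpansion [FiniteDimensional ℝ Y] {γbar : Bdry → Mat2}
    (hγ : ∀ A B, Cinf fun x => γbar x A B) {g : Y → Bulk → Mat3} {φ Crr : Y → ℝ} {C : Y → Mat2}
    (h : HasExpansion l ρ γbar π (fun y r => g y (pt r (π y))) φ Crr C) (hs : ∀ y, ∀ z ∈ region ρ, (g y z).IsSymm) :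
    MetricExp ρ l (gLog π g) (fun A B y => Real.exp (2 * φ y) * γbar (π y) A B) Crr (fun A B y => C y A B) := by
  obtain ⟨h1, h2, h3, h4, h5, h6⟩ := h
  have z := fun m => IsFall.zpow (Y := Y) (ρ := ρ) m
  refine ⟨⟨contDiff_const, h2, ?_⟩, fun A => ?_, fun A B => ⟨?_, h3 A B, ?_⟩, fun i j w hw => ?_⟩
  · refine (((z 2).mul (isLittleO_iff_isFall.1 h4)).congr fun w hw => ?_ : IsFall ρ (true && false) (2 + -4) _)
    have hw0 := (hρ.1.trans_lt hw).ne'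
    simp only [gLog, wt_zero, zpow_neg, neg_add_cancel, zpow_zero]
    norm_cast
    field_simp
  · refine (((z 1).mul (isBigO_iff_isFall.1 (h5 A))).congr fun w hw => ?_ : IsFall ρ (true && true) (1 + -3) _)
    simp [gLog]
  · exact (Real.contDiff_exp.comp (contDiff_const.mul h1)).mul ((hγ A B).comp π.contDiff)
  · refine (isLittleO_iff_isFall.1 (h6 A B)).congr fun w hw => ?_
    simp only [gLog, wt_succ, zpow_zero, zero_add]
    norm_cast
    ring
  · have hz : pt w.2 (π w.1) ∈ region ρ := hw
    simp only [gLog, (hs w.1 _ hz).apply j i]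
    ring

lemma fieldExp_iff [FiniteDimensional ℝ Y] {ξ : Y → Bulk → Bulk} {V N : Fin 2 → Y → ℝ}
    {ψ R : Y → ℝ} : FieldExp ρ l (xLog π ξ) V ψ R N ↔ (∀ A, Cinf (V A)) ∧ (∀ A, Cinf (N A)) ∧ Cinf ψ ∧ Cinf R ∧
    (IsLittleO ρ (-1) fun y r => ξ y (pt r (π y)) 0 - (-(1 / 2) * ψ y * r + R y / r)) ∧
    ∀ A : Fin 2, IsBigO ρ (-4) fun y r =>
      ξ y (pt r (π y)) A.succ - (V A y - l ^ 2 / (4 * r ^ 2) * N A y) := by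
  have z := fun m => IsFall.zpow (Y := Y) (ρ := ρ) m
  have e2 : ∀ r : ℝ, r ^ (-2 : ℤ) = (r ^ 2)⁻¹ := fun r => by rw [zpow_neg]; norm_cast
  constructor
  · intro h
    refine ⟨h.smooth_V, h.smooth_N, h.smooth_ψ, h.r.right, isLittleO_iff_isFall.2 ?_, fun A =>
      isBigO_iff_isFall.2 ?_⟩
    · refine (((z 1).mul h.r.fall).congr fun w hw => ?_ : IsFall ρ (true && false) (1 + -2) _)
      have hw0 := (hρ.1.trans_lt hw).ne'
      simp only [xLog, wt_zero, neg_add_cancel, zpow_zero, e2, zpow_one]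
      field_simp
    · refine (h.A A).congr fun w hw => ?_
      have hw0 := (hρ.1.trans_lt hw).ne'
      simp only [xLog, wt_succ, e2]
      field_simp
  · rintro ⟨hV, hN, hψ, hR, h1, h2⟩
    refine ⟨hV, hN, ⟨contDiff_const.mul hψ, hR, ?_⟩, fun A => ?_⟩
    · refine (((z (-1)).mul (isLittleO_iff_isFall.1 h1)).congr fun w hw => ?_ : IsFall ρ (true && false) (-1 + -1) _)
      have hw0 := (hρ.1.trans_lt hw).ne'
      simp only [xLog, wt_zero, neg_add_cancel, zpow_zero, e2, zpow_neg_one]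
      field_simp
    · refine (isBigO_iff_isFall.1 (h2 A)).congr fun w hw => ?_
      have hw0 := (hρ.1.trans_lt hw).ne'
      simp only [xLog, wt_succ, e2]
      field_simp

lemma gradB_eq {γ : Fin 2 → Fin 2 → Y → ℝ} {M : Mat2} {y : Y}
    (hM : ∀ A B, γ A B y = M A B) (hs : M.IsSymm) (ψ : Y → ℝ) (A : Fin 2) :
    gradB J γ ψ A y = ∑ B, M⁻¹ A B * bd J B ψ y := by
  obtain ⟨i1, i2, i3, i4⟩ := inv_two M
  have hd : det2 γ y = M.det := by rw [det_fin_two, det2, hM, hM, hM, hs.apply 0 1]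
  have h10 : M 1 0 = M 0 1 := hs.apply 0 1
  fin_cases A
  · simp only [gradB, Fin.zero_eta, cons_val_zero, Fin.sum_univ_two, i1, i2, hd, hM]
    ring
  · simp only [gradB, Fin.mk_one, cons_val_one, cons_val_zero, Fin.sum_univ_two, i3, i4, hd, hM, h10]
    ring

lemma bd_comp (hπ : ∀ v, π (J v) = v) {ψ : Bdry → ℝ} (hψ : Cinf ψ) (A : Fin 2) (y : Y) :
    bd J A (fun y => ψ (π y)) y = pd A ψ (π y) := by
  have h := ((hψ.dif) (π y)).hasFDerivAt.comp y π.hasFDerivAt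
  have h' : HasFDerivAt (fun y => ψ (π y)) _ y := h
  simp only [bd, h'.fderiv, comp_apply, hπ, pd]

lemma trace_eq {γ C : Fin 2 → Fin 2 → Y → ℝ} {M N : Mat2} {y : Y}
    (hM : ∀ A B, γ A B y = M A B) (hN : ∀ A B, C A B y = N A B) (hs : M.IsSymm) (hs' : N.IsSymm) :
    ∑ A, ∑ B, M⁻¹ A B * N A B = pol2 γ C y / det2 γ y := by
  obtain ⟨i1, i2, i3, i4⟩ := inv_two M
  have hd : det2 γ y = M.det := by rw [det_fin_two, det2, hM, hM, hM, hs.apply 0 1]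
  simp only [Fin.sum_univ_two, i1, i2, i3, i4, hd, pol2, hM, hN, hs.apply 0 1, hs'.apply 0 1]
  ring

lemma Ex.eq_of_eq {k : ℤ} {f : Fn Y} {a c : Y → ℝ} (h : Ex ρ k f a c) {y y' : Y}
    (e : ∀ r, ρ < r → f (y', r) = f (y, r)) : a y' = a y ∧ c y' = c y := by
  have ha : a y' = a y := by
    refine tendsto_nhds_unique ((h.tendsto_left y').congr' ?_) (h.tendsto_left y)
    filter_upwards [eventually_gt_atTop ρ] with r hr
    rw [e r hr]
  refine ⟨ha, ?_⟩
  have h1 := (h.fall.tendsto y').sub (h.fall.tendsto y)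
  have h2 : Tendsto (fun _ : ℝ => c y - c y') atTop (𝓝 (0 - 0)) := by
    refine h1.congr' ?_
    filter_upwards [eventually_gt_atTop ρ] with r hr
    have := zpow_ne_zero k (hρ.1.trans_lt hr).ne'
    rw [e r hr, ha, zpow_neg]
    field_simp
    ring
  have := tendsto_nhds_unique h2 tendsto_const_nhds
  linarith

/-- The Lie derivative of a periodic tensor along a periodic field is periodic. -/
lemma lieDeriv_add_period {ξ : Bulk → Bulk} {g : Bulk → Mat3} {T : Bulk}
    (hξ : ∀ z ∈ region ρ, ξ (z + T) = ξ z) (hg : ∀ z ∈ region ρ, g (z + T) = g z)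
    {z : Bulk} (hz : z ∈ region ρ) : lieDeriv ξ g (z + T) = lieDeriv ξ g z := by
  have hp : ∀ (f : Bulk → ℝ), (∀ z ∈ region ρ, f (z + T) = f z) → ∀ i, pd i f (z + T) = pd i f z := by
    intro f hf i
    rw [pd, ← fderiv_comp_add_right]
    change pd i (fun x => f (x + T)) z = pd i f z
    refine pd_congr ?_ i
    have ho : region ρ ∈ 𝓝 z := (isOpen_lt continuous_const (continuous_apply 0)).mem_nhds hz
    filter_upwards [ho] with z' hz' using hf z' hz'
  ext i j
  have hpg : ∀ i j k, pd k (fun y => g y i j) (z + T) = pd k (fun y => g y i j) z := fun i j k =>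
    hp (fun y => g y i j) (fun z hz => by rw [hg z hz]) k
  have hpξ : ∀ i k, pd k (fun y => ξ y i) (z + T) = pd k (fun y => ξ y i) z := fun i k =>
    hp (fun y => ξ y i) (fun z hz => by rw [hξ z hz]) k
  simp only [lieDeriv, of_apply, hξ z hz, hg z hz, hpg, hpξ]

lemma pt_add_period (r : ℝ) (x : Bdry) (t : ℝ) : pt r (x + Pi.single 1 t) = pt r x + Pi.single 2 t := by
  funext i; fin_cases i <;> simp [pt]

end Interface

section Constraint

variable {γ C : Fin 2 → Fin 2 → Bdry → ℝ} {V : Fin 2 → Bdry → ℝ} {c ψ R : Bdry → ℝ} {l : ℝ} {x : Bdry}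

lemma bd_id (A : Fin 2) (f : Bdry → ℝ) (x : Bdry) : bd idB A f x = pd A f x := rfl

lemma lieB_id_symm (hs : ∀ A B y, C A B y = C B A y) (A B : Fin 2) (y : Bdry) :
    lieB idB V C A B y = lieB idB V C B A y := by
  simp only [lieB, fun D => hs D A, fun D => hs D B, show C A B = C B A from funext (hs A B)]
  exact sum_congr rfl fun D _ => by ring

/-- The Lie derivative of the metric along a gradient is twice the Hessian. -/
lemma pol2_lieB_gradB (hγ : ∀ A B, Cinf (γ A B)) (hs : ∀ A B y, γ A B y = γ B A y)
    (hd : ∀ y, det2 γ y ≠ 0) (hψ : Cinf ψ) (x : Bdry) : pol2 γ (lieB idB (gradB idB γ ψ) γ) x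
      = 2 * det2 γ x * laplacian (fun y => Matrix.of fun A B => γ A B y) ψ x := by
  set N := gradB idB γ ψ with hN
  set M : Bdry → Mat2 := fun y => Matrix.of fun A B => γ A B y with hM
  have hsM : ∀ y, (M y).IsSymm := fun y => Matrix.IsSymm.ext fun A B => hs _ _ _
  have hdet : ∀ y, (M y).det = det2 γ y := fun y => by
    rw [det_fin_two, det2]; simp [hM, hs 1 0]
  have hgrad : ∀ D, grad M ψ x D = N D x := fun D =>
    (gradB_eq (J := .id ℝ Bdry) (fun A B => rfl) (hsM x) ψ D).symm
  have h1 := laplacian_explicit (ψ := ψ) (hsM x) (by rw [hdet]; exact hd x)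
  have dγ := fun A B => ((hγ A B).dif) x
  have dN := fun A => ((contDiff_gradB (J := .id ℝ Bdry) hγ hd hψ A).dif) x
  have hNd : ∀ A B, ∑ D, (pd A (γ B D) x * N D x + γ B D x * pd A (N D) x) = pd A (pd B ψ) x := by
    intro A B
    have e : (fun y => γ B 0 y * N 0 y + γ B 1 y * N 1 y) = pd B ψ := funext fun y => by
      have := sum_gradB (J := .id ℝ Bdry) hd hs ψ B y
      rw [Fin.sum_univ_two] at this
      exact this
    rw [← e, pd_add ((dγ B 0).fun_mul (dN 0)) ((dγ B 1).fun_mul (dN 1)), pd_mul (dγ B 0) (dN 0),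
      pd_mul (dγ B 1) (dN 1), Fin.sum_univ_two]
  have a00 := hNd 0 0
  have a01 := hNd 0 1
  have a10 := hNd 1 0
  have a11 := hNd 1 1
  have hγ10 : γ 1 0 = γ 0 1 := funext (hs 1 0)
  simp only [hdet, Fin.sum_univ_two, hgrad] at h1 a00 a01 a10 a11
  simp only [hM, of_apply, hγ10] at h1 a00 a01 a10 a11
  change _ = 2 * det2 γ x * laplacian M ψ x
  rw [mul_assoc, mul_comm (det2 γ x), h1]
  simp only [pol2, lieB, Fin.sum_univ_two, hγ10]
  change γ 0 0 x * (N 0 x * pd 0 (γ 1 1) x + γ 0 1 x * pd 1 (N 0) x + γ 0 1 x * pd 1 (N 0) x +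
    (N 1 x * pd 1 (γ 1 1) x + γ 1 1 x * pd 1 (N 1) x + γ 1 1 x * pd 1 (N 1) x)) +
    (N 0 x * pd 0 (γ 0 0) x + γ 0 0 x * pd 0 (N 0) x + γ 0 0 x * pd 0 (N 0) x +
    (N 1 x * pd 1 (γ 0 0) x + γ 0 1 x * pd 0 (N 1) x + γ 0 1 x * pd 0 (N 1) x)) * γ 1 1 x -
    2 * (γ 0 1 x * (N 0 x * pd 0 (γ 0 1) x + γ 0 1 x * pd 0 (N 0) x + γ 0 0 x * pd 1 (N 0) x +
    (N 1 x * pd 1 (γ 0 1) x + γ 1 1 x * pd 0 (N 1) x + γ 0 1 x * pd 1 (N 1) x))) = _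
  linear_combination 2 * γ 1 1 x * a00 + 2 * γ 0 0 x * a11 - 2 * γ 0 1 x * (a01 + a10)

/-- The variation of the constraint is the Laplacian of `ψ`. -/
lemma constraint_variation (hl : l ≠ 0) (hγ : ∀ A B, Cinf (γ A B)) (hs : ∀ A B y, γ A B y = γ B A y)
    (hd : ∀ y, det2 γ y ≠ 0) (hC : ∀ A B, Cinf (C A B)) (hsC : ∀ A B y, C A B y = C B A y)
    (hψ : Cinf ψ) (hc : Cinf c) (hcon : ∀ y, c y * det2 γ y = -l ^ 2 * pol2 γ C y)
    {σ om : ℝ} (hσ : ∀ A B, lieB idB V γ A B x = σ * γ A B x) (hom : 2 * om = σ - ψ x) :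
    -2 * om * (pol2 γ C x / det2 γ x) + pol2 γ (fun A B y => 2 * R y * γ A B y + lieB idB V C A B y
        - l ^ 2 / 4 * lieB idB (gradB idB γ ψ) γ A B y) x / det2 γ x
      + 1 / l ^ 2 * (ψ x * c x - 4 * l ^ 2 * R x + ∑ A, V A x * bd idB A c x)
      = -(l ^ 2 / 2) * laplacian (fun y => Matrix.of fun A B => γ A B y) ψ x := by
  have hL := pol2_lieB_gradB hγ hs hd hψ x
  have dγ := fun A B => ((hγ A B).dif) x
  have dC := fun A B => ((hC A B).dif) x
  have dc := (hc.dif) x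
  have hdc : ∀ D, pd D c x * det2 γ x + c x * (pd D (γ 0 0) x * γ 1 1 x + γ 0 0 x * pd D (γ 1 1) x
      - 2 * (pd D (γ 0 1) x * γ 0 1 x)) = -l ^ 2 * (pd D (γ 0 0) x * C 1 1 x + γ 0 0 x * pd D (C 1 1) x
      + (pd D (C 0 0) x * γ 1 1 x + C 0 0 x * pd D (γ 1 1) x)
      - 2 * (pd D (γ 0 1) x * C 0 1 x + γ 0 1 x * pd D (C 0 1) x)) := by
    intro D
    have e : (fun y => c y * (γ 0 0 y * γ 1 1 y + (-1) * (γ 0 1 y * γ 0 1 y)))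
        = fun y => -l ^ 2 * ((γ 0 0 y * C 1 1 y + C 0 0 y * γ 1 1 y) + (-2) * (γ 0 1 y * C 0 1 y)) :=
      funext fun y => by have := hcon y; simp only [det2, pol2] at this; linarith
    have e1 := congrFun (congrArg (pd D) e) x
    have d1 := ((dγ 0 0).fun_mul (dγ 1 1))
    have d2 := ((dγ 0 1).fun_mul (dγ 0 1))
    have d3 := ((dγ 0 0).fun_mul (dC 1 1))
    have d4 := ((dC 0 0).fun_mul (dγ 1 1))
    have d5 := ((dγ 0 1).fun_mul (dC 0 1))
    rw [pd_mul dc (d1.fun_add (d2.const_mul _)), pd_add d1 (d2.const_mul _), pd_const_mul d2,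
      pd_const_mul ((d3.fun_add d4).fun_add (d5.const_mul _)), pd_add (d3.fun_add d4) (d5.const_mul _),
      pd_add d3 d4, pd_const_mul d5, pd_mul (dγ 0 0) (dγ 1 1), pd_mul (dγ 0 1) (dγ 0 1),
      pd_mul (dγ 0 0) (dC 1 1), pd_mul (dC 0 0) (dγ 1 1), pd_mul (dγ 0 1) (dC 0 1)] at e1
    simp only [det2]
    linear_combination e1
  have b0 := hdc 0
  have b1 := hdc 1
  have s00 := hσ 0 0
  have s01 := hσ 0 1
  have s11 := hσ 1 1
  have hc0 := hcon x
  have hγ10 : γ 1 0 = γ 0 1 := funext (hs 1 0)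
  have hC10 : C 1 0 = C 0 1 := funext (hsC 1 0)
  have hLC : pol2 γ (lieB idB V C) x = -(1 / l ^ 2) * (V 0 x * pd 0 c x + V 1 x * pd 1 c x) * det2 γ x
      + σ * pol2 γ C x := by
    simp only [lieB, bd_id, Fin.sum_univ_two, hγ10] at s00 s01 s11
    have hl2 : l ^ 2 ≠ 0 := pow_ne_zero 2 hl
    apply mul_left_cancel₀ hl2
    have e1 : l ^ 2 * (-(1 / l ^ 2) * (V 0 x * pd 0 c x + V 1 x * pd 1 c x) * det2 γ x + σ * pol2 γ C x)
        = -(V 0 x * pd 0 c x + V 1 x * pd 1 c x) * det2 γ x + l ^ 2 * σ * pol2 γ C x := by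
      field_simp
    rw [e1]
    simp only [pol2, det2, lieB, bd_id, Fin.sum_univ_two, hC10] at b0 b1 hc0 ⊢
    linear_combination V 0 x * b0 + V 1 x * b1 - l ^ 2 * (C 1 1 x * s00 + C 0 0 x * s11 - 2 * C 0 1 x * s01)
      - c x * (γ 1 1 x * s00 + γ 0 0 x * s11 - 2 * γ 0 1 x * s01) - (2 * σ - 2 * (pd 0 (V 0) x + pd 1 (V 1) x)) * hc0
  have hsplit : pol2 γ (fun A B y => 2 * R y * γ A B y + lieB idB V C A B y
        - l ^ 2 / 4 * lieB idB (gradB idB γ ψ) γ A B y) x = 4 * R x * det2 γ x + pol2 γ (lieB idB V C) x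
        - l ^ 2 / 4 * pol2 γ (lieB idB (gradB idB γ ψ) γ) x := by
    simp only [pol2, det2]; ring
  have hbd : ∑ A, V A x * bd idB A c x = V 0 x * pd 0 c x + V 1 x * pd 1 c x := Fin.sum_univ_two _
  rw [hsplit, hLC, hL, hbd]
  have := hd x
  have hc1 : c x = -l ^ 2 * pol2 γ C x / det2 γ x := by rw [eq_div_iff this, hc0]
  rw [hc1]
  field_simp
  linear_combination (-8 * l ^ 2 * pol2 γ C x) * hom

end Constraint

/-! ### Vector fields preserving the conditions at a metric -/

variable (m : AsympMetric l ρ γbar) {ξ : FieldVF l ρ γbar} {c : P → AsympMetric l ρ γbar}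

section PartOne

lemma AsympMetric.contDiff_γ (A B : Fin 2) : Cinf fun y => m.γ y A B :=
  contDiff_conformal (fun A B => (hγ.1.smooth A B).1) m.expansion.1 A B

lemma AsympMetric.isSymm_γ (x : Bdry) : (m.γ x).IsSymm := (hγ.1.symm x).smul _

lemma AsympMetric.det_γ_neg (x : Bdry) : (m.γ x).det < 0 := by
  rw [AsympMetric.γ, det_smul]
  exact mul_neg_of_pos_of_neg (by positivity) (hγ.1.lorentz x)

lemma AsympMetric.det2_γ (x : Bdry) : det2 (fun A B y => m.γ y A B) x = (m.γ x).det := by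
  rw [det_fin_two, det2, (m.isSymm_γ x).apply 0 1]

lemma AsympMetric.periodic_γ (x : Bdry) : m.γ (x + period 1) = m.γ x := by
  ext A B
  simp only [AsympMetric.γ, m.periodic_φ, Matrix.smul_apply, (hγ.1.smooth A B).2 x]

lemma AsympMetric.metricExp :
    MetricExp ρ l (gLog idB fun _ => m.g) (fun A B y => m.γ y A B) m.Crr (fun A B y => m.C y A B) :=
  metricExp_of_hasExpansion (π := .id ℝ Bdry) (g := fun _ => m.g)
    (fun A B => (hγ.1.smooth A B).1) m.expansion fun _ z hz => m.symm z hz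

lemma MetricExp.symm_C {G : Fin 3 → Fin 3 → Fn Y} {γ C : Fin 2 → Fin 2 → Y → ℝ} {c : Y → ℝ}
    (hG : MetricExp ρ l G γ c C) (A B : Fin 2) (y : Y) : C A B y = C B A y :=
  congrFun ((hG.AB A B).unique ((hG.AB B A).congr fun w hw => hG.symm _ _ w hw)).2 y

lemma AsympMetric.isSymm_C (x : Bdry) : (m.C x).IsSymm := Matrix.IsSymm.ext fun A B => (m.metricExp).symm_C B A x

lemma isLittleO_sq_iff {f : ℝ → ℝ} : f =o[atTop] (fun r : ℝ => r ^ (-2 : ℤ)) ↔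
    Tendsto (fun r => r ^ 2 * f r) atTop (𝓝 0) := by
  rw [isLittleO_iff_tendsto']
  · refine tendsto_congr fun r => ?_
    rw [zpow_neg, div_inv_eq_mul, mul_comm]
    norm_cast
  · filter_upwards [eventually_gt_atTop 0] with r hr h
    exact absurd h (zpow_ne_zero _ hr.ne')

lemma tendsto_extrinsicTrace_iff (hl : 0 < l) {G : Fin 3 → Fin 3 → Bdry × ℝ → ℝ}
    {γ C : Fin 2 → Fin 2 → Bdry → ℝ} {c : Bdry → ℝ} (hG : MetricExp ρ l G γ c C) {g : Bulk → Mat3}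
    (hg : ∀ i j r x, ρ < r → wt i r * wt j r * g (pt r x) i j = G i j (x, r)) {x : Bdry} (hγ : det2 γ x < 0) :
    (fun r => extrinsicTrace g (pt r x) - (-2 / l)) =o[atTop] (fun r : ℝ => r ^ (-2 : ℤ)) ↔
      c x * det2 γ x = -l ^ 2 * pol2 γ C x := by
  rw [isLittleO_sq_iff]
  have h1 := tendsto_extrinsicTrace hl hG hg hγ
  have h2 : 1 / l * (c x / l ^ 2 + pol2 γ C x / det2 γ x) = 0 ↔ c x * det2 γ x = -l ^ 2 * pol2 γ C x := by
    have := hγ.ne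
    field_simp
    constructor <;> intro h <;> linarith
  rw [← h2]
  exact ⟨fun h => tendsto_nhds_unique h1 h, fun h => h ▸ h1⟩

lemma AsympMetric.constraint (hl : 0 < l)
    (m : AsympMetric l ρ γbar) (x : Bdry) : m.Crr x * det2 (fun A B y => m.γ y A B) x
      = -l ^ 2 * pol2 (fun A B y => m.γ y A B) (fun A B y => m.C y A B) x :=
  (tendsto_extrinsicTrace_iff hl (m.metricExp) (fun _ _ _ _ _ => rfl)
    (by rw [m.det2_γ]; exact m.det_γ_neg x)).1 (m.extrinsic x)

lemma contDiff_pt : Cinf fun w : Bdry × ℝ => pt w.2 w.1 := by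
  refine contDiff_pi.2 fun i => ?_
  refine Fin.cases ?_ (fun A => ?_) i
  · simpa using contDiff_snd
  · simp only [pt_succ]
    exact (contDiff_apply ℝ ℝ A).comp contDiff_fst

lemma contDiffOn_wt_inv (i : Fin 3) : CinfOn (fun w : Y × ℝ => (wt i w.2)⁻¹) (far ρ) := by
  refine Fin.cases ?_ (fun A => ?_) i
  · simp only [wt_zero]
    exact ContDiffOn.inv contDiffOn_snd fun w hw => (hρ.1.trans_lt hw).ne'
  · simpa using contDiffOn_const

lemma IsBulkField.xLog_contDiffOn {ξ : Bulk → Bulk} (hξ : IsBulkField ρ ξ) (i : Fin 3) :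
    CinfOn (xLog idB (fun _ => ξ) i) (far ρ) := by
  have h1 : CinfOn (fun w : Bdry × ℝ => ξ (pt w.2 w.1) i) (far ρ) :=
    (contDiffOn_pi.1 (hξ.1.comp contDiff_pt.contDiffOn fun w hw => hw)) i
  exact h1.mul (contDiffOn_wt_inv i)

/-- The data entering the definition of `Preserves`, in the logarithmic frame. -/
lemma preserves_iff_lieLog {ξ : Bulk → Bulk} (hξ : IsBulkField ρ ξ) : Preserves m ξ ↔
    ∃ (om ηrr : Bdry → ℝ) (η : Bdry → Mat2), CylSmooth om ∧ CylSmooth ηrr ∧ (∀ A B, CylSmooth fun x => η x A B) ∧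
      Ex ρ (-2) (lieLog idB (gLog idB fun _ => m.g) (xLog idB fun _ => ξ) 0 0) 0 ηrr ∧
      (∀ A : Fin 2, IsFall ρ true (-2) (lieLog idB (gLog idB fun _ => m.g) (xLog idB fun _ => ξ) 0 A.succ)) ∧
      (∀ A B : Fin 2, Ex ρ 0 (lieLog idB (gLog idB fun _ => m.g)
        (xLog idB fun _ => ξ) A.succ B.succ) (fun x => 2 * om x * m.γ x A B) (fun x => η x A B)) ∧
      ∀ x, -2 * om x * (∑ A, ∑ B, (m.γ x)⁻¹ A B * m.C x A B)
        + (∑ A, ∑ B, (m.γ x)⁻¹ A B * η x A B) + 1 / l ^ 2 * ηrr x = 0 := by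
  have z := fun k => IsFall.zpow (Y := Bdry) (ρ := ρ) k
  have e : ∀ i j (w : Bdry × ℝ), ρ < w.2 → lieLog idB (gLog idB fun _ => m.g)
      (xLog idB fun _ => ξ) i j w = wt i w.2 * wt j w.2 * lieDeriv ξ m.g (pt w.2 w.1) i j :=
    fun i j w hw => lieLog_gLog (fun _ => rfl) (fun _ _ => rfl) (fun _ _ => rfl)
      ((m.metricExp).differentiableAt) (hξ.xLog_contDiffOn) hw i j
  have e2 : ∀ r : ℝ, r ^ (-2 : ℤ) = (r ^ 2)⁻¹ := fun r => by rw [zpow_neg]; norm_cast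
  refine exists_congr fun om => exists_congr fun ηrr => exists_congr fun η =>
    and_congr_right fun ho => and_congr_right fun hr => and_congr_right fun hη =>
    and_congr ?_ (and_congr (forall_congr' fun A => ?_) (and_congr_left fun _ =>
      forall_congr' fun A => forall_congr' fun B => ?_))
  · rw [isLittleO_iff_isFall]
    constructor
    · intro h
      refine ⟨contDiff_const, hr.1, (((z 2).mul h).congr fun w hw => ?_ : IsFall ρ (true && false) (2 + -4) _)⟩
      have hw0 := (hρ.1.trans_lt hw).ne'
      rw [e 0 0 w hw]
      simp only [wt_zero, e2, Pi.zero_apply, mul_zero, zero_add]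
      norm_cast
      field_simp
    · intro h
      refine (((z (-2)).mul h.fall).congr fun w hw => ?_ : IsFall ρ (true && false) (-2 + -2) _)
      have hw0 := (hρ.1.trans_lt hw).ne'
      rw [e 0 0 w hw]
      simp only [wt_zero, e2, Pi.zero_apply, mul_zero, zero_add]
      field_simp
  · rw [isBigO_iff_isFall]
    constructor
    · intro h
      refine (((z 1).mul h).congr fun w hw => ?_ : IsFall ρ (true && true) (1 + -3) _)
      rw [e 0 _ w hw]
      simp
    · intro h
      refine (((z (-1)).mul h).congr fun w hw => ?_ : IsFall ρ (true && true) (-1 + -2) _)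
      have hw0 := (hρ.1.trans_lt hw).ne'
      rw [e 0 _ w hw]
      simp only [wt_zero, wt_succ, mul_one, zpow_neg_one]
      field_simp
  · rw [isLittleO_iff_isFall]
    constructor
    · intro h
      refine ⟨(contDiff_const.mul ho.1).mul (m.contDiff_γ A B), (hη A B).1, h.congr fun w hw => ?_⟩
      rw [e _ _ w hw]
      simp only [wt_succ, zpow_zero, zero_add]
      norm_cast
      ring
    · intro h
      refine h.fall.congr fun w hw => ?_
      rw [e _ _ w hw]
      simp only [wt_succ, zpow_zero, zero_add]
      norm_cast
      ring

lemma preserves_iff_of_fieldExp (hl : 0 < l)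
    (m : AsympMetric l ρ γbar) {ξ : Bulk → Bulk} (hξ : IsBulkField ρ ξ) {V : Fin 2 → Bdry → ℝ}
    {ψ R : Bdry → ℝ} (hX : FieldExp ρ l (xLog idB fun _ => ξ) V ψ R (gradB idB (fun A B y => m.γ y A B) ψ)) :
    Preserves m ξ ↔ IsConformalKilling m.γ (fun x A => V A x) ∧ ∀ x, laplacian m.γ ψ x = 0 := by
  have hG := m.metricExp
  have hd : ∀ y, det2 (fun A B y => m.γ y A B) y ≠ 0 := fun y => by
    rw [m.det2_γ]; exact (m.det_γ_neg y).ne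
  have hs : ∀ A B y, m.γ y A B = m.γ y B A := fun A B y => (m.isSymm_γ y).apply B A
  have h00 := lieLog_rr (J := .id ℝ Bdry) hG hX
  have h0A := lieLog_rA (J := .id ℝ Bdry) hG hX fun A y => sum_gradB hd hs ψ A y
  have hψ := hX.smooth_ψ
  have hlie : ∀ A B x, lieDeriv (fun x A => V A x) m.γ x A B
      = lieB idB V (fun A B y => m.γ y A B) A B x := fun A B x => rfl
  obtain ⟨S, hS⟩ : ∃ S : Fin 2 → Fin 2 → Bdry → ℝ, S = fun A B y => 2 * R y * m.γ y A B
      + lieB idB V (fun A B y => m.C y A B) A B y - l ^ 2 / 4 * lieB idB (gradB idB (fun A B y => m.γ y A B) ψ)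
        (fun A B y => m.γ y A B) A B y := ⟨_, rfl⟩
  have hAB : ∀ A B : Fin 2, Ex ρ 0 (lieLog idB (gLog idB fun _ => m.g) (xLog idB fun _ => ξ) A.succ B.succ)
      (fun y => lieB idB V (fun A B y => m.γ y A B) A B y - ψ y * m.γ y A B) (S A B) := by
    subst hS
    exact lieLog_AB (J := .id ℝ Bdry) hG hX
  have hSs : ∀ A B x, S A B x = S B A x := fun A B x => by
    subst hS
    simp only []
    rw [hs, lieB_id_symm hG.symm_C, lieB_id_symm hs]
  have hvar : ∀ x (σ om : ℝ), (∀ A B, lieB idB V (fun A B y => m.γ y A B) A B x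
      = σ * m.γ x A B) → 2 * om = σ - ψ x → -2 * om * (∑ A, ∑ B, (m.γ x)⁻¹ A B * m.C x A B)
        + (∑ A, ∑ B, (m.γ x)⁻¹ A B * S A B x)
        + 1 / l ^ 2 * (ψ x * m.Crr x - 4 * l ^ 2 * R x + ∑ A, V A x * bd idB A m.Crr x)
        = -(l ^ 2 / 2) * laplacian m.γ ψ x := fun x σ om h1 h2 => by
    have e2 := trace_eq (γ := fun A B y => m.γ y A B) (C := S) (y := x)
      (N := Matrix.of fun A B => S A B x) (fun _ _ => rfl) (fun A B => rfl) (m.isSymm_γ x)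
      (Matrix.IsSymm.ext fun A B => hSs B A x)
    simp only [of_apply] at e2
    rw [trace_eq (γ := fun A B y => m.γ y A B) (C := fun A B y => m.C y A B) (fun _ _ => rfl)
        (fun _ _ => rfl) (m.isSymm_γ x) (m.isSymm_C x), e2]
    subst hS
    exact constraint_variation (V := V) (R := R) (x := x) (σ := σ) (om := om) hl.ne'
      (m.contDiff_γ) hs hd (fun A B => (hG.AB A B).right) hG.symm_C hψ hG.rr.right (m.constraint hl) h1 h2
  rw [preserves_iff_lieLog m hξ]
  constructor
  · rintro ⟨om, ηrr, η, ho, hr, hη, k1, k2, k3, k4⟩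
    have u1 := (h00.unique k1).2
    have u2 := fun A B => (hAB A B).unique (k3 A B)
    have hσ : ∀ x A B, lieB idB V (fun A B y => m.γ y A B) A B x = (2 * om x + ψ x) * m.γ x A B := fun x A B => by
      have : lieB idB V (fun A B y => m.γ y A B) A B x - ψ x * m.γ x A B = 2 * om x * m.γ x A B := congrFun (u2 A B).1 x
      linarith
    refine ⟨⟨fun x => 2 * om x + ψ x, fun x => ?_⟩, fun x => ?_⟩
    · ext A B
      rw [hlie, hσ]
      rfl
    · have h1 := hvar x (2 * om x + ψ x) (om x) (hσ x) (by ring)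
      have h2 : ∀ A B, S A B x = η x A B := fun A B => congrFun (u2 A B).2 x
      have h4 := k4 x
      rw [← congrFun u1 x] at h4
      simp only [← h2] at h4
      rw [h1] at h4
      have := pow_pos hl 2
      simpa [this.ne'] using h4
  · rintro ⟨⟨σ, hσ⟩, hΔ⟩
    have hσ' : ∀ x A B, lieB idB V (fun A B y => m.γ y A B) A B x = σ x * m.γ x A B :=
      fun x A B => by rw [← hlie, hσ]; rfl
    set om : Bdry → ℝ := fun y => pol2 (fun A B y => m.γ y A B) (fun A B y =>
      lieB idB V (fun A B y => m.γ y A B) A B y - ψ y * m.γ y A B) y / (4 * det2 (fun A B y => m.γ y A B) y) with hom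
    have hom2 : ∀ y, 2 * om y = σ y - ψ y := fun y => by
      simp only [hom, pol2, hσ']
      have := hd y
      rw [← mul_div_assoc, div_eq_iff (by simpa using this)]
      simp only [det2]
      ring
    have hper : ∀ (i j : Fin 3) (x : Bdry) r, ρ < r → lieLog idB (gLog idB fun _ => m.g)
        (xLog idB fun _ => ξ) i j (x + period 1, r) =
        lieLog idB (gLog idB fun _ => m.g) (xLog idB fun _ => ξ) i j (x, r) := by
      intro i j x r hr
      have e := fun x => lieLog_gLog (J := .id ℝ Bdry) (π := .id ℝ Bdry) (g := fun _ => m.g)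
        (ξ := fun _ => ξ) (w := (x, r)) (fun _ => rfl) (fun _ _ => rfl) (fun _ _ => rfl)
        (hG.differentiableAt) (hξ.xLog_contDiffOn) hr i j
      rw [e, e]
      simp only [id_apply, pt_add_period]
      rw [lieDeriv_add_period hξ.2 m.periodic hr]
    have pAB := fun A B x => (hAB A B).eq_of_eq (hper A.succ B.succ x)
    have hγper : ∀ x A B, m.γ (x + period 1) A B = m.γ x A B := fun x A B => by
      rw [m.periodic_γ]
    refine ⟨om, _, fun y => Matrix.of fun A B => S A B y, ⟨?_, fun x => ?_⟩,
      ⟨h00.right, fun x => (h00.eq_of_eq (hper 0 0 x)).2⟩, fun A B => ?_, h00, h0A,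
      fun A B => (hAB A B).congr_coeff (fun y => ?_) fun y => rfl, fun x => ?_⟩
    · have g := m.contDiff_γ
      have s := fun A B => (hAB A B).left
      refine ContDiff.div ((((g 0 0).mul (s 1 1)).add ((s 0 0).mul (g 1 1))).sub
        (contDiff_const.mul ((g 0 1).mul (s 0 1)))) (contDiff_const.mul (((g 0 0).mul (g 1 1)).sub
        ((g 0 1).mul (g 0 1)))) fun y => by simpa using hd y
    · have s := fun A B => (pAB A B x).1
      simp only [hom, pol2, det2, hγper]
      simp only [hγper] at s
      rw [s 0 0, s 1 1, s 0 1]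
    · exact (⟨(hAB A B).right, fun x => (pAB A B x).2⟩ : CylSmooth (S A B))
    · rw [hom2, hσ']; ring
    · have h1 := hvar x (σ x) (om x) (hσ' x) (hom2 x)
      rw [hΔ x, mul_zero] at h1
      exact h1

end PartOne

/-! ### The form of the vector fields, at a metric and in families -/

section Translation

variable {Y Y' : Type*} [NormedAddCommGroup Y] [NormedSpace ℝ Y] [NormedAddCommGroup Y']
  [NormedSpace ℝ Y'] {ρ : ℝ} {k : ℤ} {b : Bool} {f : Fn Y}

lemma logD_comp_add (y₀ : Y) (v w : Y × ℝ) : logD v (fun w => f (w.1 + y₀, w.2)) w = logD v f (w.1 + y₀, w.2) := by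
  have h : (fun w : Y × ℝ => f (w.1 + y₀, w.2)) = fun w => f (w + (y₀, 0)) := by
    funext w
    congr 1
    ext <;> simp
  simp only [logD, h, fderiv_comp_add_right]
  congr 2
  ext <;> simp

lemma IsFall.comp_add (hf : IsFall ρ b k f) (y₀ : Y) : IsFall ρ b k (fun w => f (w.1 + y₀, w.2)) := by
  have smooth : CinfOn (fun w : Y × ℝ => f (w.1 + y₀, w.2)) (far ρ) :=
    hf.smooth.comp ((contDiff_fst.add contDiff_const).prodMk contDiff_snd).contDiffOn fun w hw => hw
  refine ⟨smooth, fun K hK => ⟨germSmooth_of_contDiffOn smooth K, fun n => ?_⟩⟩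
  have ht : Tendsto (fun w : Y × ℝ => ((w.1 + y₀, w.2) : Y × ℝ)) (endAt K) (endAt ((fun y => y + y₀) '' K)) :=
    (tendsto_principal.2 ((eventually_mem_endAt K).mono fun w hw =>
      Set.mem_image_of_mem (fun y => y + y₀) hw)).prodMk tendsto_snd
  have hsm : ∀ f : Fn Y, Small b ((fun y => y + y₀) '' K) k f → Small b K k (fun w => f (w.1 + y₀, w.2)) := by
    intro f hf
    cases b
    · exact IsLittleO.comp_tendsto hf ht
    · exact IsBigO.comp_tendsto hf ht
  have aux : ∀ n (f : Fn Y), Jet b ((fun y => y + y₀) '' K) k n f → Jet b K k n (fun w => f (w.1 + y₀, w.2)) := by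
    intro n
    induction n with
    | zero => exact fun f h => hsm f h
    | succ n ih =>
      refine fun f h => ⟨hsm f h.1, fun v => ?_⟩
      rw [funext fun w => logD_comp_add (f := f) y₀ v w]
      exact ih _ (h.2 v)
  exact aux n f ((hf.fall _ (hK.image (by fun_prop))).jet n)

/-- Restriction to an affine subspace of parameters. -/
lemma IsFall.comp_affine (hf : IsFall ρ b k f) (L : Y' →L[ℝ] Y) (y₀ : Y) :
    IsFall ρ b k (fun w : Y' × ℝ => f (L w.1 + y₀, w.2)) := (hf.comp_add y₀).comp_clm L

lemma Ex.comp_affine {a c : Y → ℝ} (h : Ex ρ k f a c) (L : Y' →L[ℝ] Y) (y₀ : Y) :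
    Ex ρ k (fun w : Y' × ℝ => f (L w.1 + y₀, w.2)) (fun y => a (L y + y₀)) (fun y => c (L y + y₀)) :=
  ⟨h.left.comp (L.contDiff.add contDiff_const), h.right.comp (L.contDiff.add contDiff_const), h.fall.comp_affine L y₀⟩

lemma FieldExp.comp_affine {l : ℝ} {X : Fin 3 → Fn Y} {V N : Fin 2 → Y → ℝ} {ψ R : Y → ℝ}
    (h : FieldExp ρ l X V ψ R N) (L : Y' →L[ℝ] Y) (y₀ : Y) :
    FieldExp ρ l (fun i (w : Y' × ℝ) => X i (L w.1 + y₀, w.2)) (fun A y => V A (L y + y₀))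
      (fun y => ψ (L y + y₀)) (fun y => R (L y + y₀)) (fun A y => N A (L y + y₀)) :=
  ⟨fun A => (h.smooth_V A).comp (L.contDiff.add contDiff_const),
    fun A => (h.smooth_N A).comp (L.contDiff.add contDiff_const), h.r.comp_affine L y₀,
    fun A => (h.A A).comp_affine L y₀⟩

end Translation

section Family

lemma AsympMetric.gradB_γ (ψ : Bdry → ℝ) (A : Fin 2) (x : Bdry) :
    gradB idB (fun A B y => m.γ y A B) ψ A x = grad m.γ ψ x A := gradB_eq (fun _ _ => rfl) (m.isSymm_γ x) ψ A

lemma hasForm_iff_fieldExp {ξ : Bulk → Bulk} {Y : Bdry → Bdry} {ψ : Bdry → ℝ} (hY : CylSmooth Y) (hψ : CylSmooth ψ) :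
    HasForm m ξ Y ψ ↔ ∃ R, CylSmooth R ∧ FieldExp ρ l (xLog idB fun _ => ξ) (fun A x => Y x A) ψ R
      (gradB idB (fun A B y => m.γ y A B) ψ) := by
  have hN : ∀ A, Cinf (gradB idB (fun A B y => m.γ y A B) ψ A) := fun A =>
    contDiff_gradB (m.contDiff_γ) (fun y => by rw [m.det2_γ]; exact (m.det_γ_neg y).ne) hψ.1 A
  constructor
  · rintro ⟨⟨R, hR, h1⟩, h2⟩
    refine ⟨R, hR, (fieldExp_iff).2 ⟨contDiff_pi.1 hY.1, hN, hψ.1, hR.1, h1, fun A => ?_⟩⟩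
    simp only [m.gradB_γ]
    exact h2 A
  · rintro ⟨R, hR, h⟩
    obtain ⟨-, -, -, -, h1, h2⟩ := (fieldExp_iff).1 h
    simp only [m.gradB_γ] at h2
    exact ⟨⟨R, hR, h1⟩, h2⟩

/-- The form of the vector fields preserving the asymptotic conditions at a metric. -/
lemma preserves_iff (hl : 0 < l) (m : AsympMetric l ρ γbar) {ξ : Bulk → Bulk} (hξ : IsBulkField ρ ξ) :
    Preserves m ξ ↔ ∃ (Y : Bdry → Bdry) (ψ : Bdry → ℝ), CylSmooth Y ∧ CylSmooth ψ ∧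
      IsConformalKilling m.γ Y ∧ (∀ x, laplacian m.γ ψ x = 0) ∧ HasForm m ξ Y ψ := by
  constructor
  · intro h
    obtain ⟨om, ηrr, η, ho, hr, hη, k1, k2, k3, -⟩ := (preserves_iff_lieLog m hξ).1 h
    obtain ⟨V, ψ, R, hX⟩ := exists_fieldExp (J := .id ℝ Bdry) hl.ne' (m.metricExp)
      (fun A B y => (m.isSymm_γ y).apply B A)
      (fun y => by rw [m.det2_γ]; exact (m.det_γ_neg y).ne) (hξ.xLog_contDiffOn) k1 k2 fun A B => (k3 A B).big'
    obtain ⟨c1, c2⟩ := (preserves_iff_of_fieldExp hl m hξ hX).1 h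
    have e : ∀ i x r, ρ < r → xLog idB (fun _ => ξ) i (x + period 1, r)
        = xLog idB (fun _ => ξ) i (x, r) := fun i x r hr => by
      simp only [xLog, id_apply, pt_add_period]
      rw [hξ.2 _ hr]
    have hY : CylSmooth fun x A => V A x := ⟨contDiff_pi.2 hX.smooth_V, fun x => funext fun A =>
      ((hX.A_ex A).eq_of_eq (e A.succ x)).1⟩
    have hψ : CylSmooth ψ := ⟨hX.smooth_ψ, fun x => by
      have := (hX.r.eq_of_eq (e 0 x)).1
      linarith⟩
    exact ⟨_, ψ, hY, hψ, c1, c2, (hasForm_iff_fieldExp m hY hψ).2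
      ⟨R, ⟨hX.r.right, fun x => (hX.r.eq_of_eq (e 0 x)).2⟩, hX⟩⟩
  · rintro ⟨Y, ψ, hY, hψ, c1, c2, h⟩
    obtain ⟨R, -, hX⟩ := (hasForm_iff_fieldExp m hY hψ).1 h
    exact (preserves_iff_of_fieldExp hl m hξ hX).2 ⟨c1, c2⟩

lemma IsSmoothFamily.metricExp (hc : IsSmoothFamily c) : MetricExp ρ l (gLog sndB P fun y => (c y.1).g) (famG c)
      (fun y => (c y.1).Crr y.2) (fun A B y => (c y.1).C y.2 A B) :=
  metricExp_of_hasExpansion (π := .snd ℝ P Bdry) (g := fun y => (c y.1).g)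
    (fun A B => (hγ.1.smooth A B).1) hc fun y z hz => (c y.1).symm z hz

lemma IsSmoothFamily.contDiff_γ (hc : IsSmoothFamily c) (A B : Fin 2) : Cinf fun y : P × Bdry => (c y.1).γ y.2 A B :=
  (Real.contDiff_exp.comp (contDiff_const.mul hc.1)).mul ((hγ.1.smooth A B).1.comp contDiff_snd)

lemma IsSmoothFamily.const : IsSmoothFamily fun _ : P => m := by
  obtain ⟨h1, h2, h3, h4, h5, h6⟩ := m.expansion
  refine ⟨h1.comp contDiff_snd, h2.comp contDiff_snd, fun A B => (h3 A B).comp contDiff_snd, ?_,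
    fun A => ?_, fun A B => ?_⟩
  · exact isLittleO_iff_isFall.2 ((isLittleO_iff_isFall.1 h4).comp_clm sndB P)
  · exact isBigO_iff_isFall.2 ((isBigO_iff_isFall.1 (h5 A)).comp_clm sndB P)
  · exact isLittleO_iff_isFall.2 ((isLittleO_iff_isFall.1 (h6 A B)).comp_clm sndB P)

lemma family_gradB (c : P → AsympMetric l ρ γbar) {ψ : Bdry → ℝ} (hψ : CylSmooth ψ) (A : Fin 2) (y : P × Bdry) :
    gradB inB P (famG c) (fun y => ψ y.2) A y = grad (c y.1).γ ψ y.2 A := by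
  rw [gradB_eq (M := (c y.1).γ y.2) (fun _ _ => rfl) ((c y.1).isSymm_γ y.2)]
  exact sum_congr rfl fun B _ => congrArg _ (bd_comp (J := .inr ℝ P Bdry) (π := .snd ℝ P Bdry) (fun _ => rfl) hψ.1 B y)

lemma family_contDiff_gradB (hc : IsSmoothFamily c) {ψ : Bdry → ℝ} (hψ : CylSmooth ψ) (A : Fin 2) : Cinf
      (gradB inB P (famG c) (fun y => ψ y.2) A) := contDiff_gradB (hc.contDiff_γ) (fun y => by
    have := (c y.1).det2_γ y.2
    simp only [det2] at this ⊢
    rw [this]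
    exact ((c y.1).det_γ_neg y.2).ne) (hψ.1.comp contDiff_snd) A

variable {Y : Bdry → Bdry} {ψ : Bdry → ℝ}

/-- The forms of a metric dependent vector field on a family, in the logarithmic frame. -/
lemma family_form_iff (hY : CylSmooth Y) (hψ : CylSmooth ψ) (hc : IsSmoothFamily c) (R : P × Bdry → ℝ) :
    FieldExp ρ l (xLog sndB P fun y => ξ (c y.1)) (fun A y => Y y.2 A) (fun y => ψ y.2) R
      (gradB inB P (famG c) (fun y => ψ y.2)) ↔ (Cinf R ∧ IsLittleO ρ (-1) fun (y : P × Bdry) r =>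
      ξ (c y.1) (pt r y.2) 0 - (-(1 / 2) * ψ y.2 * r + R y / r)) ∧
    ∀ A : Fin 2, IsBigO ρ (-4) fun (y : P × Bdry) r =>
      ξ (c y.1) (pt r y.2) A.succ - (Y y.2 A - l ^ 2 / (4 * r ^ 2) * grad (c y.1).γ ψ y.2 A) := by
  rw [fieldExp_iff]
  simp only [family_gradB c hψ]
  constructor
  · rintro ⟨-, -, -, h1, h2, h3⟩
    exact ⟨⟨h1, h2⟩, h3⟩
  · rintro ⟨⟨h1, h2⟩, h3⟩
    refine ⟨fun A => ((contDiff_apply ℝ ℝ A).comp hY.1).comp contDiff_snd, fun A => ?_,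
      hψ.1.comp contDiff_snd, h1, h2, h3⟩
    have := family_contDiff_gradB hc hψ A
    rwa [funext fun y => family_gradB c hψ A y] at this ⊢

lemma IsGenerator.fieldExp (h : IsGenerator ξ Y ψ)
    (hc : IsSmoothFamily c) : ∃ R, FieldExp ρ l (xLog sndB P fun y => ξ (c y.1)) (fun A y => Y y.2 A) (fun y => ψ y.2) R
      (gradB inB P (famG c) (fun y => ψ y.2)) := by
  obtain ⟨R, hR⟩ := h.form_r P c hc
  exact ⟨R, (family_form_iff h.smooth_Y h.smooth_ψ hc R).2 ⟨hR, h.form_A P c hc⟩⟩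

/-- The expansion at a member of a family. -/
lemma fieldExp_member (hψ : CylSmooth ψ) {R : P × Bdry → ℝ}
    (h : FieldExp ρ l (xLog sndB P fun y => ξ (c y.1)) (fun A y => Y y.2 A) (fun y => ψ y.2) R
      (gradB inB P (famG c) (fun y => ψ y.2))) (p : P) :
    FieldExp ρ l (xLog idB fun _ => ξ (c p)) (fun A x => Y x A) ψ (fun x => R (p, x))
      (gradB idB (fun A B y => (c p).γ y A B) ψ) := by
  have e := h.comp_affine inB P (p, 0)
  have hN : gradB idB (fun A B y => (c p).γ y A B) ψ = fun A x =>
      gradB inB P (famG c) (fun y => ψ y.2) A (p, x) := by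
    funext A x
    rw [family_gradB c hψ, (c p).gradB_γ]
  rw [hN]
  simp only [inr_apply, Prod.mk_add_mk, zero_add, add_zero] at e
  exact e

/-- A metric dependent vector field with the expected joint form is an asymptotic symmetry. -/
lemma isGenerator_of_form (hl : 0 < l) (hY : CylSmooth Y) (hψ : CylSmooth ψ)
    (hk : IsConformalKilling γbar Y) (hh : ∀ x, laplacian γbar ψ x = 0) (hξ : ∀ m, IsBulkField ρ (ξ m))
    (hf : ∀ (P : Type) [NormedAddCommGroup P] [NormedSpace ℝ P] [FiniteDimensional ℝ P]
      (c : P → AsympMetric l ρ γbar), IsSmoothFamily c → ∃ R,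
      FieldExp ρ l (xLog sndB P fun y => ξ (c y.1)) (fun A y => Y y.2 A) (fun y => ψ y.2) R
        (gradB inB P (famG c) (fun y => ψ y.2))) : IsGenerator ξ Y ψ where
  smooth_Y := hY
  smooth_ψ := hψ
  field := hξ
  preserves m := by
    obtain ⟨R, hR⟩ := hf ℝ (fun _ => m) (.const m)
    refine (preserves_iff_of_fieldExp hl m (hξ m) 
      (fieldExp_member (ξ := ξ) (Y := Y) (c := fun _ : ℝ => m) (R := R) hψ hR (0 : ℝ))).2 ⟨?_, ?_⟩
    · exact (isConformalKilling_conformal_iff (fun A B => (hγ.1.smooth A B).1) m.expansion.1).2 hk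
    · exact fun x => (laplacian_conformal_eq_zero_iff (fun A B => (hγ.1.smooth A B).1)
        hγ.1.symm (fun x => (hγ.1.lorentz x).ne) m.expansion.1).2 (hh x)
  form_r P _ _ _ c hc := by
    obtain ⟨R, hR⟩ := hf P c hc
    exact ⟨R, ((family_form_iff hY hψ hc R).1 hR).1⟩
  form_A P _ _ _ c hc := by
    obtain ⟨R, hR⟩ := hf P c hc
    exact ((family_form_iff hY hψ hc R).1 hR).2

lemma IsGenerator.conformalKilling_and_harmonic (hl : 0 < l) (h : IsGenerator ξ Y ψ)
    (m : AsympMetric l ρ γbar) : IsConformalKilling γbar Y ∧ ∀ x, laplacian γbar ψ x = 0 := by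
  obtain ⟨R, hR⟩ := h.fieldExp (IsSmoothFamily.const (P := ℝ) m)
  obtain ⟨h1, h2⟩ := (preserves_iff_of_fieldExp hl m (h.field m)
    (fieldExp_member (ξ := ξ) (Y := Y) (c := fun _ : ℝ => m) (R := R) h.smooth_ψ hR (0 : ℝ))).1 (h.preserves m)
  refine ⟨(isConformalKilling_conformal_iff (fun A B => (hγ.1.smooth A B).1) m.expansion.1).1 h1, fun x => ?_⟩
  exact (laplacian_conformal_eq_zero_iff (fun A B => (hγ.1.smooth A B).1)
    hγ.1.symm (fun x => (hγ.1.lorentz x).ne) m.expansion.1).1 (h2 x)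

end Family

/-! ### Difference quotients along a parameter -/

section Hadamard

variable {B : Type*} [NormedAddCommGroup B] [NormedSpace ℝ B] [FiniteDimensional ℝ B] {k : ℤ}
  {b : Bool} {f : (ℝ × B) × ℝ → ℝ} {w : (ℝ × B) × ℝ}

/-- Rescaling of the first parameter. -/
def shrink (u : ℝ) : (ℝ × B) × ℝ →L[ℝ] (ℝ × B) × ℝ :=
  ((u • ContinuousLinearMap.id ℝ ℝ).prodMap (.id ℝ B)).prodMap (.id ℝ ℝ)

@[simp] lemma shrink_apply (u : ℝ) (w : (ℝ × B) × ℝ) : shrink u w = ((u * w.1.1, w.1.2), w.2) := rfl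

lemma continuous_shrink : Continuous fun u : ℝ => (shrink u : (ℝ × B) × ℝ →L[ℝ] (ℝ × B) × ℝ) := by
  have h : (fun u : ℝ => (shrink u : (ℝ × B) × ℝ →L[ℝ] (ℝ × B) × ℝ)) = fun u : ℝ => shrink 0 +
      u • (((ContinuousLinearMap.id ℝ ℝ).prodMap (0 : B →L[ℝ] B)).prodMap (0 : ℝ →L[ℝ] ℝ)) := by
    funext u
    ext <;> simp
  rw [h]
  fun_prop

/-- Weighted average of `f` over the rescalings of the first parameter. -/
def shrinkAvg (n : ℕ) (f : (ℝ × B) × ℝ → ℝ) (w : (ℝ × B) × ℝ) : ℝ := ∫ u in (0 : ℝ)..1, u ^ n * f (shrink u w)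

lemma continuous_shrink_apply (hf : ContinuousOn f (far ρ)) (hw : ρ < w.2) : Continuous fun u : ℝ => f (shrink u w) :=
  hf.comp_continuous (by simp only [shrink_apply]; fun_prop) fun _ => hw

lemma hasFDerivAt_shrinkAvg (hf : CinfOn f (far ρ)) (hw : ρ < w.2) (n : ℕ) :
    HasFDerivAt (shrinkAvg n f) (∫ u in (0 : ℝ)..1, u ^ n • (fderiv ℝ f (shrink u w)).comp (shrink u)) w := by
  have ho : IsOpen {w : (ℝ × B) × ℝ | ρ < w.2} := isOpen_end ρ
  have hf' : ContinuousOn (fderiv ℝ f) (far ρ) := hf.continuousOn_fderiv_of_isOpen ho (by simp)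
  obtain ⟨ε, hε, hball⟩ := Metric.nhds_basis_closedBall.mem_iff.1 (ho.mem_nhds hw)
  have hc : ContinuousOn (fun q : ℝ × ((ℝ × B) × ℝ) => q.1 ^ n • (fderiv ℝ f (shrink q.1 q.2)).comp
      (shrink q.1)) (Set.Icc 0 1 ×ˢ Metric.closedBall w ε) := by
    have h1 : ContinuousOn (fun q : ℝ × ((ℝ × B) × ℝ) => fderiv ℝ f (shrink q.1 q.2))
        (Set.Icc 0 1 ×ˢ Metric.closedBall w ε) := hf'.comp (by simp only [shrink_apply]; fun_prop) fun q hq =>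
        show ρ < q.2.2 from hball hq.2
    exact ((continuous_fst.pow n).continuousOn).smul
      (h1.clm_comp ((continuous_shrink (B := B)).comp continuous_fst).continuousOn)
  obtain ⟨C, hC⟩ := (isCompact_Icc.prod (isCompact_closedBall w ε)).exists_bound_of_continuousOn hc
  have hI : ∀ {t : ℝ}, t ∈ Set.uIoc (0 : ℝ) 1 → t ∈ Set.Icc (0 : ℝ) 1 := fun ht => by
    rw [Set.uIoc_of_le zero_le_one] at ht
    exact ⟨ht.1.le, ht.2⟩
  have hF : ∀ x : (ℝ × B) × ℝ, ρ < x.2 → Continuous fun u : ℝ => u ^ n * f (shrink u x) := fun x hx =>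
    (continuous_pow n).mul (continuous_shrink_apply hf.continuousOn hx)
  have hd : ∀ (u : ℝ) (x : (ℝ × B) × ℝ), ρ < x.2 → HasFDerivAt (fun x => u ^ n * f (shrink u x))
      (u ^ n • (fderiv ℝ f (shrink u x)).comp (shrink u)) x := fun u x hx => by
    have h1 : HasFDerivAt f (fderiv ℝ f (shrink u x)) (shrink u x) :=
      ((hf.contDiffAt (ho.mem_nhds (show ρ < (shrink u x).2 from hx))).differentiableAt (by simp)).hasFDerivAt
    exact (h1.comp x (shrink (B := B) u).hasFDerivAt).const_mul _
  refine intervalIntegral.hasFDerivAt_integral_of_dominated_of_fderiv_le (bound := fun _ => C)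
    (F := fun x u => u ^ n * f (shrink u x)) (F' := fun x u => u ^ n • (fderiv ℝ f (shrink u x)).comp (shrink u))
    (Metric.closedBall_mem_nhds w hε) ?_ ((hF w hw).intervalIntegrable _ _) ?_ ?_ intervalIntegrable_const ?_
  · filter_upwards [ho.mem_nhds hw] with x hx using (hF x hx).aestronglyMeasurable
  · refine Continuous.aestronglyMeasurable ((continuous_pow n).smul ?_)
    have : Continuous fun u : ℝ => fderiv ℝ f (shrink u w) :=
      hf'.comp_continuous (by simp only [shrink_apply]; fun_prop) fun _ => hw
    exact this.clm_comp continuous_shrink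
  · exact .of_forall fun t ht x hx => hC (t, x) ⟨hI ht, hx⟩
  · exact .of_forall fun t ht x hx => hd t x (hball hx)

lemma fderiv_shrinkAvg (hf : CinfOn f (far ρ)) (hw : ρ < w.2) (n : ℕ) (v : (ℝ × B) × ℝ) : fderiv ℝ (shrinkAvg n f) w v =
      v.1.1 * shrinkAvg (n + 1) (fun w => fderiv ℝ f w ((1, 0), 0)) w
        + shrinkAvg n (fun w => fderiv ℝ f w ((0, v.1.2), v.2)) w := by
  have ho : IsOpen {w : (ℝ × B) × ℝ | ρ < w.2} := isOpen_end ρ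
  have hf' : ContinuousOn (fderiv ℝ f) (far ρ) := hf.continuousOn_fderiv_of_isOpen ho (by simp)
  have hc : Continuous fun u : ℝ => fderiv ℝ f (shrink u w) :=
    hf'.comp_continuous (by simp only [shrink_apply]; fun_prop) fun _ => hw
  have hcv : ∀ v, Continuous fun u : ℝ => fderiv ℝ f (shrink u w) v := fun v =>
    hc.clm_apply continuous_const
  rw [(hasFDerivAt_shrinkAvg hf hw n).fderiv, ContinuousLinearMap.intervalIntegral_apply]
  · rw [shrinkAvg, shrinkAvg, ← intervalIntegral.integral_const_mul, ← intervalIntegral.integral_add]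
    · refine intervalIntegral.integral_congr fun u _ => ?_
      have e : (shrink u v : (ℝ × B) × ℝ) = (u * v.1.1) • ((1, 0), 0) + ((0, v.1.2), v.2) := by
        ext <;> simp
      simp only [smul_apply, comp_apply]
      rw [e, map_add, map_smul]
      simp only [smul_eq_mul]
      ring
    · exact (continuous_const.mul ((continuous_pow _).mul (hcv _))).intervalIntegrable _ _
    · exact ((continuous_pow _).mul (hcv _)).intervalIntegrable _ _
  · exact ((continuous_pow n).smul (hc.clm_comp continuous_shrink)).intervalIntegrable _ _

lemma contDiffOn_shrinkAvg (hf : CinfOn f (far ρ)) (n : ℕ) : CinfOn (shrinkAvg n f) (far ρ) := by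
  have ho : IsOpen {w : (ℝ × B) × ℝ | ρ < w.2} := isOpen_end ρ
  rw [contDiffOn_infty]
  intro m
  induction m generalizing n f with
  | zero =>
    exact contDiffOn_zero.2 fun w hw => (hasFDerivAt_shrinkAvg hf hw n).continuousAt.continuousWithinAt
  | succ m ih =>
    have hv : ∀ v, CinfOn (fun w => fderiv ℝ f w v) (far ρ) := fun v =>
      (hf.fderiv_of_isOpen ho (by simp)).clm_apply contDiffOn_const
    rw [Nat.cast_add, Nat.cast_one, contDiffOn_succ_iff_fderiv_of_isOpen ho]
    refine ⟨fun w hw => (hasFDerivAt_shrinkAvg hf hw n).differentiableAt.differentiableWithinAt,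
      by simp, contDiffOn_clm_apply.2 fun v => ?_⟩
    exact ((contDiffOn_const.mul (ih (hv _) (n + 1))).add (ih (hv _) n)).congr fun w hw =>
      fderiv_shrinkAvg hf hw n v

lemma logD_shrinkAvg (hf : CinfOn f (far ρ)) (hw : ρ < w.2) (n : ℕ) (v : (ℝ × B) × ℝ) : logD v (shrinkAvg n f) w =
      v.1.1 * shrinkAvg (n + 1) (logD ((1, 0), 0) f) w + shrinkAvg n (logD ((0, v.1.2), v.2) f) w := by
  rw [logD, fderiv_shrinkAvg hf hw]
  simp [shrinkAvg, logD]

lemma eventually_shrinkAvg_le {K : Set (ℝ × B)} {C : ℝ} (n : ℕ)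
    (h : ∀ᶠ w in endAt ((fun q : ℝ × (ℝ × B) => (q.1 * q.2.1, q.2.2)) '' (Set.Icc 0 1 ×ˢ K)),
      ‖f w‖ ≤ C * ‖w.2 ^ k‖) : ∀ᶠ w in endAt K, ‖shrinkAvg n f w‖ ≤ C * ‖w.2 ^ k‖ := by
  obtain ⟨S, hS⟩ := eventually_endAt.1 h
  refine eventually_endAt.2 ⟨S, fun y hy r hr => ?_⟩
  refine (intervalIntegral.norm_integral_le_of_norm_le_const (C := C * ‖r ^ k‖) fun u hu => ?_).trans (by simp)
  rw [Set.uIoc_of_le zero_le_one] at hu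
  have h1 := hS _ ⟨(u, y), ⟨⟨hu.1.le, hu.2⟩, hy⟩, rfl⟩ r hr
  rw [norm_mul, norm_pow]
  refine (mul_le_of_le_one_left (norm_nonneg _) ?_).trans h1
  exact pow_le_one₀ (norm_nonneg _) (by rw [Real.norm_of_nonneg hu.1.le]; exact hu.2)

lemma IsFall.shrinkAvg (hf : IsFall ρ b k f) (n : ℕ) : IsFall ρ b k (shrinkAvg n f) := by
  have hs := contDiffOn_shrinkAvg hf.smooth n
  refine ⟨hs, fun K hK => ⟨germSmooth_of_contDiffOn hs K, fun m => ?_⟩⟩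
  set K' := (fun q : ℝ × (ℝ × B) => (q.1 * q.2.1, q.2.2)) '' (Set.Icc 0 1 ×ˢ K) with hK'
  have hKc : IsCompact K' := (isCompact_Icc.prod hK).image (by fun_prop)
  have small : ∀ (f : (ℝ × B) × ℝ → ℝ) n, Small b K' k f → Small b K k (AsymptoticAdS3.shrinkAvg n f) := by
    intro f n h
    cases b
    · exact isLittleO_iff.2 fun c hc =>
        eventually_shrinkAvg_le n (isLittleO_iff.1 h hc)
    · obtain ⟨c, hc⟩ := isBigO_iff.1 h
      exact isBigO_iff.2 ⟨c, eventually_shrinkAvg_le n hc⟩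
  have aux : ∀ m (f : (ℝ × B) × ℝ → ℝ) n, IsFall ρ b k f → Jet b K k m (AsymptoticAdS3.shrinkAvg n f) := by
    intro m
    induction m with
    | zero => exact fun f n h => small f n (h.fall K' hKc).small
    | succ m ih =>
      refine fun f n h => ⟨small f n (h.fall K' hKc).small, fun v => ?_⟩
      have g : ∀ v n, GermSmooth K (AsymptoticAdS3.shrinkAvg n (lD v f)) := fun v n =>
        germSmooth_of_contDiffOn (contDiffOn_shrinkAvg (h.logD v).smooth n) K
      refine (((ih _ (n + 1) (h.logD ((1, 0), 0))).const_mul v.1.1 (g _ _)).add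
        ((g _ _).const_mul _) (g _ _) (ih _ n (h.logD ((0, v.1.2), v.2)))).congr
        (GermEq.of_forall_gt (R := ρ) fun w hw => (logD_shrinkAvg h.smooth hw n v).symm)
  exact aux m f n hf

/-- The difference quotient in the first parameter. -/
def diffQuot (f : (ℝ × B) × ℝ → ℝ) : (ℝ × B) × ℝ → ℝ := shrinkAvg 0 (logD ((1, 0), 0) f)

lemma IsFall.diffQuot (hf : IsFall ρ b k f) : IsFall ρ b k (diffQuot f) := (hf.logD _).shrinkAvg 0

lemma hasDerivAt_fst_param (hf : CinfOn f (far ρ)) {r : ℝ} (hr : ρ < r) (a : ℝ) (x : B) :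
    HasDerivAt (fun a => f ((a, x), r)) (logD ((1, 0), 0) f ((a, x), r)) a := by
  have h1 : HasFDerivAt f (fderiv ℝ f ((a, x), r)) ((a, x), r) :=
    ((hf.contDiffAt ((isOpen_end ρ).mem_nhds hr)).difAt).hasFDerivAt
  have h2 : HasDerivAt (fun a : ℝ => ((a, x), r)) (((1 : ℝ), (0 : B)), (0 : ℝ)) a :=
    ((hasDerivAt_id a).prodMk (hasDerivAt_const a x)).prodMk (hasDerivAt_const a r)
  have h3 : HasDerivAt (fun a => f ((a, x), r)) (fderiv ℝ f ((a, x), r) ((1, 0), 0)) a := h1.comp_hasDerivAt a h2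
  simpa only [logD, zero_mul] using h3

lemma mul_diffQuot (hf : CinfOn f (far ρ)) {r : ℝ} (hr : ρ < r) (a : ℝ) (x : B) :
    a * diffQuot f ((a, x), r) = f ((a, x), r) - f ((0, x), r) := by
  have hd : ∀ u ∈ Set.uIcc (0 : ℝ) 1, HasDerivAt (fun u => f ((u * a, x), r))
      (logD ((1, 0), 0) f ((u * a, x), r) * a) u := fun u _ => by
    have h1 : HasDerivAt (fun u : ℝ => u * a) a u := by simpa using (hasDerivAt_id u).mul_const a
    exact (hasDerivAt_fst_param hf hr (u * a) x).comp u h1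
  have hc : Continuous fun u : ℝ => logD ((1, 0), 0) f ((u * a, x), r) * a :=
    (continuous_shrink_apply (w := ((a, x), r)) (logD_contDiffOn hf _).continuousOn hr).mul continuous_const
  have := intervalIntegral.integral_eq_sub_of_hasDerivAt hd (hc.intervalIntegrable _ _)
  rw [one_mul, zero_mul, intervalIntegral.integral_mul_const] at this
  rw [← this, diffQuot, shrinkAvg]
  simp [mul_comm]

end Hadamard

/-! ### A linear chart on the space of metrics -/

section SmoothData

variable {Y' : Type*} [NormedAddCommGroup Y'] [NormedSpace ℝ Y'] {ρ : ℝ}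

/-- Asymptotic data `φ`, `C_AB` and a remainder `Q` in the logarithmic frame, depending smoothly on
parameters and with the fall-off demanded by the asymptotic conditions. -/
structure SmoothData (ρ : ℝ) (φ : Y → ℝ) (C : Fin 2 → Fin 2 → Y → ℝ) (Q : Fin 3 → Fin 3 → Fn Y) :
    Prop where
  φ : Cinf φ
  C : ∀ A B, Cinf (C A B)
  rr : IsFall ρ false (-2) (Q 0 0)
  rA : ∀ A : Fin 2, IsFall ρ true (-2) (Q 0 A.succ)
  AB : ∀ A B : Fin 2, IsFall ρ false 0 (Q A.succ B.succ)

variable {φ φ' : Y → ℝ} {C C' : Fin 2 → Fin 2 → Y → ℝ} {Q Q' : Fin 3 → Fin 3 → Fn Y}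

lemma SmoothData.congr (h : SmoothData ρ φ C Q) (e : ∀ i j w, ρ < w.2 → Q i j w = Q' i j w) : SmoothData ρ φ C Q' :=
  ⟨h.φ, h.C, h.rr.congr (e 0 0), fun A => (h.rA A).congr (e _ _), fun A B => (h.AB A B).congr (e _ _)⟩

lemma SmoothData.zero : SmoothData (Y := Y) ρ (fun _ => 0) (fun _ _ _ => 0) (fun _ _ _ => 0) :=
  ⟨contDiff_const, fun _ _ => contDiff_const, .zero, fun _ => .zero, fun _ _ => .zero⟩

lemma SmoothData.add (h : SmoothData ρ φ C Q) (h' : SmoothData ρ φ' C' Q') :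
    SmoothData ρ (fun y => φ y + φ' y) (fun A B y => C A B y + C' A B y) (fun i j w => Q i j w + Q' i j w) :=
  ⟨h.φ.add h'.φ, fun A B => (h.C A B).add (h'.C A B), h.rr.add h'.rr, fun A => (h.rA A).add (h'.rA A),
    fun A B => (h.AB A B).add (h'.AB A B)⟩

lemma SmoothData.smul (h : SmoothData ρ φ C Q) {t : Y → ℝ} (ht : Cinf t) :
    SmoothData ρ (fun y => t y * φ y) (fun A B y => t y * C A B y) (fun i j w => t w.1 * Q i j w) := by
  have m : ∀ {b k f}, IsFall ρ b k f → IsFall ρ b k fun w => t w.1 * f w := fun {b k f} hf => by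
    simpa using (IsFall.of_fst ht).mul hf
  exact ⟨ht.mul h.φ, fun A B => ht.mul (h.C A B), m h.rr, fun A => m (h.rA A), fun A B => m (h.AB A B)⟩

lemma SmoothData.comp_affine (h : SmoothData ρ φ C Q) (L : Y' →L[ℝ] Y) (y₀ : Y) :
    SmoothData ρ (fun y => φ (L y + y₀)) (fun A B y => C A B (L y + y₀)) (fun i j w => Q i j (L w.1 + y₀, w.2)) :=
  ⟨h.φ.comp (L.contDiff.add contDiff_const), fun A B => (h.C A B).comp (L.contDiff.add contDiff_const),
    h.rr.comp_affine L y₀, fun A => (h.rA A).comp_affine L y₀, fun A B => (h.AB A B).comp_affine L y₀⟩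

end SmoothData

section Chart

/-- The boundary point below a bulk point. -/
def bpt (z : Bulk) : Bdry := fun A => z A.succ

@[simp] lemma bpt_pt (r : ℝ) (x : Bdry) : bpt (pt r x) = x := funext fun A => pt_succ r x A

lemma pt_bpt (z : Bulk) : pt (z 0) (bpt z) = z := by
  funext i; fin_cases i <;> simp [pt, bpt]

lemma bpt_add_period (z : Bulk) (t : ℝ) : bpt (z + Pi.single 2 t) = bpt z + Pi.single 1 t := by
  funext A; fin_cases A <;> simp [bpt]

lemma add_period_zero (z : Bulk) (t : ℝ) : (z + Pi.single 2 t : Bulk) 0 = z 0 := by simp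

/-- Asymptotic data and remainder of a metric. -/
abbrev PreDatum : Type := (Bdry → ℝ) × (Bdry → Mat2) × (Bulk → Mat3)

/-- Admissible asymptotic data and remainders; they form a vector space. -/
def Datum (ρ : ℝ) : Submodule ℝ PreDatum where
  carrier := {d | (∀ x, d.1 (x + period 1) = d.1 x) ∧ (∀ x, d.2.1 (x + period 1) = d.2.1 x) ∧ (∀ x, (d.2.1 x).IsSymm) ∧
    (∀ z, (d.2.2 z).IsSymm) ∧ (∀ z, d.2.2 (z + period 2) = d.2.2 z) ∧ (∀ z, ¬ ρ < z 0 → d.2.2 z = 0) ∧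
    SmoothData ρ d.1 (fun A B x => d.2.1 x A B) (gLog idB fun _ => d.2.2)}
  add_mem' {a b} ha hb := by
    obtain ⟨a1, a2, a3, a4, a5, a6, a7⟩ := ha
    obtain ⟨b1, b2, b3, b4, b5, b6, b7⟩ := hb
    refine ⟨fun x => ?_, fun x => ?_, fun x => (a3 x).add (b3 x), fun z => (a4 z).add (b4 z), fun z => ?_,
      fun z hz => ?_, (a7.add b7).congr fun i j w _ => ?_⟩
    · simp [a1 x, b1 x]
    · simp [a2 x, b2 x]
    · simp [a5 z, b5 z]
    · simp [a6 z hz, b6 z hz]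
    · simp [gLog, mul_add]
  zero_mem' := by
    refine ⟨fun _ => rfl, fun _ => rfl, fun _ => isSymm_zero, fun _ => isSymm_zero,
      fun _ => rfl, fun _ _ => rfl, SmoothData.zero.congr fun i j w _ => ?_⟩
    simp [gLog]
  smul_mem' t a ha := by
    obtain ⟨a1, a2, a3, a4, a5, a6, a7⟩ := ha
    refine ⟨fun x => ?_, fun x => ?_, fun x => (a3 x).smul t, fun z => (a4 z).smul t, fun z => ?_,
      fun z hz => ?_, (a7.smul (contDiff_const (c := t))).congr fun i j w _ => ?_⟩
    · simp [a1 x]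
    · simp [a2 x]
    · simp [a5 z]
    · simp [a6 z hz]
    · simp only [gLog, Prod.smul_snd, Pi.smul_apply, Matrix.smul_apply, smul_eq_mul]
      ring

/-- The conformal factor of a datum. -/
def Datum.φ (d : Datum ρ) : Bdry → ℝ := d.1.1

/-- The subleading coefficient of a datum. -/
def Datum.C (d : Datum ρ) : Bdry → Mat2 := d.1.2.1

/-- The remainder of a datum. -/
def Datum.rem (d : Datum ρ) : Bulk → Mat3 := d.1.2.2

lemma Datum.periodic_φ (d : Datum ρ) (x : Bdry) : Datum.φ d (x + period 1) = Datum.φ d x := d.2.1 x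

lemma Datum.periodic_C (d : Datum ρ) (x : Bdry) : Datum.C d (x + period 1) = Datum.C d x := d.2.2.1 x

lemma Datum.isSymm_C (d : Datum ρ) (x : Bdry) : (Datum.C d x).IsSymm := d.2.2.2.1 x

lemma Datum.isSymm_rem (d : Datum ρ) (z : Bulk) : (Datum.rem d z).IsSymm := d.2.2.2.2.1 z

lemma Datum.periodic_rem (d : Datum ρ) (z : Bulk) : Datum.rem d (z + period 2) = Datum.rem d z := d.2.2.2.2.2.1 z

lemma Datum.rem_eq_zero (d : Datum ρ) {z : Bulk} (hz : ¬ ρ < z 0) : Datum.rem d z = 0 := d.2.2.2.2.2.2.1 z hz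

lemma Datum.smooth (d : Datum ρ) : SmoothData ρ (Datum.φ d) (fun A B x => Datum.C d x A B)
    (gLog idB fun _ => Datum.rem d) := d.2.2.2.2.2.2.2

@[simp] lemma Datum.φ_add (d e : Datum ρ) (x : Bdry) : Datum.φ (d + e) x = Datum.φ d x + Datum.φ e x := rfl
@[simp] lemma Datum.C_add (d e : Datum ρ) (x : Bdry) : Datum.C (d + e) x = Datum.C d x + Datum.C e x := rfl
@[simp] lemma Datum.rem_add (d e : Datum ρ) (z : Bulk) : Datum.rem (d + e) z = Datum.rem d z + Datum.rem e z := rfl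
@[simp] lemma Datum.φ_smul (t : ℝ) (d : Datum ρ) (x : Bdry) : Datum.φ (t • d) x = t * Datum.φ d x := rfl
@[simp] lemma Datum.C_smul (t : ℝ) (d : Datum ρ) (x : Bdry) : Datum.C (t • d) x = t • Datum.C d x := rfl
@[simp] lemma Datum.rem_smul (t : ℝ) (d : Datum ρ) (z : Bulk) : Datum.rem (t • d) z = t • Datum.rem d z := rfl

lemma Datum.ext {d e : Datum ρ} (h1 : ∀ x, Datum.φ d x = Datum.φ e x) (h2 : ∀ x, Datum.C d x = Datum.C e x)
    (h3 : ∀ z, Datum.rem d z = Datum.rem e z) : d = e :=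
  Subtype.ext (Prod.ext (funext h1) (Prod.ext (funext h2) (funext h3)))

/-- The value of `C_rr` enforced by the constraint. -/
def constraintRR (l : ℝ) (γ : Mat2) (φ : ℝ) (C : Mat2) : ℝ :=
  -l ^ 2 * Real.exp (-(2 * φ)) * (γ 0 0 * C 1 1 + C 0 0 * γ 1 1 - 2 * (γ 0 1 * C 0 1)) / (γ 0 0 * γ 1 1 - γ 0 1 * γ 0 1)

/-- The leading terms of a metric with boundary metric `γ` and coefficients `c = C_rr` and `C_AB`. -/
def leadingPart (l : ℝ) (γ : Mat2) (c : ℝ) (C : Mat2) (r : ℝ) :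
    Mat3 :=
  Matrix.of fun i j => Fin.cases (Fin.cases (l ^ 2 / r ^ 2 + c / r ^ 4) (fun _ => 0) j)
    (fun A => Fin.cases 0 (fun B => r ^ 2 * γ A B + C A B) j) i

@[simp] lemma leadingPart_rr (γ C : Mat2) (c r : ℝ) : leadingPart l γ c C r 0 0 = l ^ 2 / r ^ 2 + c / r ^ 4 := rfl
@[simp] lemma leadingPart_rA (γ C : Mat2) (c r : ℝ) (A : Fin 2) : leadingPart l γ c C r 0 A.succ = 0 := rfl
@[simp] lemma leadingPart_AB (γ C : Mat2) (c r : ℝ) (A B : Fin 2) :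
    leadingPart l γ c C r A.succ B.succ = r ^ 2 * γ A B + C A B := rfl

lemma leadingPart_isSymm {γ C : Mat2} (hγ : γ.IsSymm) (hC : C.IsSymm) (c r : ℝ) : (leadingPart l γ c C r).IsSymm := by
  refine Matrix.IsSymm.ext fun i j => ?_
  refine Fin.cases (Fin.cases rfl (fun B => rfl) j) (fun A => Fin.cases rfl (fun B => ?_) j) i
  rw [leadingPart_AB, leadingPart_AB, hγ.apply, hC.apply]

/-- The boundary metric of a datum. -/
def Datum.γ (γbar : Bdry → Mat2) (d : Datum ρ) (x : Bdry) :
    Mat2 := Real.exp (2 * Datum.φ d x) • γbar x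

/-- The coefficient `C_rr` of a datum. -/
def Datum.Crr (l : ℝ) (γbar : Bdry → Mat2) (d : Datum ρ) (x : Bdry) : ℝ :=
  constraintRR l (γbar x) (Datum.φ d x) (Datum.C d x)

/-- The metric with given asymptotic data and remainder, continued arbitrarily. -/
def Datum.metric (l : ℝ) (γbar : Bdry → Mat2) (d : Datum ρ) (junk : Bulk → Mat3) (z : Bulk) : Mat3 :=
  if ρ < z 0 then leadingPart l (Datum.γ γbar d (bpt z)) (Datum.Crr l γbar d (bpt z)) (Datum.C d (bpt z)) (z 0)
    + Datum.rem d z else junk z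

lemma Datum.metric_of_lt (d : Datum ρ) (junk : Bulk → Mat3) {z : Bulk} (hz : ρ < z 0) :
    Datum.metric l γbar d junk z = leadingPart l (Datum.γ γbar d (bpt z)) (Datum.Crr l γbar d (bpt z))
      (Datum.C d (bpt z)) (z 0) + Datum.rem d z := if_pos hz

lemma contDiff_constraintRR {π : Y →L[ℝ] Bdry} {φ : Y → ℝ} {C : Y → Mat2}
    (hφ : Cinf φ) (hC : ∀ A B, Cinf fun y => C y A B) : Cinf fun y => constraintRR l (γbar (π y)) (φ y) (C y) := by
  have g := fun A B => (hγ.1.smooth A B).1.comp π.contDiff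
  refine ContDiff.div ((contDiff_const.mul (Real.contDiff_exp.comp (contDiff_const.mul hφ).neg)).mul
    ((((g 0 0).mul (hC 1 1)).add ((hC 0 0).mul (g 1 1))).sub (contDiff_const.mul ((g 0 1).mul (hC 0 1)))))
    (((g 0 0).mul (g 1 1)).sub ((g 0 1).mul (g 0 1))) fun y => ?_
  have := (hγ.1.lorentz (π y)).ne
  rw [det_fin_two, (hγ.1.symm (π y)).apply 0 1] at this
  exact this

lemma hasExpansion_of_smoothData [FiniteDimensional ℝ Y] {π : Y →L[ℝ] Bdry} {d : Y → Datum ρ} {junk : Y → Bulk → Mat3}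
    (h : SmoothData ρ (fun y => Datum.φ (d y) (π y)) (fun A B y => Datum.C (d y) (π y) A B)
      (gLog π fun y => Datum.rem (d y))) :
    HasExpansion l ρ γbar π (fun y r => Datum.metric l γbar (d y) (junk y) (pt r (π y)))
      (fun y => Datum.φ (d y) (π y)) (fun y => Datum.Crr l γbar (d y) (π y)) (fun y => Datum.C (d y) (π y)) := by
  have z := fun k => IsFall.zpow (Y := Y) (ρ := ρ) k
  refine ⟨h.φ, contDiff_constraintRR h.φ h.C, h.C, isLittleO_iff_isFall.2 ?_,
    fun A => isBigO_iff_isFall.2 ?_, fun A B => isLittleO_iff_isFall.2 ?_⟩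
  · refine (((z (-2)).mul h.rr).congr fun w hw => ?_ : IsFall ρ (true && false) (-2 + -2) _)
    have hw0 := (hρ.1.trans_lt hw).ne'
    beta_reduce
    rw [Datum.metric_of_lt _ _ (z := pt w.2 (π w.1)) (by simpa using hw)]
    simp only [gLog, wt_zero, Matrix.add_apply, leadingPart_rr, pt_zero, bpt_pt, add_sub_cancel_left, zpow_neg]
    norm_cast
    field_simp
  · refine (((z (-1)).mul (h.rA A)).congr fun w hw => ?_ : IsFall ρ (true && true) (-1 + -2) _)
    have hw0 := (hρ.1.trans_lt hw).ne'
    beta_reduce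
    rw [Datum.metric_of_lt _ _ (z := pt w.2 (π w.1)) (by simpa using hw)]
    simp only [gLog, wt_zero, wt_succ, Matrix.add_apply, leadingPart_rA, pt_zero, bpt_pt, zero_add, zpow_neg_one]
    field_simp
  · refine (h.AB A B).congr fun w hw => ?_
    beta_reduce
    rw [Datum.metric_of_lt _ _ (z := pt w.2 (π w.1)) (by simpa using hw)]
    simp only [gLog, wt_succ, Matrix.add_apply, leadingPart_AB, pt_zero, bpt_pt, Datum.γ,
      Matrix.smul_apply, smul_eq_mul]
    ring

lemma constraintRR_iff (x : Bdry) (φ c : ℝ) (C : Mat2) :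
    c * (Real.exp (2 * φ) * γbar x 0 0 * (Real.exp (2 * φ) * γbar x 1 1)
      - Real.exp (2 * φ) * γbar x 0 1 * (Real.exp (2 * φ) * γbar x 0 1)) = -l ^ 2 *
      (Real.exp (2 * φ) * γbar x 0 0 * C 1 1 + C 0 0 * (Real.exp (2 * φ) * γbar x 1 1)
        - 2 * (Real.exp (2 * φ) * γbar x 0 1 * C 0 1)) ↔ c = constraintRR l (γbar x) φ C := by
  have hd := (hγ.1.lorentz x).ne
  rw [det_fin_two, (hγ.1.symm x).apply 0 1] at hd
  rw [constraintRR, Real.exp_neg, eq_div_iff hd]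
  have he := (Real.exp_pos (2 * φ)).ne'
  generalize Real.exp (2 * φ) = s at *
  constructor
  · intro h
    field_simp
    have : s * (s * (c * (γbar x 0 0 * γbar x 1 1 - γbar x 0 1 * γbar x 0 1)))
      = s * (-l ^ 2 * (γbar x 0 0 * C 1 1 + C 0 0 * γbar x 1 1 - 2 * (γbar x 0 1 * C 0 1))) := by
      linear_combination h
    have := mul_left_cancel₀ he this
    linear_combination this
  · intro h
    field_simp at h
    linear_combination s * h

/-- The metric of a datum. -/
def Datum.build (hl : 0 < l) (d : Datum ρ) (junk : Bulk → Mat3) : AsympMetric l ρ γbar :=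
  have exp : HasExpansion l ρ γbar id (fun x r => Datum.metric l γbar d junk (pt r x))
      (Datum.φ d) (Datum.Crr l γbar d) (Datum.C d) :=
    hasExpansion_of_smoothData (π := .id ℝ Bdry) (d := fun _ => d) (junk := fun _ => junk) (Datum.smooth d)
  have symm : ∀ z ∈ region ρ, (Datum.metric l γbar d junk z).IsSymm := fun z hz => by
    rw [Datum.metric_of_lt d junk hz]
    exact (leadingPart_isSymm ((hγ.1.symm _).smul _) (Datum.isSymm_C d _) _ _).add (Datum.isSymm_rem d z)
  { g := Datum.metric l γbar d junk
    φ := Datum.φ d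
    Crr := Datum.Crr l γbar d
    C := Datum.C d
    symm := symm
    periodic := fun z hz => by
      have e : ∀ x, γbar (x + period 1) = γbar x := fun x => by
        ext A B; exact (hγ.1.smooth A B).2 x
      rw [Datum.metric_of_lt d junk hz, Datum.metric_of_lt d junk (by rw [add_period_zero]; exact hz)]
      simp only [bpt_add_period, Datum.γ, Datum.Crr, Datum.periodic_φ, Datum.periodic_C, e,
        Datum.periodic_rem, add_period_zero]
    periodic_φ := Datum.periodic_φ d
    periodic_Crr := fun x => by
      have e : ∀ x, γbar (x + period 1) = γbar x := fun x => by
        ext A B; exact (hγ.1.smooth A B).2 x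
      simp only [Datum.Crr, Datum.periodic_φ, Datum.periodic_C, e]
    periodic_C := Datum.periodic_C d
    expansion := exp
    extrinsic := fun x => by
      have hG := metricExp_of_hasExpansion (π := .id ℝ Bdry) (g := fun _ => Datum.metric l γbar d junk)
        (fun A B => (hγ.1.smooth A B).1) exp fun _ z hz => symm z hz
      refine (tendsto_extrinsicTrace_iff hl hG (fun _ _ _ _ _ => rfl) ?_).2 ?_
      · have hd := hγ.1.lorentz x
        rw [det_fin_two, (hγ.1.symm x).apply 0 1] at hd
        have := mul_neg_of_pos_of_neg (pow_pos (Real.exp_pos (2 * Datum.φ d x)) 2) hd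
        simp only [det2, id_apply]
        linarith
      · exact (constraintRR_iff x (Datum.φ d x) _ (Datum.C d x)).2 rfl }

lemma AsympMetric.ext' {m m' : AsympMetric l ρ γbar} (h1 : m.g = m'.g) (h2 : m.φ = m'.φ)
    (h3 : m.Crr = m'.Crr) (h4 : m.C = m'.C) : m = m' := by
  cases m; cases m'; simp only at h1 h2 h3 h4; subst h1 h2 h3 h4; rfl

lemma AsympMetric.Crr_eq (hl : 0 < l)
    (m : AsympMetric l ρ γbar) (x : Bdry) : m.Crr x = constraintRR l (γbar x) (m.φ x) (m.C x) :=
  (constraintRR_iff x (m.φ x) _ (m.C x)).1 (m.constraint hl x)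

open Classical in
/-- The remainder of a metric. -/
def AsympMetric.remainder (m : AsympMetric l ρ γbar) (z : Bulk) : Mat3 :=
  if ρ < z 0 then m.g z - leadingPart l (m.γ (bpt z)) (m.Crr (bpt z)) (m.C (bpt z)) (z 0) else 0

lemma AsympMetric.remainder_of_lt {z : Bulk} (hz : ρ < z 0) :
    m.remainder z = m.g z - leadingPart l (m.γ (bpt z)) (m.Crr (bpt z)) (m.C (bpt z)) (z 0) := if_pos hz

lemma smoothData_of_hasExpansion [FiniteDimensional ℝ Y] {π : Y →L[ℝ] Bdry} {c : Y → AsympMetric l ρ γbar}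
    (h : HasExpansion l ρ γbar π (fun y r => (c y).g (pt r (π y))) (fun y => (c y).φ (π y))
      (fun y => (c y).Crr (π y)) (fun y => (c y).C (π y))) :
    SmoothData ρ (fun y => (c y).φ (π y)) (fun A B y => (c y).C (π y) A B) (gLog π fun y => (c y).remainder) := by
  have z := fun k => IsFall.zpow (Y := Y) (ρ := ρ) k
  obtain ⟨h1, -, h3, h4, h5, h6⟩ := h
  refine ⟨h1, h3, (((z 2).mul (isLittleO_iff_isFall.1 h4)).congr fun w hw => ?_ :
    IsFall ρ (true && false) (2 + -4) _), fun A => (((z 1).mul (isBigO_iff_isFall.1 (h5 A))).congr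
      fun w hw => ?_ : IsFall ρ (true && true) (1 + -3) _), fun A B =>
      (isLittleO_iff_isFall.1 (h6 A B)).congr fun w hw => ?_⟩
  · rw [gLog, AsympMetric.remainder_of_lt _ (z := pt w.2 (π w.1)) (by simpa using hw)]
    simp only [wt_zero, Matrix.sub_apply, leadingPart_rr, pt_zero, bpt_pt]
    norm_cast
    ring
  · rw [gLog, AsympMetric.remainder_of_lt _ (z := pt w.2 (π w.1)) (by simpa using hw)]
    simp
  · rw [gLog, AsympMetric.remainder_of_lt _ (z := pt w.2 (π w.1)) (by simpa using hw)]
    simp [AsympMetric.γ]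

/-- The datum of a metric. -/
def AsympMetric.datum (m : AsympMetric l ρ γbar) : Datum ρ :=
  ⟨(m.φ, m.C, m.remainder), m.periodic_φ, m.periodic_C, m.isSymm_C, fun z => by
    by_cases hz : ρ < z 0
    · change (m.remainder z).IsSymm
      rw [m.remainder_of_lt hz]
      exact (m.symm z hz).sub (leadingPart_isSymm (m.isSymm_γ _) (m.isSymm_C _) _ _)
    · change (m.remainder z).IsSymm
      rw [AsympMetric.remainder, if_neg hz]
      exact isSymm_zero, fun z => by
    change m.remainder _ = m.remainder z
    by_cases hz : ρ < z 0
    · rw [m.remainder_of_lt hz, m.remainder_of_lt (by rwa [add_period_zero]), m.periodic z hz,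
        bpt_add_period, m.periodic_γ, m.periodic_Crr, m.periodic_C, add_period_zero]
    · rw [AsympMetric.remainder, AsympMetric.remainder, if_neg hz, if_neg (by rwa [add_period_zero])],
    fun z hz => if_neg hz,
    smoothData_of_hasExpansion (π := .id ℝ Bdry) (c := fun _ => m) m.expansion⟩

lemma AsympMetric.build_datum (hl : 0 < l) (m : AsympMetric l ρ γbar) : Datum.build hl (m.datum) m.g = m := by
  have e : Datum.Crr l γbar (m.datum) = m.Crr := funext fun x => (m.Crr_eq hl x).symm
  refine AsympMetric.ext' (funext fun z => ?_) rfl (by exact e) rfl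
  change Datum.metric l γbar (m.datum) m.g z = m.g z
  by_cases hz : ρ < z 0
  · rw [Datum.metric_of_lt _ _ hz, e]
    change leadingPart l (m.γ (bpt z)) (m.Crr (bpt z)) (m.C (bpt z)) (z 0) + m.remainder z = m.g z
    rw [m.remainder_of_lt hz]
    abel
  · exact if_neg hz

/-- A smooth family of data. -/
def IsDatumFamily (D : P → Datum ρ) : Prop :=
  SmoothData ρ (fun y : P × Bdry => Datum.φ (D y.1) y.2) (fun A B y => Datum.C (D y.1) y.2 A B)
    (gLog sndB P fun y => Datum.rem (D y.1))

lemma IsDatumFamily.build (hl : 0 < l) {D : P → Datum ρ} (hD : IsDatumFamily D) (junk : P → Bulk → Mat3) :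
    IsSmoothFamily fun p => Datum.build (γbar := γbar) hl (D p) (junk p) :=
  hasExpansion_of_smoothData (l := l) (π := .snd ℝ P Bdry) (d := fun y => D y.1) (junk := fun y => junk y.1) hD

lemma IsSmoothFamily.datum (hc : IsSmoothFamily c) : IsDatumFamily fun p => (c p).datum :=
  smoothData_of_hasExpansion (π := .snd ℝ P Bdry) (c := fun y => c y.1) hc

lemma IsDatumFamily.add_smul {D E : P → Datum ρ} (hD : IsDatumFamily D) (hE : IsDatumFamily E) {t : P → ℝ}
    (ht : Cinf t) : IsDatumFamily fun p => D p + t p • E p := by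
  refine (SmoothData.add hD (hE.smul (ht.comp contDiff_fst))).congr fun i j w _ => ?_
  simp only [gLog, Datum.rem_add, Datum.rem_smul, Matrix.add_apply, Matrix.smul_apply, smul_eq_mul]
  simp only [Function.comp]
  ring

lemma IsDatumFamily.comp_clm {P' : Type} [NormedAddCommGroup P'] [NormedSpace ℝ P'] {D : P → Datum ρ}
    (hD : IsDatumFamily D) (L : P' →L[ℝ] P) : IsDatumFamily fun p => D (L p) := by
  have := SmoothData.comp_affine hD (L.prodMap idB) 0
  simp only [add_zero] at this
  exact this

lemma IsDatumFamily.const (d : Datum ρ) : IsDatumFamily fun _ : P => d := by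
  have := SmoothData.comp_affine (Datum.smooth d) sndB P 0
  simp only [add_zero] at this
  exact this

end Chart

/-! ### Velocities of families of metrics, and variations of vector fields -/

section Velocity

/-- The velocity of the metric when the datum `d` moves with velocity `w`. -/
def Datum.vel (l : ℝ) (γbar : Bdry → Mat2) (d w : Datum ρ) (z : Bulk) :
    Mat3 :=
  leadingPart 0 ((2 * Datum.φ w (bpt z)) • Datum.γ γbar d (bpt z)) (-2 * Datum.φ w (bpt z) * Datum.Crr l γbar d (bpt z)
      + constraintRR l (γbar (bpt z)) (Datum.φ d (bpt z)) (Datum.C w (bpt z))) (Datum.C w (bpt z)) (z 0) + Datum.rem w z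

lemma hasDerivAt_constraintRR (γ : Mat2) {φ : ℝ → ℝ} {C : ℝ → Mat2} {φ' : ℝ} {C' : Mat2} {t : ℝ}
    (hφ : HasDerivAt φ φ' t) (hC : ∀ A B, HasDerivAt (fun ε => C ε A B) (C' A B) t) :
    HasDerivAt (fun ε => constraintRR l γ (φ ε) (C ε))
      (-2 * φ' * constraintRR l γ (φ t) (C t) + constraintRR l γ (φ t) C') t := by
  have h1 : HasDerivAt (fun ε => Real.exp (-(2 * φ ε))) (Real.exp (-(2 * φ t)) * (-(2 * φ'))) t :=
    ((hφ.const_mul 2).neg).exp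
  have h2 := (((hC 1 1).const_mul (γ 0 0)).add ((hC 0 0).mul_const (γ 1 1))).sub
    (((hC 0 1).const_mul (γ 0 1)).const_mul 2)
  refine (((h1.const_mul (-l ^ 2)).mul h2).div_const (γ 0 0 * γ 1 1 - γ 0 1 * γ 0 1)).congr_deriv ?_
  simp only [constraintRR, Pi.add_apply, Pi.sub_apply]
  ring

lemma hasDerivAt_metric {D : ℝ → Datum ρ} {w : Datum ρ} {junk : ℝ → Bulk → Mat3}
    {t : ℝ} (hφ : ∀ x, HasDerivAt (fun ε => Datum.φ (D ε) x) (Datum.φ w x) t)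
    (hC : ∀ x A B, HasDerivAt (fun ε => Datum.C (D ε) x A B) (Datum.C w x A B) t) {z : Bulk} (hz : ρ < z 0)
    (hr : ∀ i j, HasDerivAt (fun ε => Datum.rem (D ε) z i j) (Datum.rem w z i j) t) (i j : Fin 3) :
    HasDerivAt (fun ε => Datum.metric l γbar (D ε) (junk ε) z i j) (Datum.vel l γbar (D t) w z i j) t := by
  simp only [Datum.metric_of_lt _ _ hz, Datum.vel, Matrix.add_apply]
  refine HasDerivAt.add ?_ (hr i j)
  refine Fin.cases (Fin.cases ?_ (fun B => ?_) j) (fun A => Fin.cases ?_ (fun B => ?_) j) i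
  · simp only [leadingPart_rr]
    refine (((hasDerivAt_constraintRR (l := l) (γbar (bpt z)) (hφ (bpt z)) (hC (bpt z))).div_const
      (z 0 ^ 4)).const_add (l ^ 2 / z 0 ^ 2)).congr_deriv ?_
    simp [Datum.Crr]
  · exact hasDerivAt_const _ _
  · exact hasDerivAt_const _ _
  · simp only [leadingPart_AB, Datum.γ, Matrix.smul_apply, smul_eq_mul]
    have h1 : HasDerivAt (fun ε => Real.exp (2 * Datum.φ (D ε) (bpt z)))
      (Real.exp (2 * Datum.φ (D t) (bpt z)) * (2 * Datum.φ w (bpt z))) t := ((hφ (bpt z)).const_mul 2).exp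
    refine (((h1.mul_const (γbar (bpt z) A B)).const_mul (z 0 ^ 2)).add (hC (bpt z) A B)).congr_deriv ?_
    ring

lemma Datum.vel_AB_ex (d w : Datum ρ) (A B : Fin 2) : Ex ρ 0 (gLog idB (fun _ => Datum.vel l γbar d w) A.succ B.succ)
      (fun x => 2 * Datum.φ w x * Datum.γ γbar d x A B) (fun x => Datum.C w x A B) := by
  have h := Datum.smooth w
  refine ⟨(contDiff_const.mul h.φ).mul ((Real.contDiff_exp.comp
    (contDiff_const.mul (Datum.smooth d).φ)).mul (hγ.1.smooth A B).1), h.C A B, (h.AB A B).congr fun y hy => ?_⟩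
  simp only [gLog, wt_succ, Datum.vel, Matrix.add_apply, leadingPart_AB, bpt_pt, pt_zero,
    id_apply, Matrix.smul_apply, smul_eq_mul, zpow_zero, zero_add]
  norm_cast
  ring

lemma Datum.vel_injective {d w w' : Datum ρ}
    (h : ∀ z ∈ region ρ, ∀ i j, Datum.vel l γbar d w z i j = Datum.vel l γbar d w' z i j) : w = w' := by
  have h1 := fun A B => (Datum.vel_AB_ex (l := l) (γbar := γbar) d w A B).unique
    ((Datum.vel_AB_ex (l := l) (γbar := γbar) d w' A B).congr fun y hy => by
      simp only [gLog, h _ (show pt y.2 y.1 ∈ region ρ from hy), id_apply])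
  have hC : ∀ x, Datum.C w x = Datum.C w' x := fun x => by
    ext A B; exact congrFun (h1 A B).2 x
  have hφ : ∀ x, Datum.φ w x = Datum.φ w' x := fun x => by
    by_contra hne
    have h0 : ∀ A B, γbar x A B = 0 := fun A B => by
      have := congrFun (h1 A B).1 x
      simp only [Datum.γ, Matrix.smul_apply, smul_eq_mul] at this
      by_contra hg
      have he := (Real.exp_pos (2 * Datum.φ d x)).ne'
      exact hne (by
        have := mul_right_cancel₀ (mul_ne_zero he hg) this
        linarith)
    have := hγ.1.lorentz x
    simp [det_fin_two, h0] at this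
  refine Datum.ext hφ hC fun z => ?_
  by_cases hz : ρ < z 0
  · ext i j
    have := h z hz i j
    simpa only [Datum.vel, hφ, hC, Matrix.add_apply, add_right_inj] using this
  · rw [Datum.rem_eq_zero _ hz, Datum.rem_eq_zero _ hz]

lemma wt_ne_zero (i : Fin 3) {r : ℝ} (hr : 0 < r) : wt i r ≠ 0 := (wt_pos i hr).ne'

lemma exists_datumFamily {φ : P × Bdry → ℝ} {C : Fin 2 → Fin 2 → P × Bdry → ℝ}
    {Q : Fin 3 → Fin 3 → (P × Bdry) × ℝ → ℝ} (h : SmoothData ρ φ C Q) (pφ : ∀ p x, φ (p, x + period 1) = φ (p, x))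
    (pC : ∀ A B p x, C A B (p, x + period 1) = C A B (p, x))
    (sC : ∀ A B y, C A B y = C B A y) (sQ : ∀ i j w, ρ < w.2 → Q i j w = Q j i w)
    (pQ : ∀ i j p x r, ρ < r → Q i j ((p, x + period 1), r) = Q i j ((p, x), r)) :
    ∃ D : P → Datum ρ, IsDatumFamily D ∧ (∀ p x, Datum.φ (D p) x = φ (p, x)) ∧
      (∀ p x A B, Datum.C (D p) x A B = C A B (p, x)) ∧ ∀ p z, ρ < z 0 → ∀ i j, Datum.rem (D p) z i j
        = Q i j ((p, bpt z), z 0) / (wt i (z 0) * wt j (z 0)) := by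
  classical
  let rem : P → Bulk → Mat3 := fun p z => if ρ < z 0 then
    Matrix.of fun i j => Q i j ((p, bpt z), z 0) / (wt i (z 0) * wt j (z 0)) else 0
  have hrem : ∀ p z, ρ < z 0 → ∀ i j, rem p z i j = Q i j ((p, bpt z), z 0) / (wt i (z 0) * wt j (z 0)) :=
    fun p z hz i j => by simp only [rem, if_pos hz, of_apply]
  have hg : ∀ i j (w : (P × Bdry) × ℝ), ρ < w.2 → Q i j w = gLog sndB P (fun y => rem y.1) i j w := fun i j w hw => by
    have h0 := hρ.1.trans_lt hw
    have h1 := wt_ne_zero i h0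
    have h2 := wt_ne_zero j h0
    rw [gLog, hrem _ _ (by simpa using hw)]
    simp only [bpt_pt, pt_zero, coe_snd']
    field_simp
  have hs : SmoothData ρ φ C (gLog sndB P fun y => rem y.1) := h.congr hg
  refine ⟨fun p => ⟨(fun x => φ (p, x), fun x => Matrix.of fun A B => C A B (p, x), rem p), pφ p, fun x => ?_,
    fun x => Matrix.IsSymm.ext fun A B => sC _ _ _, fun z => Matrix.IsSymm.ext fun i j => ?_, fun z => ?_,
    fun z hz => if_neg hz, ?_⟩, hs, fun _ _ => rfl, fun _ _ _ _ => rfl, hrem⟩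
  · ext A B; exact pC A B p x
  · by_cases hz : ρ < z 0
    · change rem p z j i = rem p z i j
      rw [hrem p z hz, hrem p z hz, sQ _ _ _ hz, mul_comm (wt i _)]
    · change rem p z j i = rem p z i j
      simp only [rem, if_neg hz, Matrix.zero_apply]
  · by_cases hz : ρ < z 0
    · ext i j
      change rem p _ i j = rem p z i j
      rw [hrem p z hz, hrem p _ (by rwa [add_period_zero]), bpt_add_period, add_period_zero, pQ _ _ _ _ _ hz]
    · simp only [rem, if_neg hz, add_period_zero]
  · have := hs.comp_affine inB P (p, 0)
    simp only [inr_apply, Prod.mk_add_mk, zero_add, add_zero] at this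
    exact this

lemma contDiff_slice {f : Fn Y} (hf : CinfOn f (far ρ)) {r : ℝ} (hr : ρ < r) : Cinf fun y => f (y, r) :=
  contDiffOn_univ.1 (hf.comp (contDiff_id.prodMk contDiff_const).contDiffOn fun _ _ => hr)

lemma diffQuot_add_period {f : (ℝ × Bdry) × ℝ → ℝ} {T : Bdry}
    (hf : ∀ a x r, ρ < r → f ((a, x + T), r) = f ((a, x), r)) {a : ℝ} {x : Bdry} {r : ℝ} (hr : ρ < r) :
    diffQuot f ((a, x + T), r) = diffQuot f ((a, x), r) := by
  have h : ∀ w : (ℝ × Bdry) × ℝ, ρ < w.2 → logD ((1, 0), 0) f (w.1 + (0, T), w.2) = logD ((1, 0), 0) f w := by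
    intro w hw
    rw [← logD_comp_add]
    have : (fun w : (ℝ × Bdry) × ℝ => f (w.1 + (0, T), w.2)) =ᶠ[𝓝 w] f := by
      filter_upwards [(isOpen_end ρ).mem_nhds hw] with w' hw'
      have := hf w'.1.1 w'.1.2 w'.2 hw'
      have e : w'.1 + (0, T) = (w'.1.1, w'.1.2 + T) := by ext <;> simp
      rw [e]
      exact this
    simp only [logD, this.fderiv_eq]
  simp only [diffQuot, shrinkAvg]
  refine intervalIntegral.integral_congr fun u _ => ?_
  have := h ((u * a, x), r) hr
  simp only [Prod.mk_add_mk, add_zero] at this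
  simp only [shrink_apply, this]

lemma diffQuot_congr {f g : (ℝ × Bdry) × ℝ → ℝ} (h : ∀ w : (ℝ × Bdry) × ℝ, ρ < w.2 → f w = g w)
    {w : (ℝ × Bdry) × ℝ} (hw : ρ < w.2) : diffQuot f w = diffQuot g w := by
  simp only [diffQuot, shrinkAvg]
  refine intervalIntegral.integral_congr fun u _ => ?_
  have : f =ᶠ[𝓝 (shrink u w)] g := by
    filter_upwards [(isOpen_end ρ).mem_nhds (show shrink u w ∈ {w : (ℝ × Bdry) × ℝ | ρ < w.2} from hw)]
      with w' hw' using h w' hw'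
  simp only [logD, this.fderiv_eq]

/-- A smooth curve of data is linear up to a smooth rescaling of its velocity. -/
lemma IsDatumFamily.exists_quotient {D : ℝ → Datum ρ} (hD : IsDatumFamily D) :
    ∃ w : ℝ → Datum ρ, IsDatumFamily w ∧ ∀ b, D b = D 0 + b • w b := by
  have hr : ρ < ρ + 1 := by linarith
  have fφ : IsFall ρ true 0 fun w : (ℝ × Bdry) × ℝ => Datum.φ (D w.1.1) w.1.2 := IsFall.of_fst hD.φ
  have fC : ∀ A B, IsFall ρ true 0 fun w : (ℝ × Bdry) × ℝ => Datum.C (D w.1.1) w.1.2 A B :=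
    fun A B => IsFall.of_fst (hD.C A B)
  have hs : SmoothData ρ (fun y => diffQuot (fun w => Datum.φ (D w.1.1) w.1.2) (y, ρ + 1))
      (fun A B y => diffQuot (fun w => Datum.C (D w.1.1) w.1.2 A B) (y, ρ + 1))
      (fun i j => diffQuot (gLog (.snd ℝ ℝ Bdry) (fun y => Datum.rem (D y.1)) i j)) :=
    ⟨contDiff_slice fφ.diffQuot.smooth hr, fun A B => contDiff_slice (fC A B).diffQuot.smooth hr,
      hD.rr.diffQuot, fun A => (hD.rA A).diffQuot, fun A B => (hD.AB A B).diffQuot⟩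
  have hQs : ∀ i j, CinfOn (gLog (.snd ℝ ℝ Bdry) (fun y => Datum.rem (D y.1)) i j) (far ρ) := by
    intro i j
    refine Fin.cases (Fin.cases hD.rr.smooth (fun B => (hD.rA B).smooth) j) (fun A => Fin.cases ?_
      (fun B => (hD.AB A B).smooth) j) i
    exact (hD.rA A).smooth.congr fun w _ => by
      simp only [gLog, (Datum.isSymm_rem (D w.1.1) _).apply 0 A.succ]
      ring
  obtain ⟨w, hw, w1, w2, w3⟩ := exists_datumFamily hs (fun p x => diffQuot_add_period (ρ := ρ)
    (fun a x r _ => Datum.periodic_φ (D a) x) hr) (fun A B p x => diffQuot_add_period (ρ := ρ)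
      (fun a x r _ => by simp only [Datum.periodic_C (D a) x]) hr) (fun A B y => diffQuot_congr (ρ := ρ)
      (fun w _ => (Datum.isSymm_C (D w.1.1) _).apply B A) hr) (fun i j w hw => diffQuot_congr (fun w _ => by
        simp only [gLog, (Datum.isSymm_rem (D w.1.1) _).apply i j]
        ring) hw) (fun i j p x r hr => diffQuot_add_period (fun a x r hr => by
        simp only [gLog, coe_snd', pt_add_period, Datum.periodic_rem]) hr)
  refine ⟨w, hw, fun b => Datum.ext (fun x => ?_) (fun x => ?_) fun z => ?_⟩
  · rw [Datum.φ_add, Datum.φ_smul, w1, mul_diffQuot fφ.smooth hr]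
    ring
  · ext A B
    rw [Datum.C_add, Datum.C_smul, Matrix.add_apply, Matrix.smul_apply, w2, smul_eq_mul,
      mul_diffQuot (fC A B).smooth hr]
    ring
  · by_cases hz : ρ < z 0
    · ext i j
      have h0 := hρ.1.trans_lt hz
      have h1 := wt_ne_zero i h0
      have h2 := wt_ne_zero j h0
      rw [Datum.rem_add, Datum.rem_smul, Matrix.add_apply, Matrix.smul_apply, w3 _ _ hz, smul_eq_mul,
        ← mul_div_assoc, mul_diffQuot (hQs i j) hz]
      simp only [gLog, coe_snd', pt_bpt]
      field_simp
      ring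
    · rw [Datum.rem_eq_zero _ hz, Datum.rem_eq_zero _ hz]

lemma hasDerivAt_add_smul {a : ℝ} {q : ℝ → ℝ} (hq : ContinuousAt q 0) : HasDerivAt (fun b => a + b * q b) (q 0) 0 := by
  rw [hasDerivAt_iff_tendsto_slope_zero]
  refine (hq.tendsto.mono_left nhdsWithin_le_nhds).congr' ?_
  filter_upwards [self_mem_nhdsWithin] with b hb
  have hb' : b ≠ 0 := hb
  simp
  field_simp

lemma FieldExp.contDiffOn
    {X : Fin 3 → Fn Y} {V N : Fin 2 → Y → ℝ} {ψ R : Y → ℝ} (h : FieldExp ρ l X V ψ R N) (i : Fin 3) :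
    CinfOn (X i) (far ρ) := Fin.cases (h.r.smooth) (fun A => (h.A_ex A).smooth) i

variable {Y : Bdry → Bdry} {ψ : Bdry → ℝ}

lemma IsGenerator.contDiff_param (h : IsGenerator ξ Y ψ)
    (hc : IsSmoothFamily c) {z : Bulk} (hz : z ∈ region ρ) (i : Fin 3) : Cinf fun p => ξ (c p) z i := by
  obtain ⟨R, hX⟩ := h.fieldExp hc
  have hz' : ρ < z 0 := hz
  have h1 : Cinf fun p : P => wt i (z 0) * xLog sndB P (fun y => ξ (c y.1)) i ((p, bpt z), z 0) :=
    contDiff_const.mul ((contDiff_slice (hX.contDiffOn i) hz').comp (contDiff_id.prodMk contDiff_const))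
  refine (funext fun p => ?_ : _ = fun p : P => _) ▸ h1
  have := wt_ne_zero i (hρ.1.trans_lt hz')
  simp only [xLog, coe_snd', pt_bpt]
  field_simp

/-- The derivative along the straight line in the chart is the derivative along every curve with the
same velocity. -/
lemma isVariation_of_tangent (hl : 0 < l) (hξ : IsGenerator ξ Y ψ) (m : AsympMetric l ρ γbar) {W : Datum ρ} {h : Bulk → Mat3}
    (hW : ∀ z ∈ region ρ, ∀ i j, Datum.vel l γbar (m.datum) W z i j = h z i j) : IsVariation ξ m h fun z μ =>
      deriv (fun ε : ℝ => ξ (Datum.build hl (m.datum + ε • W) m.g) z μ) 0 := by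
  classical
  intro c hc c0 hv z hz μ
  obtain ⟨w, hw, hD⟩ := (hc.datum).exists_quotient
  simp only [c0] at hD
  have w0 : w 0 = W := by
    refine Datum.vel_injective (l := l) (γbar := γbar) (d := m.datum) fun z hz i j => ?_
    rw [hW z hz]
    refine HasDerivAt.unique ?_ (hv z hz i j)
    have hz' : ρ < z 0 := hz
    have hd := hasDerivAt_metric (l := l) (γbar := γbar) (D := fun b => m.datum + b • w b) (w := w 0)
      (junk := fun b => (c b).g) (t := 0) (z := z) ?_ ?_ hz ?_ i j
    · simp only [zero_smul, add_zero] at hd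
      refine hd.congr_of_eventuallyEq (Eventually.of_forall fun b => ?_)
      have := congrArg AsympMetric.g ((c b).build_datum hl)
      beta_reduce
      rw [← hD]
      exact congrFun (congrFun (congrFun this.symm z) i) j
    · exact fun x => hasDerivAt_add_smul (hw.φ.continuous.comp (continuous_id.prodMk continuous_const)).continuousAt
    · exact fun x A B => hasDerivAt_add_smul
        ((hw.C A B).continuous.comp (continuous_id.prodMk continuous_const)).continuousAt
    · intro i j
      refine hasDerivAt_add_smul (q := fun b => Datum.rem (w b) z i j) ?_
      have hs : CinfOn (gLog (.snd ℝ ℝ Bdry) (fun y => Datum.rem (w y.1)) i j) (far ρ) := by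
        refine Fin.cases (Fin.cases hw.rr.smooth (fun B => (hw.rA B).smooth) j) (fun A => Fin.cases ?_
          (fun B => (hw.AB A B).smooth) j) i
        exact (hw.rA A).smooth.congr fun y _ => by
          simp only [gLog, (Datum.isSymm_rem (w y.1.1) _).apply 0 A.succ]
          ring
      have h1 : Continuous fun b : ℝ => gLog (.snd ℝ ℝ Bdry) (fun y => Datum.rem (w y.1)) i j ((b, bpt z), z 0)
          / (wt i (z 0) * wt j (z 0)) :=
        ((contDiff_slice hs hz').continuous.comp (continuous_id.prodMk continuous_const)).div_const _
      refine (h1.congr fun b => ?_).continuousAt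
      have e1 := wt_ne_zero i (hρ.1.trans_lt hz')
      have e2 := wt_ne_zero j (hρ.1.trans_lt hz')
      simp only [gLog, coe_snd', pt_bpt]
      field_simp
  have hF : IsSmoothFamily fun q : ℝ × ℝ => Datum.build (γbar := γbar) hl (m.datum + q.1 • w q.2)
      (if q.1 = q.2 then (c q.2).g else m.g) :=
    ((IsDatumFamily.const _).add_smul (hw.comp_clm (.snd ℝ ℝ ℝ)) contDiff_fst).build hl _
  have hf := ((hξ.contDiff_param hF hz μ).dif (0, 0)).hasFDerivAt
  set f : ℝ × ℝ → ℝ := fun q => ξ (Datum.build hl (m.datum + q.1 • w q.2)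
      (if q.1 = q.2 then (c q.2).g else m.g)) z μ with hfdef
  have hm := m.build_datum hl
  have e1 : ∀ b, f (b, b) = ξ (c b) z μ := fun b => by
    simp only [hfdef, if_true, ← hD, (c b).build_datum hl]
  have e2 : ∀ b, f (0, b) = ξ m z μ := fun b => by
    have : (if (0 : ℝ) = b then (c b).g else m.g) = m.g := by
      split_ifs with hb
      · rw [← hb, c0]
      · rfl
    simp only [hfdef, zero_smul, add_zero, this, hm]
  have e3 : ∀ a, f (a, 0) = ξ (Datum.build hl (m.datum + a • W) m.g) z μ := fun a => by
    have : (if a = 0 then (c 0).g else m.g) = m.g := by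
      split_ifs <;> simp [c0]
    simp only [hfdef, this, w0]
  have d1 : HasDerivAt (fun b : ℝ => f (b, b)) (fderiv ℝ f (0, 0) (1, 1)) 0 :=
    HasFDerivAt.comp_hasDerivAt (0 : ℝ) (f := fun b : ℝ => (b, b)) hf ((hasDerivAt_id _).prodMk (hasDerivAt_id _))
  have d2 : HasDerivAt (fun b : ℝ => f (0, b)) (fderiv ℝ f (0, 0) (0, 1)) 0 :=
    HasFDerivAt.comp_hasDerivAt (0 : ℝ) (f := fun b : ℝ => ((0 : ℝ), b)) hf
      ((hasDerivAt_const _ _).prodMk (hasDerivAt_id _))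
  have d3 : HasDerivAt (fun b : ℝ => f (b, 0)) (fderiv ℝ f (0, 0) (1, 0)) 0 :=
    HasFDerivAt.comp_hasDerivAt (0 : ℝ) (f := fun b : ℝ => (b, (0 : ℝ))) hf
      ((hasDerivAt_id _).prodMk (hasDerivAt_const _ _))
  simp only [e1] at d1
  simp only [e2] at d2
  simp only [e3] at d3
  have h0 : fderiv ℝ f (0, 0) (0, 1) = 0 := d2.unique (hasDerivAt_const _ _)
  have h1 : fderiv ℝ f (0, 0) (1, 1) = fderiv ℝ f (0, 0) (1, 0) := by
    have : ((1 : ℝ), (1 : ℝ)) = (1, 0) + (0, 1) := by simp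
    rw [this, map_add, h0, add_zero]
  beta_reduce
  rw [d3.deriv, ← h1]
  exact d1

end Velocity

/-! ### The direction in the chart generated by an asymptotic symmetry -/

section Tangent

lemma constraintRR_eq_trace (x : Bdry) {N : Mat2} (hN : N.IsSymm) :
    constraintRR l (γbar x) (m.φ x) N = -l ^ 2 * ∑ A, ∑ B, (m.γ x)⁻¹ A B * N A B := by
  rw [trace_eq (γ := fun A B y => m.γ y A B) (C := fun A B _ => N A B) (y := x) (fun _ _ => rfl)
    (fun _ _ => rfl) (m.isSymm_γ x) hN]
  have hd := (hγ.1.lorentz x).ne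
  rw [det_fin_two, (hγ.1.symm x).apply 0 1] at hd
  have he := (Real.exp_pos (2 * m.φ x)).ne'
  simp only [constraintRR, pol2, det2, AsympMetric.γ, Matrix.smul_apply, smul_eq_mul, Real.exp_neg]
  generalize Real.exp (2 * m.φ x) = s at *
  have e : s * γbar x 0 0 * (s * γbar x 1 1) - s * γbar x 0 1 * (s * γbar x 0 1)
      = s * (s * (γbar x 0 0 * γbar x 1 1 - γbar x 0 1 * γbar x 0 1)) := by ring
  rw [e]
  field_simp

lemma family_lieLog (hc : IsSmoothFamily c)
    (hX : ∀ i, CinfOn (xLog sndB P (fun y => ξ (c y.1)) i) (far ρ)) {w : (P × Bdry) × ℝ} (hw : ρ < w.2) (i j : Fin 3) :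
    lieLog inB P (gLog sndB P fun y => (c y.1).g) (xLog sndB P fun y => ξ (c y.1)) i j w
      = wt i w.2 * wt j w.2 * lieDeriv (ξ (c w.1.1)) (c w.1.1).g (pt w.2 w.1.2) i j :=
  lieLog_gLog (J := .inr ℝ P Bdry) (π := .snd ℝ P Bdry) (g := fun y => (c y.1).g) (ξ := fun y => ξ (c y.1)) (fun _ => rfl) (fun y v => by simp) (fun y v => by simp)
    ((hc.metricExp).differentiableAt) hX hw i j

lemma IsGenerator.exists_tangent {Y : Bdry → Bdry} {ψ : Bdry → ℝ} (h : IsGenerator ξ Y ψ) (hl : 0 < l) (hc : IsSmoothFamily c) :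
    ∃ W : P → Datum ρ, IsDatumFamily W ∧ ∀ p, (∀ z ∈ region ρ, ∀ i j,
      Datum.vel l γbar ((c p).datum) (W p) z i j = lieDeriv (ξ (c p)) (c p).g z i j) ∧
      ∀ x A B, 2 * Datum.φ (W p) x * (c p).γ x A B = lieDeriv Y (c p).γ x A B - ψ x * (c p).γ x A B := by
  obtain ⟨R, hX⟩ := h.fieldExp hc
  have hG := hc.metricExp
  have hXs := hX.contDiffOn
  have hd : ∀ y : P × Bdry, det2 (fun A B (y : P × Bdry) => (c y.1).γ y.2 A B) y ≠ 0 := fun y => by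
    have := (c y.1).det2_γ y.2
    simp only [det2] at this ⊢
    rw [this]
    exact ((c y.1).det_γ_neg y.2).ne
  have hs : ∀ A B (y : P × Bdry), (c y.1).γ y.2 A B = (c y.1).γ y.2 B A := fun A B y =>
    ((c y.1).isSymm_γ y.2).apply B A
  have hfam := fun {w} (hw : ρ < w.2) => family_lieLog (ξ := ξ) (w := w) hc hXs hw
  have h00 := lieLog_rr (J := .inr ℝ P Bdry) hG hX
  have h0A := lieLog_rA (J := .inr ℝ P Bdry) hG hX fun A y => sum_gradB hd hs _ A y
  have hAB := lieLog_AB (J := .inr ℝ P Bdry) hG hX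
  set LL := lieLog inB P (gLog sndB P fun y => (c y.1).g) (xLog sndB P fun y => ξ (c y.1)) with hLL
  obtain ⟨ηrr, hηrr⟩ : ∃ ηrr, Ex ρ (-2) (LL 0 0) 0 ηrr := ⟨_, h00⟩
  obtain ⟨S, hS⟩ : ∃ S : Fin 2 → Fin 2 → P × Bdry → ℝ, ∀ A B : Fin 2, Ex ρ 0 (LL A.succ B.succ)
    (fun y => lieB inB P (fun A y => Y y.2 A) (fun A B (y : P × Bdry) => (c y.1).γ y.2 A B) A B y
      - ψ y.2 * (c y.1).γ y.2 A B) (S A B) := ⟨_, hAB⟩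
  clear h00 hAB
  have hlie : ∀ A B (y : P × Bdry), lieB inB P (fun A y => Y y.2 A)
      (fun A B (y : P × Bdry) => (c y.1).γ y.2 A B) A B y = lieDeriv Y (c y.1).γ y.2 A B := by
    intro A B y
    have e : ∀ (f : Bdry → ℝ), Cinf f → ∀ D, bd inB P D (fun y : P × Bdry => f y.2) y
      = pd D f y.2 := fun f hf D => bd_comp (J := .inr ℝ P Bdry) (π := .snd ℝ P Bdry) (fun _ => rfl) hf D y
    have e' : ∀ A B D, bd inB P D (fun y : P × Bdry => (c y.1).γ y.2 A B) y
        = pd D (fun x => (c y.1).γ x A B) y.2 := fun A B D => by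
      have h1 := ((hc.contDiff_γ A B).dif y).hasFDerivAt
      have h2 : HasFDerivAt (fun x : Bdry => (y.1, x)) inB P y.2 := (hasFDerivAt_const _ _).prodMk (hasFDerivAt_id _)
      have h3 : HasFDerivAt (fun x => (c y.1).γ x A B) ((fderiv ℝ (fun y : P × Bdry => (c y.1).γ y.2 A B) y).comp
          inB P) y.2 := HasFDerivAt.comp (g := fun y : P × Bdry => (c y.1).γ y.2 A B) (f := fun x => (y.1, x)) y.2 h1 h2
      simp only [bd, pd, h3.fderiv, comp_apply]
    simp only [lieB, lieDeriv, of_apply, e', e _ (contDiff_pi.1 h.smooth_Y.1 _)]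
  simp only [hlie] at hS
  have hmem : ∀ p, (∃ om : Bdry → ℝ, ∀ x, (∀ A B, 2 * om x * (c p).γ x A B
        = lieDeriv Y (c p).γ x A B - ψ x * (c p).γ x A B) ∧ -2 * om x * (∑ A, ∑ B, ((c p).γ x)⁻¹ A B * (c p).C x A B)
        + (∑ A, ∑ B, ((c p).γ x)⁻¹ A B * S A B (p, x)) + 1 / l ^ 2 * ηrr (p, x) = 0) := by
    intro p
    have hXp := fieldExp_member h.smooth_ψ hX p
    obtain ⟨om, ηrr', η, ho, hr, hη, k1, k2, k3, k4⟩ := (preserves_iff_lieLog (c p) (h.field _)).1 (h.preserves (c p))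
    have e : ∀ i j (w : Bdry × ℝ), ρ < w.2 → LL i j ((p, w.1), w.2) = lieLog idB
        (gLog idB fun _ => (c p).g) (xLog idB fun _ => ξ (c p)) i j w := fun i j w hw => by
      rw [hfam (w := ((p, w.1), w.2)) hw, lieLog_gLog (J := .id ℝ Bdry) (π := .id ℝ Bdry)
        (g := fun _ => (c p).g) (ξ := fun _ => ξ (c p)) (fun _ => rfl) (fun _ _ => rfl) (fun _ _ => rfl)
        (((c p).metricExp).differentiableAt) (hXp.contDiffOn) hw]
      rfl
    have c1 := hηrr.comp_affine inB P (p, 0)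
    have c2 := fun A B => (hS A B).comp_affine inB P (p, 0)
    simp only [inr_apply, Prod.mk_add_mk, zero_add, add_zero] at c1 c2
    have u1 := ((c1.congr fun w hw => e _ _ w hw).unique k1).2
    have u2 := fun A B => ((c2 A B).congr fun w hw => e _ _ w hw).unique (k3 A B)
    refine ⟨om, fun x => ⟨fun A B => (congrFun (u2 A B).1 x).symm, ?_⟩⟩
    have v1 : ηrr (p, x) = ηrr' x := congrFun u1 x
    have v2 : ∀ A B, S A B (p, x) = η x A B := fun A B => congrFun (u2 A B).2 x
    simp only [v1, v2]
    exact k4 x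
  choose om hom using hmem
  have homs : Cinf fun y : P × Bdry => om y.1 y.2 := by
    have g := hc.contDiff_γ
    have s := fun A B => (hS A B).left
    have h1 : Cinf fun y : P × Bdry => (((c y.1).γ y.2 0 0 * (lieDeriv Y (c y.1).γ y.2 1 1 -
        ψ y.2 * (c y.1).γ y.2 1 1) + (lieDeriv Y (c y.1).γ y.2 0 0 - ψ y.2 * (c y.1).γ y.2 0 0)
          * (c y.1).γ y.2 1 1) - 2 * ((c y.1).γ y.2 0 1 * (lieDeriv Y (c y.1).γ y.2 0 1 -
        ψ y.2 * (c y.1).γ y.2 0 1))) / (4 * ((c y.1).γ y.2 0 0 * (c y.1).γ y.2 1 1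
          - (c y.1).γ y.2 0 1 * (c y.1).γ y.2 0 1)) :=
      ContDiff.div ((((g 0 0).mul (s 1 1)).add ((s 0 0).mul (g 1 1))).sub
        (contDiff_const.mul ((g 0 1).mul (s 0 1)))) (contDiff_const.mul (((g 0 0).mul (g 1 1)).sub
        ((g 0 1).mul (g 0 1)))) fun y => mul_ne_zero four_ne_zero (hd y)
    refine (funext fun y => ?_ : _ = fun y : P × Bdry => om y.1 y.2) ▸ h1
    have h2 := (hom y.1 y.2).1
    rw [← h2, ← h2, ← h2, div_eq_iff (by exact mul_ne_zero four_ne_zero (hd y))]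
    ring
  have hper : ∀ i j p x r, ρ < r → LL i j ((p, x + period 1), r) = LL i j ((p, x), r) := by
    intro i j p x r hr
    have e := fun x => hfam (w := ((p, x), r)) hr i j
    rw [e, e]
    simp only [pt_add_period]
    rw [lieDeriv_add_period (h.field (c p)).2 (c p).periodic hr]
  have sLL : ∀ i j w, ρ < w.2 → LL i j w = LL j i w := fun i j w hw =>
    lieLog_symm hG i j hw
  have sS : ∀ A B y, S A B y = S B A y := fun A B y =>
    congrFun ((hS A B).unique ((hS B A).congr fun w hw => sLL _ _ w hw)).2 y
  have pη : ∀ p x, ηrr (p, x + period 1) = ηrr (p, x) := fun p x =>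
    (hηrr.eq_of_eq fun r hr => hper 0 0 p x r hr).2
  have pS := fun A B p x => (hS A B).eq_of_eq fun r hr => hper A.succ B.succ p x r hr
  have pom : ∀ p x, om p (x + period 1) = om p x := fun p x => by
    have h1 := fun A B => (pS A B p x).1
    simp only [← (hom p _).1] at h1
    simp only [(c p).periodic_γ] at h1
    by_contra hne
    have h2 : ∀ A B, (c p).γ x A B = 0 := fun A B => by
      by_contra hg
      have := mul_right_cancel₀ hg (h1 A B)
      exact hne (by linarith)
    have := (c p).det_γ_neg x
    simp [det_fin_two, h2] at this
  have hsd : SmoothData ρ (fun y : P × Bdry => om y.1 y.2) S fun i j w => LL i j w - wt i w.2 * wt j w.2 *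
      leadingPart 0 ((2 * om w.1.1 w.1.2) • (c w.1.1).γ w.1.2) (ηrr w.1) (Matrix.of fun A B => S A B w.1) w.2 i j := by
    refine ⟨homs, fun A B => (hS A B).right, hηrr.fall.congr fun w hw => ?_, fun A => (h0A A).congr fun w hw => ?_,
      fun A B => (hS A B).fall.congr fun w hw => ?_⟩
    · have hw0 := (hρ.1.trans_lt hw).ne'
      simp only [leadingPart_rr, wt_zero, Pi.zero_apply, zpow_neg]
      norm_cast
      field_simp
      ring
    · simp
    · rw [← (hom w.1.1 w.1.2).1]
      simp only [leadingPart_AB, wt_succ, zpow_zero, zero_add, Matrix.smul_apply, smul_eq_mul, of_apply]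
      norm_cast
      ring
  obtain ⟨W, hW, w1, w2, w3⟩ := exists_datumFamily hsd pom (fun A B p x => (pS A B p x).2) sS (fun i j w hw => by
      have hS' : (Matrix.of fun A B => S A B w.1).IsSymm := Matrix.IsSymm.ext fun A B => sS _ _ _
      have e := (leadingPart_isSymm (l := 0) (((c w.1.1).isSymm_γ w.1.2).smul (2 * om w.1.1 w.1.2)) hS'
        (ηrr w.1) w.2).apply i j
      simp only [e, sLL i j w hw, mul_comm (wt i w.2)])
    (fun i j p x r hr => by
      have : (Matrix.of fun A B => S A B (p, x + period 1))
        = Matrix.of fun A B => S A B (p, x) := by ext A B; exact (pS A B p x).2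
      simp only [hper i j p x r hr, pom, pη, (c p).periodic_γ, this])
  refine ⟨W, hW, fun p => ⟨fun z hz i j => ?_, fun x A B => by rw [w1]; exact (hom p x).1 A B⟩⟩
  have hz' : ρ < z 0 := hz
  replace w1 : ∀ p x, Datum.φ (W p) x = om p x := w1
  have e1 := wt_ne_zero i (hρ.1.trans_lt hz')
  have e2 := wt_ne_zero j (hρ.1.trans_lt hz')
  have hC : Datum.C (W p) (bpt z) = Matrix.of fun A B => S A B (p, bpt z) := by ext A B; exact w2 p _ A B
  have hc' : -2 * Datum.φ (W p) (bpt z) * Datum.Crr l γbar ((c p).datum) (bpt z)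
      + constraintRR l (γbar (bpt z)) (Datum.φ ((c p).datum) (bpt z)) (Datum.C (W p) (bpt z)) = ηrr (p, bpt z) := by
    have t1 : Datum.Crr l γbar ((c p).datum) (bpt z)
        = -l ^ 2 * ∑ A, ∑ B, ((c p).γ (bpt z))⁻¹ A B * (c p).C (bpt z) A B :=
      constraintRR_eq_trace (c p) (bpt z) ((c p).isSymm_C (bpt z))
    have t2 : constraintRR l (γbar (bpt z)) (Datum.φ ((c p).datum) (bpt z)) (Datum.C (W p) (bpt z))
        = -l ^ 2 * ∑ A, ∑ B, ((c p).γ (bpt z))⁻¹ A B * Datum.C (W p) (bpt z) A B :=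
      constraintRR_eq_trace (c p) (bpt z) (Datum.isSymm_C (W p) (bpt z))
    rw [t1, t2, w1]
    simp only [w2]
    have t3 := (hom p (bpt z)).2
    have t4 : l ^ 2 * (1 / l ^ 2 * ηrr (p, bpt z)) = ηrr (p, bpt z) := by
      have := hl.ne'
      field_simp
    linear_combination (-l ^ 2) * t3 + t4
  rw [Datum.vel, hc', Matrix.add_apply, w3 p z hz', hC, w1, hfam (w := ((p, bpt z), z 0)) hz']
  simp only [pt_bpt]
  change leadingPart 0 ((2 * om p (bpt z)) • (c p).γ (bpt z)) _ _ _ i j + _ = _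
  generalize leadingPart 0 ((2 * om p (bpt z)) • (c p).γ (bpt z)) (ηrr (p, bpt z))
    (Matrix.of fun A B => S A B (p, bpt z)) (z 0) i j = a
  field_simp
  ring

end Tangent

/-! ### Expansions with a remainder of relative order `r⁻⁴` -/

section ExO

variable {Y Y' : Type*} [NormedAddCommGroup Y] [NormedSpace ℝ Y] [NormedAddCommGroup Y'] [NormedSpace ℝ Y'] {f g : Fn Y} {a a' c c' : Y → ℝ}

/-- `f = a + c r⁻² + O(r⁻⁴)`. -/
structure ExO (ρ : ℝ) (f : Fn Y) (a c : Y → ℝ) : Prop where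
  left : Cinf a
  right : Cinf c
  fall : IsFall ρ true (-4) (fun w => f w - (a w.1 + w.2 ^ (-2 : ℤ) * c w.1))

lemma ExO.congr (h : ExO ρ f a c) (e : ∀ w : Y × ℝ, ρ < w.2 → f w = g w) : ExO ρ g a c :=
  ⟨h.left, h.right, h.fall.congr fun w hw => by rw [e w hw]⟩

lemma ExO.congr_coeff (h : ExO ρ f a c) (ha : ∀ y, a y = a' y) (hc : ∀ y, c y = c' y) : ExO ρ f a' c' := by
  rwa [← funext ha, ← funext hc]

lemma ExO.add (h : ExO ρ f a c) (h' : ExO ρ g a' c') :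
    ExO ρ (fun w => f w + g w) (fun y => a y + a' y) (fun y => c y + c' y) :=
  ⟨h.left.add h'.left, h.right.add h'.right, (h.fall.add h'.fall).congr fun w _ => by ring⟩

lemma ExO.sub (h : ExO ρ f a c) (h' : ExO ρ g a' c') :
    ExO ρ (fun w => f w - g w) (fun y => a y - a' y) (fun y => c y - c' y) :=
  ⟨h.left.sub h'.left, h.right.sub h'.right, (h.fall.sub h'.fall).congr fun w _ => by ring⟩

lemma ExO.toEx (h : ExO ρ f a c) : Ex ρ (-2) f a c :=
  ⟨h.left, h.right, (h.fall.lt (by norm_num)).congr fun w _ => by simp⟩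

lemma Ex.sub {k : ℤ} (h : Ex ρ k f a c) (h' : Ex ρ k g a' c') :
    Ex ρ k (fun w => f w - g w) (fun y => a y - a' y) (fun y => c y - c' y) :=
  ⟨h.left.sub h'.left, h.right.sub h'.right, (h.fall.sub h'.fall).congr fun w _ => by ring⟩

/-- The remainder after the leading term. -/
lemma ExO.sub_left (h : ExO ρ f a c) : IsFall ρ true (-2) (fun w => f w - a w.1) := by
  have := h.toEx.big
  simpa using this

lemma ExO.mul (h : ExO ρ f a c) (h' : ExO ρ g a' c') :
    ExO ρ (fun w => f w * g w) (fun y => a y * a' y) (fun y => a y * c' y + c y * a' y) := by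
  refine ⟨h.left.mul h'.left, (h.left.mul h'.right).add (h.right.mul h'.left), ?_⟩
  have t1 : IsFall ρ (true && true) (-2 + -2) _ := (h.sub_left).mul (h'.sub_left)
  have t2 : IsFall ρ (true && true) (0 + -4) _ := (IsFall.of_fst h.left).mul h'.fall
  have t3 : IsFall ρ (true && true) (-4 + 0) _ := h.fall.mul (IsFall.of_fst h'.left)
  refine (((t1 : IsFall ρ true (-4) _).add (t2 : IsFall ρ true (-4) _)).add
    (t3 : IsFall ρ true (-4) _)).congr fun w _ => ?_
  ring

/-- Product with an expansion whose leading term vanishes. -/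
lemma ExO.mul_of_zero (h : Ex ρ (-2) f a c) (h' : ExO ρ g (fun _ => 0) c') :
    ExO ρ (fun w => f w * g w) (fun _ => 0) (fun y => a y * c' y) := by
  refine ⟨contDiff_const, h.left.mul h'.right, ?_⟩
  have h1 : IsFall ρ true (-2) (fun w => f w - a w.1) := by simpa using h.big
  have h2 : IsFall ρ true (-2) g := by simpa using h'.sub_left
  have t1 : IsFall ρ (true && true) (-2 + -2) _ := h1.mul h2
  have t2 : IsFall ρ (true && true) (0 + -4) _ := (IsFall.of_fst h.left).mul h'.fall
  refine ((t1 : IsFall ρ true (-4) _).add (t2 : IsFall ρ true (-4) _)).congr fun w _ => ?_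
  ring

lemma ExO.smooth (h : ExO ρ f a c) : CinfOn f (far ρ) := h.toEx.smooth

lemma ExO.logD (h : ExO ρ f a c) (v : Y × ℝ) :
    ExO ρ (logD v f) (fun y => fderiv ℝ a y v.1) (fun y => fderiv ℝ c y v.1 + v.2 * (-2) * c y) := by
  have hf := h.smooth
  refine ⟨h.left.fderiv_right (by simp) |>.clm_apply contDiff_const,
    (h.right.fderiv_right (by simp) |>.clm_apply contDiff_const).add (contDiff_const.mul h.right),
    (h.fall.logD v).congr fun w hw => ?_⟩
  have hw0 := hρ.1.trans_lt hw
  have df : DiffAt f w := (hf.contDiffAt ((isOpen_end ρ).mem_nhds hw)).difAt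
  have da : DiffAt (fun w : Y × ℝ => a w.1) w := ((h.left.comp contDiff_fst).dif) w
  have dc : DiffAt (fun w : Y × ℝ => c w.1) w := ((h.right.comp contDiff_fst).dif) w
  have dz : DiffAt (fun w : Y × ℝ => w.2 ^ (-2 : ℤ)) w := (contDiffAt_zpow_snd (-2) hw0).difAt
  have e1 : lD v (fun w => f w - (a w.1 + w.2 ^ (-2 : ℤ) * c w.1)) w = lD v f w - (lD v (fun w => a w.1) w
        + lD v (fun w => w.2 ^ (-2 : ℤ) * c w.1) w) := by
    simp only [AsymptoticAdS3.logD]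
    rw [fderiv_fun_sub df (da.fun_add (dz.fun_mul dc)), fderiv_fun_add da (dz.fun_mul dc)]
    rfl
  rw [e1, logD_mul_at dz dc, logD_zpow hw0, logD_fst ((h.left.dif) _), logD_fst ((h.right.dif) _)]
  push_cast
  ring

lemma ExO.comp_affine (h : ExO ρ f a c) (L : Y' →L[ℝ] Y) (y₀ : Y) :
    ExO ρ (fun w : Y' × ℝ => f (L w.1 + y₀, w.2)) (fun y => a (L y + y₀)) (fun y => c (L y + y₀)) :=
  ⟨h.left.comp (L.contDiff.add contDiff_const), h.right.comp (L.contDiff.add contDiff_const), h.fall.comp_affine L y₀⟩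

lemma FieldExp.A_exO {l : ℝ} {X : Fin 3 → Fn Y} {V N : Fin 2 → Y → ℝ} {ψ R : Y → ℝ}
    (h : FieldExp ρ l X V ψ R N) (A : Fin 2) : ExO ρ (X A.succ) (V A) (fun y => -(l ^ 2 / 4) * N A y) :=
  ⟨h.smooth_V A, contDiff_const.mul (h.smooth_N A), (h.A A).congr fun w _ => by ring⟩

end ExO

section Bracket

/-- The bracket of vector fields in the logarithmic frame. -/
def brLog (J : Bdry →L[ℝ] Y) (X X' : Fin 3 → Fn Y) (i : Fin 3) (w : Y × ℝ) : ℝ :=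
  ∑ k, (X k w * ld J k (X' i) w - X' k w * ld J k (X i) w)

lemma lieBracket_bulk {V W : Bulk → Bulk} {z : Bulk} (hV : DiffAt V z)
    (hW : DiffAt W z) (i : Fin 3) : VectorField.lieBracket ℝ V W z i
      = ∑ k, (V z k * pd k (fun y => W y i) z - W z k * pd k (fun y => V y i) z) := by
  have h : ∀ {U : Bulk → Bulk}, DiffAt U z → ∀ v, fderiv ℝ U z v i
      = ∑ k, v k * pd k (fun y => U y i) z := fun {U} hU v => by
    have e : v = ∑ k, v k • Pi.single k (1 : ℝ) := by
      funext j; simp [Finset.sum_apply, Pi.single_apply]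
    have e2 : ∀ k, pd k (fun y => U y i) z = fderiv ℝ U z (Pi.single k 1) i := fun k => by
      rw [pd, fderiv_apply hU]; rfl
    conv_lhs => rw [e, map_sum]
    simp only [Finset.sum_apply, map_smul, Pi.smul_apply, smul_eq_mul, e2]
  simp only [VectorField.lieBracket, Pi.sub_apply, h hV, h hW, sum_sub_distrib]

lemma pd_wt_mul {r : ℝ} (hr : ρ < r) {X : Fin 3 → Fn Y} {y : Y} {x : Bdry}
    {J : Bdry →L[ℝ] Y} {V : Bulk → Bulk} (hX : ∀ i, DiffAt (X i) (y, r))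
    (hV : ∀ i r' x', ρ < r' → V (pt r' x') i = wt i r' * X i (y + J (x' - x), r')) (k i : Fin 3) :
    pd k (fun z => V z i) (pt r x) =
      (wt i r * (ld J k (X i) (y, r) + if k = 0 ∧ i = 0 then X i (y, r) else 0)) / wt k r := by
  rw [eq_div_iff (wt_pos k (hρ.1.trans_lt hr)).ne', mul_comm]
  rw [pd_eq_logD hr (F := fun w => wt i w.2 * X i w) (y := y) (J := J)
    ((differentiableAt_wt i).fun_mul (hX i)) (fun r' x' hr' => hV i r' x' hr') k]
  rw [logD_wt_mul (hX i)]

lemma lieBracket_eq_brLog {r : ℝ} (hr : ρ < r) {X X' : Fin 3 → Fn Y} {y : Y} {x : Bdry}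
    {J : Bdry →L[ℝ] Y} {V V' : Bulk → Bulk} (hX : ∀ i, DiffAt (X i) (y, r)) (hX' : ∀ i, DiffAt (X' i) (y, r))
    (hV : ∀ i r' x', ρ < r' → V (pt r' x') i = wt i r' * X i (y + J (x' - x), r'))
    (hV' : ∀ i r' x', ρ < r' → V' (pt r' x') i = wt i r' * X' i (y + J (x' - x), r'))
    (dV : DiffAt V (pt r x)) (dV' : DiffAt V' (pt r x)) (i : Fin 3) :
    VectorField.lieBracket ℝ V V' (pt r x) i = wt i r * brLog J X X' i (y, r) := by
  have e1 : ∀ k, V (pt r x) k = wt k r * X k (y, r) := fun k => by simpa using hV k r x hr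
  have e2 : ∀ k, V' (pt r x) k = wt k r * X' k (y, r) := fun k => by simpa using hV' k r x hr
  have h := fun k => (wt_pos k (hρ.1.trans_lt hr)).ne'
  have key : ∀ {a b : ℝ} k, wt k r * a * (b / wt k r) = a * b := fun k => by
    have := h k
    field_simp
  rw [lieBracket_bulk dV dV', brLog, mul_sum]
  simp only [e1, e2, pd_wt_mul hr hX hV, pd_wt_mul hr hX' hV', key]
  simp only [Fin.sum_univ_three, Fin.isValue, true_and, one_ne_zero, false_and, if_false,
    show (2 : Fin 3) ≠ 0 by decide, add_zero]
  split_ifs with hi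
  · subst hi; ring
  · ring

variable {X X' : Fin 3 → Fn Y} {V V' N N' : Fin 2 → Y → ℝ} {ψ ψ' R R' : Y → ℝ} {J : Bdry →L[ℝ] Y}

lemma brLog_r (h : FieldExp ρ l X V ψ R N) (h' : FieldExp ρ l X' V' ψ' R' N') :
    ∃ S, Ex ρ (-2) (brLog J X X' 0) (fun y => -(1 / 2) * ∑ A, (V A y * bd J A ψ' y - V' A y * bd J A ψ y)) S := by
  have half : ∀ {X X' : Fin 3 → Fn Y} {V V' N N' : Fin 2 → Y → ℝ} {ψ ψ' R R' : Y → ℝ},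
      FieldExp ρ l X V ψ R N → FieldExp ρ l X' V' ψ' R' N' → ∃ S, Ex ρ (-2)
        (fun w => ∑ k, X k w * ld J k (X' 0) w) (fun y => -(1 / 2) * ∑ A, V A y * bd J A ψ' y) S := by
    intro X X' V V' N N' ψ ψ' R R' h h'
    have t0 : Ex ρ (-2 + -2 + 2) _ _ _ := h.r.mul (h'.r.logD (frame J 0))
    have t1 : ∀ A : Fin 2, Ex ρ (-2 + -2 + 2) _ _ _ := fun A =>
      (h.A_ex A).mul (h'.r.logD (frame J A.succ))
    have e := (t0 : Ex ρ (-2) _ _ _).add ((t1 0 : Ex ρ (-2) _ _ _).add (t1 1 : Ex ρ (-2) _ _ _))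
    refine ⟨_, (e.congr fun w _ => ?_).congr_coeff (fun y => ?_) fun y => rfl⟩
    · rw [Fin.sum_univ_three, add_assoc]
      rfl
    · have d : ∀ A, fderiv ℝ (fun y => -(1 / 2) * ψ' y) y (frame J (Fin.succ A)).1 = -(1 / 2) * bd J A ψ' y := by
        intro A
        rw [fderiv_const_mul ((h'.smooth_ψ.dif) y)]
        rfl
      rw [d, d]
      simp only [frame_zero, map_zero, frame_succ, Fin.sum_univ_two]
      push_cast
      ring
  obtain ⟨S, hS⟩ := half h h'
  obtain ⟨S', hS'⟩ := half h' h
  refine ⟨_, ((hS.sub hS').congr fun w _ => ?_).congr_coeff (fun y => ?_) fun y => rfl⟩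
  · rw [brLog, sum_sub_distrib]
  · rw [sum_sub_distrib]; ring

lemma brLog_A (h : FieldExp ρ l X V ψ R N) (h' : FieldExp ρ l X' V' ψ' R' N') (A : Fin 2) :
    ExO ρ (brLog J X X' A.succ) (fun y => ∑ B, (V B y * bd J B (V' A) y - V' B y * bd J B (V A) y))
      (fun y => -(l ^ 2 / 4) * (ψ y * N' A y - ψ' y * N A y + ∑ B, (V B y * bd J B (N' A) y + N B y * bd J B (V' A) y
          - V' B y * bd J B (N A) y - N' B y * bd J B (V A) y))) := by
  have half : ∀ {X X' : Fin 3 → Fn Y} {V V' N N' : Fin 2 → Y → ℝ} {ψ ψ' R R' : Y → ℝ},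
      FieldExp ρ l X V ψ R N → FieldExp ρ l X' V' ψ' R' N' → ExO ρ
        (fun w => ∑ k, X k w * ld J k (X' A.succ) w) (fun y => ∑ B, V B y * bd J B (V' A) y)
        (fun y => -(l ^ 2 / 4) * (ψ y * N' A y + ∑ B, (V B y * bd J B (N' A) y + N B y * bd J B (V' A) y))) := by
    intro X X' V V' N N' ψ ψ' R R' h h'
    have s0 := (h'.A_exO A).logD (frame J 0)
    have t0 := ExO.mul_of_zero h.r (s0.congr_coeff (a' := fun _ => 0) (fun y => by simp) fun y => rfl)
    have t1 : ∀ B : Fin 2, ExO ρ _ _ _ := fun B =>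
      (h.A_exO B).mul ((h'.A_exO A).logD (frame J B.succ))
    have d : ∀ y v, fderiv ℝ (fun y => -(l ^ 2 / 4) * N' A y) y v = -(l ^ 2 / 4) * fderiv ℝ (N' A) y v := by
      intro y v
      rw [fderiv_const_mul (((h'.smooth_N A).dif) y)]
      rfl
    refine ((t0.add ((t1 0).add (t1 1))).congr fun w _ => ?_).congr_coeff (fun y => ?_) fun y => ?_
    · rw [Fin.sum_univ_three, add_assoc]
      rfl
    · rw [Fin.sum_univ_two, zero_add]
      rfl
    · simp only [d, frame_zero, map_zero, frame_succ, Fin.sum_univ_two, bd]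
      ring
  refine (((half h h').sub (half h' h)).congr fun w _ => ?_).congr_coeff (fun y => ?_) fun y => ?_
  · rw [brLog, sum_sub_distrib]
  · rw [sum_sub_distrib]
  · simp only [Fin.sum_univ_two]
    ring

end Bracket

section Gradient

variable {γ : Bdry → Mat2} {ψ χ : Bdry → ℝ} {x : Bdry}

lemma sum_grad (hd : (γ x).det ≠ 0) (C : Fin 2) : ∑ B, γ x C B * grad γ ψ x B = pd C ψ x := by
  have h : Matrix.mulVec (γ x) (Matrix.mulVec (γ x)⁻¹ fun B => pd B ψ x) = fun B => pd B ψ x := by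
    rw [Matrix.mulVec_mulVec, Matrix.mul_nonsing_inv _ (isUnit_iff_ne_zero.2 hd), Matrix.one_mulVec]
  exact congrFun h C

lemma contDiff_grad (hγ : ∀ A B, Cinf fun y => γ y A B) (hs : ∀ x, (γ x).IsSymm)
    (hd : ∀ x, (γ x).det ≠ 0) (hψ : Cinf ψ) (A : Fin 2) : Cinf fun y => grad γ ψ y A := by
  have e : gradB idB (fun A B y => γ y A B) ψ A = fun y => grad γ ψ y A := by
    funext y
    rw [gradB_eq (M := γ y) (fun _ _ => rfl) (hs y)]
    rfl
  rw [← e]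
  refine contDiff_gradB hγ (fun y => ?_) hψ A
  have := hd y
  rw [det_fin_two, (hs y).apply 0 1] at this
  simpa only [det2] using this

lemma grad_conformal (hd : (γ x).det ≠ 0) (φ : Bdry → ℝ) (A : Fin 2) :
    grad (fun y => Real.exp (2 * φ y) • γ y) ψ x A = Real.exp (-2 * φ x) * grad γ ψ x A := by
  have e : (Real.exp (2 * φ x) • γ x)⁻¹ = Real.exp (-2 * φ x) • (γ x)⁻¹ := by
    refine Matrix.inv_eq_right_inv ?_
    rw [Matrix.smul_mul, Matrix.mul_smul, Matrix.mul_nonsing_inv _ (isUnit_iff_ne_zero.2 hd), smul_smul,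
      ← Real.exp_add, show 2 * φ x + -2 * φ x = 0 by ring, Real.exp_zero, one_smul]
  simp only [grad, e, Matrix.smul_apply, smul_eq_mul, mul_assoc, mul_sum]

lemma grad_sub (hψ : DiffAt ψ x) (hχ : DiffAt χ x) (A : Fin 2) :
    grad γ (fun y => ψ y - χ y) x A = grad γ ψ x A - grad γ χ x A := by
  simp only [grad, pd, fderiv_fun_sub hψ hχ, sub_apply, mul_sub, sum_sub_distrib]

/-- The commutator of a conformal Killing vector and a gradient. -/
lemma lie_grad (hγ : ∀ A B, Cinf fun y => γ y A B) (hs : ∀ x, (γ x).IsSymm)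
    (hd : ∀ x, (γ x).det ≠ 0) (hψ : Cinf ψ) {V : Bdry → Bdry} (hV : Cinf V) {σ : ℝ}
    (h : ∀ A B, lieDeriv V γ x A B = σ * γ x A B) (A : Fin 2) :
    ∑ B, (V x B * pd B (fun y => grad γ ψ y A) x - grad γ ψ x B * pd B (fun y => V y A) x)
      = grad γ (fun y => fderiv ℝ ψ y (V y)) x A - σ * grad γ ψ x A := by
  have dV := fun B => ((contDiff_pi.1 hV B).dif) x
  have dN := fun B => ((contDiff_grad hγ hs hd hψ B).dif) x
  have dγ := fun A B => ((hγ A B).dif) x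
  have dψ := fun B => ((contDiff_pd hψ B).dif) x
  have k1 := fun C => sum_grad (ψ := ψ) (hd x) C
  have k2 : ∀ B C, pd B (fun y => γ y C 0 * grad γ ψ y 0 + γ y C 1 * grad γ ψ y 1) x = pd B (pd C ψ) x :=
    fun B C => pd_congr (Eventually.of_forall fun y => by
      have := sum_grad (ψ := ψ) (hd y) C
      rwa [Fin.sum_univ_two] at this) B
  have k3 : ∀ C, pd C (fun y => fderiv ℝ ψ y (V y)) x
      = pd C (fun y => V y 0 * pd 0 ψ y + V y 1 * pd 1 ψ y) x := fun C => by
    congr 1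
    funext y
    rw [fderiv_eq_sum_pd, Fin.sum_univ_two]
  have k4 := h
  simp only [lieDeriv, of_apply, Fin.sum_univ_two] at k4
  simp only [pd_add ((dγ _ _).fun_mul (dN _)) ((dγ _ _).fun_mul (dN _)), pd_mul (dγ _ _) (dN _)] at k2
  simp only [pd_add ((dV _).fun_mul (dψ _)) ((dV _).fun_mul (dψ _)), pd_mul (dV _) (dψ _)] at k3
  simp only [Fin.sum_univ_two] at k1 k2 k4 ⊢
  have key : ∀ C, γ x C 0 * (∑ B, (V x B * pd B (fun y => grad γ ψ y 0) x - grad γ ψ x B * pd B (fun y => V y 0) x))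
      + γ x C 1 * (∑ B, (V x B * pd B (fun y => grad γ ψ y 1) x - grad γ ψ x B * pd B (fun y => V y 1) x))
      = pd C (fun y => fderiv ℝ ψ y (V y)) x - σ * pd C ψ x := by
    intro C
    have pc := fun B => congrFun (pd_comm hψ B C) x
    rw [k3]
    simp only [Fin.sum_univ_two]
    linear_combination V x 0 * k2 0 C + V x 1 * k2 1 C - grad γ ψ x 0 * k4 C 0 - grad γ ψ x 1 * k4 C 1
      + pd C (fun y => V y 0) x * k1 0 + pd C (fun y => V y 1) x * k1 1 - σ * k1 C + V x 0 * pc 0 + V x 1 * pc 1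
  have h0 := Matrix.eq_zero_of_mulVec_eq_zero (hd x) (v := fun A =>
    ∑ B, (V x B * pd B (fun y => grad γ ψ y A) x - grad γ ψ x B * pd B (fun y => V y A) x)
      - (grad γ (fun y => fderiv ℝ ψ y (V y)) x A - σ * grad γ ψ x A)) (funext fun C => by
    have k5 := sum_grad (ψ := fun y => fderiv ℝ ψ y (V y)) (hd x) C
    rw [Fin.sum_univ_two] at k5
    simp only [Matrix.mulVec, dotProduct, Pi.zero_apply]
    rw [Fin.sum_univ_two]
    linear_combination key C - k5 + σ * k1 C)
  have := congrFun h0 A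
  simp only [Fin.sum_univ_two, Pi.zero_apply] at this
  linarith

end Gradient

section Variation

/-- The family of lines in the chart of data with directions `W`. -/
def lineFamily (hl : 0 < l) (c : P → AsympMetric l ρ γbar) (W : P → Datum ρ) (q : P × ℝ) : AsympMetric l ρ γbar :=
  Datum.build hl ((c q.1).datum + q.2 • W q.1) (c q.1).g

variable {hl : 0 < l} {W : P → Datum ρ}

lemma lineFamily_zero (p : P) : lineFamily hl c W (p, 0) = c p := by
  simp only [lineFamily, zero_smul, add_zero, (c p).build_datum hl]

lemma isSmoothFamily_line (hc : IsSmoothFamily c) (hW : IsDatumFamily W) : IsSmoothFamily (lineFamily hl c W) :=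
  (((hc.datum).comp_clm (.fst ℝ P ℝ)).add_smul (hW.comp_clm (.fst ℝ P ℝ)) contDiff_snd).build hl _

lemma isSmoothFamily_line_at (p : P) : IsSmoothFamily fun ε : ℝ => lineFamily hl c W (p, ε) :=
  ((IsDatumFamily.const ((c p).datum)).add_smul (IsDatumFamily.const (W p)) contDiff_id).build hl _

lemma hasDerivAt_line (p : P) {z : Bulk} (hz : z ∈ region ρ) (i j : Fin 3) :
    HasDerivAt (fun ε => (lineFamily hl c W (p, ε)).g z i j) (Datum.vel l γbar ((c p).datum) (W p) z i j) 0 := by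
  have lin : ∀ a b : ℝ, HasDerivAt (fun ε : ℝ => a + ε * b) b 0 := fun a b => by
    simpa using ((hasDerivAt_id (0 : ℝ)).mul_const b).const_add a
  have hd := hasDerivAt_metric (l := l) (γbar := γbar) (D := fun ε : ℝ => (c p).datum + ε • W p)
    (w := W p) (junk := fun _ => (c p).g) (t := 0) (z := z) (fun x => lin _ _) (fun x A B => lin _ _) hz
    (fun i j => lin _ _) i j
  simp only [zero_smul, add_zero] at hd
  exact hd

lemma exists_varLog {Y : Bdry → Bdry} {ψ : Bdry → ℝ} (h : IsGenerator ξ Y ψ)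
    (hc : IsSmoothFamily c) (hW : IsDatumFamily W) : ∃ δ : Fin 3 → (P × Bdry) × ℝ → ℝ,
    (∃ S, Ex ρ (-2) (δ 0) (fun _ => 0) S) ∧ (∀ A : Fin 2, ExO ρ (δ A.succ) (fun _ => 0) fun y =>
      -(l ^ 2 / 4) * (-2 * Datum.φ (W y.1) y.2 * grad (c y.1).γ ψ y.2 A)) ∧
    ∀ p, ∀ z ∈ region ρ, ∀ i, HasDerivAt (fun ε => ξ (lineFamily hl c W (p, ε)) z i)
      (wt i (z 0) * δ i ((p, bpt z), z 0)) 0 := by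
  obtain ⟨R, hX⟩ := h.fieldExp (isSmoothFamily_line (hl := hl) hc hW)
  have hXs := hX.contDiffOn
  set X := xLog (.snd ℝ (P × ℝ) Bdry) fun y => ξ (lineFamily hl c W y.1) with hXdef
  set L : P × Bdry →L[ℝ] (P × ℝ) × Bdry := ((ContinuousLinearMap.fst ℝ P Bdry).prod 0).prod sndB P
  have line : ∀ {F : (P × ℝ) × Bdry → ℝ} (p : P) (x : Bdry), DiffAt F ((p, 0), x) →
      HasDerivAt (fun ε : ℝ => F ((p, ε), x)) (fderiv ℝ F ((p, 0), x) ((0, 1), 0)) 0 := fun {F} p x hF =>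
    HasFDerivAt.comp_hasDerivAt (0 : ℝ) (f := fun ε : ℝ => ((p, ε), x)) hF.hasFDerivAt
      (((hasDerivAt_const _ _).prodMk (hasDerivAt_id _)).prodMk (hasDerivAt_const _ _))
  have hN : ∀ p (x : Bdry) (A : Fin 2) ε, gradB (.inr ℝ (P × ℝ) Bdry)
      (fun A B y => (lineFamily hl c W y.1).γ y.2 A B) (fun y => ψ y.2) A ((p, ε), x)
      = Real.exp (-2 * (Datum.φ ((c p).datum) x + ε * Datum.φ (W p) x)) * grad γbar ψ x A := fun p x A ε => by
    rw [family_gradB (lineFamily hl c W) h.smooth_ψ]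
    exact grad_conformal (hγ.1.lorentz x).ne (fun y => Datum.φ ((c p).datum) y + ε * Datum.φ (W p) y) A
  have dN : ∀ p (x : Bdry) (A : Fin 2), fderiv ℝ (gradB (.inr ℝ (P × ℝ) Bdry)
      (fun A B y => (lineFamily hl c W y.1).γ y.2 A B) (fun y => ψ y.2) A) ((p, 0), x) ((0, 1), 0)
      = -2 * Datum.φ (W p) x * grad (c p).γ ψ x A := fun p x A => by
    refine (line p x ((hX.smooth_N A).dif _)).unique ?_
    simp only [hN]
    have e : grad (c p).γ ψ x A = _ := grad_conformal (γ := γbar) (ψ := ψ) (hγ.1.lorentz x).ne (c p).φ A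
    rw [e]
    have h1 : HasDerivAt (fun ε : ℝ => -2 * (Datum.φ ((c p).datum) x + ε * Datum.φ (W p) x))
        (-2 * Datum.φ (W p) x) 0 := by
      simpa using (((hasDerivAt_id (0 : ℝ)).mul_const (Datum.φ (W p) x)).const_add
        (Datum.φ ((c p).datum) x)).const_mul (-2)
    refine (h1.exp.mul_const (grad γbar ψ x A)).congr_deriv ?_
    rw [zero_mul, add_zero]
    change Real.exp (-2 * (c p).φ x) * _ * _ = _
    ring
  have dsnd : ∀ (f : Bdry → ℝ), Cinf f → ∀ p x,
      fderiv ℝ (fun y : (P × ℝ) × Bdry => f y.2) ((p, 0), x) ((0, 1), 0) = 0 := fun f hf p x =>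
    (line (F := fun y => f y.2) p x (((hf.comp contDiff_snd).dif) _)).unique (hasDerivAt_const (0 : ℝ) (f x))
  have e0 := (hX.r.logD (((0, 1), 0), 0)).comp_affine L 0
  have eA := fun A => ((hX.A_exO A).logD (((0, 1), 0), 0)).comp_affine L 0
  simp only [add_zero] at e0 eA
  refine ⟨fun i w => logD (((0, 1), 0), 0) (X i) (((w.1.1, 0), w.1.2), w.2),
    ⟨_, e0.congr_coeff (fun y => ?_) fun y => rfl⟩, fun A => (eA A).congr_coeff (fun y => ?_) fun y => ?_,
    fun p z hz i => ?_⟩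
  · rw [zero_mul, zero_mul, add_zero]
    exact dsnd (fun x => -(1 / 2) * ψ x) (contDiff_const.mul h.smooth_ψ.1) y.1 y.2
  · exact dsnd (fun x => Y x A) (contDiff_pi.1 h.smooth_Y.1 A) y.1 y.2
  · rw [fderiv_const_mul ((hX.smooth_N A).dif _), smul_apply, smul_eq_mul]
    rw [zero_mul, zero_mul, add_zero]
    exact congrArg _ (dN y.1 y.2 A)
  · have hz' : ρ < z 0 := hz
    have hd := (hXs i).contDiffAt ((isOpen_end ρ).mem_nhds (show ((((p, 0), bpt z), z 0) : ((P × ℝ) × Bdry) × ℝ)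
      ∈ {w : ((P × ℝ) × Bdry) × ℝ | ρ < w.2} from hz')) |>.difAt
    have h1 : HasDerivAt (fun ε : ℝ => X i (((p, ε), bpt z), z 0))
        (fderiv ℝ (X i) (((p, 0), bpt z), z 0) (((0, 1), 0), 0)) 0 :=
      HasFDerivAt.comp_hasDerivAt (0 : ℝ) (f := fun ε : ℝ => (((p, ε), bpt z), z 0)) hd.hasFDerivAt
        ((((hasDerivAt_const _ _).prodMk (hasDerivAt_id _)).prodMk (hasDerivAt_const _ _)).prodMk
          (hasDerivAt_const _ _))
    have h2 := h1.const_mul (wt i (z 0))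
    have hw := wt_ne_zero i (hρ.1.trans_lt hz')
    simp only [hXdef, xLog, coe_snd', pt_bpt, mul_div_cancel₀ _ hw] at h2
    simpa only [logD, mul_zero, zero_mul] using h2

end Variation

section ModBracket

variable {ξ₁ ξ₂ ζ : FieldVF l ρ γbar} {Y₁ Y₂ : Bdry → Bdry} {ψ₁ ψ₂ : Bdry → ℝ}

lemma bd_inr {f : P × Bdry → ℝ} {y : P × Bdry}
    (hf : DiffAt f y) (A : Fin 2) : bd inB P A f y = pd A (fun x => f (y.1, x)) y.2 := by
  have h2 : HasFDerivAt (fun x : Bdry => (y.1, x)) inB P y.2 := (hasFDerivAt_const _ _).prodMk (hasFDerivAt_id _)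
  have h3 : HasFDerivAt (fun x => f (y.1, x)) ((fderiv ℝ f y).comp inB P) y.2 :=
    HasFDerivAt.comp (g := f) (f := fun x => (y.1, x)) y.2 hf.hasFDerivAt h2
  simp only [bd, pd, h3.fderiv, comp_apply]

lemma IsGenerator.lieBracket_eq (h₁ : IsGenerator ξ₁ Y₁ ψ₁) (h₂ : IsGenerator ξ₂ Y₂ ψ₂) (hc : IsSmoothFamily c) (p : P) {z : Bulk} (hz : z ∈ region ρ) (i : Fin 3) :
    VectorField.lieBracket ℝ (ξ₁ (c p)) (ξ₂ (c p)) z i = wt i (z 0) * brLog inB P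
      (xLog sndB P fun y => ξ₁ (c y.1)) (xLog sndB P fun y => ξ₂ (c y.1)) i ((p, bpt z), z 0) := by
  have hz' : ρ < z 0 := hz
  have hX : ∀ {ξ : FieldVF l ρ γbar} {Y ψ}, IsGenerator ξ Y ψ → ∀ i, DiffAt
      (xLog sndB P (fun y => ξ (c y.1)) i) ((p, bpt z), z 0) := fun h i => by
    obtain ⟨R, hX⟩ := h.fieldExp hc
    exact ((hX.contDiffOn i).contDiffAt ((isOpen_end ρ).mem_nhds
      (show (((p, bpt z), z 0) : (P × Bdry) × ℝ) ∈ {w : (P × Bdry) × ℝ | ρ < w.2} from hz'))).difAt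
  have hV : ∀ (ξ : FieldVF l ρ γbar) i r' x', ρ < r' → ξ (c p) (pt r' x') i = wt i r' *
      xLog sndB P (fun y => ξ (c y.1)) i ((p, bpt z) + ContinuousLinearMap.inr ℝ P Bdry (x' - bpt z), r') :=
    fun ξ i r' x' hr => by
      have := wt_ne_zero i (hρ.1.trans_lt hr)
      simp only [xLog, coe_snd', inr_apply, Prod.mk_add_mk, add_zero, add_sub_cancel, mul_div_cancel₀ _ this]
  have hd : ∀ {ξ : FieldVF l ρ γbar} {Y ψ}, IsGenerator ξ Y ψ → DiffAt (ξ (c p)) (pt (z 0) (bpt z)) := fun h => by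
      rw [pt_bpt]
      exact ((h.field (c p)).1.contDiffAt ((isOpen_lt continuous_const (continuous_apply 0)).mem_nhds hz)).difAt
  have := lieBracket_eq_brLog hz' (hX h₁) (hX h₂) (hV ξ₁) (hV ξ₂) (hd h₁) (hd h₂) i
  rwa [pt_bpt] at this

lemma IsModBracket.fieldExp (hl : 0 < l) (hζ : IsModBracket ξ₁ ξ₂ ζ)
    (h₁ : IsGenerator ξ₁ Y₁ ψ₁) (h₂ : IsGenerator ξ₂ Y₂ ψ₂) {ψ : Bdry → ℝ}
    (hψ : ψ = fun x => fderiv ℝ ψ₂ x (Y₁ x) - fderiv ℝ ψ₁ x (Y₂ x)) (hψs : CylSmooth ψ) (hc : IsSmoothFamily c) : ∃ R,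
    FieldExp ρ l (xLog sndB P fun y => ζ (c y.1)) (fun A y => VectorField.lieBracket ℝ Y₁ Y₂ y.2 A)
      (fun y => ψ y.2) R (gradB inB P (famG c) (fun y => ψ y.2)) := by
  obtain ⟨W₁, hW₁, t₁⟩ := h₁.exists_tangent hl hc
  obtain ⟨W₂, hW₂, t₂⟩ := h₂.exists_tangent hl hc
  obtain ⟨δ₂, ⟨S₂, r₂⟩, A₂, d₂⟩ := exists_varLog (hl := hl) h₂ hc hW₁
  obtain ⟨δ₁, ⟨S₁, r₁⟩, A₁, d₁⟩ := exists_varLog (hl := hl) h₁ hc hW₂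
  obtain ⟨R₁, X₁⟩ := h₁.fieldExp hc
  obtain ⟨R₂, X₂⟩ := h₂.fieldExp hc
  have hX : ∀ i (w : (P × Bdry) × ℝ), ρ < w.2 → brLog inB P (xLog sndB P fun y => ξ₁ (c y.1))
      (xLog sndB P fun y => ξ₂ (c y.1)) i w - δ₂ i w + δ₁ i w = xLog sndB P (fun y => ζ (c y.1)) i w := by
    rintro i ⟨⟨p, x⟩, r⟩ hr
    have hz : pt r x ∈ region ρ := hr
    obtain ⟨v₁₂, v₂₁, hv, hv', e⟩ := hζ (c p)
    have u₂ := (hv _ (isSmoothFamily_line_at (hl := hl) (W := W₁) p) (lineFamily_zero p)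
      (fun z hz i j => (t₁ p).1 z hz i j ▸ hasDerivAt_line p hz i j) _ hz i).unique (d₂ p _ hz i)
    have u₁ := (hv' _ (isSmoothFamily_line_at (hl := hl) (W := W₂) p) (lineFamily_zero p)
      (fun z hz i j => (t₂ p).1 z hz i j ▸ hasDerivAt_line p hz i j) _ hz i).unique (d₁ p _ hz i)
    have hw := wt_ne_zero i (hρ.1.trans_lt hr)
    rw [xLog, eq_div_iff (by exact hw)]
    simp only [coe_snd', e _ hz, Pi.add_apply, Pi.sub_apply, u₁, u₂, h₁.lieBracket_eq h₂ hc p hz, bpt_pt, pt_zero]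
    ring
  obtain ⟨S, hr⟩ := brLog_r (J := .inr ℝ P Bdry) X₁ X₂
  have hs : ∀ A B, Cinf fun x => γbar x A B := fun A B => (hγ.1.smooth A B).1
  have bc : ∀ (f : Bdry → ℝ), Cinf f → ∀ D (y : P × Bdry), bd inB P D (fun y : P × Bdry => f y.2) y
    = pd D f y.2 := fun f hf D y => bd_comp (J := .inr ℝ P Bdry) (π := .snd ℝ P Bdry) (fun _ => rfl) hf D y
  have cY₁ := contDiff_pi.1 h₁.smooth_Y.1
  have cY₂ := contDiff_pi.1 h₂.smooth_Y.1
  have dY₁ := h₁.smooth_Y.1.dif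
  have dY₂ := h₂.smooth_Y.1.dif
  have hbr : ∀ A (y : P × Bdry), ∑ B, (Y₁ y.2 B * bd inB P B (fun y : P × Bdry => Y₂ y.2 A) y
      - Y₂ y.2 B * bd inB P B (fun y : P × Bdry => Y₁ y.2 A) y) = VectorField.lieBracket ℝ Y₁ Y₂ y.2 A := fun A y => by
    rw [lieBracket_apply (dY₁ _) (dY₂ _)]
    simp only [bc _ (cY₁ A), bc _ (cY₂ A)]
  have hN := fun {χ : Bdry → ℝ} (hχ : CylSmooth χ) A => family_contDiff_gradB (ψ := χ) hc hχ A
  have eN := fun {χ : Bdry → ℝ} (hχ : CylSmooth χ) A (y : P × Bdry) => family_gradB (ψ := χ) c hχ A y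
  have hA : ∀ A : Fin 2, ExO ρ (xLog sndB P (fun y => ζ (c y.1)) A.succ)
      (fun y => VectorField.lieBracket ℝ Y₁ Y₂ y.2 A) (fun y => -(l ^ 2 / 4) *
        gradB inB P (famG c) (fun y => ψ y.2) A y) := fun A => by
    refine ((((brLog_A (J := .inr ℝ P Bdry) X₁ X₂ A).sub (A₂ A)).add (A₁ A)).congr
      (hX A.succ)).congr_coeff (fun y => ?_) fun y => ?_
    · rw [sub_zero, add_zero]
      exact hbr A y
    · have g := fun {χ : Bdry → ℝ} (hχ : CylSmooth χ) A B => bd_inr (y := y) ((hN hχ A).dif y) B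
      simp only [g h₁.smooth_ψ, g h₂.smooth_ψ, eN h₁.smooth_ψ, eN h₂.smooth_ψ, eN hψs, bc _ (cY₁ A), bc _ (cY₂ A)]
      have hg := fun A B => ((c y.1).contDiff_γ A B)
      have hsy := (c y.1).isSymm_γ
      have hd := fun x => ((c y.1).det_γ_neg x).ne
      have k₁ := lie_grad hg hsy hd h₂.smooth_ψ.1 h₁.smooth_Y.1 (x := y.2)
        (σ := 2 * Datum.φ (W₁ y.1) y.2 + ψ₁ y.2) (fun A B => by linear_combination -(t₁ y.1).2 y.2 A B) A
      have k₂ := lie_grad hg hsy hd h₁.smooth_ψ.1 h₂.smooth_Y.1 (x := y.2)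
        (σ := 2 * Datum.φ (W₂ y.1) y.2 + ψ₂ y.2) (fun A B => by linear_combination -(t₂ y.1).2 y.2 A B) A
      have k₃ : grad (c y.1).γ ψ y.2 A = _ := hψ ▸ grad_sub
        (((h₂.smooth_ψ.1.fderiv_right (by simp)).clm_apply h₁.smooth_Y.1).dif _)
        (((h₁.smooth_ψ.1.fderiv_right (by simp)).clm_apply h₂.smooth_Y.1).dif _) A
      rw [k₃]
      simp only [Fin.sum_univ_two] at k₁ k₂ ⊢
      linear_combination -(l ^ 2 / 4) * (k₁ - k₂)
  refine ⟨_, fun A => (hA A).left, hN hψs, (((hr.sub r₂).add r₁).congr (hX 0)).congr_coeff (fun y => ?_)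
    (fun y => rfl), fun A => (hA A).fall.congr fun w _ => by ring⟩
  rw [hψ]
  simp only [fderiv_eq_sum_pd, bc _ h₁.smooth_ψ.1, bc _ h₂.smooth_ψ.1, sum_sub_distrib]
  ring

end ModBracket

section Closure

variable {ξ₁ ξ₂ ζ : FieldVF l ρ γbar} {Y₁ Y₂ : Bdry → Bdry} {ψ₁ ψ₂ : Bdry → ℝ}

lemma IsGenerator.exists_modBracket (hl : 0 < l)
    (h₁ : IsGenerator ξ₁ Y₁ ψ₁) (h₂ : IsGenerator ξ₂ Y₂ ψ₂) : ∃ ζ, IsModBracket ξ₁ ξ₂ ζ := by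
  have key : ∀ {ξ ξ' : FieldVF l ρ γbar} {Y Y' ψ ψ'}, IsGenerator ξ Y ψ → IsGenerator ξ' Y' ψ' → ∀ m,
      ∃ v, IsVariation ξ' m (lieDeriv (ξ m) m.g) v := fun h h' m => by
    obtain ⟨W, -, t⟩ := h.exists_tangent hl (IsSmoothFamily.const (P := ℝ) m)
    exact ⟨_, isVariation_of_tangent hl h' m (t 0).1⟩
  choose v hv using key h₁ h₂
  choose v' hv' using key h₂ h₁
  exact ⟨fun m z => VectorField.lieBracket ℝ (ξ₁ m) (ξ₂ m) z - v m z + v' m z,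
    fun m => ⟨v m, v' m, hv m, hv' m, fun _ _ => rfl⟩⟩

lemma region_add_period {z : Bulk} (hz : z ∈ region ρ) : z + period 2 ∈ region ρ := by
  change ρ < (z + period 2 : Bulk) 0
  rwa [add_period_zero]

/-- The induced variation of a periodic field is periodic. -/
lemma IsVariation.periodic (hξ : ∀ m, IsBulkField ρ (ξ m)) {m : AsympMetric l ρ γbar}
    {h : Bulk → Mat3} {v : Bulk → Bulk} (hv : IsVariation ξ m h v)
    {c : ℝ → AsympMetric l ρ γbar} (hc : IsSmoothFamily c) (c0 : c 0 = m)
    (hd : ∀ z ∈ region ρ, ∀ i j, HasDerivAt (fun ε => (c ε).g z i j) (h z i j) 0) {z : Bulk} (hz : z ∈ region ρ) :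
    v (z + period 2) = v z := by
  funext μ
  have hz' : z + period 2 ∈ region ρ := region_add_period hz
  refine (hv c hc c0 hd _ hz' μ).unique ?_
  simp only [(hξ _).2 z hz]
  exact hv c hc c0 hd z hz μ

lemma CylSmooth.lie {ψ : Bdry → ℝ} {Y : Bdry → Bdry} (hψ : CylSmooth ψ) (hY : CylSmooth Y) :
    CylSmooth fun x => fderiv ℝ ψ x (Y x) := ⟨(hψ.1.fderiv_right (by simp)).clm_apply hY.1, fun x => by
    beta_reduce
    rw [hY.2, ← fderiv_comp_add_right]
    simp only [hψ.2]⟩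

lemma IsModBracket.isGenerator (hl : 0 < l)
    (hζ : IsModBracket ξ₁ ξ₂ ζ) (h₁ : IsGenerator ξ₁ Y₁ ψ₁) (h₂ : IsGenerator ξ₂ Y₂ ψ₂) :
    IsGenerator ζ (VectorField.lieBracket ℝ Y₁ Y₂) fun x => fderiv ℝ ψ₂ x (Y₁ x) - fderiv ℝ ψ₁ x (Y₂ x) := by
  have m₀ : AsympMetric l ρ γbar := Datum.build hl 0 0
  obtain ⟨k₁, d₁⟩ := h₁.conformalKilling_and_harmonic hl m₀
  obtain ⟨k₂, d₂⟩ := h₂.conformalKilling_and_harmonic hl m₀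
  have s₁ := h₂.smooth_ψ.lie h₁.smooth_Y
  have s₂ := h₁.smooth_ψ.lie h₂.smooth_Y
  have hψs : CylSmooth fun x => fderiv ℝ ψ₂ x (Y₁ x) - fderiv ℝ ψ₁ x (Y₂ x) := CylFun.sub_mem s₁ s₂
  refine isGenerator_of_form hl (cylVF_bracket_mem ⟨Y₁, h₁.smooth_Y⟩ ⟨Y₂, h₂.smooth_Y⟩) hψs
    (k₁.lieBracket hγ.1 h₁.smooth_Y.1 h₂.smooth_Y.1 k₂) (fun x => ?_) (fun m => ⟨?_, fun z hz => ?_⟩)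
    fun P _ _ _ c hc => hζ.fieldExp hl h₁ h₂ rfl hψs hc
  · have e := laplacian_add_smul (γ := γbar) s₁.1 s₂.1 1 (-1) x
    rw [laplacian_lie_eq_zero hγ.1 h₁.smooth_Y.1 h₂.smooth_ψ.1 k₁ d₂,
      laplacian_lie_eq_zero hγ.1 h₂.smooth_Y.1 h₁.smooth_ψ.1 k₂ d₁] at e
    simp only [one_smul, neg_smul, mul_zero, add_zero, ← sub_eq_add_neg] at e
    exact e
  · obtain ⟨R, hX⟩ := hζ.fieldExp hl h₁ h₂ rfl hψs (IsSmoothFamily.const (P := ℝ) m)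
    refine contDiffOn_pi.2 fun i => ?_
    have hb : Cinf fun z : Bulk => ((((0 : ℝ), bpt z), z 0) : (ℝ × Bdry) × ℝ) :=
      (contDiff_const.prodMk (contDiff_pi.2 fun A : Fin 2 => contDiff_apply ℝ ℝ A.succ)).prodMk (contDiff_apply ℝ ℝ (0 : Fin 3))
    have hw : Cinf fun z : Bulk => wt i (z 0) := by
      unfold wt
      split_ifs
      exacts [contDiff_apply ℝ ℝ (0 : Fin 3), contDiff_const]
    refine (hw.contDiffOn.mul ((hX.contDiffOn i).comp hb.contDiffOn fun z hz => hz)).congr fun z hz => ?_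
    have := wt_ne_zero i (hρ.1.trans_lt (show ρ < z 0 from hz))
    simp only [Function.comp, xLog, coe_snd', pt_bpt, mul_div_cancel₀ _ this]
  · have hc := IsSmoothFamily.const (P := ℝ) m
    obtain ⟨W₁, hW₁, t₁⟩ := h₁.exists_tangent hl hc
    obtain ⟨W₂, hW₂, t₂⟩ := h₂.exists_tangent hl hc
    obtain ⟨v₁₂, v₂₁, hv, hv', e⟩ := hζ m
    have hz' : z + period 2 ∈ region ρ := region_add_period hz
    have p₁ := hv.periodic h₂.field (isSmoothFamily_line_at (hl := hl)
      (c := fun _ : ℝ => m) (W := W₁) 0) (lineFamily_zero _)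
      (fun z hz i j => (t₁ 0).1 z hz i j ▸ hasDerivAt_line (c := fun _ : ℝ => m) 0 hz i j) hz
    have p₂ := hv'.periodic h₁.field (isSmoothFamily_line_at (hl := hl)
      (c := fun _ : ℝ => m) (W := W₂) 0) (lineFamily_zero _)
      (fun z hz i j => (t₂ 0).1 z hz i j ▸ hasDerivAt_line (c := fun _ : ℝ => m) 0 hz i j) hz
    have hf : ∀ {V : Bulk → Bulk}, IsBulkField ρ V → fderiv ℝ V (z + period 2) = fderiv ℝ V z := fun {V} hV => by
      rw [← fderiv_comp_add_right]
      refine EventuallyEq.fderiv_eq ?_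
      filter_upwards [(isOpen_lt continuous_const (continuous_apply 0)).mem_nhds hz] with z' hz' using hV.2 z' hz'
    rw [e z hz, e _ hz', p₁, p₂, VectorField.lieBracket, VectorField.lieBracket, hf (h₁.field m), hf (h₂.field m),
      (h₁.field m).2 z hz, (h₂.field m).2 z hz]

end Closure

section Algebra

variable {γ : Bdry → Mat2}

/-- The Lie algebra of conformal Killing vectors. -/
def confAlg (hγ : IsLorentzMetric γ) : LieSubalgebra ℝ CylVF where
  carrier := {Y | IsConformalKilling γ Y}
  add_mem' {Y Z} hY hZ := by simpa using hY.add_smul Y.2.1 Z.2.1 hZ 1 1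
  zero_mem' := ⟨0, fun x => by ext; simp [lieDeriv, pd]⟩
  smul_mem' s Y hY := by simpa using hY.add_smul Y.2.1 Y.2.1 hY s 0
  lie_mem' {Y Z} hY hZ := hY.lieBracket hγ Y.2.1 Z.2.1 hZ

lemma laplacian_zero (γ : Bdry → Mat2) (x : Bdry) : laplacian γ 0 x = 0 := by
  simpa using laplacian_add_smul (γ := γ) (0 : CylFun).2.1 (0 : CylFun).2.1 0 0 x

/-- The abelian Lie algebra of harmonic functions. -/
def harmonicAlg (γ : Bdry → Mat2) : LieSubalgebra ℝ CylFun where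
  carrier := {ψ | ∀ x, laplacian γ ψ x = 0}
  add_mem' {ψ χ} hψ hχ x := by simpa [hψ x, hχ x] using laplacian_add_smul (γ := γ) ψ.2.1 χ.2.1 1 1 x
  zero_mem' := laplacian_zero γ
  smul_mem' s ψ hψ x := by simpa [hψ x] using laplacian_add_smul (γ := γ) ψ.2.1 ψ.2.1 s 0 x
  lie_mem' _ _ := laplacian_zero γ

lemma fderiv_lie {ψ : Bdry → ℝ} {Y Z : Bdry → Bdry} (hψ : Cinf ψ) (hY : Cinf Y)
    (hZ : Cinf Z) (x : Bdry) : fderiv ℝ ψ x (VectorField.lieBracket ℝ Y Z x)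
      = fderiv ℝ (fun y => fderiv ℝ ψ y (Z y)) x (Y x) - fderiv ℝ (fun y => fderiv ℝ ψ y (Y y)) x (Z x) := by
  have hd : DiffAt (fderiv ℝ ψ) x := ((hψ.fderiv_right (m := ∞) (by simp)).dif) x
  have hs : IsSymmSndFDerivAt ℝ ψ x := hψ.contDiffAt.isSymmSndFDerivAt
    (by simpa using WithTop.coe_le_coe.2 (le_top : (2 : ℕ∞) ≤ ⊤))
  rw [fderiv_clm_apply hd (hZ.dif x), fderiv_clm_apply hd (hY.dif x)]
  simp only [VectorField.lieBracket, map_sub, add_apply, comp_apply, ContinuousLinearMap.flip_apply, hs.eq (Y x) (Z x)]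
  ring

/-- Conformal Killing vectors act on harmonic functions by derivations. -/
def lieAct (hγ : IsLorentzMetric γ) : confAlg hγ →ₗ⁅ℝ⁆ LieDerivation ℝ (harmonicAlg γ) (harmonicAlg γ) where
  toFun Y :=
    { toFun ψ := ⟨⟨fun x => fderiv ℝ ψ.1.1 x (Y.1.1 x), ψ.1.2.lie Y.1.2⟩,
        laplacian_lie_eq_zero hγ Y.1.2.1 ψ.1.2.1 Y.2 ψ.2⟩
      map_add' ψ χ := by
        ext x
        exact congrArg (fun L : Bdry →L[ℝ] ℝ => L (Y.1.1 x)) (fderiv_add (ψ.1.2.1.dif x) (χ.1.2.1.dif x))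
      map_smul' s ψ := by
        ext x
        exact congrArg (fun L : Bdry →L[ℝ] ℝ => L (Y.1.1 x)) (fderiv_const_smul (ψ.1.2.1.dif x) s)
      leibniz' ψ χ := by
        ext x
        have : fderiv ℝ (0 : Bdry → ℝ) x (Y.1.1 x) = 0 - 0 := by simp
        exact this }
  map_add' Y Z := by
    ext ψ x
    exact map_add _ _ _
  map_smul' s Y := by
    ext ψ x
    exact (fderiv ℝ ψ.1.1 x).map_smul s (Y.1.1 x)
  map_lie' {Y Z} := by
    ext ψ x
    exact fderiv_lie ψ.1.2.1 Y.1.2.1 Z.1.2.1 x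

/-- The semidirect product of the conformal algebra and the harmonic functions. -/
notation:max "SemiDir" h:max => LieAlgebra.SemiDirectSum (harmonicAlg _) (confAlg h) (lieAct h)

end Algebra

section Generators

variable {ξ ξ' : FieldVF l ρ γbar} {Y Y' : Bdry → Bdry}
  {ψ ψ' : Bdry → ℝ}

lemma IsGenerator.unique (m : AsympMetric l ρ γbar)
    (h : IsGenerator ξ Y ψ) (h' : IsGenerator ξ Y' ψ') : Y = Y' ∧ ψ = ψ' := by
  obtain ⟨R, hX⟩ := h.fieldExp (IsSmoothFamily.const (P := ℝ) m)
  obtain ⟨R', hX'⟩ := h'.fieldExp (IsSmoothFamily.const (P := ℝ) m)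
  refine ⟨funext fun x => funext fun A => congrFun ((hX.A_ex A).unique (hX'.A_ex A)).1 ((0 : ℝ), x), funext fun x => ?_⟩
  have := congrFun (hX.r.unique hX'.r).1 ((0 : ℝ), x)
  simp only at this
  linarith

lemma FieldExp.add_smul {B : Type*} [NormedAddCommGroup B] [NormedSpace ℝ B] {X X' : Fin 3 → B × ℝ → ℝ}
    {V V' N N' : Fin 2 → B → ℝ} {ψ ψ' R R' : B → ℝ} (h : FieldExp ρ l X V ψ R N)
    (h' : FieldExp ρ l X' V' ψ' R' N') (s t : ℝ) : FieldExp ρ l (fun i w => s * X i w + t * X' i w)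
      (fun A y => s * V A y + t * V' A y) (fun y => s * ψ y + t * ψ' y) (fun y => s * R y + t * R' y)
      fun A y => s * N A y + t * N' A y where
  smooth_V A := (contDiff_const.mul (h.smooth_V A)).add (contDiff_const.mul (h'.smooth_V A))
  smooth_N A := (contDiff_const.mul (h.smooth_N A)).add (contDiff_const.mul (h'.smooth_N A))
  r := ((h.r.const_mul s).add (h'.r.const_mul t)).congr_coeff (fun y => by ring) fun y => rfl
  A A := (((h.A A).const_mul s).add ((h'.A A).const_mul t)).congr fun w _ => by ring

lemma grad_add_smul {γ : Bdry → Mat2} (hψ : Cinf ψ) (hψ' : Cinf ψ') (s t : ℝ) (x : Bdry) (A : Fin 2) :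
    grad γ (s • ψ + t • ψ') x A = s * grad γ ψ x A + t * grad γ ψ' x A := by
  have dψ := hψ.dif x
  have dψ' := hψ'.dif x
  have e : ∀ B, pd B (s • ψ + t • ψ') x = s * pd B ψ x + t * pd B ψ' x := fun B => by
    rw [pd, fderiv_add (dψ.const_smul s) (dψ'.const_smul t), fderiv_const_smul dψ, fderiv_const_smul dψ']
    rfl
  simp only [grad, e, mul_sum, ← sum_add_distrib]
  exact sum_congr rfl fun B _ => by ring

lemma IsGenerator.add_smul (hl : 0 < l) (h : IsGenerator ξ Y ψ) (h' : IsGenerator ξ' Y' ψ') (s t : ℝ) :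
    IsGenerator (s • ξ + t • ξ') (s • Y + t • Y') (s • ψ + t • ψ') := by
  obtain ⟨k, d⟩ := h.conformalKilling_and_harmonic hl (Datum.build hl 0 0)
  obtain ⟨k', d'⟩ := h'.conformalKilling_and_harmonic hl (Datum.build hl 0 0)
  have hψ : CylSmooth (s • ψ + t • ψ') := CylFun.add_mem (CylFun.smul_mem s h.smooth_ψ) (CylFun.smul_mem t h'.smooth_ψ)
  refine isGenerator_of_form hl (CylVF.add_mem (CylVF.smul_mem s h.smooth_Y) (CylVF.smul_mem t h'.smooth_Y)) hψ
    (k.add_smul h.smooth_Y.1 h'.smooth_Y.1 k' s t) (fun x => ?_) (fun m => ⟨?_, fun z hz => ?_⟩) fun P _ _ _ c hc => ?_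
  · rw [laplacian_add_smul h.smooth_ψ.1 h'.smooth_ψ.1, d, d', mul_zero, mul_zero, add_zero]
  · exact ((h.field m).1.const_smul s).add ((h'.field m).1.const_smul t)
  · simp only [Pi.add_apply, Pi.smul_apply, (h.field m).2 z hz, (h'.field m).2 z hz]
  · obtain ⟨R, hX⟩ := h.fieldExp hc
    obtain ⟨R', hX'⟩ := h'.fieldExp hc
    have e := hX.add_smul hX' s t
    have e1 : (fun i w => s * xLog sndB P (fun y => ξ (c y.1)) i w + t * xLog sndB P (fun y => ξ' (c y.1)) i w)
        = xLog sndB P fun y => (s • ξ + t • ξ') (c y.1) := by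
      funext i w
      simp only [xLog, Pi.add_apply, Pi.smul_apply, smul_eq_mul]
      ring
    have e2 : (fun A y => s * gradB inB P (famG c) (fun y => ψ y.2) A y
        + t * gradB inB P (famG c) (fun y => ψ' y.2) A y) = gradB inB P (famG c) (fun y => (s • ψ + t • ψ') y.2) := by
      funext A y
      rw [family_gradB c h.smooth_ψ, family_gradB c h'.smooth_ψ, family_gradB c hψ,
        grad_add_smul h.smooth_ψ.1 h'.smooth_ψ.1]
    rw [e1, e2] at e
    exact ⟨_, e⟩

lemma AsympMetric.grad_add_period (hψ : CylSmooth ψ) (x : Bdry) : grad m.γ ψ (x + period 1) = grad m.γ ψ x := by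
  funext A
  have : ∀ B, pd B ψ (x + period 1) = pd B ψ x := fun B => by
    rw [pd, ← fderiv_comp_add_right]
    simp only [hψ.2]
    rfl
  simp only [grad, this, m.periodic_γ]

/-- The vector field with given leading data and no subleading terms. -/
def leadingField (l ρ : ℝ) (γbar : Bdry → Mat2) (Y : Bdry → Bdry) (ψ : Bdry → ℝ) :
    FieldVF l ρ γbar := fun m z =>
  Fin.cons (-(1 / 2) * ψ (bpt z) * z 0) fun A => Y (bpt z) A - l ^ 2 / (4 * z 0 ^ 2) * grad m.γ ψ (bpt z) A

lemma isGenerator_leadingField (hl : 0 < l) (hY : CylSmooth Y)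
    (hψ : CylSmooth ψ) (hk : IsConformalKilling γbar Y) (hh : ∀ x, laplacian γbar ψ x = 0) :
    IsGenerator (leadingField l ρ γbar Y ψ) Y ψ := by
  refine isGenerator_of_form hl hY hψ hk hh (fun m => ⟨?_, fun z hz => ?_⟩) fun P _ _ _ c hc => ⟨0, ?_⟩
  · have hb : Cinf bpt := contDiff_pi.2 fun A : Fin 2 => contDiff_apply ℝ ℝ A.succ
    have h0 : Cinf fun z : Bulk => z 0 := contDiff_apply ℝ ℝ (0 : Fin 3)
    refine contDiffOn_pi.2 fun i => Fin.cases ?_ (fun A => ?_) i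
    · exact ((contDiff_const.mul (hψ.1.comp hb)).mul h0).contDiffOn
    · have hg := contDiff_grad (m.contDiff_γ) (m.isSymm_γ) (fun x => (m.det_γ_neg x).ne) hψ.1 A
      refine (((contDiff_pi.1 hY.1 A).comp hb).contDiffOn).sub (ContDiffOn.mul ?_ (hg.comp hb).contDiffOn)
      refine contDiffOn_const.div (contDiff_const.mul (h0.pow 2)).contDiffOn fun z hz => ?_
      have := hρ.1.trans_lt (show ρ < z 0 from hz)
      positivity
  · simp only [leadingField, bpt_add_period, add_period_zero, hY.2, hψ.2, m.grad_add_period hψ]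
  · have hN := family_contDiff_gradB hc hψ
    refine ⟨fun A => (contDiff_pi.1 hY.1 A).comp contDiff_snd, hN, ⟨contDiff_const.mul (hψ.1.comp contDiff_snd),
      contDiff_const, IsFall.zero.congr fun w hw => ?_⟩, fun A => IsFall.zero.congr fun w hw => ?_⟩
    · have := (hρ.1.trans_lt hw).ne'
      simp only [xLog, leadingField, coe_snd', bpt_pt, pt_zero, wt_zero, Fin.cons_zero, mul_div_cancel_right₀ _ this]
      simp
    · rw [family_gradB c hψ]
      simp only [xLog, leadingField, coe_snd', bpt_pt, pt_zero, wt_succ, Fin.cons_succ, div_one]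
      rw [zpow_neg]
      norm_cast
      have := (hρ.1.trans_lt hw).ne'
      field_simp
      ring

/-- The space of asymptotic symmetries. -/
def genSpace (hl : 0 < l) (ρ : ℝ) (γbar : Bdry → Mat2) [Fact (0 ≤ ρ)] [hγ : Fact (IsLorentzMetric γbar)] :
    Submodule ℝ (FieldVF l ρ γbar) where
  carrier := {ξ | ∃ Y ψ, IsGenerator ξ Y ψ}
  add_mem' := by
    rintro ξ ξ' ⟨Y, ψ, h⟩ ⟨Y', ψ', h'⟩
    exact ⟨_, _, by simpa using h.add_smul hl h' 1 1⟩
  zero_mem' := by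
    have h := isGenerator_leadingField (l := l) (ρ := ρ) hl CylVF.zero_mem CylFun.zero_mem
      (confAlg hγ.1).zero_mem (harmonicAlg γbar).zero_mem
    exact ⟨_, _, by simpa using h.add_smul hl h 0 0⟩
  smul_mem' := by
    rintro s ξ ⟨Y, ψ, h⟩
    exact ⟨_, _, by simpa using h.add_smul hl h s 0⟩

/-- The leading data of an asymptotic symmetry. -/
lemma exists_leadingData (hl : 0 < l) (ξ : genSpace hl ρ γbar) : ∃ T : SemiDir hγ.1,
      IsGenerator (ξ : FieldVF l ρ γbar) ((T.right : CylVF) : Bdry → Bdry) ((T.left : CylFun) : Bdry → ℝ) := by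
  obtain ⟨Y, ψ, h⟩ := ξ.2
  obtain ⟨k, d⟩ := h.conformalKilling_and_harmonic hl (Datum.build hl 0 0)
  exact ⟨⟨⟨⟨ψ, h.smooth_ψ⟩, d⟩, ⟨⟨Y, h.smooth_Y⟩, k⟩⟩, h⟩

lemma leadingData_unique (hl : 0 < l) {T T' : SemiDir hγ.1}
    (h : IsGenerator ξ ((T.right : CylVF) : Bdry → Bdry) ((T.left : CylFun) : Bdry → ℝ))
    (h' : IsGenerator ξ ((T'.right : CylVF) : Bdry → Bdry) ((T'.left : CylFun) : Bdry → ℝ)) : T = T' := by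
  obtain ⟨e, e'⟩ := h.unique (Datum.build hl 0 0) h'
  exact LieAlgebra.SemiDirectSum.ext (Subtype.ext (Subtype.ext e')) (Subtype.ext (Subtype.ext e))

/-- The leading data as a linear map. -/
def leadingData (hl : 0 < l) : genSpace hl ρ γbar →ₗ[ℝ] SemiDir hγ.1 where
  toFun ξ := (exists_leadingData hl ξ).choose
  map_add' ξ ξ' := leadingData_unique hl (exists_leadingData hl _).choose_spec (by
    simpa using (exists_leadingData hl ξ).choose_spec.add_smul hl (exists_leadingData hl ξ').choose_spec 1 1)
  map_smul' s ξ := leadingData_unique hl (exists_leadingData hl _).choose_spec (by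
    simpa using (exists_leadingData hl ξ).choose_spec.add_smul hl (exists_leadingData hl ξ).choose_spec s 0)

lemma leadingData_spec (hl : 0 < l) (ξ : genSpace hl ρ γbar) :
    IsGenerator (ξ : FieldVF l ρ γbar) (((leadingData hl ξ).right : CylVF) : Bdry → Bdry)
      (((leadingData hl ξ).left : CylFun) : Bdry → ℝ) := (exists_leadingData hl ξ).choose_spec

lemma leadingData_surjective (hl : 0 < l) :
    Function.Surjective (leadingData hl : genSpace hl ρ γbar →ₗ[ℝ] _) := fun T => by
  have h := isGenerator_leadingField (l := l) (ρ := ρ) hl T.right.1.2 T.left.1.2 T.right.2 T.left.2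
  exact ⟨⟨_, _, _, h⟩, leadingData_unique hl (leadingData_spec hl _) h⟩

end Generators

section Fourier

local instance : Fact (0 < twoPi) := ⟨Real.two_pi_pos⟩

/-- Smooth `2π`-periodic functions. -/
def CircSmooth {E : Type*} [NormedAddCommGroup E] [NormedSpace ℝ E] (f : ℝ → E) : Prop :=
  Cinf f ∧ ∀ t, f (t + twoPi) = f t

/-- The character `e^{int}`. -/
def chr (n : ℤ) (t : ℝ) : ℂ := Complex.exp (I * (n : ℂ) * (t : ℂ))

/-- The Fourier series with coefficients `c`. -/
def expSer (c : ℤ → ℂ) (t : ℝ) : ℂ := ∑' n, c n * chr n t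

lemma norm_chr (n : ℤ) (t : ℝ) : ‖chr n t‖ = 1 := by
  have : I * (n : ℂ) * (t : ℂ) = ((n * t : ℝ) : ℂ) * I := by push_cast; ring
  rw [chr, this, Complex.norm_exp_ofReal_mul_I]

lemma chr_eq_fourier (n : ℤ) (t : ℝ) : chr n t = fourier n (t : AddCircle twoPi) := by
  rw [fourier_coe_apply, chr]
  congr 1
  have : (Real.pi : ℂ) ≠ 0 := by exact_mod_cast Real.pi_ne_zero
  push_cast
  field_simp

lemma chr_periodic (n : ℤ) (t : ℝ) : chr n (t + twoPi) = chr n t := by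
  rw [chr_eq_fourier, chr_eq_fourier, AddCircle.coe_add_period]

lemma hasDerivAt_chr (n : ℤ) (t : ℝ) : HasDerivAt (chr n) (I * n * chr n t) t := by
  have := (((hasDerivAt_id (t : ℂ)).const_mul (I * (n : ℂ))).cexp).comp_ofReal
  simp only [id, mul_one] at this
  exact this.congr_deriv (mul_comm _ _)

lemma contDiff_chr (n : ℤ) : Cinf (chr n) := (contDiff_const.mul Complex.ofRealCLM.contDiff).cexp

variable {c d : ℤ → ℂ}

lemma RapidDecay.summable_norm (hc : RapidDecay c) : Summable fun n => ‖c n‖ := by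
  simpa using hc 0

lemma RapidDecay.summable_chr (hc : RapidDecay c) (t : ℝ) : Summable fun n => c n * chr n t :=
  Summable.of_norm (by simpa only [norm_mul, norm_chr, mul_one] using hc.summable_norm)

lemma RapidDecay.deriv (hc : RapidDecay c) : RapidDecay fun n => c n * (I * n) := fun k => by
  refine (hc (k + 1)).congr fun n => ?_
  rw [norm_mul, norm_mul, Complex.norm_I, Complex.norm_intCast]
  ring

lemma RapidDecay.sub (hc : RapidDecay c) (hd : RapidDecay d) : RapidDecay fun n => c n - d n := fun k => by
  refine ((hc k).add (hd k)).of_nonneg_of_le (fun n => by positivity) fun n => ?_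
  rw [← mul_add]
  exact mul_le_mul_of_nonneg_left (norm_sub_le _ _) (by positivity)

lemma rapidDecay_single (m : ℤ) (z : ℂ) : RapidDecay (Pi.single m z) := fun k =>
  summable_of_ne_finset_zero (s := {m}) fun n hn => by
    rw [Pi.single_eq_of_ne (by simpa using hn), norm_zero, mul_zero]

lemma expSer_single (m : ℤ) (z : ℂ) (t : ℝ) : expSer (Pi.single m z) t = z * chr m t := by
  rw [expSer, tsum_eq_single m fun n hn => by rw [Pi.single_eq_of_ne hn, zero_mul], Pi.single_eq_same]

lemma expSer_sub (hc : RapidDecay c) (hd : RapidDecay d) (t : ℝ) :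
    expSer (fun n => c n - d n) t = expSer c t - expSer d t := by
  simp only [expSer, sub_mul]
  exact (hc.summable_chr t).tsum_sub (hd.summable_chr t)

lemma hasDerivAt_expSer (hc : RapidDecay c) (t : ℝ) : HasDerivAt (expSer c) (expSer (fun n => c n * (I * n)) t) t := by
  refine (hasDerivAt_tsum (u := fun n => ‖c n * (I * n)‖) hc.deriv.summable_norm
    (fun n t => (hasDerivAt_chr n t).const_mul (c n)) (fun n t => ?_) (hc.summable_chr 0) t).congr_deriv ?_
  · rw [← mul_assoc, norm_mul, norm_chr, mul_one]
  · simp only [expSer, mul_assoc]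

lemma circSmooth_expSer (hc : RapidDecay c) : CircSmooth (expSer c) := by
  refine ⟨contDiff_infty.2 fun k => ?_, fun t => by simp only [expSer, chr_periodic]⟩
  induction k generalizing c with
  | zero => exact contDiff_zero.2 (continuous_iff_continuousAt.2 fun t => (hasDerivAt_expSer hc t).continuousAt)
  | succ k ih =>
    rw [Nat.cast_succ, contDiff_succ_iff_deriv]
    refine ⟨fun t => (hasDerivAt_expSer hc t).differentiableAt, by simp, ?_⟩
    rw [funext fun t => (hasDerivAt_expSer hc t).deriv]
    exact ih hc.deriv

lemma expSer_eq_const (hc : RapidDecay c) {z : ℂ} (h : ∀ t, expSer c t = z) : c = Pi.single 0 z := by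
  have hs : Summable fun n => c n • (fourier n : C(AddCircle twoPi, ℂ)) :=
    Summable.of_norm (by simpa only [norm_smul, fourier_norm, mul_one] using hc.summable_norm)
  have e : ∑' n, c n • (fourier n : C(AddCircle twoPi, ℂ)) = z • fourier 0 := by
    ext x
    induction x using QuotientAddGroup.induction_on with | _ t
    have h1 := (ContinuousMap.evalCLM ℂ (t : AddCircle twoPi)).map_tsum hs
    simp only [ContinuousMap.evalCLM_apply, ContinuousMap.smul_apply, smul_eq_mul, ← chr_eq_fourier] at h1
    have h2 : expSer c t = z * chr 0 t := by rw [h]; simp [chr]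
    rw [ContinuousMap.smul_apply, smul_eq_mul]
    exact h1.trans (h2.trans (by rw [chr_eq_fourier]))
  funext m
  let L := (innerSL ℂ (fourierLp (T := twoPi) 2 m)).comp (ContinuousMap.toLp (E := ℂ) 2 AddCircle.haarAddCircle ℂ)
  have hL : ∀ n, L (fourier n) = if m = n then 1 else 0 := fun n => by
    have := orthonormal_iff_ite.1 (orthonormal_fourier (T := twoPi)) m n
    exact this
  have h3 := congrArg L e
  rw [L.map_tsum hs, map_smul] at h3
  simp only [map_smul, hL, smul_eq_mul, mul_ite, mul_one, mul_zero] at h3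
  rw [tsum_eq_single m fun n hn => if_neg hn.symm, if_pos rfl] at h3
  rw [h3, Pi.single_apply]

lemma exists_expSer {f : ℝ → ℂ} (hf : CircSmooth f) : ∃ c, RapidDecay c ∧ ∀ t, f t = expSer c t := by
  let fc : (ℝ → ℂ) → ℤ → ℂ := fun f n => ∫ t in (0 : ℝ)..twoPi, chr (-n) t * f t
  have hcont : ∀ {f : ℝ → ℂ} n, CircSmooth f → Continuous fun t => chr n t * f t := fun n hf =>
    (contDiff_chr n).continuous.mul hf.1.continuous
  have hderiv : ∀ {f : ℝ → ℂ}, CircSmooth f → CircSmooth (_root_.deriv f) := fun {f} hf =>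
    ⟨(contDiff_infty_iff_deriv.1 hf.1).2, fun t => by rw [← deriv_comp_add_const]; simp only [hf.2]⟩
  have hstep : ∀ {f : ℝ → ℂ} n, CircSmooth f → I * n * fc f n = fc (_root_.deriv f) n := fun {f} n hf => by
    have hd : ∀ t : ℝ, HasDerivAt (fun t => chr (-n) t * f t)
        (chr (-n) t * _root_.deriv f t - I * n * (chr (-n) t * f t)) t := fun t => by
      refine ((hasDerivAt_chr (-n) t).mul (hf.1.dif t).hasDerivAt).congr_deriv ?_
      push_cast
      ring
    have i1 := (hcont (-n) (hderiv hf)).intervalIntegrable (μ := volume) 0 twoPi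
    have i2 := ((hcont (-n) hf).intervalIntegrable (μ := volume) 0 twoPi).const_mul (I * n)
    have := intervalIntegral.integral_eq_sub_of_hasDerivAt (fun t _ => hd t) (i1.sub i2)
    rw [intervalIntegral.integral_sub i1 i2, intervalIntegral.integral_const_mul] at this
    have p1 := chr_periodic (-n) 0
    have p2 := hf.2 0
    rw [zero_add] at p1 p2
    rw [p1, p2, sub_self] at this
    exact (sub_eq_zero.1 this).symm
  have hbound : ∀ k : ℕ, ∀ {f : ℝ → ℂ}, CircSmooth f → ∃ C, ∀ n : ℤ, |(n : ℝ)| ^ k * ‖fc f n‖ ≤ C := by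
    intro k
    induction k with
    | zero =>
      intro f hf
      obtain ⟨C, hC⟩ := isCompact_Icc.exists_bound_of_continuousOn (s := Set.Icc 0 twoPi) hf.1.continuous.continuousOn
      refine ⟨C * |twoPi - 0|, fun n => ?_⟩
      rw [pow_zero, one_mul]
      refine intervalIntegral.norm_integral_le_of_norm_le_const fun t ht => ?_
      rw [norm_mul, norm_chr, one_mul]
      rw [Set.uIoc_of_le Real.two_pi_pos.le] at ht
      exact hC t ⟨ht.1.le, ht.2⟩
    | succ k ih =>
      intro f hf
      obtain ⟨C, hC⟩ := ih (hderiv hf)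
      refine ⟨C, fun n => ?_⟩
      have := hC n
      rw [← hstep n hf, norm_mul, norm_mul, Complex.norm_I, Complex.norm_intCast, one_mul] at this
      calc _ = |(n : ℝ)| ^ k * (|(n : ℝ)| * ‖fc f n‖) := by ring
        _ ≤ C := this
  have hdecay : RapidDecay fun n => (1 / twoPi) • fc f n := fun k => by
    obtain ⟨C, hC⟩ := hbound (k + 2) hf
    have hs := (Real.summable_one_div_int_pow.2 one_lt_two).mul_left (‖(1 / twoPi : ℝ)‖ * C)
    refine Summable.of_norm_bounded_eventually hs ?_
    rw [eventually_cofinite]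
    refine (Set.finite_singleton (0 : ℤ)).subset fun n hn => ?_
    by_contra h0
    refine hn ?_
    have hn0 : (n : ℝ) ≠ 0 := by exact_mod_cast h0
    have h2 := hC n
    rw [pow_add, sq_abs, mul_right_comm] at h2
    rw [norm_smul, Real.norm_of_nonneg (by positivity), mul_left_comm, mul_assoc]
    refine mul_le_mul_of_nonneg_left ?_ (norm_nonneg _)
    rw [mul_one_div, le_div_iff₀ (by positivity)]
    exact h2
  have hp : Function.Periodic f twoPi := hf.2
  let F : C(AddCircle twoPi, ℂ) := ⟨hp.lift, hf.1.continuous.quotient_lift _⟩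
  have hF : ∀ n, fourierCoeff F n = (1 / twoPi) • fc f n := fun n => by
    rw [fourierCoeff_eq_intervalIntegral _ n 0, zero_add]
    simp only [← chr_eq_fourier, smul_eq_mul, fc]
    rfl
  refine ⟨_, hdecay, fun t => ?_⟩
  have h := has_pointwise_sum_fourier_series_of_summable (f := F)
    (Summable.of_norm (hdecay.summable_norm.congr fun n => by rw [hF])) (t : AddCircle twoPi)
  rw [expSer, ← show F (t : AddCircle twoPi) = f t from rfl, ← h.tsum_eq]
  simp only [hF, ← chr_eq_fourier, smul_eq_mul]

end Fourier

section Flat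

variable {ψ : Bdry → ℝ} {v : Bdry → Bdry} {s : ℤˣ}

lemma sum_units {M : Type*} [AddCommMonoid M] (f : ℤˣ → M) : ∑ s, f s = f 1 + f (-1) := by
  rw [UnitsInt.univ, Finset.sum_pair (by decide)]

/-- The differential of `lc s`. -/
def dlcR (s : ℤˣ) : Bdry := ![1, ((s : ℤ) : ℝ)]

lemma units_sq (s : ℤˣ) : (((s : ℤ) : ℝ)) * ((s : ℤ) : ℝ) = 1 := by
  rcases Int.units_eq_one_or s with rfl | rfl <;> simp

lemma contDiff_lc (s : ℤˣ) : Cinf (lc s) :=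
  (contDiff_apply ℝ ℝ (0 : Fin 2)).add (contDiff_const.mul (contDiff_apply ℝ ℝ (1 : Fin 2)))

lemma fderiv_lc {E : Type*} [NormedAddCommGroup E] [NormedSpace ℝ E] {f : ℝ → E} (hf : Cinf f)
    (s : ℤˣ) (x : Bdry) (B : Fin 2) :
    fderiv ℝ (fun y => f (lc s y)) x (Pi.single B 1) = dlcR s B • deriv f (lc s x) := by
  have h1 : HasFDerivAt (lc s) (ContinuousLinearMap.proj (R := ℝ) (φ := fun _ : Fin 2 => ℝ) 0
      + ((s : ℤ) : ℝ) • ContinuousLinearMap.proj (R := ℝ) (φ := fun _ : Fin 2 => ℝ) 1) x :=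
    (hasFDerivAt_apply 0 x).add ((hasFDerivAt_apply 1 x).const_mul _)
  have h2 : HasFDerivAt (fun y => f (lc s y)) _ x := HasFDerivAt.comp (g := f) x (hf.dif (lc s x)).hasFDerivAt h1
  rw [h2.fderiv, comp_apply, fderiv_eq_smul_deriv]
  fin_cases B <;> simp [dlcR]

lemma lc_add_period (s : ℤˣ) (x : Bdry) : lc s (x + period 1) = lc s x + ((s : ℤ) : ℝ) * twoPi := by
  simp [lc]; ring

lemma CircSmooth.comp_lc {E : Type*} [NormedAddCommGroup E] [NormedSpace ℝ E] {f : ℝ → E} (hf : CircSmooth f)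
    (s : ℤˣ) : CylSmooth fun x => f (lc s x) := by
  refine ⟨hf.1.comp (contDiff_lc s), fun x => ?_⟩
  beta_reduce
  rw [lc_add_period]
  rcases Int.units_eq_one_or s with rfl | rfl
  · simpa using hf.2 (lc 1 x)
  · have := hf.2 (lc (-1) x + -1 * twoPi)
    rw [neg_one_mul, neg_add_cancel_right] at this
    simpa using this.symm

lemma eq_of_fderiv_eq_zero {F : Bdry → ℝ} (hF : Cinf F) {w : Bdry} (h : ∀ x, fderiv ℝ F x w = 0) (x : Bdry)
    (t : ℝ) : F (x + t • w) = F x := by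
  have hd : ∀ t : ℝ, HasDerivAt (fun t : ℝ => F (x + t • w)) 0 t := fun t => by
    have h1 : HasDerivAt (fun t : ℝ => x + t • w) w t := by
      simpa using ((hasDerivAt_id t).smul_const w).const_add x
    have h2 := (hF.dif (x + t • w)).hasFDerivAt.comp_hasDerivAt t h1
    rw [h] at h2
    exact h2
  simpa using is_const_of_deriv_eq_zero (fun t => (hd t).differentiableAt) (fun t => (hd t).deriv) t 0

lemma flat_conformalKilling_iff : IsConformalKilling flat v ↔ ∀ x,
    pd 0 (fun y => v y 0) x = pd 1 (fun y => v y 1) x ∧ pd 0 (fun y => v y 1) x = pd 1 (fun y => v y 0) x := by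
  have hc : ∀ (k i j : Fin 2) x, pd k (fun y => flat y i j) x = 0 := fun k i j x => by simp [pd, flat]
  constructor
  · rintro ⟨σ, h⟩ x
    have e := fun i j => congrFun (congrFun (h x) i) j
    have e00 := e 0 0
    have e01 := e 0 1
    have e11 := e 1 1
    simp only [lieDeriv, of_apply, hc] at e00 e01 e11
    simp [flat, Fin.sum_univ_two] at e00 e01 e11
    constructor <;> linarith
  · intro h
    refine ⟨fun x => 2 * pd 0 (fun y => v y 0) x, fun x => ?_⟩
    obtain ⟨h1, h2⟩ := h x
    ext i j
    simp only [lieDeriv, of_apply, hc]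
    fin_cases i <;> fin_cases j <;> simp [flat, Fin.sum_univ_two, h1, h2] <;> ring

lemma laplacian_flat (ψ : Bdry → ℝ) (x : Bdry) : laplacian flat ψ x = pd 1 (pd 1 ψ) x - pd 0 (pd 0 ψ) x := by
  have hc : ∀ (k i j : Fin 2) x, pd k (fun y => flat y i j) x = 0 := fun k i j x => by simp [pd, flat]
  obtain ⟨i1, i2, i3, i4⟩ := inv_two (flat x)
  simp only [laplacian, christoffel, hc, Fin.sum_univ_two, i1, i2, i3, i4]
  simp [flat, det_fin_two]
  ring

lemma flat_conformalKilling_of {f : ℤˣ → ℝ → ℝ} (hf : ∀ s, CircSmooth (f s)) :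
    CylSmooth (fun x A => ∑ s, f s (lc s x) * (dlcR s A / 2)) ∧
      IsConformalKilling flat fun x A => ∑ s, f s (lc s x) * (dlcR s A / 2) := by
  have h := fun s => (hf s).comp_lc s
  refine ⟨⟨contDiff_pi.2 fun A => ContDiff.sum fun s _ => (h s).1.mul contDiff_const, fun x => by
    simp only [(h _).2]⟩, flat_conformalKilling_iff.2 fun x => ?_⟩
  have e : ∀ A B, pd B (fun x => ∑ s, f s (lc s x) * (dlcR s A / 2)) x
      = ∑ s, dlcR s B * deriv (f s) (lc s x) * (dlcR s A / 2) := fun A B => by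
    simp only [sum_units]
    rw [pd, fderiv_fun_add (((h 1).1.dif x).mul_const _)
      (((h (-1)).1.dif x).mul_const _), fderiv_mul_const ((h 1).1.dif x),
      fderiv_mul_const ((h (-1)).1.dif x), add_apply, smul_apply, smul_apply, fderiv_lc (hf 1).1, fderiv_lc (hf (-1)).1]
    simp only [smul_eq_mul]
    ring
  simp only [e]
  simp [dlcR]
  constructor <;> ring

lemma exists_of_flat_conformalKilling (hv : CylSmooth v) (h : IsConformalKilling flat v) :
    ∃ f : ℤˣ → ℝ → ℝ, (∀ s, CircSmooth (f s)) ∧ ∀ x A, v x A = ∑ s, f s (lc s x) * (dlcR s A / 2) := by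
  have key : ∀ (s : ℤˣ) x, v x 0 + ((s : ℤ) : ℝ) * v x 1 = v ![lc s x, 0] 0 + ((s : ℤ) : ℝ) * v ![lc s x, 0] 1 := by
    intro s x
    have c := contDiff_pi.1 hv.1
    have hF : Cinf fun x => v x 0 + ((s : ℤ) : ℝ) * v x 1 := (c 0).add (contDiff_const.mul (c 1))
    have := eq_of_fderiv_eq_zero hF (w := ![1, -((s : ℤ) : ℝ)]) (fun x => by
      obtain ⟨h1, h2⟩ := flat_conformalKilling_iff.1 h x
      have d := fun A => (c A).dif x
      rw [fderiv_eq_sum_pd, Fin.sum_univ_two]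
      simp only [pd_add (d 0) ((d 1).const_mul _), pd_const_mul (d 1), h1, h2]
      simp
      linear_combination (-pd 1 (fun y => v y 1) x) * units_sq s) x (((s : ℤ) : ℝ) * x 1)
    have e : x + (((s : ℤ) : ℝ) * x 1) • ![1, -((s : ℤ) : ℝ)] = ![lc s x, 0] := by
      ext A
      fin_cases A
      · simp [lc]
      · simp
        linear_combination (-x 1) * units_sq s
    rw [e] at this
    exact this.symm
  refine ⟨fun s t => v ![t, 0] 0 + ((s : ℤ) : ℝ) * v ![t, 0] 1, fun s => ⟨?_, fun t => ?_⟩, fun x A => ?_⟩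
  · have c := contDiff_pi.1 hv.1
    have hl : Cinf fun t : ℝ => (![t, 0] : Bdry) := contDiff_pi.2 fun A => by
      fin_cases A
      exacts [contDiff_id, contDiff_const]
    exact ((c 0).comp hl).add (contDiff_const.mul ((c 1).comp hl))
  · have p := hv.2 ![t, 0]
    have k := fun s => key s (![t, 0] + period 1)
    rw [p] at k
    simp only [lc_add_period] at k
    rcases Int.units_eq_one_or s with rfl | rfl
    · simpa [lc] using (k 1).symm
    · have p := hv.2 ![t + twoPi, 0]
      have k := key (-1) (![t + twoPi, 0] + period 1)
      rw [p, lc_add_period] at k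
      simpa [lc] using k
  · simp only [← key, sum_units]
    fin_cases A <;> simp [dlcR] <;> ring

lemma flat_harmonic_of {g : ℤˣ → ℝ → ℝ} (hg : ∀ s, CircSmooth (g s)) (V : ℝ) :
    CylSmooth (fun x => ∑ s, g s (lc s x) + V * x 0) ∧
      ∀ x, laplacian flat (fun x => ∑ s, g s (lc s x) + V * x 0) x = 0 := by
  have h := fun s => (hg s).comp_lc s
  have h0 : Cinf fun x : Bdry => V * x 0 := contDiff_const.mul (contDiff_apply ℝ ℝ (0 : Fin 2))
  have hs : Cinf fun x => ∑ s, g s (lc s x) := ContDiff.sum fun s _ => (h s).1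
  refine ⟨⟨hs.add h0, fun x => by simp [(h _).2]⟩, fun x => ?_⟩
  have e : ∀ {g : ℤˣ → ℝ → ℝ}, (∀ s, Cinf (g s)) → ∀ B x, pd B (fun x => ∑ s, g s (lc s x)) x
      = ∑ s, dlcR s B * deriv (g s) (lc s x) := fun {g} hg B x => by
    have h : ∀ s, Cinf fun x => g s (lc s x) := fun s => (hg s).comp (contDiff_lc s)
    simp only [sum_units]
    rw [pd, fderiv_fun_add ((h 1).dif x) ((h (-1)).dif x), add_apply, fderiv_lc (hg 1), fderiv_lc (hg (-1))]
    rfl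
  have hd := fun s => (contDiff_infty_iff_deriv.1 (hg s).1).2
  have e0 : ∀ B x, pd B (fun x : Bdry => V * x 0) x = V * if B = 0 then 1 else 0 := fun B x => by
    rw [pd_const_mul (differentiableAt_apply 0 x), pd, (hasFDerivAt_apply (𝕜 := ℝ) (0 : Fin 2) x).fderiv]
    fin_cases B <;> simp
  have e1 : ∀ B, pd B (fun x => ∑ s, g s (lc s x) + V * x 0)
      = fun x => ∑ s, dlcR s B * deriv (g s) (lc s x) + V * if B = 0 then 1 else 0 := fun B => by
    funext x
    rw [pd_add (hs.dif x) (h0.dif x), e fun s => (hg s).1, e0]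
  have hd' : ∀ B s, Cinf fun t => dlcR s B * deriv (g s) t := fun B s => contDiff_const.mul (hd s)
  have e2 : ∀ B x, pd B (pd B (fun x => ∑ s, g s (lc s x) + V * x 0)) x
      = ∑ s, dlcR s B * (dlcR s B * deriv (deriv (g s)) (lc s x)) := fun B x => by
    have hs' : Cinf fun x => ∑ s, dlcR s B * deriv (g s) (lc s x) :=
      ContDiff.sum fun s _ => (hd' B s).comp (contDiff_lc s)
    rw [e1, pd_add (hs'.dif x) (differentiableAt_const _), e (g := fun s t => dlcR s B * deriv (g s) t) (hd' B)]
    simp [pd, deriv_const_mul_field]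
  rw [laplacian_flat, e2, e2]
  simp [dlcR]

lemma exists_of_flat_harmonic (hψ : CylSmooth ψ) (h : ∀ x, laplacian flat ψ x = 0) :
    ∃ (g : ℤˣ → ℝ → ℝ) (V : ℝ), (∀ s, CircSmooth (g s)) ∧ ∀ x, ψ x = ∑ s, g s (lc s x) + V * x 0 := by
  have hd := fun B => contDiff_pd hψ.1 B
  have dd := fun B x => (hd B).dif x
  have h1 : ∀ x (t : ℝ), pd 0 ψ (x + t • ![1 / 2, 1 / 2]) - pd 1 ψ (x + t • ![1 / 2, 1 / 2]) = pd 0 ψ x - pd 1 ψ x :=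
    eq_of_fderiv_eq_zero ((hd 0).sub (hd 1)) fun x => by
      have hl := h x
      rw [laplacian_flat] at hl
      have hc := congrFun (pd_comm hψ.1 0 1) x
      rw [fderiv_eq_sum_pd, Fin.sum_univ_two]
      have e : ∀ B, pd B (fun x => pd 0 ψ x - pd 1 ψ x) x = pd B (pd 0 ψ) x - pd B (pd 1 ψ) x := fun B => by
        rw [pd, fderiv_fun_sub (dd 0 x) (dd 1 x)]
        rfl
      simp only [e, cons_val_zero, cons_val_one]
      linear_combination (-1 / 2) * hl - (1 / 2) * hc
  have h2 : ∀ t s : ℝ, ψ (s • ![1 / 2, -1 / 2] + t • ![1 / 2, 1 / 2]) - ψ (s • ![1 / 2, -1 / 2])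
      = ψ (t • ![1 / 2, 1 / 2]) - ψ 0 := fun t s => by
    have hs : Cinf fun x => ψ (x + t • ![1 / 2, 1 / 2]) := hψ.1.comp (contDiff_id.add contDiff_const)
    have := eq_of_fderiv_eq_zero (hs.sub hψ.1) (w := ![1 / 2, -1 / 2]) (fun x => by
      have e := h1 x t
      rw [fderiv_fun_sub (hs.dif x) (hψ.1.dif x), fderiv_comp_add_right,
        sub_apply, fderiv_eq_sum_pd, fderiv_eq_sum_pd, Fin.sum_univ_two, Fin.sum_univ_two]
      simp only [cons_val_zero, cons_val_one]
      linear_combination (1 / 2) * e) 0 s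
    simpa using this
  have hdec : ∀ u w : ℝ, ψ ![(u + w) / 2, (u - w) / 2] = ψ (u • ![1 / 2, 1 / 2]) + ψ (w • ![1 / 2, -1 / 2]) - ψ 0 :=
    fun u w => by
      have : (![(u + w) / 2, (u - w) / 2] : Bdry) = w • ![1 / 2, -1 / 2] + u • ![1 / 2, 1 / 2] := by
        ext A; fin_cases A <;> simp <;> ring
      rw [this]
      linarith [h2 u w]
  set κ := ψ (twoPi • ![1 / 2, 1 / 2]) - ψ 0 with hκ
  have hper : ∀ u w : ℝ, ψ ((u + twoPi) • ![1 / 2, 1 / 2]) + ψ ((w - twoPi) • ![1 / 2, -1 / 2])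
      = ψ (u • ![1 / 2, 1 / 2]) + ψ (w • ![1 / 2, -1 / 2]) := fun u w => by
    have e := hψ.2 ![(u + w) / 2, (u - w) / 2]
    have e' : (![(u + w) / 2, (u - w) / 2] + period 1 : Bdry)
        = ![(u + twoPi + (w - twoPi)) / 2, (u + twoPi - (w - twoPi)) / 2] := by
      ext A; fin_cases A <;> simp <;> ring
    rw [e', hdec, hdec] at e
    linarith
  have c1 : ∀ s : ℤˣ, Cinf fun t : ℝ => ψ (t • ![1 / 2, ((s : ℤ) : ℝ) / 2]) :=
    fun s => hψ.1.comp (contDiff_id.smul contDiff_const)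
  refine ⟨fun s t => ψ (t • ![1 / 2, ((s : ℤ) : ℝ) / 2]) - ψ 0 / 2 - κ / twoPi * t, κ / Real.pi,
    fun s => ⟨((c1 s).sub contDiff_const).sub (contDiff_const.mul contDiff_id), fun t => ?_⟩, fun x => ?_⟩
  · have hpi := Real.pi_ne_zero
    have e : κ / twoPi * (t + twoPi) = κ / twoPi * t + κ := by field_simp
    have z1 := hper 0 twoPi
    simp only [zero_add, sub_self, zero_smul] at z1
    beta_reduce
    rw [e]
    rcases Int.units_eq_one_or s with rfl | rfl
    · have := hper t twoPi
      simp only [sub_self, zero_smul] at this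
      simp only [Units.val_one, Int.cast_one]
      linarith
    · have := hper 0 (t + twoPi)
      simp only [zero_add, add_sub_cancel_right, zero_smul] at this
      simp only [Units.val_neg, Units.val_one, Int.cast_neg, Int.cast_one]
      linarith
  · have e := hdec (lc 1 x) (lc (-1) x)
    have e' : (![(lc 1 x + lc (-1) x) / 2, (lc 1 x - lc (-1) x) / 2] : Bdry) = x := by
      ext A; fin_cases A <;> simp [lc] <;> ring
    rw [e'] at e
    rw [e, sum_units]
    simp only [Units.val_neg, Units.val_one, Int.cast_neg, Int.cast_one]
    have hpi := Real.pi_ne_zero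
    have : lc 1 x + lc (-1) x = 2 * x 0 := by simp [lc]; ring
    have e2 : κ / twoPi * lc 1 x + κ / twoPi * lc (-1) x = κ / Real.pi * x 0 := by
      rw [← mul_add, this]; field_simp
    linarith

end Flat

section Complexification

variable {γ : Bdry → Mat2} {hγ : IsLorentzMetric γ}
  {T T' : ℂ ⊗[ℝ] SemiDir hγ}
  {Y Y' : Bdry → Fin 2 → ℂ} {ψ ψ' : Bdry → ℂ}

lemma Represents.unique (h : Represents T Y ψ) (h' : Represents T' Y ψ) : T = T' := by
  obtain ⟨a, b, rfl, hY, hψ⟩ := h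
  obtain ⟨a', b', rfl, hY', hψ'⟩ := h'
  have key : ∀ {u v u' v' : ℝ}, (u : ℂ) + I * v = u' + I * v' → u = u' ∧ v = v' := fun h => by
    have h1 := congrArg Complex.re h
    have h2 := congrArg Complex.im h
    simp at h1 h2
    exact ⟨h1, h2⟩
  have e1 := fun x A => key ((hY x A).symm.trans (hY' x A))
  have e2 := fun x => key ((hψ x).symm.trans (hψ' x))
  have ha : a = a' := LieAlgebra.SemiDirectSum.ext (Subtype.ext (Subtype.ext (funext fun x => (e2 x).1)))
    (Subtype.ext (Subtype.ext (funext fun x => funext fun A => (e1 x A).1)))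
  have hb : b = b' := LieAlgebra.SemiDirectSum.ext (Subtype.ext (Subtype.ext (funext fun x => (e2 x).2)))
    (Subtype.ext (Subtype.ext (funext fun x => funext fun A => (e1 x A).2)))
  rw [ha, hb]

lemma Represents.smul (h : Represents T Y ψ) (z : ℂ) : Represents (z • T) (z • Y) (z • ψ) := by
  obtain ⟨a, b, rfl, hY, hψ⟩ := h
  refine ⟨z.re • a - z.im • b, z.im • a + z.re • b, ?_, fun x A => ?_, fun x => ?_⟩
  · rw [smul_add, TensorProduct.smul_tmul', TensorProduct.smul_tmul', TensorProduct.tmul_sub, TensorProduct.tmul_add]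
    simp only [← TensorProduct.smul_tmul, smul_eq_mul, mul_one]
    have e1 : z = z.re • (1 : ℂ) + z.im • I := by
      simp only [Complex.real_smul, mul_one, Complex.re_add_im]
    have e2 : z * I = z.re • I - z.im • (1 : ℂ) := by
      conv_lhs => rw [e1]
      simp only [Complex.real_smul]
      linear_combination (z.im : ℂ) * Complex.I_mul_I
    generalize z.re = p at e1 e2 ⊢
    generalize z.im = q at e1 e2 ⊢
    rw [e2, e1]
    rw [TensorProduct.add_tmul, TensorProduct.sub_tmul]
    abel
  · have : ((z.re • a - z.im • b).right : CylVF).1 x A = z.re * (a.right : CylVF).1 x A - z.im * (b.right : CylVF).1 x A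
      ∧ ((z.im • a + z.re • b).right : CylVF).1 x A = z.im * (a.right : CylVF).1 x A + z.re * (b.right : CylVF).1 x A :=
      ⟨rfl, rfl⟩
    rw [this.1, this.2, Pi.smul_apply, Pi.smul_apply, hY, smul_eq_mul]
    push_cast
    nth_rw 1 [← Complex.re_add_im z]
    linear_combination (z.im * ((b.right : CylVF).1 x A) : ℂ) * Complex.I_mul_I
  · have : ((z.re • a - z.im • b).left : CylFun).1 x = z.re * (a.left : CylFun).1 x - z.im * (b.left : CylFun).1 x
      ∧ ((z.im • a + z.re • b).left : CylFun).1 x = z.im * (a.left : CylFun).1 x + z.re * (b.left : CylFun).1 x :=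
      ⟨rfl, rfl⟩
    rw [this.1, this.2, Pi.smul_apply, hψ, smul_eq_mul]
    push_cast
    nth_rw 1 [← Complex.re_add_im z]
    linear_combination (z.im * ((b.left : CylFun).1 x) : ℂ) * Complex.I_mul_I

lemma semidirect_lie_left (a b : SemiDir hγ) (x : Bdry) :
    (⁅a, b⁆.left : CylFun).1 x = fderiv ℝ (b.left : CylFun).1 x ((a.right : CylVF).1 x)
      - fderiv ℝ (a.left : CylFun).1 x ((b.right : CylVF).1 x) := by
  have h : (⁅a, b⁆.left : CylFun).1 x = (0 : ℝ) + fderiv ℝ (b.left : CylFun).1 x ((a.right : CylVF).1 x)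
    - fderiv ℝ (a.left : CylFun).1 x ((b.right : CylVF).1 x) := rfl
  rw [h, zero_add]

lemma fderiv_re_add_im {f g : Bdry → ℝ} {x : Bdry} (hf : DiffAt f x) (hg : DiffAt g x)
    (v : Bdry) : fderiv ℝ (fun y => (f y : ℂ) + I * (g y : ℂ)) x v
      = (fderiv ℝ f x v : ℂ) + I * (fderiv ℝ g x v : ℂ) := by
  have h1 : HasFDerivAt (fun y => (f y : ℂ)) (Complex.ofRealCLM.comp (fderiv ℝ f x)) x :=
    Complex.ofRealCLM.hasFDerivAt.comp x hf.hasFDerivAt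
  have h2 : HasFDerivAt (fun y => (g y : ℂ)) (Complex.ofRealCLM.comp (fderiv ℝ g x)) x :=
    Complex.ofRealCLM.hasFDerivAt.comp x hg.hasFDerivAt
  rw [(h1.fun_add (h2.const_mul I)).fderiv]
  rfl

/-- The bracket of the complexified semidirect product in terms of complex fields. -/
lemma Represents.lie (h : Represents T Y ψ) (h' : Represents T' Y' ψ') : Represents ⁅T, T'⁆
    (fun x A => ∑ B, (Y x B * fderiv ℝ (fun y => Y' y A) x (Pi.single B 1)
      - Y' x B * fderiv ℝ (fun y => Y y A) x (Pi.single B 1)))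
    (fun x => ∑ B, (Y x B * fderiv ℝ ψ' x (Pi.single B 1) - Y' x B * fderiv ℝ ψ x (Pi.single B 1))) := by
  obtain ⟨a, b, rfl, hY, hψ⟩ := h
  obtain ⟨a', b', rfl, hY', hψ'⟩ := h'
  obtain rfl : Y = _ := funext fun x => funext fun A => hY x A
  obtain rfl : Y' = _ := funext fun x => funext fun A => hY' x A
  obtain rfl : ψ = _ := funext hψ
  obtain rfl : ψ' = _ := funext hψ'
  have hr : ∀ (a b : SemiDir hγ) x A, (⁅a, b⁆.right : CylVF).1 x A
      = ∑ B, ((a.right : CylVF).1 x B * fderiv ℝ (fun y => (b.right : CylVF).1 y A) x (Pi.single B 1)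
        - (b.right : CylVF).1 x B * fderiv ℝ (fun y => (a.right : CylVF).1 y A) x (Pi.single B 1)) := fun a b x A =>
    lieBracket_apply (cylVF_diff a.right x) (cylVF_diff b.right x) A
  have hl : ∀ (a b : SemiDir hγ) x, (⁅a, b⁆.left : CylFun).1 x
      = ∑ B, ((a.right : CylVF).1 x B * fderiv ℝ (b.left : CylFun).1 x (Pi.single B 1)
        - (b.right : CylVF).1 x B * fderiv ℝ (a.left : CylFun).1 x (Pi.single B 1)) := fun a b x => by
    rw [sum_sub_distrib]
    have e := fun a b : SemiDir hγ =>
      fderiv_eq_sum_pd (f := (a.left : CylFun).1) ((b.right : CylVF).1 x) x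
    simp only [pd] at e
    rw [← e, ← e, semidirect_lie_left]
  have dY : ∀ (a : SemiDir hγ) x A, DiffAt (fun y => (a.right : CylVF).1 y A) x := fun a x A =>
    (contDiff_pi.1 a.right.1.2.1 A).dif x
  have dψ : ∀ (a : SemiDir hγ) x, DiffAt (a.left : CylFun).1 x := fun a x => a.left.1.2.1.dif x
  refine ⟨⁅a, a'⁆ - ⁅b, b'⁆, ⁅a, b'⁆ + ⁅b, a'⁆, ?_, fun x A => ?_, fun x => ?_⟩
  · simp only [lie_add, add_lie, LieAlgebra.ExtendScalars.bracket_tmul, mul_one, one_mul, Complex.I_mul_I,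
      TensorProduct.neg_tmul, TensorProduct.tmul_sub, TensorProduct.tmul_add]
    abel
  · have : ((⁅a, a'⁆ - ⁅b, b'⁆).right : CylVF).1 x A = (⁅a, a'⁆.right : CylVF).1 x A - (⁅b, b'⁆.right : CylVF).1 x A
      ∧ ((⁅a, b'⁆ + ⁅b, a'⁆).right : CylVF).1 x A = (⁅a, b'⁆.right : CylVF).1 x A + (⁅b, a'⁆.right : CylVF).1 x A :=
      ⟨rfl, rfl⟩
    rw [this.1, this.2]
    simp only [hr, fderiv_re_add_im (dY _ x _) (dY _ x _), Fin.sum_univ_two]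
    push_cast
    ring_nf
    simp only [Complex.I_sq]
    ring
  · have : ((⁅a, a'⁆ - ⁅b, b'⁆).left : CylFun).1 x = (⁅a, a'⁆.left : CylFun).1 x - (⁅b, b'⁆.left : CylFun).1 x
      ∧ ((⁅a, b'⁆ + ⁅b, a'⁆).left : CylFun).1 x = (⁅a, b'⁆.left : CylFun).1 x + (⁅b, a'⁆.left : CylFun).1 x :=
      ⟨rfl, rfl⟩
    rw [this.1, this.2]
    simp only [hl, fderiv_re_add_im (dψ _ x) (dψ _ x), Fin.sum_univ_two]
    push_cast
    ring_nf
    simp only [Complex.I_sq]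
    ring

end Complexification

section FlatComplex

variable {hγ : IsLorentzMetric flat} {c d w w' : ℤˣ → ℤ → ℂ} {V V' : ℂ}

lemma CircSmooth.add_mul_I {f g : ℝ → ℝ} (hf : CircSmooth f) (hg : CircSmooth g) :
    CircSmooth fun t => (f t : ℂ) + I * (g t : ℂ) :=
  ⟨(Complex.ofRealCLM.contDiff.comp hf.1).add (contDiff_const.mul (Complex.ofRealCLM.contDiff.comp hg.1)),
    fun t => by simp only [hf.2, hg.2]⟩

lemma CircSmooth.re {f : ℝ → ℂ} (hf : CircSmooth f) : CircSmooth fun t => (f t).re :=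
  ⟨Complex.reCLM.contDiff.comp hf.1, fun t => by simp only [hf.2]⟩

lemma CircSmooth.im {f : ℝ → ℂ} (hf : CircSmooth f) : CircSmooth fun t => (f t).im :=
  ⟨Complex.imCLM.contDiff.comp hf.1, fun t => by simp only [hf.2]⟩

lemma dlc_eq (s : ℤˣ) (A : Fin 2) : dlc s A = ((dlcR s A / 2 : ℝ) : ℂ) := by
  fin_cases A <;> simp [dlc, dlcR]

lemma exists_represents (hγ : IsLorentzMetric flat) {f g : ℤˣ → ℝ → ℂ} (hf : ∀ s, CircSmooth (f s))
    (hg : ∀ s, CircSmooth (g s)) (V : ℂ) : ∃ T : ℂ ⊗[ℝ] SemiDir hγ,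
      Represents T (fun x => ∑ s, f s (lc s x) • dlc s) fun x => ∑ s, g s (lc s x) + V * x 0 := by
  have k1 := flat_conformalKilling_of fun s => (hf s).re
  have k2 := flat_conformalKilling_of fun s => (hf s).im
  have h1 := flat_harmonic_of (fun s => (hg s).re) V.re
  have h2 := flat_harmonic_of (fun s => (hg s).im) V.im
  refine ⟨_, ⟨⟨⟨_, h1.1⟩, h1.2⟩, ⟨⟨_, k1.1⟩, k1.2⟩⟩, ⟨⟨⟨_, h2.1⟩, h2.2⟩, ⟨⟨_, k2.1⟩, k2.2⟩⟩, rfl, fun x A => ?_, fun x => ?_⟩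
  · simp only [sum_units, Pi.add_apply, Pi.smul_apply, smul_eq_mul, dlc_eq]
    conv_lhs => rw [← Complex.re_add_im (f 1 _), ← Complex.re_add_im (f (-1) _)]
    push_cast
    ring
  · simp only [sum_units]
    conv_lhs => rw [← Complex.re_add_im (g 1 _), ← Complex.re_add_im (g (-1) _), ← Complex.re_add_im V]
    push_cast
    ring

lemma Represents.exists_expansion {T : ℂ ⊗[ℝ] SemiDir hγ} {Y : Bdry → Fin 2 → ℂ} {ψ : Bdry → ℂ} (h : Represents T Y ψ) :
    ∃ (c w : ℤˣ → ℤ → ℂ) (V : ℂ), (∀ s, RapidDecay (c s)) ∧ (∀ s, RapidDecay (w s)) ∧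
      (∀ x, Y x = ∑ s, expSer (c s) (lc s x) • dlc s) ∧ ∀ x, ψ x = ∑ s, expSer (w s) (lc s x) + V * x 0 := by
  obtain ⟨a, b, -, hY, hψ⟩ := h
  obtain ⟨f, hf, ea⟩ := exists_of_flat_conformalKilling a.right.1.2 a.right.2
  obtain ⟨f', hf', eb⟩ := exists_of_flat_conformalKilling b.right.1.2 b.right.2
  obtain ⟨g, V, hg, ga⟩ := exists_of_flat_harmonic a.left.1.2 a.left.2
  obtain ⟨g', V', hg', gb⟩ := exists_of_flat_harmonic b.left.1.2 b.left.2
  choose c hc ec using fun s => exists_expSer ((hf s).add_mul_I (hf' s))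
  choose w hw ew using fun s => exists_expSer ((hg s).add_mul_I (hg' s))
  refine ⟨c, w, V + I * V', hc, hw, fun x => funext fun A => ?_, fun x => ?_⟩
  · rw [hY, ea, eb]
    simp only [sum_units, Pi.add_apply, Pi.smul_apply, smul_eq_mul, dlc_eq, ← ec]
    push_cast
    ring
  · rw [hψ, ga, gb]
    simp only [sum_units, ← ew]
    push_cast
    ring

lemma chr_zero (t : ℝ) : chr 0 t = 1 := by simp [chr]

lemma exists_normalized (hw : ∀ s, RapidDecay (w s)) : ∃ w' : ℤˣ → ℤ → ℂ, (∀ s, RapidDecay (w' s)) ∧ w' (-1) 0 = 0 ∧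
    ∀ x, ∑ s, expSer (w s) (lc s x) = ∑ s, expSer (w' s) (lc s x) := by
  refine ⟨fun s n => w s n - (Pi.single 0 (-((s : ℤ) : ℂ) * w (-1) 0) : ℤ → ℂ) n,
    fun s => (hw s).sub (rapidDecay_single _ _), by simp, fun x => ?_⟩
  simp only [expSer_sub (hw _) (rapidDecay_single _ _), expSer_single, chr_zero, sum_units]
  simp

lemma expSer_injective {c d : ℤ → ℂ} (hc : RapidDecay c) (hd : RapidDecay d) (z : ℂ)
    (h : ∀ t, expSer c t - expSer d t = z) : (fun n => c n - d n) = Pi.single 0 z :=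
  expSer_eq_const (hc.sub hd) fun t => by rw [expSer_sub hc hd, h]

lemma eq_of_sum_expSer_smul_dlc (hc : ∀ s, RapidDecay (c s)) (hd : ∀ s, RapidDecay (d s))
    (h : ∀ x, ∑ s, expSer (c s) (lc s x) • dlc s = ∑ s, expSer (d s) (lc s x) • dlc s) : c = d := by
  funext s n
  have := congrFun (expSer_injective (hc s) (hd s) 0 fun t => by
    have e := fun A => congrFun (h ![t, 0]) A
    have e0 := e 0
    have e1 := e 1
    simp only [sum_units, Pi.add_apply, Pi.smul_apply, smul_eq_mul, dlc, lc, cons_val_zero,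
      cons_val_one, mul_zero, add_zero, Units.val_one, Units.val_neg, Int.cast_one, Int.cast_neg] at e0 e1
    rcases Int.units_eq_one_or s with rfl | rfl
    · linear_combination e0 + e1
    · linear_combination e0 - e1) n
  rw [Pi.single_zero] at this
  exact sub_eq_zero.1 this

lemma eq_of_sum_expSer (hw : ∀ s, RapidDecay (w s)) (hw' : ∀ s, RapidDecay (w' s)) (h0 : w (-1) 0 = 0)
    (h0' : w' (-1) 0 = 0) (h : ∀ x : Bdry, ∑ s, expSer (w s) (lc s x) + V * x 0 = ∑ s, expSer (w' s) (lc s x) + V' * x 0) :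
    w = w' ∧ V = V' := by
  have e : ∀ a b : ℝ, expSer (w 1) (a + b) + expSer (w (-1)) (a - b) + V * a
      = expSer (w' 1) (a + b) + expSer (w' (-1)) (a - b) + V' * a := fun a b => by
    simpa [sum_units, lc, sub_eq_add_neg] using h ![a, b]
  have hV : V = V' := by
    have p := fun s => (circSmooth_expSer (hw s)).2 0
    have p' := fun s => (circSmooth_expSer (hw' s)).2 0
    have e1 := e twoPi 0
    have e0 := e 0 0
    simp only [zero_add, add_zero, sub_zero] at p p' e1 e0
    rw [p, p, p', p'] at e1
    have hp : ((twoPi : ℝ) : ℂ) ≠ 0 := by exact_mod_cast (by positivity : twoPi ≠ 0)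
    refine mul_right_cancel₀ hp ?_
    push_cast at e1 e0 ⊢
    linear_combination e1 - e0
  subst hV
  have e1 : ∀ t, expSer (w 1) t - expSer (w' 1) t = expSer (w' (-1)) 0 - expSer (w (-1)) 0 := fun t => by
    have := e (t / 2) (t / 2)
    rw [add_halves, sub_self] at this
    linear_combination this
  have e2 : ∀ t, expSer (w (-1)) t - expSer (w' (-1)) t = expSer (w' 1) 0 - expSer (w 1) 0 := fun t => by
    have := e (t / 2) (-(t / 2))
    rw [add_neg_cancel, sub_neg_eq_add, add_halves] at this
    linear_combination this
  have f2 := expSer_injective (hw (-1)) (hw' (-1)) _ e2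
  have z2 : expSer (w' 1) 0 - expSer (w 1) 0 = 0 := by
    have := congrFun f2 0
    rw [Pi.single_eq_same, h0, h0', sub_zero] at this
    exact this.symm
  have f1 := expSer_injective (hw 1) (hw' 1) _ e1
  rw [z2, Pi.single_zero] at f2
  rw [show expSer (w' (-1)) 0 - expSer (w (-1)) 0 = 0 by linear_combination -z2 - e1 0 , Pi.single_zero] at f1
  refine ⟨funext fun s => funext fun n => ?_, rfl⟩
  rcases Int.units_eq_one_or s with rfl | rfl
  · exact sub_eq_zero.1 (congrFun f1 n)
  · exact sub_eq_zero.1 (congrFun f2 n)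

lemma mode_mul (s : ℤˣ) (m n : ℤ) (x : Bdry) : mode s m x * mode s n x = mode s (m + n) x := by
  rw [mode, mode, mode, ← Complex.exp_add]
  push_cast
  ring_nf

lemma fderiv_mode_mul (s : ℤˣ) (n : ℤ) (z : ℂ) (x : Bdry) (B : Fin 2) :
    fderiv ℝ (fun y => mode s n y * z) x (Pi.single B 1) = dlcR s B * (I * n * mode s n x * z) := by
  have := fderiv_lc (f := fun t => chr n t * z) ((contDiff_chr n).mul contDiff_const) s x B
  rw [((hasDerivAt_chr n _).mul_const z).deriv, Complex.real_smul] at this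
  exact this

lemma fderiv_mode (s : ℤˣ) (n : ℤ) (x : Bdry) (B : Fin 2) :
    fderiv ℝ (mode s n) x (Pi.single B 1) = dlcR s B * (I * n * mode s n x) := by
  simpa using fderiv_mode_mul s n 1 x B

lemma Represents.unique' {T T' : ℂ ⊗[ℝ] SemiDir hγ}
    {Y Y' : Bdry → Fin 2 → ℂ} {ψ ψ' : Bdry → ℂ} (h : Represents T Y ψ) (h' : Represents T' Y' ψ')
    (hY : ∀ x A, Y x A = Y' x A) (hψ : ∀ x, ψ x = ψ' x) : T = T' := by
  obtain rfl : Y = Y' := funext fun x => funext fun A => hY x A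
  obtain rfl : ψ = ψ' := funext hψ
  exact h.unique h'

lemma represents_zero : Represents (0 : ℂ ⊗[ℝ] SemiDir hγ) 0 0 :=
  ⟨0, 0, by rw [TensorProduct.tmul_zero, TensorProduct.tmul_zero, add_zero], fun x A => by change (0 : ℂ) = ((0 : ℝ) : ℂ) + I * ((0 : ℝ) : ℂ); simp,
    fun x => by change (0 : ℂ) = ((0 : ℝ) : ℂ) + I * ((0 : ℝ) : ℂ); simp⟩

variable {L Lm L' P P' Q : ℂ ⊗[ℝ] SemiDir hγ} {s : ℤˣ} {m n : ℤ}

lemma bracket_ell_ell (h : Represents L (fun x => mode s m x • dlc s) 0)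
    (h' : Represents L' (fun x => mode s n x • dlc s) 0) (hm : Represents Lm (fun x => mode s (m + n) x • dlc s) 0) :
    I • ⁅L, L'⁆ = ((m : ℂ) - n) • Lm := by
  refine ((h.lie h').smul _).unique' (hm.smul _) (fun x A => ?_) fun x => by simp
  rcases Int.units_eq_one_or s with rfl | rfl <;>
  · simp only [Pi.smul_apply, smul_eq_mul, fderiv_mode_mul, Fin.sum_univ_two, ← mode_mul]
    simp [dlc, dlcR]
    ring_nf
    simp only [Complex.I_sq]
    ring

lemma bracket_ell_ell_neg (h : Represents L (fun x => mode 1 m x • dlc 1) 0)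
    (h' : Represents L' (fun x => mode (-1) n x • dlc (-1)) 0) : I • ⁅L, L'⁆ = 0 := by
  refine ((h.lie h').smul _).unique' represents_zero (fun x A => ?_) fun x => by simp
  simp only [Pi.smul_apply, smul_eq_mul, fderiv_mode_mul, Fin.sum_univ_two]
  simp [dlc, dlcR]
  ring_nf

lemma bracket_ell_p (h : Represents L (fun x => mode s m x • dlc s) 0) (h' : Represents P 0 (mode s n))
    (hm : Represents P' 0 (mode s (m + n))) : I • ⁅L, P⁆ = (-(n : ℂ)) • P' := by
  refine ((h.lie h').smul _).unique' (hm.smul _) (fun x A => by simp) fun x => ?_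
  rcases Int.units_eq_one_or s with rfl | rfl <;>
  · simp only [Pi.smul_apply, smul_eq_mul, fderiv_mode, Fin.sum_univ_two, ← mode_mul]
    simp [dlc, dlcR]
    ring_nf
    simp only [Complex.I_sq]
    ring

lemma bracket_ell_p_neg (h : Represents L (fun x => mode s m x • dlc s) 0) (h' : Represents P 0 (mode (-s) n)) :
    I • ⁅L, P⁆ = 0 := by
  refine ((h.lie h').smul _).unique' represents_zero (fun x A => by simp) fun x => ?_
  rcases Int.units_eq_one_or s with rfl | rfl <;>
  · simp only [Pi.smul_apply, smul_eq_mul, fderiv_mode, Fin.sum_univ_two]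
    simp [dlc, dlcR]
    try ring

lemma bracket_functions {ψ ψ' : Bdry → ℂ} (h : Represents P 0 ψ) (h' : Represents P' 0 ψ') : I • ⁅P, P'⁆ = 0 :=
  ((h.lie h').smul _).unique' represents_zero (fun x A => by simp) fun x => by simp

lemma bracket_ell_q (h : Represents L (fun x => mode s m x • dlc s) 0) (h' : Represents Q 0 fun x => (x 0 : ℂ))
    (hp : Represents P 0 (mode s m)) : I • ⁅L, Q⁆ = (I / 2) • P := by
  refine ((h.lie h').smul _).unique' (hp.smul _) (fun x A => by simp) fun x => ?_
  have e : ∀ B : Fin 2, fderiv ℝ (fun x : Bdry => (x 0 : ℂ)) x (Pi.single B 1) = ((Pi.single B 1 : Bdry) 0 : ℂ) := fun B => by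
    have h : HasFDerivAt (fun x : Bdry => (x 0 : ℂ)) _ x :=
      Complex.ofRealCLM.hasFDerivAt.comp x (hasFDerivAt_apply (𝕜 := ℝ) (0 : Fin 2) x)
    rw [h.fderiv]
    rfl
  simp only [Pi.smul_apply, smul_eq_mul, Fin.sum_univ_two, e]
  simp [dlc]
  ring

end FlatComplex

end

end AsymptoticAdS3

open AsymptoticAdS3 in
theorem mainTheorem2 (l r₀ : ℝ) (hl : 0 < l) (hr₀ : 0 ≤ r₀)
    (γbar : Bdry → Matrix (Fin 2) (Fin 2) ℝ) (hγ : IsLorentzMetric γbar) :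
    -- form of the vector fields preserving the conditions at a given metric
    (∀ (m : AsympMetric l r₀ γbar) (ξ : Bulk → Bulk), IsBulkField r₀ ξ →
      (Preserves m ξ ↔ ∃ (Y : Bdry → Bdry) (ψ : Bdry → ℝ), CylSmooth Y ∧ CylSmooth ψ ∧
        IsConformalKilling m.γ Y ∧ (∀ x, laplacian m.γ ψ x = 0) ∧ HasForm m ξ Y ψ)) ∧
    -- the modified bracket of two asymptotic symmetries
    (∀ (ξ₁ ξ₂ : FieldVF l r₀ γbar) (Y₁ Y₂ : Bdry → Bdry) (ψ₁ ψ₂ : Bdry → ℝ),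
      IsGenerator ξ₁ Y₁ ψ₁ → IsGenerator ξ₂ Y₂ ψ₂ →
      (∃ ζ, IsModBracket ξ₁ ξ₂ ζ) ∧
      ∀ ζ, IsModBracket ξ₁ ξ₂ ζ → IsGenerator ζ (VectorField.lieBracket ℝ Y₁ Y₂)
        (fun x => fderiv ℝ ψ₂ x (Y₁ x) - fderiv ℝ ψ₁ x (Y₂ x))) ∧
    -- the conformal algebra, the harmonic Weyl rescalings, the action, the space of all asymptotic
    -- symmetries and the subspace of pure gauge transformations
    ∃ (𝔠 : LieSubalgebra ℝ CylVF) (ℋ : LieSubalgebra ℝ CylFun)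
      (act : 𝔠 →ₗ⁅ℝ⁆ LieDerivation ℝ ℋ ℋ)
      (𝔛 : Submodule ℝ (FieldVF l r₀ γbar)) (𝔑 : Submodule ℝ 𝔛),
      (∀ Y : CylVF, Y ∈ 𝔠 ↔ IsConformalKilling γbar Y) ∧
      (∀ ψ : CylFun, ψ ∈ ℋ ↔ ∀ x, laplacian γbar ψ x = 0) ∧
      (∀ (Y : 𝔠) (ψ : ℋ) (x : Bdry), ((act Y ψ : CylFun) : Bdry → ℝ) x
        = fderiv ℝ ((ψ : CylFun) : Bdry → ℝ) x (((Y : CylVF) : Bdry → Bdry) x)) ∧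
      (∀ ξ, ξ ∈ 𝔛 ↔ ∃ Y ψ, IsGenerator ξ Y ψ) ∧
      (∀ ξ : 𝔛, ξ ∈ 𝔑 ↔ IsGenerator (ξ : FieldVF l r₀ γbar) 0 0) ∧
      -- the quotient algebra is the semidirect product
      (∃ Φ : (𝔛 ⧸ 𝔑) ≃ₗ[ℝ] LieAlgebra.SemiDirectSum ℋ 𝔠 act,
        (∀ (ξ : 𝔛) (Y : Bdry → Bdry) (ψ : Bdry → ℝ), IsGenerator (ξ : FieldVF l r₀ γbar) Y ψ →
          (((Φ (𝔑.mkQ ξ)).right : CylVF) : Bdry → Bdry) = Y ∧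
          (((Φ (𝔑.mkQ ξ)).left : CylFun) : Bdry → ℝ) = ψ) ∧
        ∀ ξ₁ ξ₂ ζ : 𝔛, IsModBracket (ξ₁ : FieldVF l r₀ γbar) ξ₂ ζ →
          Φ (𝔑.mkQ ζ) = ⁅Φ (𝔑.mkQ ξ₁), Φ (𝔑.mkQ ξ₂)⁆) ∧
      -- the asymptotically `AdS₃` case
      (γbar = flat →
        ∃ (ell p : ℤˣ → ℤ → ℂ ⊗[ℝ] LieAlgebra.SemiDirectSum ℋ 𝔠 act)
          (q : ℂ ⊗[ℝ] LieAlgebra.SemiDirectSum ℋ 𝔠 act),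
          (∀ s m, Represents (ell s m) (fun x => mode s m x • dlc s) 0) ∧
          (∀ s m, Represents (p s m) 0 (mode s m)) ∧
          Represents q 0 (fun x => (x 0 : ℂ)) ∧
          p 1 0 = p (-1) 0 ∧
          (∀ s m n, Complex.I • ⁅ell s m, ell s n⁆ = ((m : ℂ) - n) • ell s (m + n)) ∧
          (∀ m n, Complex.I • ⁅ell 1 m, ell (-1) n⁆ = 0) ∧
          (∀ s m n, Complex.I • ⁅ell s m, p s n⁆ = (-(n : ℂ)) • p s (m + n)) ∧
          (∀ s m n, Complex.I • ⁅ell s m, p (-s) n⁆ = 0) ∧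
          (∀ s m n, Complex.I • ⁅p s m, p s n⁆ = 0) ∧
          (∀ m n, Complex.I • ⁅p 1 m, p (-1) n⁆ = 0) ∧
          (∀ s m, Complex.I • ⁅ell s m, q⁆ = (Complex.I / 2) • p s m) ∧
          (∀ s m, Complex.I • ⁅p s m, q⁆ = 0) ∧
          -- every element has a unique expansion in these generators, and every rapidly
          -- decreasing expansion defines an element
          (∀ (T : ℂ ⊗[ℝ] LieAlgebra.SemiDirectSum ℋ 𝔠 act) (Y : Bdry → Fin 2 → ℂ)
            (ψ : Bdry → ℂ), Represents T Y ψ →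
            ∃! d : (ℤˣ → ℤ → ℂ) × (ℤˣ → ℤ → ℂ) × ℂ,
              (∀ s, RapidDecay (d.1 s)) ∧ (∀ s, RapidDecay (d.2.1 s)) ∧ d.2.1 (-1) 0 = 0 ∧
              (∀ x, Y x = ∑ s, (∑' n, d.1 s n * mode s n x) • dlc s) ∧
              ∀ x, ψ x = (∑ s, ∑' n, d.2.1 s n * mode s n x) + d.2.2 * (x 0 : ℂ)) ∧
          ∀ (c w : ℤˣ → ℤ → ℂ) (V : ℂ), (∀ s, RapidDecay (c s)) → (∀ s, RapidDecay (w s)) →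
            ∃! T : ℂ ⊗[ℝ] LieAlgebra.SemiDirectSum ℋ 𝔠 act,
              Represents T (fun x => ∑ s, (∑' n, c s n * mode s n x) • dlc s)
                (fun x => (∑ s, ∑' n, w s n * mode s n x) + V * (x 0 : ℂ))) := by
  have := Fact.mk hr₀
  have := Fact.mk hγ
  refine ⟨fun m ξ hξ => preserves_iff hl m hξ, fun ξ₁ ξ₂ Y₁ Y₂ ψ₁ ψ₂ h₁ h₂ =>
    ⟨h₁.exists_modBracket hl h₂, fun ζ hζ => hζ.isGenerator hl h₁ h₂⟩, confAlg hγ, harmonicAlg γbar,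
    lieAct hγ, genSpace hl r₀ γbar, LinearMap.ker (leadingData hl : genSpace hl r₀ γbar →ₗ[ℝ] _), fun Y => Iff.rfl, fun ψ => Iff.rfl,
    fun Y ψ x => rfl, fun ξ => Iff.rfl, fun ξ => ?_, ⟨(leadingData hl).quotKerEquivOfSurjective
      (leadingData_surjective hl), fun ξ Y ψ h => ?_, fun ξ₁ ξ₂ ζ h => ?_⟩, ?_⟩
  · rw [LinearMap.mem_ker]
    have h := leadingData_spec hl ξ
    refine ⟨fun e => ?_, fun h' => leadingData_unique hl h (T' := 0) h'⟩
    rw [e] at h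
    exact h
  · obtain ⟨rfl, rfl⟩ := h.unique (Datum.build hl 0 0) (leadingData_spec hl ξ)
    exact ⟨rfl, rfl⟩
  · have h' := h.isGenerator hl (leadingData_spec hl ξ₁) (leadingData_spec hl ξ₂)
    refine leadingData_unique hl (leadingData_spec hl ζ) (T' := ⁅leadingData hl ξ₁, leadingData hl ξ₂⁆) ?_
    rw [funext fun x => semidirect_lie_left (leadingData hl ξ₁) (leadingData hl ξ₂) x]
    exact h'
  · rintro rfl
    have hs : ∀ (s : ℤˣ) m t, CircSmooth ((Pi.single s (chr m) : ℤˣ → ℝ → ℂ) t) := fun s m t => by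
      rcases eq_or_ne t s with rfl | h
      · rw [Pi.single_eq_same]
        exact ⟨contDiff_chr m, chr_periodic m⟩
      · rw [Pi.single_eq_of_ne h]
        exact ⟨contDiff_const, fun _ => rfl⟩
    have h0 : ∀ s : ℤˣ, CircSmooth ((0 : ℤˣ → ℝ → ℂ) s) := fun _ => ⟨contDiff_const, fun _ => rfl⟩
    have hsum : ∀ {M : Type} [AddCommGroup M] [Module ℂ M] (s : ℤˣ) m x (v : ℤˣ → M),
        ∑ t, (Pi.single s (chr m) : ℤˣ → ℝ → ℂ) t (lc t x) • v t = mode s m x • v s := fun s m x v => by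
      rw [Finset.sum_eq_single s (fun t _ h => by rw [Pi.single_eq_of_ne h]; exact zero_smul _ _)
        fun h => absurd (Finset.mem_univ s) h, Pi.single_eq_same]
      rfl
    have hell : ∀ s m, ∃ T : ℂ ⊗[ℝ] LieAlgebra.SemiDirectSum (harmonicAlg flat) (confAlg hγ) (lieAct hγ),
        Represents T (fun x => mode s m x • dlc s) 0 := fun s m => by
      obtain ⟨T, hT⟩ := exists_represents hγ (hs s m) h0 0
      simp only [hsum] at hT
      exact ⟨T, by convert hT using 1; funext x; simp⟩
    have hp : ∀ s m, ∃ T : ℂ ⊗[ℝ] LieAlgebra.SemiDirectSum (harmonicAlg flat) (confAlg hγ) (lieAct hγ),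
        Represents T 0 (mode s m) := fun s m => by
      obtain ⟨T, hT⟩ := exists_represents hγ h0 (hs s m) 0
      have e := fun x => hsum s m x fun _ => (1 : ℂ)
      simp only [smul_eq_mul, mul_one] at e
      simp only [e] at hT
      exact ⟨T, by convert hT using 1 <;> funext x <;> simp⟩
    have hq : ∃ T : ℂ ⊗[ℝ] LieAlgebra.SemiDirectSum (harmonicAlg flat) (confAlg hγ) (lieAct hγ),
        Represents T 0 (fun x => (x 0 : ℂ)) := by
      obtain ⟨T, hT⟩ := exists_represents hγ h0 h0 1
      exact ⟨T, by convert hT using 1 <;> funext x <;> simp⟩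
    choose ell hell using hell
    choose p hp using hp
    obtain ⟨q, hq⟩ := hq
    refine ⟨ell, p, q, hell, hp, hq, (hp 1 0).unique' (hp (-1) 0) (fun _ _ => rfl) (fun x => by simp [mode]),
      fun s m n => bracket_ell_ell (hell s m) (hell s n) (hell s _),
      fun m n => bracket_ell_ell_neg (hell 1 m) (hell (-1) n), fun s m n => bracket_ell_p (hell s m) (hp s n) (hp s _),
      fun s m n => bracket_ell_p_neg (hell s m) (hp (-s) n),
      fun s m n => bracket_functions (hp s m) (hp s n), fun m n => bracket_functions (hp 1 m) (hp (-1) n),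
      fun s m => bracket_ell_q (hell s m) hq (hp s m), fun s m => bracket_functions (hp s m) hq,
      fun T Y ψ h => ?_, fun c w V hc hw => ?_⟩
    · obtain ⟨c, w, V, hc, hw, eY, eψ⟩ := h.exists_expansion
      obtain ⟨w', hw', hn, e⟩ := exists_normalized hw
      refine ⟨(c, w', V), ⟨hc, hw', hn, eY, fun x => by rw [eψ, e]; rfl⟩, ?_⟩
      rintro ⟨d, v, U⟩ ⟨hd, hv, h0, eY', eψ'⟩
      obtain ⟨rfl, rfl⟩ := eq_of_sum_expSer hv hw' h0 hn fun x => by rw [← e, ← eψ]; exact (eψ' x).symm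
      exact congrArg (·, _, _) (eq_of_sum_expSer_smul_dlc hd hc fun x => by rw [← eY]; exact (eY' x).symm)
    · obtain ⟨T, hT⟩ := exists_represents hγ (fun s => circSmooth_expSer (hc s)) (fun s => circSmooth_expSer (hw s)) V
      exact ⟨T, hT, fun T' hT' => Represents.unique hT' hT⟩
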